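/- **Setting.** Let $n,l\ge 0$, $N=\mathbb Z^{n+l+1}$ with dual lattice $N^*$, and let $\sigma=(v_0,\dots,v_l)\subset N^*$, $\tau=(w_0,\dots,w_n)\subset N$ be lattice simplices with $\langle v_i,w_j\rangle=1$ for all $i,j$. Choose bases $(e_i)$ of $N_\sigma=\{y\in N:\langle v_k,y\rangle=0\ \forall k\}$ and $(m_p)$ of $N^*_\tau=\{m\in N^*:\langle m,w_j\rangle=0\ \forall j\}$; they give coordinates $s_i=\langle\cdot,e_i\rangle$ on $N^*_{\mathbb R}/\sigma\cong\mathbb R^n$ and $t_p=\langle m_p,\cdot\rangle$ on $N_{\mathbb R}/\tau\cong\mathbb R^l$. Let $Q^\tau_j=\{s:\langle s,w_a-w_j\rangle>0\ \forall a\ne j\}$ and $Q^\sigma_i=\{t:\langle v_a-v_i,t\rangle>0\ \forall a\neq i\}$ be the open normal cones of the vertices, and let $\Pi(\tau),\Pi(\sigma)$ be the unions of the walls $\mathrm{wall}_{ab}$ between these cones. Let $R\subset\mathbb R^n\times\mathbb R^l$ be a convex open set containing the origin, $R^\circ=R\setminus(\Pi(\tau)\times\Pi(\sigma))$, $U_{v_i}=R\cap(\mathbb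 R^n\times Q_i^\sigma)$, $U_{w_j}=R\cap(Q_j^\tau\times\mathbb R^l)$. These sets cover $R^\circ$. Let $\Sigma^\vee\subset N_{\mathbb R}$ and $\mathcal T^\vee\subset N^*_{\mathbb R}$ be the dual cones of the cones over $\sigma$ and $\tau$. **Split solutions.** A $(\sigma,\tau)$-type singular split Monge–Ampère solution on $R$ is a pair of positive definite symmetric matrix functions $V=(V^{ij})$, $W=(W^{pq})$ on $R^\circ$ with $\det V=\det W$, given locally on $R^\circ$ by a smooth potential, $V^{ij}=\partial^2K/\partial s_i\partial s_j$ and $W^{pq}=-\partial^2K/\partial t_p\partial t_q$, locally integrable on $R$, and such that, in the sense of distributions on $R$, $$\frac{\partial^2W^{pq}}{\partial s_i\partial s_j}+\frac{\partial^2V^{ij}}{\partial t_p\partial t_q}=-\gamma_\tau^{ij}(s)\,\gamma_\sigma^{pq}(t)\quad\text{for all } i,j,p,q,$$ where $\gamma_\tau^{ij}=\sum_{a<b}\frac{(w_a-w_b)^i(w_a-w_b)^j}{|w_a-w_b|}\,d\mathrm{area}|_{\mathrm{wall}_{ab}}$ is the distribution of coefficients of the current $\gamma_\tau=\sum_{a<b}(w_a-w_b)[\mathrm{wall}_{ab}]$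 (components, length and area being taken in the chosen coordinates), and $\gamma_\sigma^{pq}$ is defined likewise from the $v_a$. **Bi-PIKAS.** A $(\sigma,\tau)$-type Monge–Ampère bi-polyhedral integral Kähler affine structure (bi-PIKAS) on $R$ consists of a smooth Riemannian metric $g$ on $R^\circ$ and of open embeddings $h:R^\circ\to\partial\Sigma^\vee$ and $k:R^\circ\to\partial\mathcal T^\vee$ such that: * the class of $h$ in $N_{\mathbb R}/\tau$ is $t$, and the class of $k$ in $N^*_{\mathbb R}/\sigma$ is $s$; * $h$ maps $U_{v_i}$ diffeomorphically onto an open subset of the face in $v_i^\perp$, and $h$ modulo $w_j$ maps $U_{w_j}$ diffeomorphically onto an open subset of $N_{\mathbb R}/w_j$. These are the charts of the integral affine structure, whose transition maps are the natural projections $v_i^\perp\to N_{\mathbb R}/w_j$; symmetrically, $k$ on $U_{w_j}$ with values in $w_j^\perp$ and $k$ modulo $v_i$ on $U_{v_i}$ are diffeomorphisms onto open sets; * locally in each of these charts $y$ of $h$ there is a smooth potential $\Psi(y)$ such that $g$ is the Hessian of $\Psi$, $\det(\partial^2\Psi/\partial y_a\partial y_b)=1$ in integral affine coordinates, and $d\Psi$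 is the dual coordinate given by $k$ (with values in $(v_i^\perp)^*=N^*_{\mathbb R}/v_i$, respectively $(N_{\mathbb R}/w_j)^*=w_j^\perp$), so that $k$ gives the dual affine structure. Two bi-PIKAS are identified when they have the same metric and the same (real) affine structure on $R^\circ$. **Theorem.** 1. There is a bijection from the set of $(\sigma,\tau)$-type singular split Monge–Ampère solutions on $R$ to the set of $(\sigma,\tau)$-type Monge–Ampère bi-PIKAS on $R$. 2. It is given by the partial Legendre transform: a solution $(V,W)$ corresponds to the class of $(g,h,k)$ if and only if locally in each chart, for all vectors $f_p$ with $\langle m_q,f_p\rangle=\delta_{pq}$ (and $f_p\in v_i^\perp$ in the chart $U_{v_i}$), there is a potential $K$ of $(V,W)$ such that $h=\sum_i\frac{\partial K}{\partial s_i}e_i+\sum_pt_pf_p$ (modulo $w_j$ in the chart $U_{w_j}$) and $\langle k,f_p\rangle=-\frac{\partial K}{\partial t_p}$; that is, $y_i=\partial K/\partial s_i$, $y_p=t_p$, $\partial\Psi/\partial y_i=s_i$, $\partial\Psi/\partial y_p=-\partial K/\partial t_p$. 3. If $(V,W)$ corresponds to the class of $(g,h,k)$, then $g=V^{ij}\,ds_i\,ds_j+W^{pq}\,dt_p\,dt_q$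 on $R^\circ$. 4. For every such bi-PIKAS and every loop in $R^\circ$ that runs successively in $U_{v_{i_1}},U_{w_{j_1}},U_{v_{i_2}},U_{w_{j_2}}$ and back in $U_{v_{i_1}}$, parallel transport of tangent vectors along the loop for the flat connection of the affine structure, read in the chart with values in $v_{i_1}^\perp$, is $y\mapsto y+\langle v_{i_2}-v_{i_1},y\rangle(w_{j_2}-w_{j_1})$, that is $1+(v_{i_2}-v_{i_1})\otimes(w_{j_2}-w_{j_1})$. -/

import Mathlib

open Set Filter Topology MeasureTheory
open scoped Matrix ContDiff

noncomputable section

/-! ### Lattices, pairings, cones -/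

/-- The inclusion of the lattice `ℤ^d` into `ℝ^d`. -/
def toReal {d : ℕ} : (Fin d → ℤ) →ₗ[ℤ] (Fin d → ℝ) where
  toFun a := fun i => (a i : ℝ)
  map_add' a b := by ext i; simp
  map_smul' c a := by ext i; simp

/-- The lattice vectors that are orthogonal to all the vectors `a i`. -/
def annLattice {ι : Type} {d : ℕ} (a : ι → Fin d → ℤ) : Submodule ℤ (Fin d → ℤ) where
  carrier := {y | ∀ i, a i ⬝ᵥ y = 0}
  add_mem' := by
    intro x y hx hy i
    rw [dotProduct_add, hx i, hy i, add_zero]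
  zero_mem' := by intro i; simp
  smul_mem' := by
    intro c x hx i
    rw [dotProduct_smul, hx i, smul_zero]

/-- The real hyperplane `a^⊥`. -/
def perp {d : ℕ} (a : Fin d → ℤ) : Submodule ℝ (Fin d → ℝ) where
  carrier := {y | toReal a ⬝ᵥ y = 0}
  add_mem' := by
    intro x y hx hy
    simp only [Set.mem_ofPred_eq] at hx hy ⊢
    rw [dotProduct_add, hx, hy, add_zero]
  zero_mem' := by simp
  smul_mem' := by
    intro c x hx
    simp only [Set.mem_ofPred_eq] at hx ⊢
    rw [dotProduct_smul, hx, smul_zero]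

/-- The real line spanned by `a`. -/
def line {d : ℕ} (a : Fin d → ℤ) : Submodule ℝ (Fin d → ℝ) :=
  Submodule.span ℝ {toReal a}

instance isClosed_line {d : ℕ} (a : Fin d → ℤ) :
    IsClosed ((line a : Submodule ℝ (Fin d → ℝ)) : Set (Fin d → ℝ)) :=
  Submodule.closed_of_finiteDimensional _

/-- The quotient space `ℝ^d / a`, with its quotient norm. -/
abbrev QuotLine {d : ℕ} (a : Fin d → ℤ) : Type := (Fin d → ℝ) ⧸ line a

/-- The lattice of integral vectors in the hyperplane `a^⊥`. -/
def perpLattice {d : ℕ} (a : Fin d → ℤ) : Submodule ℤ (perp a) :=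
  (LinearMap.range (toReal (d := d))).comap ((perp a).subtype.restrictScalars ℤ)

/-- The image of the lattice in the quotient `ℝ^d / a`. -/
def quotLattice {d : ℕ} (a : Fin d → ℤ) : Submodule ℤ (QuotLine a) :=
  (LinearMap.range (toReal (d := d))).map ((line a).mkQ.restrictScalars ℤ)

/-- The dual of the cone generated by the vectors `a i`. -/
def dualCone {ι : Type} {d : ℕ} (a : ι → Fin d → ℤ) : Set (Fin d → ℝ) :=
  {y | ∀ i, 0 ≤ toReal (a i) ⬝ᵥ y}

/-! ### Normal fans, walls and their currents

`c j k` stands for the coordinates of the difference of the `j`-th and the `k`-th vertex of a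
simplex. -/

/-- The open normal cone of the `j`-th vertex: the linear forms whose minimum on the simplex is
attained at the `j`-th vertex only. -/
def normalCone {k : ℕ} (c : Fin (k + 1) → Fin (k + 1) → EuclideanSpace ℝ (Fin k))
    (j : Fin (k + 1)) : Set (EuclideanSpace ℝ (Fin k)) :=
  {s | ∀ a, a ≠ j → 0 < inner ℝ (c a j) s}

/-- The wall between the normal cones of the `a`-th and the `b`-th vertex. -/
def wall {k : ℕ} (c : Fin (k + 1) → Fin (k + 1) → EuclideanSpace ℝ (Fin k))
    (a b : Fin (k + 1)) : Set (EuclideanSpace ℝ (Fin k)) :=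
  {s | inner ℝ (c a b) s = 0 ∧ ∀ j, 0 ≤ inner ℝ (c j a) s}

/-- The polyhedral complex `Π`: the union of all the walls. -/
def wallComplex {k : ℕ} (c : Fin (k + 1) → Fin (k + 1) → EuclideanSpace ℝ (Fin k)) :
    Set (EuclideanSpace ℝ (Fin k)) :=
  ⋃ a, ⋃ b, ⋃ _ : a ≠ b, wall c a b

/-- Integral of a function over a wall with respect to surface measure, that is Lebesgue measure
of the Euclidean hyperplane containing the wall. -/
def wallIntegral {k : ℕ} (c : Fin (k + 1) → Fin (k + 1) → EuclideanSpace ℝ (Fin k))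
    (a b : Fin (k + 1)) (f : EuclideanSpace ℝ (Fin k) → ℝ) : ℝ :=
  ∫ x in {x : ↥(Submodule.span ℝ {c a b})ᗮ | (x : EuclideanSpace ℝ (Fin k)) ∈ wall c a b},
    f (x : EuclideanSpace ℝ (Fin k))

/-- The coefficient of `ds_i` of the `j`-th component of the vector valued `1`-current
`γ = ∑_{a < b} (w_a - w_b) [wall_{ab}]`. The `1`-current `[wall_{ab}]` of integration over the
cooriented wall is the unit conormal `(w_a - w_b) / |w_a - w_b|` times surface measure. -/
def gammaCurrent {k : ℕ} (c : Fin (k + 1) → Fin (k + 1) → EuclideanSpace ℝ (Fin k))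
    (i j : Fin k) (f : EuclideanSpace ℝ (Fin k) → ℝ) : ℝ :=
  ∑ a, ∑ b, if a < b then (c a b) j * ((c a b) i / ‖c a b‖) * wallIntegral c a b f else 0

/-! ### The base -/

/-- The space `ℝ^n × ℝ^l` with coordinates `(s, t)`. -/
abbrev Base (n l : ℕ) : Type := EuclideanSpace ℝ (Fin n) × EuclideanSpace ℝ (Fin l)

/-- The coordinate vector field `∂/∂s_i`. -/
def sdir {n l : ℕ} (i : Fin n) : Base n l := (EuclideanSpace.single i 1, 0)

/-- The coordinate vector field `∂/∂t_p`. -/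
def tdir {n l : ℕ} (p : Fin l) : Base n l := (0, EuclideanSpace.single p 1)

/-- Second derivative of `f` at `p` in the directions `u` and `u'`. -/
def secondDeriv {F : Type} [NormedAddCommGroup F] [NormedSpace ℝ F] (f : F → ℝ) (p u u' : F) : ℝ :=
  fderiv ℝ (fun q => fderiv ℝ f q u) p u'

/-- Lattice simplices `σ = (v_0, …, v_l)` in `N^*` and `τ = (w_0, …, w_n)` in `N` with
`⟨σ, τ⟩ = 1`, together with bases of the lattices `N_σ = σ^⊥` and `N^*_τ = τ^⊥`. Here
`N = ℤ^(n+l+1)`, and `N^*` is identified with `ℤ^(n+l+1)` by the dot product. -/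
structure SimplexPair (n l : ℕ) where
  v : Fin (l + 1) → Fin (n + l + 1) → ℤ
  w : Fin (n + 1) → Fin (n + l + 1) → ℤ
  v_indep : AffineIndependent ℤ v
  w_indep : AffineIndependent ℤ w
  pairing : ∀ i j, v i ⬝ᵥ w j = 1
  e : Module.Basis (Fin n) ℤ (annLattice v)
  m : Module.Basis (Fin l) ℤ (annLattice w)

namespace SimplexPair

variable {n l : ℕ} (S : SimplexPair n l)

theorem w_sub_mem (a b : Fin (n + 1)) : S.w a - S.w b ∈ annLattice S.v := by
  intro i
  rw [dotProduct_sub, S.pairing, S.pairing, sub_self]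

theorem v_sub_mem (a b : Fin (l + 1)) : S.v a - S.v b ∈ annLattice S.w := by
  intro j
  rw [dotProduct_comm, sub_dotProduct, S.pairing, S.pairing, sub_self]

/-- Coordinates of `w_a - w_b` in the basis of `N_σ`. A point `s` of `ℝ^n` is the class in
`N^*_ℝ/σ` of the linear forms that take the value `s_i` on the `i`-th basis vector of `N_σ`, so
the inner product with `s` is the value of this class on `w_a - w_b`. -/
def edgeW (a b : Fin (n + 1)) : EuclideanSpace ℝ (Fin n) :=
  WithLp.toLp 2 fun i => (S.e.repr ⟨S.w a - S.w b, S.w_sub_mem a b⟩ i : ℝ)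

/-- Coordinates of `v_a - v_b` in the basis of `N^*_τ`. -/
def edgeV (a b : Fin (l + 1)) : EuclideanSpace ℝ (Fin l) :=
  WithLp.toLp 2 fun p => (S.m.repr ⟨S.v a - S.v b, S.v_sub_mem a b⟩ p : ℝ)

/-- The discriminant locus `Π(τ) × Π(σ)`. -/
def disc : Set (Base n l) := wallComplex S.edgeW ×ˢ wallComplex S.edgeV

/-- `R° = R \ (Π(τ) × Π(σ))`. -/
def regular (R : Set (Base n l)) : Set (Base n l) := R \ S.disc

/-- The open set `U_{v_i} = ℝ^n × Q_i^σ`, intersected with `R`. -/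
def chartV (R : Set (Base n l)) (i : Fin (l + 1)) : Set (Base n l) :=
  {p ∈ R | p.2 ∈ normalCone S.edgeV i}

/-- The open set `U_{w_j} = Q_j^τ × ℝ^l`, intersected with `R`. -/
def chartW (R : Set (Base n l)) (j : Fin (n + 1)) : Set (Base n l) :=
  {p ∈ R | p.1 ∈ normalCone S.edgeW j}

end SimplexPair

/-! ### Singular solutions of the split Monge-Ampère equation -/

/-- `K` is a smooth potential on `O` for the pair of matrix functions `(V, W)`. -/
structure IsSplitPotential {n l : ℕ} (K : Base n l → ℝ) (O : Set (Base n l))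
    (V : Base n l → Matrix (Fin n) (Fin n) ℝ) (W : Base n l → Matrix (Fin l) (Fin l) ℝ) :
    Prop where
  smooth : ContDiffOn ℝ ∞ K O
  hess_s : ∀ q ∈ O, ∀ i j, V q i j = secondDeriv K q (sdir i) (sdir j)
  hess_t : ∀ q ∈ O, ∀ i j, W q i j = -secondDeriv K q (tdir i) (tdir j)

/-- A `(σ,τ)`-type singular solution of the split Monge-Ampère equation in `R`. The matrix
functions live on `R°`; for definiteness they are extended by zero.

The last field is the distributional equation
`(∂²W^{pq}/∂s_i∂s_j + ∂²V^{ij}/∂t_p∂t_q) ds_i ∧ dt_p = γ_τ^j ∧ γ_σ^q` on `R`, written out for the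
coefficients of `ds_i ∧ dt_p` as generalized functions. The orientation of the currents is the one
for which the right hand side is a nonpositive multiple of surface measure, so that the equation
is `∂²V/∂s² + ∂²V/∂t² = -δ` for two segments of length one. -/
structure SingularSplitSolution {n l : ℕ} (S : SimplexPair n l) (R : Set (Base n l)) where
  V : Base n l → Matrix (Fin n) (Fin n) ℝ
  W : Base n l → Matrix (Fin l) (Fin l) ℝ
  V_off : ∀ p ∉ S.regular R, V p = 0
  W_off : ∀ p ∉ S.regular R, W p = 0
  V_posDef : ∀ p ∈ S.regular R, (V p).PosDef
  W_posDef : ∀ p ∈ S.regular R, (W p).PosDef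
  det_eq : ∀ p ∈ S.regular R, (V p).det = (W p).det
  potential : ∀ p ∈ S.regular R, ∃ O : Set (Base n l), IsOpen O ∧ p ∈ O ∧ O ⊆ S.regular R ∧
    ∃ K : Base n l → ℝ, IsSplitPotential K O V W
  V_locInt : ∀ i j, LocallyIntegrableOn (fun p => V p i j) R
  W_locInt : ∀ i j, LocallyIntegrableOn (fun p => W p i j) R
  current : ∀ (i j : Fin n) (p q : Fin l) (ψ : Base n l → ℝ), ContDiff ℝ ∞ ψ →
    HasCompactSupport ψ → tsupport ψ ⊆ R →
    ∫ x, (W x p q * secondDeriv ψ x (sdir i) (sdir j) +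
        V x i j * secondDeriv ψ x (tdir p) (tdir q)) =
      -gammaCurrent S.edgeW i j (fun s => gammaCurrent S.edgeV p q (fun t => ψ (s, t)))

/-! ### Monge-Ampère bi-polyhedral integral Kähler affine structures -/

/-- `y` is a diffeomorphism from the open set `U` to an open subset of the vector space `F`. -/
structure IsSmoothChart {n l : ℕ} {F : Type} [NormedAddCommGroup F] [NormedSpace ℝ F]
    (U : Set (Base n l)) (y : Base n l → F) : Prop where
  smooth : ContDiffOn ℝ ∞ y U
  injOn : InjOn y U
  bijective : ∀ p ∈ U, Function.Bijective (fderiv ℝ y p)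

/-- In the affine coordinates `y` on `U`, which take values in a vector space `F` with lattice
`L`, the metric `g` is Monge-Ampère: it is locally the Hessian of a potential `Ψ` with
`det = 1` in integral coordinates, and the differential of `Ψ` is the given map `x` from `U` to
the dual space of `F`. So `x` is an affine coordinate of the dual affine structure. -/
def IsMongeAmpere {n l : ℕ} {F : Type} [NormedAddCommGroup F] [NormedSpace ℝ F]
    (L : Submodule ℤ F) (U : Set (Base n l)) (y : Base n l → F) (x : Base n l → F → ℝ)
    (g : Base n l → Base n l →L[ℝ] Base n l →L[ℝ] ℝ) : Prop :=
  ∀ p ∈ U, ∃ O : Set (Base n l), IsOpen O ∧ p ∈ O ∧ O ⊆ U ∧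
    ∃ Ψ : F → ℝ, ContDiffOn ℝ ∞ Ψ (y '' O) ∧ ∀ q ∈ O,
      (∀ u, fderiv ℝ Ψ (y q) u = x q u) ∧
      (∀ u u', g q u u' = secondDeriv Ψ (y q) (fderiv ℝ y q u) (fderiv ℝ y q u')) ∧
      ∃ b : Module.Basis (Fin (n + l)) ℤ L,
        (Matrix.of fun i j => secondDeriv Ψ (y q) (b i : F) (b j : F)).det = 1

/-- The coordinate given by `h` with values in the hyperplane `a^⊥`, where `h` lies in it. -/
def perpCoord {n l d : ℕ} (a : Fin d → ℤ) (h : Base n l → Fin d → ℝ) (p : Base n l) : perp a :=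
  open Classical in if hp : h p ∈ perp a then ⟨h p, hp⟩ else 0

/-- The coordinate given by `h` with values in the quotient by `b`. -/
def quotCoord {n l d : ℕ} (b : Fin d → ℤ) (h : Base n l → Fin d → ℝ) (p : Base n l) : QuotLine b :=
  (line b).mkQ (h p)

/-- The map `h` is an open embedding of `D` in the boundary of the dual cone of the simplex with
vertices `a i`. It provides affine coordinates on the sets `A i`, which it identifies with open
subsets of the faces orthogonal to the `a i`, and on the sets `B j`, on which the coordinates are
the natural projections of `h` to the quotients by the `b j`. Thus the transition maps between
these charts are induced by the natural projections from `(a i)^⊥` to the quotient by `b j`. -/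
structure IsPolyhedral {n l d : ℕ} {ι κ : Type} (a : ι → Fin d → ℤ) (b : κ → Fin d → ℤ)
    (D : Set (Base n l)) (A : ι → Set (Base n l)) (B : κ → Set (Base n l))
    (h : Base n l → Fin d → ℝ) : Prop where
  mapsTo : MapsTo h D (frontier (dualCone a))
  embedding : IsOpenEmbedding (mapsTo.restrict h D (frontier (dualCone a)))
  face : ∀ i, ∀ p ∈ A i, h p ∈ perp (a i)
  chart_perp : ∀ i, IsSmoothChart (A i) (perpCoord (a i) h)
  chart_quot : ∀ j, IsSmoothChart (B j) (quotCoord (b j) h)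

/-- A Monge-Ampère bi-polyhedral integral Kähler affine structure of type `(σ,τ)` on `R`. The
affine structure on `R°` is polyhedral by the map `h` to `∂Σ^∨ ⊆ N_ℝ` over the coordinate `t`, the
dual affine structure is polyhedral by the map `k` to `∂T^∨ ⊆ N^*_ℝ` over the coordinate `s`, and
`g` is the metric. In the chart `v_i` the dual of `v_i^⊥` is `N^*_ℝ/v_i`, and in the chart `w_j`
the dual of `N_ℝ/w_j` is `w_j^⊥`; in both charts `k` is the differential of the potential. -/
structure BiPIKAS {n l : ℕ} (S : SimplexPair n l) (R : Set (Base n l)) where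
  h : Base n l → Fin (n + l + 1) → ℝ
  k : Base n l → Fin (n + l + 1) → ℝ
  g : Base n l → Base n l →L[ℝ] Base n l →L[ℝ] ℝ
  g_smooth : ContDiffOn ℝ ∞ g (S.regular R)
  g_symm : ∀ p ∈ S.regular R, ∀ u u', g p u u' = g p u' u
  g_pos : ∀ p ∈ S.regular R, ∀ u, u ≠ 0 → 0 < g p u u
  h_proj : ∀ p ∈ S.regular R, ∀ i, toReal (S.m i : Fin (n + l + 1) → ℤ) ⬝ᵥ h p = p.2 i
  k_proj : ∀ p ∈ S.regular R, ∀ i, k p ⬝ᵥ toReal (S.e i : Fin (n + l + 1) → ℤ) = p.1 i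
  h_polyhedral : IsPolyhedral S.v S.w (S.regular R) (S.chartV R) (S.chartW R) h
  k_polyhedral : IsPolyhedral S.w S.v (S.regular R) (S.chartW R) (S.chartV R) k
  mongeAmpere_v : ∀ i, IsMongeAmpere (perpLattice (S.v i)) (S.chartV R i) (perpCoord (S.v i) h)
    (fun p u => k p ⬝ᵥ (u : Fin (n + l + 1) → ℝ)) g
  mongeAmpere_w : ∀ j, ∃ x : Base n l → QuotLine (S.w j) → ℝ,
    (∀ p ∈ S.chartW R j, ∀ u, x p ((line (S.w j)).mkQ u) = k p ⬝ᵥ u) ∧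
    IsMongeAmpere (quotLattice (S.w j)) (S.chartW R j) (quotCoord (S.w j) h) x g

/-- Two systems of coordinates on `U` define the same affine structure. -/
def SameAffine {n l : ℕ} {F : Type} [NormedAddCommGroup F] [NormedSpace ℝ F]
    (U : Set (Base n l)) (y y' : Base n l → F) : Prop :=
  ∀ p ∈ U, ∃ A : F ≃ᵃ[ℝ] F, ∀ᶠ q in 𝓝 p, y' q = A (y q)

theorem SameAffine.refl {n l : ℕ} {F : Type} [NormedAddCommGroup F] [NormedSpace ℝ F]
    (U : Set (Base n l)) (y : Base n l → F) : SameAffine U y y :=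
  fun _ _ => ⟨AffineEquiv.refl ℝ F, Eventually.of_forall fun _ => rfl⟩

theorem SameAffine.symm {n l : ℕ} {F : Type} [NormedAddCommGroup F] [NormedSpace ℝ F]
    {U : Set (Base n l)} {y y' : Base n l → F} (H : SameAffine U y y') : SameAffine U y' y := by
  intro p hp
  obtain ⟨A, hA⟩ := H p hp
  refine ⟨A.symm, hA.mono fun q hq => ?_⟩
  rw [hq, AffineEquiv.symm_apply_apply]

theorem SameAffine.trans {n l : ℕ} {F : Type} [NormedAddCommGroup F] [NormedSpace ℝ F]
    {U : Set (Base n l)} {y y' y'' : Base n l → F} (H : SameAffine U y y')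
    (H' : SameAffine U y' y'') : SameAffine U y y'' := by
  intro p hp
  obtain ⟨A, hA⟩ := H p hp
  obtain ⟨A', hA'⟩ := H' p hp
  refine ⟨A.trans A', ?_⟩
  filter_upwards [hA, hA'] with q hq hq'
  rw [hq', hq, AffineEquiv.trans_apply]

namespace BiPIKAS

variable {n l : ℕ} {S : SimplexPair n l} {R : Set (Base n l)}

/-- Bi-PIKAS are identified when they have the same metric and the same affine structure on `R°`
(and hence the same dual affine structure). -/
instance setoid (S : SimplexPair n l) (R : Set (Base n l)) : Setoid (BiPIKAS S R) where
  r P Q := (∀ p ∈ S.regular R, P.g p = Q.g p) ∧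
    (∀ i, SameAffine (S.chartV R i) (perpCoord (S.v i) P.h) (perpCoord (S.v i) Q.h)) ∧
    (∀ j, SameAffine (S.chartW R j) (quotCoord (S.w j) P.h) (quotCoord (S.w j) Q.h))
  iseqv :=
    { refl := fun _ => ⟨fun _ _ => rfl, fun _ => SameAffine.refl _ _, fun _ => SameAffine.refl _ _⟩
      symm := fun H => ⟨fun p hp => (H.1 p hp).symm, fun i => (H.2.1 i).symm,
        fun j => (H.2.2 j).symm⟩
      trans := fun H H' => ⟨fun p hp => (H.1 p hp).trans (H'.1 p hp),
        fun i => (H.2.1 i).trans (H'.2.1 i), fun j => (H.2.2 j).trans (H'.2.2 j)⟩ }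

/-- The vector field `X` along the curve `c : [0,1] → R°` is parallel for the flat connection of
the affine structure: its components in the affine charts are locally constant. -/
def IsParallel (P : BiPIKAS S R) (c X : ℝ → Base n l) : Prop :=
  ∀ r ∈ Icc (0 : ℝ) 1,
    (∀ i, c r ∈ S.chartV R i → ∀ᶠ r' in 𝓝[Icc 0 1] r,
      fderiv ℝ (perpCoord (S.v i) P.h) (c r') (X r') =
        fderiv ℝ (perpCoord (S.v i) P.h) (c r) (X r)) ∧
    (∀ j, c r ∈ S.chartW R j → ∀ᶠ r' in 𝓝[Icc 0 1] r,
      fderiv ℝ (quotCoord (S.w j) P.h) (c r') (X r') =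
        fderiv ℝ (quotCoord (S.w j) P.h) (c r) (X r))

/-- Parallel transport along the loop `c` based in the chart `v_i` exists, and in this chart it
is the map `M`. -/
def HasMonodromy (P : BiPIKAS S R) (i : Fin (l + 1)) (c : ℝ → Base n l)
    (M : (Fin (n + l + 1) → ℝ) → Fin (n + l + 1) → ℝ) : Prop :=
  (∀ X₀, ∃ X, P.IsParallel c X ∧ X 0 = X₀) ∧
  ∀ X, P.IsParallel c X →
    (fderiv ℝ (perpCoord (S.v i) P.h) (c 1) (X 1) : Fin (n + l + 1) → ℝ) =
      M (fderiv ℝ (perpCoord (S.v i) P.h) (c 0) (X 0))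

end BiPIKAS

/-- A loop in `R°` of type `(v_{i₁} w_{j₁} v_{i₂} w_{j₂})`: it runs successively in the sets
`U_{v_{i₁}}`, `U_{w_{j₁}}`, `U_{v_{i₂}}`, `U_{w_{j₂}}`, and back in `U_{v_{i₁}}`. -/
def IsLoop {n l : ℕ} (S : SimplexPair n l) (R : Set (Base n l)) (i₁ : Fin (l + 1))
    (j₁ : Fin (n + 1)) (i₂ : Fin (l + 1)) (j₂ : Fin (n + 1)) (c : ℝ → Base n l) : Prop :=
  ContinuousOn c (Icc 0 1) ∧ c 0 = c 1 ∧
  ∃ r₁ r₂ r₃ r₄ : ℝ, 0 ≤ r₁ ∧ r₁ ≤ r₂ ∧ r₂ ≤ r₃ ∧ r₃ ≤ r₄ ∧ r₄ ≤ 1 ∧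
    MapsTo c (Icc 0 r₁) (S.chartV R i₁) ∧ MapsTo c (Icc r₁ r₂) (S.chartW R j₁) ∧
    MapsTo c (Icc r₂ r₃) (S.chartV R i₂) ∧ MapsTo c (Icc r₃ r₄) (S.chartW R j₂) ∧
    MapsTo c (Icc r₄ 1) (S.chartV R i₁)

/-- The split solution `A` and the bi-PIKAS `P` correspond under the partial Legendre transform:
locally in each chart there is a potential `K` of `A` such that the affine coordinates are
`y_i = ∂K/∂s_i` (along the basis of `N_σ`) and `y_p = t_p` (along a complement with basis `f_p`
dual to the basis of `N^*_τ`), and the dual affine coordinates, which are the derivatives of the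
potential `Ψ(y)`, are `s_i` and `-∂K/∂t_p`. -/
def IsPartialLegendre {n l : ℕ} {S : SimplexPair n l} {R : Set (Base n l)}
    (A : SingularSplitSolution S R) (P : BiPIKAS S R) : Prop :=
  ∀ f : Fin l → Fin (n + l + 1) → ℝ,
    (∀ a b, toReal (S.m a : Fin (n + l + 1) → ℤ) ⬝ᵥ f b = if a = b then 1 else 0) →
    (∀ i, (∀ b, f b ∈ perp (S.v i)) → ∀ p ∈ S.chartV R i,
      ∃ O : Set (Base n l), IsOpen O ∧ p ∈ O ∧ O ⊆ S.chartV R i ∧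
        ∃ K : Base n l → ℝ, IsSplitPotential K O A.V A.W ∧ ∀ q ∈ O,
          P.h q = ∑ a, fderiv ℝ K q (sdir a) • toReal (S.e a : Fin (n + l + 1) → ℤ) +
            ∑ b, q.2 b • f b ∧
          ∀ b, P.k q ⬝ᵥ f b = -fderiv ℝ K q (tdir b)) ∧
    (∀ j, ∀ p ∈ S.chartW R j,
      ∃ O : Set (Base n l), IsOpen O ∧ p ∈ O ∧ O ⊆ S.chartW R j ∧
        ∃ K : Base n l → ℝ, IsSplitPotential K O A.V A.W ∧ ∀ q ∈ O,
          quotCoord (S.w j) P.h q = (line (S.w j)).mkQ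
            (∑ a, fderiv ℝ K q (sdir a) • toReal (S.e a : Fin (n + l + 1) → ℤ) +
              ∑ b, q.2 b • f b) ∧
          ∀ b, P.k q ⬝ᵥ f b = -fderiv ℝ K q (tdir b))

end

/-!
**Coordinates.** The bases of `σ^⊥` and `τ^⊥` extend to an adapted frame of `N`
(`SimplexPair.exists_frame`), in which a vector has coordinates `(η, t)` and the value of `v_0`, and
a covector has coordinates `(s, θ)` and its value on `w_0`. The boundaries of the dual cones are
graphs: `h` has to take the value `-min_a ⟨v_a, t⟩` on `v_0`, and `k` the value `-min_j ⟨w_j, s⟩`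
on `w_0`. So a bi-PIKAS is the same as a pair of functions `η` and `θ` on `R°` with suitable
gradients (`IsEmbeddingGradient`): in the chart `v_a` the pair `(η, θ + ⟨w, s⟩ v_a)` and in the
chart `w_j` the pair `(η + ⟨v, t⟩ w_j, θ)`, where `⟨w, s⟩` and `⟨v, t⟩` stand for the two minima,
is `(∂K/∂s, -∂K/∂t)` for a potential `K`.

**The partial Legendre transform.** In a single chart, `Ψ = ⟨s, η⟩ - K` exchanges the potentials of
the metric with split potentials. It turns the Hessian of `Ψ` into `V ds² + W dt²`, and the equation
`det Hess Ψ = 1` into `det V = det W` (`IsMongeAmpere.exists_hasSplitGradient`,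
`HasSplitGradient.metric_eq`, `HasSplitGradient.det_mul`, `isMongeAmpere_of_hasSplitGradient`).

**Gluing.** The matrices `V` and `W` determine the third derivatives of a potential. Hence on a
convex chart the local potentials of a split solution glue (`exists_isSplitPotential`), and two of
them differ by a biaffine function (`exists_biaffine`). On the cell where the charts `v_a` and `w_j`
meet, the two potentials differ by a biaffine function with a mixed part `D j a`; a split solution
comes from a bi-PIKAS when, after normalization, the biaffine function is the bilinear form
`⟨w_j, s⟩ ⟨v_a, t⟩` of the model `D j a = w_j ⊗ v_a`.

**The current.** The condition on the mixed part is equivalent to the equation of currents. Since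
`V` and `W` are positive, the gradients of the potentials are monotone on slices, which makes them
locally bounded even at the singular locus (`exists_bound_of_monotone`), and makes `V` and `W`
locally integrable (`IsGlued.locallyIntegrableOn_V`). The singular locus has codimension two, so
cutoffs around it are harmless for bounded gradients, and integration by parts turns the left side
of the equation into a sum over the cells that contains only the biaffine jumps
(`IsMixedPair.integral_integrand`, `IsGlued.integral_current`). For the model, the divergence
theorem on the normal cones (`IsSimplexEdges.gammaCurrent_eq`) identifies the sum with the product
of the two wall currents, up to the sign (`SimplexPair.sum_integral_model`). Conversely, test
functions concentrated at the product of two walls show that the jumps and the model have the same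
alternating sums over two cones in each factor (`SimplexPair.plaquette_eq_zero`,
`IsGlued.plaquette`), and then biaffine functions can be added to the potentials so as to reach the
model (`SingularSplitSolution.exists_normalized_potentials`).

**Embeddings.** That `h` and `k`, built from the potentials of a split solution, are open embeddings
with the required charts follows from convexity of `R`: the gradients are strictly monotone on the
slices of the charts, and injectivity across the walls follows by density
(`AdaptedFrame.isPolyhedral`).

**Uniqueness and monodromy.** The embeddings that correspond to the same solution differ by
gradients of biaffine functions, hence have the same metric and affine structure, and the solution
is recovered from the metric (`IsCompatible.equiv`, `IsCompatible.matrix_eq`). The monodromy only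
uses that the charts with values in `v_i^⊥` and those with values modulo `w_j` are related by the
projections (`BiPIKAS.hasMonodromy`).
-/

noncomputable section

set_option maxSynthPendingDepth 3

/-! ### Adapted frames of the lattice -/

/-- The edges of a lattice simplex that issue from one vertex are a nondegenerate family in every
basis of a lattice of their rank that contains them. -/
theorem det_edge_coordinates_ne_zero {k d : ℕ} {A : Submodule ℤ (Fin d → ℤ)}
    (bA : Module.Basis (Fin k) ℤ A) {u : Fin (k + 1) → Fin d → ℤ} (hu : AffineIndependent ℤ u)
    (hmem : ∀ i j, u i - u j ∈ A) :
    (Matrix.of fun i j : Fin k => bA.repr ⟨u i.succ - u 0, hmem _ _⟩ j).det ≠ 0 := by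
  intro h0
  obtain ⟨c, hc0, hc⟩ := Matrix.exists_vecMul_eq_zero_iff.2 h0
  have hli := (affineIndependent_iff_linearIndependent_vsub ℤ u 0).1 hu
  have hli' : LinearIndependent ℤ fun i : Fin k => u i.succ - u 0 :=
    hli.comp (fun i : Fin k => (⟨i.succ, Fin.succ_ne_zero i⟩ : {x : Fin (k + 1) // x ≠ 0}))
      (fun i j h => by simpa using h)
  have hsum : ∑ i, c i • (⟨u i.succ - u 0, hmem _ _⟩ : A) = 0 := by
    apply bA.repr.injective
    ext j
    have := congrFun hc j
    rw [map_sum, Finsupp.finsetSum_apply]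
    simp only [map_smul, Finsupp.smul_apply, smul_eq_mul, map_zero, Finsupp.zero_apply]
    simpa [Matrix.vecMul, dotProduct] using this
  refine hc0 (funext fun i => ?_)
  refine Fintype.linearIndependent_iff.1 hli' c ?_ i
  simpa [-zsmul_eq_mul] using congrArg (Subtype.val) hsum

/-- Bases of a lattice and of its dual lattice that are adapted to a pair of lattice simplices
`a` and `b` with `⟨a i, b j⟩ = 1`. The basis of the lattice consists of the `e i`, which span
`a^⊥`, of the `f p`, and of `b 0`; the dual basis consists of the `es i`, of the `fs p`, which
span `b^⊥`, and of `a 0`. -/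
structure AdaptedFrame {n l d : ℕ} (a : Fin (l + 1) → Fin d → ℤ) (b : Fin (n + 1) → Fin d → ℤ) where
  e : Fin n → Fin d → ℤ
  f : Fin l → Fin d → ℤ
  es : Fin n → Fin d → ℤ
  fs : Fin l → Fin d → ℤ
  /-- coordinates of `a i - a 0` with respect to the `fs p` -/
  al : Fin (l + 1) → Fin l → ℤ
  /-- coordinates of `b j - b 0` with respect to the `e i` -/
  be : Fin (n + 1) → Fin n → ℤ
  es_e : ∀ i j, es i ⬝ᵥ e j = if i = j then 1 else 0
  es_f : ∀ i p, es i ⬝ᵥ f p = 0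
  es_b : ∀ i, es i ⬝ᵥ b 0 = 0
  fs_e : ∀ p i, fs p ⬝ᵥ e i = 0
  fs_f : ∀ p q, fs p ⬝ᵥ f q = if p = q then 1 else 0
  fs_b : ∀ p, fs p ⬝ᵥ b 0 = 0
  a_e : ∀ i, a 0 ⬝ᵥ e i = 0
  a_f : ∀ p, a 0 ⬝ᵥ f p = 0
  a_b : a 0 ⬝ᵥ b 0 = 1
  complete : ∀ y, y = ∑ i, (es i ⬝ᵥ y) • e i + ∑ p, (fs p ⬝ᵥ y) • f p + (a 0 ⬝ᵥ y) • b 0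
  a_eq : ∀ i, a i = a 0 + ∑ p, al i p • fs p
  b_eq : ∀ j, b j = b 0 + ∑ i, be j i • e i

theorem toReal_dotProduct {d : ℕ} (x y : Fin d → ℤ) :
    toReal x ⬝ᵥ toReal y = ((x ⬝ᵥ y : ℤ) : ℝ) := by
  simp [toReal, dotProduct]

theorem toReal_sum {d : ℕ} {ι : Type} [Fintype ι] (c : ι → ℤ) (x : ι → Fin d → ℤ) :
    toReal (∑ i, c i • x i) = ∑ i, (c i : ℝ) • toReal (x i) := by
  ext j
  simp [toReal, Finset.sum_apply]

/-- Every integral linear functional on `ℤ^d` is the dot product with a lattice vector. -/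
theorem exists_dotProduct_eq {d : ℕ} (φ : (Fin d → ℤ) →ₗ[ℤ] ℤ) :
    ∃ x : Fin d → ℤ, ∀ y, x ⬝ᵥ y = φ y := by
  refine ⟨fun i => φ (Pi.single i 1), fun y => ?_⟩
  conv_rhs => rw [pi_eq_sum_univ' y]
  simp [-zsmul_eq_mul, dotProduct, map_sum, mul_comm]

namespace AdaptedFrame

variable {n l d : ℕ} {a : Fin (l + 1) → Fin d → ℤ} {b : Fin (n + 1) → Fin d → ℤ}
  (F : AdaptedFrame a b)

theorem complete_dual (y : Fin d → ℤ) : y = ∑ p, (F.f p ⬝ᵥ y) • F.fs p +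
    ∑ i, (F.e i ⬝ᵥ y) • F.es i + (b 0 ⬝ᵥ y) • a 0 := by
  have key : ∀ z, z ⬝ᵥ y = z ⬝ᵥ (∑ p, (F.f p ⬝ᵥ y) • F.fs p +
    ∑ i, (F.e i ⬝ᵥ y) • F.es i + (b 0 ⬝ᵥ y) • a 0) := by
    intro z
    conv_lhs => rw [F.complete z]
    simp only [add_dotProduct, sum_dotProduct, smul_dotProduct, smul_eq_mul]
    rw [dotProduct_comm z]
    simp only [add_dotProduct, sum_dotProduct, smul_dotProduct, smul_eq_mul]
    rw [add_comm (∑ i, F.es i ⬝ᵥ z * _)]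
    simp only [mul_comm]
  ext i
  simpa using key (Pi.single i 1)

/-- The frame with the roles of the two simplices, and of a lattice and its dual, exchanged. -/
def swap : AdaptedFrame b a where
  e := F.fs
  f := F.es
  es := F.f
  fs := F.e
  al := F.be
  be := F.al
  es_e i j := by rw [dotProduct_comm, F.fs_f]; simp [eq_comm]
  es_f i p := by rw [dotProduct_comm, F.es_f]
  es_b i := by rw [dotProduct_comm, F.a_f]
  fs_e p i := by rw [dotProduct_comm, F.fs_e]
  fs_f p q := by rw [dotProduct_comm, F.es_e]; simp [eq_comm]
  fs_b p := by rw [dotProduct_comm, F.a_e]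
  a_e i := by rw [dotProduct_comm, F.fs_b]
  a_f p := by rw [dotProduct_comm, F.es_b]
  a_b := by rw [dotProduct_comm, F.a_b]
  complete := F.complete_dual
  a_eq := F.b_eq
  b_eq := F.a_eq

/-- Coordinates of `a i - a 0`, as a vector of Euclidean space. -/
def alR (i : Fin (l + 1)) : EuclideanSpace ℝ (Fin l) := WithLp.toLp 2 fun p => (F.al i p : ℝ)

/-- Coordinates of `b j - b 0`, as a vector of Euclidean space. -/
def beR (j : Fin (n + 1)) : EuclideanSpace ℝ (Fin n) := WithLp.toLp 2 fun i => (F.be j i : ℝ)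

theorem al_zero (p : Fin l) : F.al 0 p = 0 := by
  have h := congrArg (fun x => x ⬝ᵥ F.f p) (F.a_eq 0)
  simpa [-zsmul_eq_mul, add_dotProduct, sum_dotProduct, F.fs_f, F.a_f] using h.symm

theorem be_zero (p : Fin n) : F.be 0 p = 0 := F.swap.al_zero p

theorem complete_real (y : Fin d → ℝ) : y = ∑ i, (toReal (F.es i) ⬝ᵥ y) • toReal (F.e i) +
    ∑ p, (toReal (F.fs p) ⬝ᵥ y) • toReal (F.f p) + (toReal (a 0) ⬝ᵥ y) • toReal (b 0) := by
  let T : (Fin d → ℝ) →ₗ[ℝ] (Fin d → ℝ) :=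
    { toFun := fun y => ∑ i, (toReal (F.es i) ⬝ᵥ y) • toReal (F.e i) +
        ∑ p, (toReal (F.fs p) ⬝ᵥ y) • toReal (F.f p) + (toReal (a 0) ⬝ᵥ y) • toReal (b 0)
      map_add' := fun x y => by
        simp only [dotProduct_add, add_smul, Finset.sum_add_distrib]; abel
      map_smul' := fun c x => by
        simp only [dotProduct_smul, smul_add, Finset.smul_sum, smul_smul, smul_eq_mul,
          RingHom.id_apply] }
  have : LinearMap.id = T := by
    refine (Pi.basisFun ℝ (Fin d)).ext fun i => ?_
    have hi : (Pi.basisFun ℝ (Fin d)) i = toReal (Pi.single i (1 : ℤ)) := by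
      ext j; simp [toReal, Pi.single_apply]
    rw [hi]
    simp only [LinearMap.id_apply, T, LinearMap.coe_mk, AddHom.coe_mk, toReal_dotProduct]
    conv_lhs => rw [F.complete (Pi.single i (1 : ℤ))]
    rw [map_add, map_add, toReal_sum, toReal_sum]
    congr 1
    ext j; simp [toReal]
  exact congrArg (fun φ : (Fin d → ℝ) →ₗ[ℝ] (Fin d → ℝ) => φ y) this

theorem a_dot (i : Fin (l + 1)) (y : Fin d → ℝ) : toReal (a i) ⬝ᵥ y =
    toReal (a 0) ⬝ᵥ y + ∑ p, F.al i p * (toReal (F.fs p) ⬝ᵥ y) := by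
  conv_lhs => rw [F.a_eq i, map_add, toReal_sum, add_dotProduct, sum_dotProduct]
  simp

theorem toReal_b (j : Fin (n + 1)) :
    toReal (b j) = toReal (b 0) + ∑ i, (F.be j i : ℝ) • toReal (F.e i) := by
  conv_lhs => rw [F.b_eq j, map_add, toReal_sum]

end AdaptedFrame

/-- A basis of the lattice `w^⊥` has dual vectors in the ambient lattice, because `w^⊥` is
saturated. -/
theorem exists_dual_vectors {k r d : ℕ} {w : Fin r → Fin d → ℤ}
    (m : Module.Basis (Fin k) ℤ (annLattice w)) :
    ∃ f : Fin k → Fin d → ℤ, ∀ p q, (m p : Fin d → ℤ) ⬝ᵥ f q = if p = q then 1 else 0 := by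
  -- The lattice `w^⊥` is saturated, hence a direct summand.
  let φ : (Fin d → ℤ) →ₗ[ℤ] (Fin r → ℤ) :=
    { toFun := fun y i => w i ⬝ᵥ y
      map_add' := fun x y => by ext i; simp [dotProduct_add]
      map_smul' := fun c x => by ext i; simp [-zsmul_eq_mul, dotProduct_smul] }
  have hker : ∀ y, φ y = 0 ↔ y ∈ annLattice w := fun y =>
    ⟨fun h i => congrFun h i, fun h => funext h⟩
  obtain ⟨s, hs⟩ := Module.projective_lifting_property φ.rangeRestrict LinearMap.id
    φ.surjective_rangeRestrict
  have hs' : ∀ y, φ (s (φ.rangeRestrict y)) = φ y := fun y => by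
    have := congrArg (fun ψ => ((ψ (φ.rangeRestrict y) : LinearMap.range φ) : Fin r → ℤ)) hs
    simpa using this
  let ρ : (Fin d → ℤ) →ₗ[ℤ] annLattice w :=
    LinearMap.codRestrict (annLattice w) (LinearMap.id - s.comp φ.rangeRestrict) fun y => by
      rw [← hker]; simp [hs']
  have hρ : ∀ y : annLattice w, ρ y = y := fun y => by
    ext1
    have : φ.rangeRestrict (y : Fin d → ℤ) = 0 := Subtype.ext ((hker _).2 y.2)
    simp [ρ, this]
  choose f hf using fun q => exists_dotProduct_eq ((m.coord q).comp ρ)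
  refine ⟨f, fun p q => ?_⟩
  rw [dotProduct_comm, hf]
  simp [hρ, Finsupp.single_apply]

namespace SimplexPair

variable {n l : ℕ} (S : SimplexPair n l)

theorem sum_repr_e (j : Fin (n + 1)) : S.w j = S.w 0 +
    ∑ i, S.e.repr ⟨S.w j - S.w 0, S.w_sub_mem j 0⟩ i • (S.e i : Fin (n + l + 1) → ℤ) := by
  have h := congrArg Subtype.val (S.e.sum_repr ⟨S.w j - S.w 0, S.w_sub_mem j 0⟩)
  simp only [Submodule.coe_sum, Submodule.coe_smul] at h
  rw [h]; abel

theorem sum_repr_m (j : Fin (l + 1)) : S.v j = S.v 0 +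
    ∑ i, S.m.repr ⟨S.v j - S.v 0, S.v_sub_mem j 0⟩ i • (S.m i : Fin (n + l + 1) → ℤ) := by
  have h := congrArg Subtype.val (S.m.sum_repr ⟨S.v j - S.v 0, S.v_sub_mem j 0⟩)
  simp only [Submodule.coe_sum, Submodule.coe_smul] at h
  rw [h]; abel

theorem m_dot_w (p : Fin l) (j : Fin (n + 1)) : (S.m p : Fin (n + l + 1) → ℤ) ⬝ᵥ S.w j = 0 := by
  rw [dotProduct_comm]; exact (S.m p).2 j

theorem m_dot_e (p : Fin l) (i : Fin n) :
    (S.m p : Fin (n + l + 1) → ℤ) ⬝ᵥ (S.e i : Fin (n + l + 1) → ℤ) = 0 := by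
  have hdet := det_edge_coordinates_ne_zero S.e S.w_indep S.w_sub_mem
  have := Matrix.eq_zero_of_mulVec_eq_zero hdet
    (v := fun i => (S.m p : Fin (n + l + 1) → ℤ) ⬝ᵥ (S.e i : Fin (n + l + 1) → ℤ)) ?_
  · exact congrFun this i
  · ext j
    have h := congrArg (fun x => (S.m p : Fin (n + l + 1) → ℤ) ⬝ᵥ x) (S.sum_repr_e j.succ)
    simp only [dotProduct_add, S.m_dot_w, dotProduct_sum, dotProduct_smul, smul_eq_mul,
      zero_add] at h
    simpa [Matrix.mulVec, dotProduct] using h.symm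

/-- A pair of simplices has an adapted frame. Vectors dual to the basis of `τ^⊥` are corrected by
multiples of `w_0`, which moves them into `v_0^⊥`; the covectors dual to the basis of `σ^⊥` come
from the projection onto `σ^⊥` along these vectors and `w_0`. -/
theorem exists_frame : ∃ F : AdaptedFrame S.v S.w, (∀ i, F.e i = S.e i) ∧ (∀ p, F.fs p = S.m p) ∧
    (∀ i p, F.al i p = S.m.repr ⟨S.v i - S.v 0, S.v_sub_mem i 0⟩ p) ∧
    (∀ j i, F.be j i = S.e.repr ⟨S.w j - S.w 0, S.w_sub_mem j 0⟩ i) := by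
  obtain ⟨f', hf'⟩ := exists_dual_vectors S.m
  let f : Fin l → Fin (n + l + 1) → ℤ := fun p => f' p - (S.v 0 ⬝ᵥ f' p) • S.w 0
  have hmf : ∀ p q, (S.m p : Fin (n + l + 1) → ℤ) ⬝ᵥ f q = if p = q then 1 else 0 := fun p q => by
    simp only [f, dotProduct_sub, dotProduct_smul, S.m_dot_w, smul_zero, sub_zero, hf']
  have hvf : ∀ p, S.v 0 ⬝ᵥ f p = 0 := fun p => by
    simp [-zsmul_eq_mul, f, dotProduct_sub, dotProduct_smul, S.pairing]
  let π : (Fin (n + l + 1) → ℤ) →ₗ[ℤ] (Fin (n + l + 1) → ℤ) :=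
    { toFun := fun y => y - ∑ p, ((S.m p : Fin (n + l + 1) → ℤ) ⬝ᵥ y) • f p - (S.v 0 ⬝ᵥ y) • S.w 0
      map_add' := fun x y => by
        simp only [dotProduct_add, add_smul, Finset.sum_add_distrib]; abel
      map_smul' := fun c x => by
        simp only [dotProduct_smul, smul_sub, Finset.smul_sum, smul_smul, smul_eq_mul,
          RingHom.id_apply] }
  have hπapp : ∀ y, π y = y - ∑ p, ((S.m p : Fin (n + l + 1) → ℤ) ⬝ᵥ y) • f p -
    (S.v 0 ⬝ᵥ y) • S.w 0 := fun _ => rfl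
  have hmπ : ∀ p y, (S.m p : Fin (n + l + 1) → ℤ) ⬝ᵥ π y = 0 := fun p y => by
    rw [hπapp]
    simp [-zsmul_eq_mul, dotProduct_sub, dotProduct_sum, dotProduct_smul, hmf, S.m_dot_w]
  have hvπ0 : ∀ y, S.v 0 ⬝ᵥ π y = 0 := fun y => by
    rw [hπapp]
    simp [-zsmul_eq_mul, dotProduct_sub, dotProduct_sum, dotProduct_smul, hvf, S.pairing]
  have hπ : ∀ y, π y ∈ annLattice S.v := fun y i => by
    rw [S.sum_repr_m i, add_dotProduct, sum_dotProduct, hvπ0]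
    simp [-zsmul_eq_mul, hmπ]
  let P : (Fin (n + l + 1) → ℤ) →ₗ[ℤ] annLattice S.v := LinearMap.codRestrict _ π hπ
  choose es hes using fun i => exists_dotProduct_eq ((S.e.coord i).comp P)
  have hve : ∀ j i, S.v j ⬝ᵥ (S.e i : Fin (n + l + 1) → ℤ) = 0 := fun j i => (S.e i).2 j
  have hPe : ∀ i, P (S.e i) = S.e i := fun i => by
    ext1
    simp [-zsmul_eq_mul, P, hπapp, S.m_dot_e, hve]
  have hPf : ∀ p, P (f p) = 0 := fun p => by
    ext1
    simp [-zsmul_eq_mul, P, hπapp, hmf, hvf]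
  have hPw : P (S.w 0) = 0 := by
    ext1
    simp [-zsmul_eq_mul, P, hπapp, S.m_dot_w, S.pairing]
  refine ⟨{ e := fun i => S.e i, f := f, es := es, fs := fun p => S.m p
            al := fun i p => S.m.repr ⟨S.v i - S.v 0, S.v_sub_mem i 0⟩ p
            be := fun j i => S.e.repr ⟨S.w j - S.w 0, S.w_sub_mem j 0⟩ i
            es_e := fun i j => ?_, es_f := fun i p => ?_, es_b := fun i => ?_
            fs_e := S.m_dot_e, fs_f := hmf, fs_b := fun p => S.m_dot_w p 0
            a_e := fun i => hve 0 i, a_f := hvf, a_b := S.pairing 0 0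
            complete := fun y => ?_, a_eq := S.sum_repr_m, b_eq := S.sum_repr_e },
    fun _ => rfl, fun _ => rfl, fun _ _ => rfl, fun _ _ => rfl⟩
  · rw [hes]; simp [hPe, Finsupp.single_apply, eq_comm]
  · rw [hes]; simp [hPf]
  · rw [hes]; simp [hPw]
  · have h := congrArg Subtype.val (S.e.sum_repr (P y))
    simp only [Submodule.coe_sum, Submodule.coe_smul] at h
    have h2 : ∀ i, es i ⬝ᵥ y = S.e.repr (P y) i := fun i => by rw [hes]; simp
    simp only [h2]
    rw [h]
    simp only [P, LinearMap.codRestrict_apply, hπapp]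
    abel

/-- An adapted frame that extends the given bases of `σ^⊥` and `τ^⊥`. -/
def frame : AdaptedFrame S.v S.w := S.exists_frame.choose

theorem frame_e (i : Fin n) : S.frame.e i = S.e i := S.exists_frame.choose_spec.1 i

theorem frame_fs (p : Fin l) : S.frame.fs p = S.m p := S.exists_frame.choose_spec.2.1 p

theorem edgeV_eq (i j : Fin (l + 1)) : S.edgeV i j = S.frame.alR i - S.frame.alR j := by
  have h := S.exists_frame.choose_spec.2.2.1
  ext p
  have e1 : (⟨S.v i - S.v j, S.v_sub_mem i j⟩ : annLattice S.w) =
    ⟨S.v i - S.v 0, S.v_sub_mem i 0⟩ - ⟨S.v j - S.v 0, S.v_sub_mem j 0⟩ := by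
    ext1; simp
  simp only [edgeV, AdaptedFrame.alR, frame, h, PiLp.sub_apply, e1, map_sub, Finsupp.sub_apply,
    Int.cast_sub]

theorem edgeW_eq (i j : Fin (n + 1)) : S.edgeW i j = S.frame.beR i - S.frame.beR j := by
  have h := S.exists_frame.choose_spec.2.2.2
  ext p
  have e1 : (⟨S.w i - S.w j, S.w_sub_mem i j⟩ : annLattice S.v) =
    ⟨S.w i - S.w 0, S.w_sub_mem i 0⟩ - ⟨S.w j - S.w 0, S.w_sub_mem j 0⟩ := by
    ext1; simp
  simp only [edgeW, AdaptedFrame.beR, frame, h, PiLp.sub_apply, e1, map_sub, Finsupp.sub_apply,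
    Int.cast_sub]

theorem det_al_ne_zero : (Matrix.of fun i j : Fin l => (S.frame.al i.succ j : ℝ)).det ≠ 0 := by
  have h := S.exists_frame.choose_spec.2.2.1
  have h2 := det_edge_coordinates_ne_zero S.m S.v_indep S.v_sub_mem
  have h3 : (Matrix.of fun i j : Fin l => (S.frame.al i.succ j : ℝ)) = (Int.castRingHom ℝ).mapMatrix
      (Matrix.of fun i j : Fin l => S.m.repr ⟨S.v i.succ - S.v 0, S.v_sub_mem _ _⟩ j) := by
    ext i j
    simp [frame, h]
  rw [h3, ← RingHom.map_det]
  simpa using h2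

theorem det_be_ne_zero : (Matrix.of fun i j : Fin n => (S.frame.be i.succ j : ℝ)).det ≠ 0 := by
  have h := S.exists_frame.choose_spec.2.2.2
  have h2 := det_edge_coordinates_ne_zero S.e S.w_indep S.w_sub_mem
  have h3 : (Matrix.of fun i j : Fin n => (S.frame.be i.succ j : ℝ)) = (Int.castRingHom ℝ).mapMatrix
      (Matrix.of fun i j : Fin n => S.e.repr ⟨S.w i.succ - S.w 0, S.w_sub_mem _ _⟩ j) := by
    ext i j
    simp [frame, h]
  rw [h3, ← RingHom.map_det]
  simpa using h2

end SimplexPair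

/-! ### The normal fan of a simplex -/

/-- The vectors `c i j` are the differences `x i - x j` of the vertices of a nondegenerate simplex
with `x 0 = 0`. -/
structure IsSimplexEdges {k : ℕ} (c : Fin (k + 1) → Fin (k + 1) → EuclideanSpace ℝ (Fin k))
    (x : Fin (k + 1) → EuclideanSpace ℝ (Fin k)) : Prop where
  eq : ∀ i j, c i j = x i - x j
  zero : x 0 = 0
  det : (Matrix.of fun i j : Fin k => x i.succ j).det ≠ 0

/-- The concave piecewise linear function whose domains of linearity are the normal cones of the
simplex with vertices `x i`: the minimum on the simplex of a linear form. -/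
def minForm {k : ℕ} (x : Fin (k + 1) → EuclideanSpace ℝ (Fin k)) (s : EuclideanSpace ℝ (Fin k)) :
    ℝ :=
  Finset.univ.inf' Finset.univ_nonempty fun a => inner ℝ (x a) s

theorem continuous_minForm {k : ℕ} (x : Fin (k + 1) → EuclideanSpace ℝ (Fin k)) :
    Continuous (minForm x) :=
  Continuous.finset_inf'_apply _ fun _ _ => by fun_prop

theorem minForm_le {k : ℕ} (x : Fin (k + 1) → EuclideanSpace ℝ (Fin k))
    (s : EuclideanSpace ℝ (Fin k)) (a : Fin (k + 1)) : minForm x s ≤ inner ℝ (x a) s :=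
  Finset.inf'_le _ (Finset.mem_univ a)

theorem exists_minForm_eq {k : ℕ} (x : Fin (k + 1) → EuclideanSpace ℝ (Fin k))
    (s : EuclideanSpace ℝ (Fin k)) : ∃ a, minForm x s = inner ℝ (x a) s := by
  obtain ⟨a, -, ha⟩ := Finset.exists_mem_eq_inf' (Finset.univ_nonempty (α := Fin (k + 1)))
    fun a => inner ℝ (x a) s
  exact ⟨a, ha⟩

theorem minForm_lipschitz {k : ℕ} (x : Fin (k + 1) → EuclideanSpace ℝ (Fin k)) :
    ∃ C : NNReal, LipschitzWith C (minForm x) := by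
  obtain ⟨C, hC⟩ : ∃ C : ℝ, ∀ a, ‖x a‖ ≤ C :=
    ⟨∑ a, ‖x a‖, fun a => Finset.single_le_sum (f := fun a => ‖x a‖)
      (fun _ _ => norm_nonneg _) (Finset.mem_univ a)⟩
  have hC0 : 0 ≤ C := (norm_nonneg _).trans (hC 0)
  refine ⟨⟨C, hC0⟩, LipschitzWith.of_le_add_mul _ fun s t => ?_⟩
  obtain ⟨a, ha⟩ := exists_minForm_eq x t
  have h1 := minForm_le x s a
  have h2 : inner ℝ (x a) (s - t) ≤ C * dist s t :=
    (real_inner_le_norm _ _).trans (by rw [dist_eq_norm]; gcongr; exact hC a)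
  rw [inner_sub_right] at h2
  rw [ha]
  show _ ≤ _ + C * dist s t
  linarith

section cones

variable {k : ℕ} {c : Fin (k + 1) → Fin (k + 1) → EuclideanSpace ℝ (Fin k)}
  {x : Fin (k + 1) → EuclideanSpace ℝ (Fin k)}

theorem isOpen_normalCone (c : Fin (k + 1) → Fin (k + 1) → EuclideanSpace ℝ (Fin k))
    (j : Fin (k + 1)) : IsOpen (normalCone c j) := by
  simp only [normalCone, ofPred_forall]
  refine isOpen_iInter_of_finite fun a => isOpen_iInter_of_finite fun _ => ?_
  exact isOpen_lt continuous_const (by fun_prop)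

theorem convex_normalCone (c : Fin (k + 1) → Fin (k + 1) → EuclideanSpace ℝ (Fin k))
    (j : Fin (k + 1)) : Convex ℝ (normalCone c j) := by
  simp only [normalCone, ofPred_forall]
  refine convex_iInter fun a => convex_iInter fun _ => ?_
  intro s hs t ht p q hp hq hpq
  simp only [mem_ofPred_eq, inner_add_right, inner_smul_right] at *
  rcases hp.eq_or_lt with rfl | hp'
  · have : q = 1 := by linarith
    subst this; simpa using ht
  · have := mul_pos hp' hs
    have := mul_nonneg hq ht.le
    linarith

namespace IsSimplexEdges

theorem inner_eq (h : IsSimplexEdges c x) (i j : Fin (k + 1)) (s : EuclideanSpace ℝ (Fin k)) :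
    inner ℝ (c i j) s = inner ℝ (x i) s - inner ℝ (x j) s := by
  rw [h.eq, inner_sub_left]

theorem mem_normalCone (h : IsSimplexEdges c x) {j : Fin (k + 1)} {s : EuclideanSpace ℝ (Fin k)} :
    s ∈ normalCone c j ↔ ∀ a, a ≠ j → inner ℝ (x j) s < inner ℝ (x a) s := by
  simp only [normalCone, mem_ofPred_eq, h.inner_eq, sub_pos]

theorem normalCone_unique (h : IsSimplexEdges c x) {i j : Fin (k + 1)}
    {s : EuclideanSpace ℝ (Fin k)} (hi : s ∈ normalCone c i) (hj : s ∈ normalCone c j) :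
    i = j := by
  by_contra hij
  exact lt_asymm (h.mem_normalCone.1 hi j (Ne.symm hij)) (h.mem_normalCone.1 hj i hij)

theorem minForm_eq (h : IsSimplexEdges c x) {j : Fin (k + 1)} {s : EuclideanSpace ℝ (Fin k)}
    (hs : s ∈ normalCone c j) : minForm x s = inner ℝ (x j) s := by
  refine le_antisymm (minForm_le x s j) (Finset.le_inf' _ _ fun a _ => ?_)
  by_cases haj : a = j
  · rw [haj]
  · exact (h.mem_normalCone.1 hs a haj).le

theorem exists_inner_eq (h : IsSimplexEdges c x) (y : Fin (k + 1) → ℝ) :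
    ∃ s, ∀ a, inner ℝ (x a) s = y a - y 0 := by
  have hu : IsUnit (Matrix.of fun i j : Fin k => x i.succ j) :=
    (Matrix.isUnit_iff_isUnit_det _).2 (isUnit_iff_ne_zero.2 h.det)
  obtain ⟨s, hs⟩ := (Matrix.mulVec_surjective_iff_isUnit.2 hu) fun i => y i.succ - y 0
  refine ⟨WithLp.toLp 2 s, fun a => ?_⟩
  refine Fin.cases ?_ (fun i => ?_) a
  · simp [h.zero]
  · have := congrFun hs i
    simp only [Matrix.mulVec, dotProduct, Matrix.of_apply] at this
    rw [← this]
    simp [PiLp.inner_apply, mul_comm]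

theorem eq_zero_of_inner (h : IsSimplexEdges c x) {s : EuclideanSpace ℝ (Fin k)}
    (hs : ∀ a, inner ℝ (x a) s = 0) : s = 0 := by
  have := Matrix.eq_zero_of_mulVec_eq_zero h.det (v := fun i => s i) ?_
  · ext i; exact congrFun this i
  · ext i
    have := hs i.succ
    simpa [Matrix.mulVec, dotProduct, PiLp.inner_apply, mul_comm] using this

theorem edge_ne_zero (h : IsSimplexEdges c x) {a b : Fin (k + 1)} (hab : a ≠ b) : c a b ≠ 0 := by
  intro h0
  obtain ⟨s, hs⟩ := h.exists_inner_eq (fun i => if i = a then 1 else 0)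
  have h1 := h.inner_eq a b s
  rw [h0, inner_zero_left, hs, hs] at h1
  simp [hab.symm] at h1

theorem mem_wall (h : IsSimplexEdges c x) {a b : Fin (k + 1)} {s : EuclideanSpace ℝ (Fin k)} :
    s ∈ wall c a b ↔ inner ℝ (x a) s = inner ℝ (x b) s ∧
      ∀ j, inner ℝ (x a) s ≤ inner ℝ (x j) s := by
  simp only [wall, mem_ofPred_eq, h.inner_eq, sub_nonneg, sub_eq_zero]

theorem exists_mem_normalCone_iff (h : IsSimplexEdges c x) {s : EuclideanSpace ℝ (Fin k)} :
    (∃ j, s ∈ normalCone c j) ↔ s ∉ wallComplex c := by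
  constructor
  · rintro ⟨j, hj⟩ hs
    simp only [wallComplex, mem_iUnion] at hs
    obtain ⟨a, b, hab, hs⟩ := hs
    rw [h.mem_wall] at hs
    rw [h.mem_normalCone] at hj
    have haj : a = j := by
      by_contra haj
      exact absurd (hj a haj) (hs.2 j).not_gt
    subst haj
    exact absurd (hj b hab.symm) hs.1.ge.not_gt
  · intro hs
    obtain ⟨a, ha⟩ := exists_minForm_eq x s
    refine ⟨a, h.mem_normalCone.2 fun b hb => ?_⟩
    have hle := fun j => ha ▸ minForm_le x s j
    refine lt_of_le_of_ne (hle b) fun heq => hs ?_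
    simp only [wallComplex, mem_iUnion]
    exact ⟨a, b, hb.symm, h.mem_wall.2 ⟨heq, hle⟩⟩

theorem exists_mem_normalCone (h : IsSimplexEdges c x) {s : EuclideanSpace ℝ (Fin k)}
    (hs : ∀ a b, a ≠ b → inner ℝ (c a b) s ≠ 0) : ∃ j, s ∈ normalCone c j := by
  rw [h.exists_mem_normalCone_iff]
  simp only [wallComplex, mem_iUnion, not_exists]
  exact fun a b hab hw => hs a b hab hw.1

end IsSimplexEdges

theorem volume_inner_eq_zero {E : Type*} [NormedAddCommGroup E] [InnerProductSpace ℝ E]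
    [FiniteDimensional ℝ E] [MeasurableSpace E] [BorelSpace E] {v : E} (hv : v ≠ 0) :
    volume {s : E | inner ℝ v s = 0} = 0 := by
  have hne : (innerSL ℝ v).ker ≠ ⊤ := by
    intro h
    have : v ∈ (innerSL ℝ v).ker := h ▸ Submodule.mem_top
    exact hv (by simpa using this)
  have := Measure.addHaar_submodule (volume : Measure E) _ hne
  convert this using 2
  ext s
  simp

namespace IsSimplexEdges

theorem ae_inner_ne_zero (h : IsSimplexEdges c x) :
    ∀ᵐ s : EuclideanSpace ℝ (Fin k), ∀ a b, a ≠ b → inner ℝ (c a b) s ≠ 0 := by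
  rw [ae_all_iff]; intro a
  rw [ae_all_iff]; intro b
  by_cases hab : a = b
  · simp [hab]
  · have := volume_inner_eq_zero (h.edge_ne_zero hab)
    filter_upwards [measure_eq_zero_iff_ae_notMem.1 this] with s hs _ using hs

theorem ae_mem_normalCone (h : IsSimplexEdges c x) :
    ∀ᵐ s : EuclideanSpace ℝ (Fin k), ∃ j, s ∈ normalCone c j :=
  h.ae_inner_ne_zero.mono fun _ hs => h.exists_mem_normalCone hs

/-- A function on a space that is cut by a fan is integrated over the cones separately. -/
theorem integral_eq_sum (h : IsSimplexEdges c x) {f : EuclideanSpace ℝ (Fin k) → ℝ}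
    (hf : Integrable f) : ∫ s, f s = ∑ j, ∫ s in normalCone c j, f s := by
  rw [← integral_iUnion_fintype (fun j => (isOpen_normalCone c j).measurableSet)
    (fun i j hij => Set.disjoint_left.2 fun s hi hj => hij (h.normalCone_unique hi hj))
    (fun i => hf.integrableOn)]
  rw [← setIntegral_univ]
  refine setIntegral_congr_set ?_
  filter_upwards [h.ae_mem_normalCone] with s hs
  have : s ∈ ⋃ j, normalCone c j := by simpa using hs
  exact propext (iff_of_true (mem_univ s) this)

end IsSimplexEdges

end cones

namespace AdaptedFrame

variable {n l d : ℕ} {a : Fin (l + 1) → Fin d → ℤ} {b : Fin (n + 1) → Fin d → ℤ}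
  (F : AdaptedFrame a b)

theorem alR_zero : F.alR 0 = 0 := by ext p; simp [alR, F.al_zero]

theorem beR_zero : F.beR 0 = 0 := by ext p; simp [beR, F.be_zero]

end AdaptedFrame

namespace SimplexPair

variable {n l : ℕ} (S : SimplexPair n l)

theorem isSimplexEdges_edgeV : IsSimplexEdges S.edgeV S.frame.alR :=
  ⟨S.edgeV_eq, S.frame.alR_zero, S.det_al_ne_zero⟩

theorem isSimplexEdges_edgeW : IsSimplexEdges S.edgeW S.frame.beR :=
  ⟨S.edgeW_eq, S.frame.beR_zero, S.det_be_ne_zero⟩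

variable {R : Set (Base n l)}

theorem isOpen_chartV (hR : IsOpen R) (i : Fin (l + 1)) : IsOpen (S.chartV R i) :=
  hR.inter ((isOpen_normalCone S.edgeV i).preimage continuous_snd)

theorem isOpen_chartW (hR : IsOpen R) (j : Fin (n + 1)) : IsOpen (S.chartW R j) :=
  hR.inter ((isOpen_normalCone S.edgeW j).preimage continuous_fst)

theorem convex_chartV (hR : Convex ℝ R) (i : Fin (l + 1)) : Convex ℝ (S.chartV R i) :=
  hR.inter ((convex_normalCone S.edgeV i).linear_preimage (LinearMap.snd ℝ _ _))

theorem convex_chartW (hR : Convex ℝ R) (j : Fin (n + 1)) : Convex ℝ (S.chartW R j) :=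
  hR.inter ((convex_normalCone S.edgeW j).linear_preimage (LinearMap.fst ℝ _ _))

theorem mem_regular_iff {p : Base n l} : p ∈ S.regular R ↔
    (∃ i, p ∈ S.chartV R i) ∨ ∃ j, p ∈ S.chartW R j := by
  have h1 : (∃ i, p ∈ S.chartV R i) ↔ p ∈ R ∧ p.2 ∉ wallComplex S.edgeV := by
    rw [← S.isSimplexEdges_edgeV.exists_mem_normalCone_iff]; simp [chartV]
  have h2 : (∃ i, p ∈ S.chartW R i) ↔ p ∈ R ∧ p.1 ∉ wallComplex S.edgeW := by
    rw [← S.isSimplexEdges_edgeW.exists_mem_normalCone_iff]; simp [chartW]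
  rw [h1, h2]
  simp only [regular, disc, Set.mem_sdiff, mem_prod]
  tauto

theorem chartV_subset (i : Fin (l + 1)) : S.chartV R i ⊆ S.regular R :=
  fun _ hp => S.mem_regular_iff.2 (Or.inl ⟨i, hp⟩)

theorem chartW_subset (j : Fin (n + 1)) : S.chartW R j ⊆ S.regular R :=
  fun _ hp => S.mem_regular_iff.2 (Or.inr ⟨j, hp⟩)

end SimplexPair

/-! ### Monodromy of the affine structure -/

theorem eq_of_eventually_eq_Icc {Z : Type*} {f : ℝ → Z} {a b : ℝ} (hab : a ≤ b)
    (h : ∀ r ∈ Icc a b, ∀ᶠ r' in 𝓝[Icc a b] r, f r' = f r) : f b = f a := by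
  refine isPreconnected_Icc.induction₂ (fun x y => f y = f x) (fun x hx => ?_) ?_ ?_
    (left_mem_Icc.2 hab) (right_mem_Icc.2 hab)
  · exact h x hx
  · exact fun x y z _ _ _ hxy hyz => hyz.trans hxy
  · exact fun x y _ _ hxy => hxy.symm

theorem toReal_pairing {n l : ℕ} (S : SimplexPair n l) (i : Fin (l + 1)) (j : Fin (n + 1)) :
    toReal (S.v i) ⬝ᵥ toReal (S.w j) = 1 := by
  rw [toReal_dotProduct, S.pairing]; simp

theorem perp_eq_of_mkQ_eq {n l : ℕ} (S : SimplexPair n l) {i : Fin (l + 1)} {j : Fin (n + 1)}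
    {x y : Fin (n + l + 1) → ℝ} (h : (line (S.w j)).mkQ x = (line (S.w j)).mkQ y) :
    x = y + (toReal (S.v i) ⬝ᵥ x - toReal (S.v i) ⬝ᵥ y) • toReal (S.w j) := by
  have hmem : x - y ∈ line (S.w j) := by
    rw [← Submodule.ker_mkQ (line (S.w j)), LinearMap.mem_ker, map_sub, h, sub_self]
  obtain ⟨c, hc⟩ := Submodule.mem_span_singleton.1 hmem
  have hx : x = y + c • toReal (S.w j) := by rw [hc]; abel
  have : toReal (S.v i) ⬝ᵥ x = toReal (S.v i) ⬝ᵥ y + c := by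
    rw [hx, dotProduct_add, dotProduct_smul, toReal_pairing]; simp
  rw [this, add_sub_cancel_left, ← hx]

theorem perp_ext_of_mkQ_eq {n l : ℕ} (S : SimplexPair n l) {i : Fin (l + 1)} {j : Fin (n + 1)}
    {x y : perp (S.v i)} (h : (line (S.w j)).mkQ x = (line (S.w j)).mkQ y) : x = y := by
  ext1
  have hx : toReal (S.v i) ⬝ᵥ (x : Fin (n + l + 1) → ℝ) = 0 := x.2
  have hy : toReal (S.v i) ⬝ᵥ (y : Fin (n + l + 1) → ℝ) = 0 := y.2
  have := perp_eq_of_mkQ_eq S (i := i) h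
  rwa [hx, hy, sub_self, zero_smul, add_zero] at this

namespace BiPIKAS

variable {n l : ℕ} {S : SimplexPair n l} {R : Set (Base n l)}

theorem perpCoord_coe (P : BiPIKAS S R) {i : Fin (l + 1)} {p : Base n l} (hp : p ∈ S.chartV R i) :
    (perpCoord (S.v i) P.h p : Fin (n + l + 1) → ℝ) = P.h p := by
  rw [perpCoord, dif_pos (P.h_polyhedral.face i p hp)]

theorem mkQ_fderiv_perpCoord (hR : IsOpen R) (P : BiPIKAS S R) {i : Fin (l + 1)} {j : Fin (n + 1)}
    {p : Base n l} (hi : p ∈ S.chartV R i) (u : Base n l) :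
    fderiv ℝ (quotCoord (S.w j) P.h) p u =
      (line (S.w j)).mkQ (fderiv ℝ (perpCoord (S.v i) P.h) p u : Fin (n + l + 1) → ℝ) := by
  let T : perp (S.v i) →L[ℝ] QuotLine (S.w j) :=
    LinearMap.toContinuousLinearMap ((line (S.w j)).mkQ ∘ₗ (perp (S.v i)).subtype)
  have hd : DifferentiableAt ℝ (perpCoord (S.v i) P.h) p :=
    ((P.h_polyhedral.chart_perp i).smooth.differentiableOn (by simp)).differentiableAt
      ((S.isOpen_chartV hR i).mem_nhds hi)
  have heq : quotCoord (S.w j) P.h =ᶠ[𝓝 p] T ∘ perpCoord (S.v i) P.h := by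
    filter_upwards [(S.isOpen_chartV hR i).mem_nhds hi] with q hq
    simp [T, quotCoord, P.perpCoord_coe hq]
  rw [heq.fderiv_eq, (T.hasFDerivAt.comp p hd.hasFDerivAt).fderiv]
  rfl

/-- The vector field `X` along the curve `c` is parallel on the interval `[a, b]`. -/
def ParallelOn (P : BiPIKAS S R) (c X : ℝ → Base n l) (a b : ℝ) : Prop :=
  ∀ r ∈ Icc a b,
    (∀ i, c r ∈ S.chartV R i → ∀ᶠ r' in 𝓝[Icc a b] r,
      fderiv ℝ (perpCoord (S.v i) P.h) (c r') (X r') =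
        fderiv ℝ (perpCoord (S.v i) P.h) (c r) (X r)) ∧
    (∀ j, c r ∈ S.chartW R j → ∀ᶠ r' in 𝓝[Icc a b] r,
      fderiv ℝ (quotCoord (S.w j) P.h) (c r') (X r') =
        fderiv ℝ (quotCoord (S.w j) P.h) (c r) (X r))

/-- Along a path in the chart `v_i` a parallel field is one whose image in `v_i^⊥` is constant. -/
theorem exists_parallelOn_chartV (hR : IsOpen R) (P : BiPIKAS S R) {c : ℝ → Base n l} {a b : ℝ}
    (hab : a ≤ b) {i : Fin (l + 1)}
    (hm : MapsTo c (Icc a b) (S.chartV R i)) (X₀ : Base n l) :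
    ∃ X, P.ParallelOn c X a b ∧ X a = X₀ := by
  have hb := (P.h_polyhedral.chart_perp i).bijective
  have hex : ∀ r, ∃ x, r ∈ Icc a b → fderiv ℝ (perpCoord (S.v i) P.h) (c r) x =
      fderiv ℝ (perpCoord (S.v i) P.h) (c a) X₀ := fun r => by
    by_cases hr : r ∈ Icc a b
    · obtain ⟨x, hx⟩ := (hb _ (hm hr)).2 (fderiv ℝ (perpCoord (S.v i) P.h) (c a) X₀)
      exact ⟨x, fun _ => hx⟩
    · exact ⟨0, fun h => absurd h hr⟩
  choose X hX using hex
  refine ⟨X, fun r hr => ⟨fun i' hi' => ?_, fun j hj => ?_⟩,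
    (hb _ (hm (left_mem_Icc.2 hab))).1 (hX a (left_mem_Icc.2 hab))⟩
  · obtain rfl := S.isSimplexEdges_edgeV.normalCone_unique hi'.2 (hm hr).2
    filter_upwards [self_mem_nhdsWithin] with r' hr'
    rw [hX r' hr', hX r hr]
  · filter_upwards [self_mem_nhdsWithin] with r' hr'
    rw [P.mkQ_fderiv_perpCoord hR (hm hr'), P.mkQ_fderiv_perpCoord hR (hm hr), hX r' hr', hX r hr]

/-- Along a path in the chart `w_j` a parallel field is one whose image modulo `w_j` is constant.
Where the path also lies in a chart `v_i`, the image in `v_i^⊥` is determined by the image modulo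
`w_j`, hence locally constant. -/
theorem exists_parallelOn_chartW (hR : IsOpen R) (P : BiPIKAS S R) {c : ℝ → Base n l} {a b : ℝ}
    (hab : a ≤ b) (hc : ContinuousOn c (Icc a b)) {j : Fin (n + 1)}
    (hm : MapsTo c (Icc a b) (S.chartW R j)) (X₀ : Base n l) :
    ∃ X, P.ParallelOn c X a b ∧ X a = X₀ := by
  have hb := (P.h_polyhedral.chart_quot j).bijective
  have hex : ∀ r, ∃ x, r ∈ Icc a b → fderiv ℝ (quotCoord (S.w j) P.h) (c r) x =
      fderiv ℝ (quotCoord (S.w j) P.h) (c a) X₀ := fun r => by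
    by_cases hr : r ∈ Icc a b
    · obtain ⟨x, hx⟩ := (hb _ (hm hr)).2 (fderiv ℝ (quotCoord (S.w j) P.h) (c a) X₀)
      exact ⟨x, fun _ => hx⟩
    · exact ⟨0, fun h => absurd h hr⟩
  choose X hX using hex
  refine ⟨X, fun r hr => ⟨fun i hi => ?_, fun j' hj' => ?_⟩,
    (hb _ (hm (left_mem_Icc.2 hab))).1 (hX a (left_mem_Icc.2 hab))⟩
  · filter_upwards [self_mem_nhdsWithin, hc r hr ((S.isOpen_chartV hR i).mem_nhds hi)]
      with r' hr' hir'
    refine perp_ext_of_mkQ_eq S (j := j) ?_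
    rw [← P.mkQ_fderiv_perpCoord hR hir', ← P.mkQ_fderiv_perpCoord hR hi, hX r' hr', hX r hr]
  · obtain rfl := S.isSimplexEdges_edgeW.normalCone_unique hj'.2 (hm hr).2
    filter_upwards [self_mem_nhdsWithin] with r' hr'
    rw [hX r' hr', hX r hr]

/-- Parallel fields on two consecutive intervals that agree at the common end point concatenate. -/
theorem ParallelOn.glue {P : BiPIKAS S R} {c X X' : ℝ → Base n l} {r₁ r₂ r₃ : ℝ}
    (h : P.ParallelOn c X r₁ r₂) (h' : P.ParallelOn c X' r₂ r₃) (h₁₂ : r₁ ≤ r₂) (h₂₃ : r₂ ≤ r₃)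
    (hX : X r₂ = X' r₂) : ∃ Y, P.ParallelOn c Y r₁ r₃ ∧ Y r₁ = X r₁ ∧ Y r₃ = X' r₃ := by
  let Y : ℝ → Base n l := fun r => if r ≤ r₂ then X r else X' r
  have hY : ∀ r ∈ Icc r₁ r₂, Y r = X r := fun r hr => if_pos hr.2
  have hY' : ∀ r ∈ Icc r₂ r₃, Y r = X' r := fun r hr => by
    rcases hr.1.eq_or_lt with rfl | hlt
    · rw [← hX]; exact if_pos le_rfl
    · exact if_neg hlt.not_ge
  -- A property of the glued field holds near `r` once it holds on both sides.
  have key : ∀ {Z : Type} (φ : ℝ → Base n l → Z) (r : ℝ), r ∈ Icc r₁ r₃ →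
      (r ∈ Icc r₁ r₂ → ∀ᶠ r' in 𝓝[Icc r₁ r₂] r, φ r' (X r') = φ r (X r)) →
      (r ∈ Icc r₂ r₃ → ∀ᶠ r' in 𝓝[Icc r₂ r₃] r, φ r' (X' r') = φ r (X' r)) →
      ∀ᶠ r' in 𝓝[Icc r₁ r₃] r, φ r' (Y r') = φ r (Y r) := by
    intro Z φ r hr H H'
    rw [← Icc_union_Icc_eq_Icc h₁₂ h₂₃, nhdsWithin_union, eventually_sup]
    constructor
    · by_cases hr' : r ∈ Icc r₁ r₂
      · filter_upwards [H hr', self_mem_nhdsWithin] with r' h1 h2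
        rw [hY _ h2, hY _ hr', h1]
      · rw [notMem_closure_iff_nhdsWithin_eq_bot.1 (by rwa [isClosed_Icc.closure_eq])]
        exact eventually_bot
    · by_cases hr' : r ∈ Icc r₂ r₃
      · filter_upwards [H' hr', self_mem_nhdsWithin] with r' h1 h2
        rw [hY' _ h2, hY' _ hr', h1]
      · rw [notMem_closure_iff_nhdsWithin_eq_bot.1 (by rwa [isClosed_Icc.closure_eq])]
        exact eventually_bot
  refine ⟨Y, fun r hr => ⟨fun i hi => ?_, fun j hj => ?_⟩, hY _ (left_mem_Icc.2 h₁₂),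
    hY' _ (right_mem_Icc.2 h₂₃)⟩
  · exact key (fun r x => fderiv ℝ (perpCoord (S.v i) P.h) (c r) x) r hr
      (fun hr => (h r hr).1 i hi) (fun hr => (h' r hr).1 i hi)
  · exact key (fun r x => fderiv ℝ (quotCoord (S.w j) P.h) (c r) x) r hr
      (fun hr => (h r hr).2 j hj) (fun hr => (h' r hr).2 j hj)

/-- Along a loop of type `(v_{i₁} w_{j₁} v_{i₂} w_{j₂})` a parallel field is transported from
`v_{i₁}^⊥` to `v_{i₂}^⊥` along the direction `w_{j₁}`, and back along the direction `w_{j₂}`. -/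
theorem hasMonodromy (hR : IsOpen R) (P : BiPIKAS S R) {i₁ i₂ : Fin (l + 1)} {j₁ j₂ : Fin (n + 1)}
    {c : ℝ → Base n l} (hc : IsLoop S R i₁ j₁ i₂ j₂ c) :
    P.HasMonodromy i₁ c (fun y =>
      y + (toReal (S.v i₂ - S.v i₁) ⬝ᵥ y) • toReal (S.w j₂ - S.w j₁)) := by
  obtain ⟨hcont, -, r₁, r₂, r₃, r₄, h0, h12, h23, h34, h4, m1, m2, m3, m4, m5⟩ := hc
  have hsub : ∀ {a b : ℝ}, 0 ≤ a → b ≤ 1 → Icc a b ⊆ Icc 0 1 := fun ha hb => Icc_subset_Icc ha hb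
  constructor
  -- A parallel field along the loop is the concatenation of five fields, one in each chart.
  · intro X₀
    obtain ⟨X1, hX1, e1⟩ := P.exists_parallelOn_chartV hR h0 m1 X₀
    obtain ⟨X2, hX2, e2⟩ := P.exists_parallelOn_chartW hR h12
      (hcont.mono (hsub (by linarith) (by linarith))) m2 (X1 r₁)
    obtain ⟨Y2, hY2, f2, g2⟩ := hX1.glue hX2 h0 h12 e2.symm
    obtain ⟨X3, hX3, e3⟩ := P.exists_parallelOn_chartV hR h23 m3 (Y2 r₂)
    obtain ⟨Y3, hY3, f3, g3⟩ := hY2.glue hX3 (by linarith) h23 e3.symm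
    obtain ⟨X4, hX4, e4⟩ := P.exists_parallelOn_chartW hR h34
      (hcont.mono (hsub (by linarith) (by linarith))) m4 (Y3 r₃)
    obtain ⟨Y4, hY4, f4, g4⟩ := hY3.glue hX4 (by linarith) h34 e4.symm
    obtain ⟨X5, hX5, e5⟩ := P.exists_parallelOn_chartV hR h4 m5 (Y4 r₄)
    obtain ⟨Y5, hY5, f5, g5⟩ := hY4.glue hX5 (by linarith) h4 e5.symm
    exact ⟨Y5, hY5, by rw [f5, f4, f3, f2, e1]⟩
  · intro X hX
    -- In each of the five pieces the components of a parallel field in the chart are constant.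
    have hcV : ∀ {a b : ℝ} {i : Fin (l + 1)}, 0 ≤ a → a ≤ b → b ≤ 1 →
        MapsTo c (Icc a b) (S.chartV R i) → fderiv ℝ (perpCoord (S.v i) P.h) (c b) (X b) =
          fderiv ℝ (perpCoord (S.v i) P.h) (c a) (X a) := fun ha hab hb hm =>
      eq_of_eventually_eq_Icc (f := fun r => fderiv ℝ (perpCoord (S.v _) P.h) (c r) (X r)) hab
        fun r hr => ((hX r (hsub ha hb hr)).1 _ (hm hr)).filter_mono
          (nhdsWithin_mono _ (hsub ha hb))
    have hcW : ∀ {a b : ℝ} {j : Fin (n + 1)}, 0 ≤ a → a ≤ b → b ≤ 1 →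
        MapsTo c (Icc a b) (S.chartW R j) → fderiv ℝ (quotCoord (S.w j) P.h) (c b) (X b) =
          fderiv ℝ (quotCoord (S.w j) P.h) (c a) (X a) := fun ha hab hb hm =>
      eq_of_eventually_eq_Icc (f := fun r => fderiv ℝ (quotCoord (S.w _) P.h) (c r) (X r)) hab
        fun r hr => ((hX r (hsub ha hb hr)).2 _ (hm hr)).filter_mono
          (nhdsWithin_mono _ (hsub ha hb))
    have E1 := hcV le_rfl h0 (by linarith) m1
    have E2 := hcW h0 h12 (by linarith) m2
    have E3 := hcV (by linarith) h23 (by linarith) m3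
    have E4 := hcW (by linarith) h34 (by linarith) m4
    have E5 := hcV (by linarith) h4 le_rfl m5
    -- Consecutive charts with values in `v^⊥` are compared modulo `w_{j₁}`, respectively `w_{j₂}`.
    rw [P.mkQ_fderiv_perpCoord hR (m1 (right_mem_Icc.2 h0)),
      P.mkQ_fderiv_perpCoord hR (m3 (left_mem_Icc.2 h23))] at E2
    rw [P.mkQ_fderiv_perpCoord hR (m3 (right_mem_Icc.2 h23)),
      P.mkQ_fderiv_perpCoord hR (m5 (left_mem_Icc.2 h4))] at E4
    rw [E1] at E2
    rw [E3] at E4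
    rw [E5]
    set x := fderiv ℝ (perpCoord (S.v i₁) P.h) (c 0) (X 0)
    set y := fderiv ℝ (perpCoord (S.v i₂) P.h) (c r₂) (X r₂)
    set z := fderiv ℝ (perpCoord (S.v i₁) P.h) (c r₄) (X r₄)
    have hx : toReal (S.v i₁) ⬝ᵥ (x : Fin (n + l + 1) → ℝ) = 0 := x.2
    have hy : toReal (S.v i₂) ⬝ᵥ (y : Fin (n + l + 1) → ℝ) = 0 := y.2
    have hz : toReal (S.v i₁) ⬝ᵥ (z : Fin (n + l + 1) → ℝ) = 0 := z.2
    have hyx := perp_eq_of_mkQ_eq S (i := i₂) E2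
    have hzy := perp_eq_of_mkQ_eq S (i := i₁) E4
    rw [hy, zero_sub] at hyx
    rw [hz, zero_sub] at hzy
    have hy1 := congrArg (fun y => toReal (S.v i₁) ⬝ᵥ y) hyx
    simp only [dotProduct_add, dotProduct_smul, toReal_pairing, hx, smul_eq_mul, mul_one,
      zero_add] at hy1
    rw [hzy, hy1, hyx]
    simp only [map_sub, sub_dotProduct, hx]
    module

end BiPIKAS

/-! ### Potentials on convex sets -/

section derivatives

variable {E : Type*} [NormedAddCommGroup E] [NormedSpace ℝ E]

theorem ContDiffAt.fderiv_infty {G : Type*} [NormedAddCommGroup G] [NormedSpace ℝ G] {f : E → G}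
    {p : E} (hf : ContDiffAt ℝ ∞ f p) : ContDiffAt ℝ ∞ (fderiv ℝ f) p :=
  hf.fderiv_right (by simp)

theorem secondDeriv_eq {E : Type} [NormedAddCommGroup E] [NormedSpace ℝ E] {f : E → ℝ} {p : E}
    (hf : ContDiffAt ℝ ∞ f p) (u u' : E) :
    secondDeriv f p u u' = fderiv ℝ (fderiv ℝ f) p u' u := by
  have hd : DifferentiableAt ℝ (fderiv ℝ f) p := hf.fderiv_infty.differentiableAt (by simp)
  have := (hd.hasFDerivAt.clm_apply (hasFDerivAt_const u p)).fderiv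
  simp [secondDeriv, this]

theorem fderiv_fderiv_comm {G : Type*} [NormedAddCommGroup G] [NormedSpace ℝ G] {f : E → G} {p : E}
    (hf : ContDiffAt ℝ ∞ f p) (u u' : E) :
    fderiv ℝ (fderiv ℝ f) p u u' = fderiv ℝ (fderiv ℝ f) p u' u :=
  (hf.isSymmSndFDerivAt (by rw [minSmoothness_of_isRCLikeNormedField]; norm_cast)).eq
    u u'

theorem secondDeriv_comm {E : Type} [NormedAddCommGroup E] [NormedSpace ℝ E] {f : E → ℝ} {p : E}
    (hf : ContDiffAt ℝ ∞ f p) (u u' : E) :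
    secondDeriv f p u u' = secondDeriv f p u' u := by
  rw [secondDeriv_eq hf, secondDeriv_eq hf, fderiv_fderiv_comm hf]

theorem hasFDerivAt_clm_apply₂ {H : E → E →L[ℝ] E →L[ℝ] ℝ} {T : E →L[ℝ] E →L[ℝ] E →L[ℝ] ℝ} {p : E}
    (hH : HasFDerivAt H T p) (v w : E) : HasFDerivAt (fun q => H q v w)
      ((ContinuousLinearMap.apply ℝ ℝ w).comp
        ((ContinuousLinearMap.apply ℝ (E →L[ℝ] ℝ) v).comp T)) p := by
  have h1 := (ContinuousLinearMap.apply ℝ (E →L[ℝ] ℝ) v).hasFDerivAt.comp p hH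
  exact (ContinuousLinearMap.apply ℝ ℝ w).hasFDerivAt.comp p h1

theorem third_apply {f : E → ℝ} {p : E} (hf : ContDiffAt ℝ ∞ f p) (u v w : E) :
    fderiv ℝ (fderiv ℝ (fderiv ℝ f)) p u v w =
      fderiv ℝ (fun q => fderiv ℝ (fderiv ℝ f) q v w) p u := by
  have hd : DifferentiableAt ℝ (fderiv ℝ (fderiv ℝ f)) p :=
    hf.fderiv_infty.fderiv_infty.differentiableAt (by simp)
  rw [(hasFDerivAt_clm_apply₂ hd.hasFDerivAt v w).fderiv]
  rfl

theorem eventually_contDiffAt_infty {f : E → ℝ} {U : Set E} (hU : IsOpen U)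
    (hf : ContDiffOn ℝ ∞ f U) {p : E} (hp : p ∈ U) : ∀ᶠ q in 𝓝 p, ContDiffAt ℝ ∞ f q :=
  (hU.eventually_mem hp).mono fun _ hq => hf.contDiffAt (hU.mem_nhds hq)

theorem third_comm {f : E → ℝ} {p : E} (hf : ∀ᶠ q in 𝓝 p, ContDiffAt ℝ ∞ f q) (u v w : E) :
    fderiv ℝ (fderiv ℝ (fderiv ℝ f)) p u v w = fderiv ℝ (fderiv ℝ (fderiv ℝ f)) p u w v := by
  rw [third_apply hf.self_of_nhds, third_apply hf.self_of_nhds]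
  have : (fun q => fderiv ℝ (fderiv ℝ f) q v w) =ᶠ[𝓝 p] fun q => fderiv ℝ (fderiv ℝ f) q w v := by
    filter_upwards [hf] with q hq using fderiv_fderiv_comm hq v w
  rw [this.fderiv_eq]

/-- A symmetric trilinear form vanishes if it does so whenever its last two arguments are both in
the range of a map `P` or both in the range of `1 - P`. -/
theorem trilinear_eq_zero (P : E →L[ℝ] E) {T : E →L[ℝ] E →L[ℝ] E →L[ℝ] ℝ}
    (h₁ : ∀ u v w, T u v w = T v u w) (h₂ : ∀ u v w, T u v w = T u w v)
    (hs : ∀ u v w, T u (P v) (P w) = 0)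
    (ht : ∀ u v w, T u (v - P v) (w - P w) = 0) : T = 0 := by
  ext u v w
  have hm : ∀ u v w, T u (P v) (w - P w) = 0 := fun u v w => by
    have e1 : T (P u) (P v) (w - P w) = 0 := by rw [h₂, h₁, hs]
    have e2 : T (u - P u) (P v) (w - P w) = 0 := by rw [h₁, ht]
    have := congrArg₂ (· + ·) e1 e2
    simpa only [← add_apply, ← map_add, add_sub_cancel, add_zero] using this
  have e : v = P v + (v - P v) := by abel
  have e' : w = P w + (w - P w) := by abel
  have hm' : T u (v - P v) (P w) = 0 := by rw [h₂]; exact hm u w v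
  have k1 : T u (P v) w = 0 := by
    have := congrArg₂ (· + ·) (hs u v w) (hm u v w)
    simpa only [← map_add, add_sub_cancel, add_zero] using this
  have k2 : T u (v - P v) w = 0 := by
    have := congrArg₂ (· + ·) hm' (ht u v w)
    simpa only [← map_add, add_sub_cancel, add_zero] using this
  have := congrArg₂ (· + ·) k1 k2
  show T u v w = 0
  simpa only [← add_apply, ← map_add, add_sub_cancel, add_zero] using this

/-- The third derivative of a function vanishes where its restrictions to two complementary
directions have vanishing Hessians. -/
theorem third_eq_zero (P : E →L[ℝ] E) {κ : E → ℝ} {p : E} (hκ : ∀ᶠ q in 𝓝 p, ContDiffAt ℝ ∞ κ q)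
    (hs : ∀ᶠ q in 𝓝 p, ∀ u v, fderiv ℝ (fderiv ℝ κ) q (P u) (P v) = 0)
    (ht : ∀ᶠ q in 𝓝 p, ∀ u v, fderiv ℝ (fderiv ℝ κ) q (u - P u) (v - P v) = 0) :
    fderiv ℝ (fderiv ℝ (fderiv ℝ κ)) p = 0 := by
  have hp := hκ.self_of_nhds
  refine trilinear_eq_zero P (fun u v w => ?_) (third_comm hκ) (fun u v w => ?_) fun u v w => ?_
  · rw [fderiv_fderiv_comm hp.fderiv_infty]
  · rw [third_apply hp, (show (fun q => fderiv ℝ (fderiv ℝ κ) q (P v) (P w)) =ᶠ[𝓝 p]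
      fun _ => 0 from hs.mono fun q hq => hq v w).fderiv_eq]
    simp
  · rw [third_apply hp, (show (fun q => fderiv ℝ (fderiv ℝ κ) q (v - P v) (w - P w)) =ᶠ[𝓝 p]
      fun _ => 0 from ht.mono fun q hq => hq v w).fderiv_eq]
    simp

theorem fderiv_fderiv_sub {f g : E → ℝ} {q : E} (hf : ∀ᶠ q in 𝓝 q, ContDiffAt ℝ ∞ f q)
    (hg : ∀ᶠ q in 𝓝 q, ContDiffAt ℝ ∞ g q) : fderiv ℝ (fderiv ℝ (fun x => f x - g x)) q =
      fderiv ℝ (fderiv ℝ f) q - fderiv ℝ (fderiv ℝ g) q := by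
  have : fderiv ℝ (fun x => f x - g x) =ᶠ[𝓝 q] fun r => fderiv ℝ f r - fderiv ℝ g r := by
    filter_upwards [hf, hg] with r h1 h2
    exact fderiv_fun_sub (h1.differentiableAt (by simp)) (h2.differentiableAt (by simp))
  rw [this.fderiv_eq]
  exact fderiv_fun_sub (hf.self_of_nhds.fderiv_infty.differentiableAt (by simp))
    (hg.self_of_nhds.fderiv_infty.differentiableAt (by simp))

/-- If two functions have the same pure second derivatives along the two summands of a splitting,
they have the same third derivative: a third derivative along vectors of the two summands always has
two arguments in the same summand. -/
theorem third_eq_third (P : E →L[ℝ] E) {f g : E → ℝ} {p : E}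
    (hf : ∀ᶠ q in 𝓝 p, ContDiffAt ℝ ∞ f q) (hg : ∀ᶠ q in 𝓝 p, ContDiffAt ℝ ∞ g q)
    (hs : ∀ᶠ q in 𝓝 p, ∀ u v, fderiv ℝ (fderiv ℝ f) q (P u) (P v) =
      fderiv ℝ (fderiv ℝ g) q (P u) (P v))
    (ht : ∀ᶠ q in 𝓝 p, ∀ u v, fderiv ℝ (fderiv ℝ f) q (u - P u) (v - P v) =
      fderiv ℝ (fderiv ℝ g) q (u - P u) (v - P v)) :
    fderiv ℝ (fderiv ℝ (fderiv ℝ f)) p = fderiv ℝ (fderiv ℝ (fderiv ℝ g)) p := by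
  have e2 : fderiv ℝ (fderiv ℝ (fun x => f x - g x)) =ᶠ[𝓝 p]
      fun r => fderiv ℝ (fderiv ℝ f) r - fderiv ℝ (fderiv ℝ g) r := by
    filter_upwards [hf.eventually_nhds, hg.eventually_nhds] with r h1 h2
    exact fderiv_fderiv_sub h1 h2
  have h3 := third_eq_zero P (κ := fun x => f x - g x) (p := p)
    (by filter_upwards [hf, hg] with q h1 h2 using h1.sub h2)
    (by filter_upwards [e2, hs] with q h1 h2 u v; rw [h1]; simp [h2 u v])
    (by filter_upwards [e2, ht] with q h1 h2 u v; rw [h1]; exact sub_eq_zero.2 (h2 u v))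
  rw [e2.fderiv_eq] at h3
  rw [← sub_eq_zero, ← h3]
  exact (fderiv_fun_sub (hf.self_of_nhds.fderiv_infty.fderiv_infty.differentiableAt (by simp))
    (hg.self_of_nhds.fderiv_infty.fderiv_infty.differentiableAt (by simp))).symm

theorem contDiffOn_infty_of_hasFDerivAt {G : Type*} [NormedAddCommGroup G] [NormedSpace ℝ G]
    {U : Set E} (hU : IsOpen U) {f : E → G} {f' : E → E →L[ℝ] G}
    (hf : ∀ q ∈ U, HasFDerivAt f (f' q) q) (hf' : ContDiffOn ℝ ∞ f' U) : ContDiffOn ℝ ∞ f U := by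
  rw [contDiffOn_infty_iff_fderiv_of_isOpen hU]
  exact ⟨fun q hq => (hf q hq).differentiableAt.differentiableWithinAt,
    hf'.congr fun q hq => (hf q hq).fderiv⟩

theorem eq_of_hasFDerivAt_zero {G : Type*} [NormedAddCommGroup G] [NormedSpace ℝ G]
    {U : Set E} (hU : IsOpen U) (hc : Convex ℝ U) {f : E → G}
    (hf : ∀ q ∈ U, HasFDerivAt f (0 : E →L[ℝ] G) q) {p q : E} (hp : p ∈ U) (hq : q ∈ U) :
    f p = f q :=
  hU.is_const_of_fderiv_eq_zero hc.isPreconnected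
    (fun q hq => (hf q hq).differentiableAt.differentiableWithinAt)
    (fun q hq => (hf q hq).fderiv) hp hq

/-- On a convex open set, functions with the same Hessians in two complementary directions come
from a single function. Two of them have the same third derivative, so three applications of the
Poincaré lemma recover a global function from the third derivative. -/
theorem exists_potential (P : E →L[ℝ] E) {U : Set E} (hU : IsOpen U) (hc : Convex ℝ U)
    {O : E → Set E} {κ : E → E → ℝ} (hO : ∀ p ∈ U, IsOpen (O p)) (hpO : ∀ p ∈ U, p ∈ O p)
    (hκ : ∀ p ∈ U, ContDiffOn ℝ ∞ (κ p) (O p))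
    (hs : ∀ p ∈ U, ∀ q ∈ U, ∀ r ∈ O p ∩ O q, ∀ u v, fderiv ℝ (fderiv ℝ (κ p)) r (P u) (P v) =
      fderiv ℝ (fderiv ℝ (κ q)) r (P u) (P v))
    (ht : ∀ p ∈ U, ∀ q ∈ U, ∀ r ∈ O p ∩ O q, ∀ u v,
      fderiv ℝ (fderiv ℝ (κ p)) r (u - P u) (v - P v) =
      fderiv ℝ (fderiv ℝ (κ q)) r (u - P u) (v - P v)) :
    ∃ K : E → ℝ, ContDiffOn ℝ ∞ K U ∧ ∀ p ∈ U, ∀ u v,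
      fderiv ℝ (fderiv ℝ K) p (P u) (P v) = fderiv ℝ (fderiv ℝ (κ p)) p (P u) (P v) ∧
      fderiv ℝ (fderiv ℝ K) p (u - P u) (v - P v) =
        fderiv ℝ (fderiv ℝ (κ p)) p (u - P u) (v - P v) := by
  rcases U.eq_empty_or_nonempty with rfl | ⟨p₀, hp₀⟩
  · exact ⟨0, contDiffOn_empty, by simp⟩
  have hev : ∀ p ∈ U, ∀ q ∈ O p, ∀ᶠ r in 𝓝 q, ContDiffAt ℝ ∞ (κ p) r := fun p hp q hq =>
    eventually_contDiffAt_infty (hO p hp) (hκ p hp) hq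
  have hat : ∀ p ∈ U, ContDiffAt ℝ ∞ (κ p) p := fun p hp => (hev p hp p (hpO p hp)).self_of_nhds
  -- The third derivatives of the local potentials agree; they are integrated three times.
  let T : E → E →L[ℝ] E →L[ℝ] E →L[ℝ] ℝ := fun q => fderiv ℝ (fderiv ℝ (fderiv ℝ (κ q))) q
  have hT : ∀ p ∈ U, T =ᶠ[𝓝 p] fderiv ℝ (fderiv ℝ (fderiv ℝ (κ p))) := fun p hp => by
    filter_upwards [hU.mem_nhds hp, (hO p hp).mem_nhds (hpO p hp)] with q hq hqp
    have hev' : ∀ᶠ r in 𝓝 q, r ∈ O q ∩ O p :=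
      ((hO q hq).inter (hO p hp)).eventually_mem ⟨hpO q hq, hqp⟩
    exact third_eq_third P (hev q hq q (hpO q hq)) (hev p hp q hqp)
      (hev'.mono fun r hr => hs q hq p hp r hr) (hev'.mono fun r hr => ht q hq p hp r hr)
  have hTs : ContDiffOn ℝ ∞ T U := fun p hp =>
    ((hat p hp).fderiv_infty.fderiv_infty.fderiv_infty.congr_of_eventuallyEq
      (hT p hp)).contDiffWithinAt
  -- The closed form `T` has a primitive, by the Poincaré lemma on the convex set.
  obtain ⟨H₀, hH₀⟩ := hc.exists_forall_hasFDerivAt_of_fderiv_symmetric hU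
    (hTs.differentiableOn (by simp)) fun p hp u v => by
      rw [(hT p hp).fderiv_eq, fderiv_fderiv_comm (hat p hp).fderiv_infty.fderiv_infty]
  -- The primitive is normalized to be the Hessian of a local potential at `p₀`; being symmetric
  -- there, it is symmetric everywhere.
  let H : E → E →L[ℝ] E →L[ℝ] ℝ := fun q => H₀ q + (fderiv ℝ (fderiv ℝ (κ p₀)) p₀ - H₀ p₀)
  have hH : ∀ q ∈ U, HasFDerivAt H (T q) q := fun q hq => (hH₀ q hq).add_const _
  have hHp₀ : H p₀ = fderiv ℝ (fderiv ℝ (κ p₀)) p₀ := by simp [H]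
  have hsymm : ∀ q ∈ U, ∀ u v, H q u v = H q v u := fun q hq u v => by
    have hd : ∀ q ∈ U, HasFDerivAt (fun q => H q u v - H q v u) (0 : E →L[ℝ] ℝ) q :=
      fun q hq => by
        refine ((hasFDerivAt_clm_apply₂ (hH q hq) u v).sub
          (hasFDerivAt_clm_apply₂ (hH q hq) v u)).congr_fderiv ?_
        ext w
        exact sub_eq_zero.2 (third_comm (hev q hq q (hpO q hq)) w u v)
    have := eq_of_hasFDerivAt_zero hU hc hd hq hp₀
    simp only [hHp₀] at this
    rw [fderiv_fderiv_comm (hat p₀ hp₀), sub_self] at this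
    exact sub_eq_zero.1 this
  obtain ⟨g, hg⟩ := hc.exists_forall_hasFDerivAt_of_fderiv_symmetric hU
    (show DifferentiableOn ℝ H U from
      fun q hq => (hH q hq).differentiableAt.differentiableWithinAt) fun p hp u v => by
      rw [(hH p hp).fderiv]
      exact fderiv_fderiv_comm (hat p hp).fderiv_infty u v
  obtain ⟨K, hK⟩ := hc.exists_forall_hasFDerivAt_of_fderiv_symmetric hU
    (show DifferentiableOn ℝ g U from
      fun q hq => (hg q hq).differentiableAt.differentiableWithinAt) fun p hp u v => by
      rw [(hg p hp).fderiv, hsymm p hp]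
  have hK2 : ∀ q ∈ U, fderiv ℝ (fderiv ℝ K) q = H q := fun q hq => by
    have : fderiv ℝ K =ᶠ[𝓝 q] g := (hU.eventually_mem hq).mono fun r hr => (hK r hr).fderiv
    rw [this.fderiv_eq, (hg q hq).fderiv]
  -- The Hessian of the new potential differs from the old one by a constant, which is `0` at `p₀`.
  have hfin : ∀ u v, (∀ p ∈ U, ∀ q ∈ U, ∀ r ∈ O p ∩ O q,
      fderiv ℝ (fderiv ℝ (κ p)) r u v = fderiv ℝ (fderiv ℝ (κ q)) r u v) →
      ∀ q ∈ U, H q u v = fderiv ℝ (fderiv ℝ (κ q)) q u v := fun u v huv q hq => by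
    have hd : ∀ q ∈ U, HasFDerivAt (fun r => H r u v - fderiv ℝ (fderiv ℝ (κ r)) r u v)
        (0 : E →L[ℝ] ℝ) q := fun q hq => by
      have hfe : (fun r => fderiv ℝ (fderiv ℝ (κ r)) r u v) =ᶠ[𝓝 q]
          fun r => fderiv ℝ (fderiv ℝ (κ q)) r u v := by
        filter_upwards [(hO q hq).mem_nhds (hpO q hq), hU.mem_nhds hq] with r hr hrU
        exact huv r hrU q hq r ⟨hpO r hrU, hr⟩
      have h2 := hasFDerivAt_clm_apply₂
        ((hat q hq).fderiv_infty.fderiv_infty.differentiableAt (by simp)).hasFDerivAt u v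
      refine ((hasFDerivAt_clm_apply₂ (hH q hq) u v).sub
        (h2.congr_of_eventuallyEq hfe)).congr_fderiv ?_
      ext w
      exact sub_self _
    have := eq_of_hasFDerivAt_zero hU hc hd hq hp₀
    simp only [hHp₀, sub_self] at this
    exact sub_eq_zero.1 this
  refine ⟨K, contDiffOn_infty_of_hasFDerivAt hU hK (contDiffOn_infty_of_hasFDerivAt hU hg
    (contDiffOn_infty_of_hasFDerivAt hU hH hTs)), fun p hp u v => ⟨?_, ?_⟩⟩
  · rw [hK2 p hp, hfin _ _ (fun p hp q hq r hr => hs p hp q hq r hr u v) p hp]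
  · rw [hK2 p hp, hfin _ _ (fun p hp q hq r hr => ht p hp q hq r hr u v) p hp]

/-- On a convex open set a function whose pure second derivatives along the two summands of a
splitting vanish has vanishing third derivative; so its differential is affine, with a linear part
that only pairs the two summands. -/
theorem exists_affine_fderiv (P : E →L[ℝ] E) {U : Set E} (hU : IsOpen U) (hc : Convex ℝ U)
    {κ : E → ℝ} (hκ : ContDiffOn ℝ ∞ κ U)
    (hs : ∀ q ∈ U, ∀ u v, fderiv ℝ (fderiv ℝ κ) q (P u) (P v) = 0)
    (ht : ∀ q ∈ U, ∀ u v, fderiv ℝ (fderiv ℝ κ) q (u - P u) (v - P v) = 0) :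
    ∃ (c : E →L[ℝ] ℝ) (M : E →L[ℝ] E →L[ℝ] ℝ), (∀ u v, M u v = M v u) ∧
      (∀ u v, M (P u) (P v) = 0) ∧ (∀ u v, M (u - P u) (v - P v) = 0) ∧
      ∀ q ∈ U, fderiv ℝ κ q = c + M q := by
  rcases U.eq_empty_or_nonempty with rfl | ⟨p₀, hp₀⟩
  · exact ⟨0, 0, by simp, by simp, by simp, by simp⟩
  have hev : ∀ q ∈ U, ∀ᶠ r in 𝓝 q, ContDiffAt ℝ ∞ κ r := fun q hq =>
    eventually_contDiffAt_infty hU hκ hq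
  have hat : ∀ q ∈ U, ContDiffAt ℝ ∞ κ q := fun q hq => (hev q hq).self_of_nhds
  have hM : ∀ q ∈ U, fderiv ℝ (fderiv ℝ κ) q = fderiv ℝ (fderiv ℝ κ) p₀ := fun q hq =>
    eq_of_hasFDerivAt_zero hU hc (fun q hq => by
      rw [← third_eq_zero P (hev q hq) ((hU.eventually_mem hq).mono hs)
        ((hU.eventually_mem hq).mono ht)]
      exact ((hat q hq).fderiv_infty.fderiv_infty.differentiableAt (by simp)).hasFDerivAt) hq hp₀
  have hc' : ∀ q ∈ U, fderiv ℝ κ q - fderiv ℝ (fderiv ℝ κ) p₀ q =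
      fderiv ℝ κ p₀ - fderiv ℝ (fderiv ℝ κ) p₀ p₀ := fun q hq =>
    eq_of_hasFDerivAt_zero hU hc (f := fun q => fderiv ℝ κ q - fderiv ℝ (fderiv ℝ κ) p₀ q)
      (fun q hq => by
        refine (((hat q hq).fderiv_infty.differentiableAt (by simp)).hasFDerivAt.sub
          (fderiv ℝ (fderiv ℝ κ) p₀).hasFDerivAt).congr_fderiv ?_
        rw [hM q hq, sub_self]) hq hp₀
  refine ⟨fderiv ℝ κ p₀ - fderiv ℝ (fderiv ℝ κ) p₀ p₀, fderiv ℝ (fderiv ℝ κ) p₀,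
    fderiv_fderiv_comm (hat p₀ hp₀), hs p₀ hp₀, ht p₀ hp₀,
    fun q hq => ?_⟩
  rw [← hc' q hq]; abel

end derivatives

section base

variable {n l : ℕ}

theorem base_decomp (u : Base n l) :
    u = ∑ i, u.1 i • (sdir i : Base n l) + ∑ p, u.2 p • (tdir p : Base n l) := by
  have h1 : ∀ (k : ℕ) (x : EuclideanSpace ℝ (Fin k)),
      ∑ i, x i • EuclideanSpace.single i (1 : ℝ) = x := fun k x => by
    ext j; simp [Finset.sum_apply, Pi.single_apply]
  ext1
  · simp [sdir, tdir, Prod.fst_sum, h1]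
  · simp [sdir, tdir, Prod.snd_sum, h1]

theorem map_base {G : Type*} [AddCommGroup G] [Module ℝ G] {𝓕 : Type*} [FunLike 𝓕 (Base n l) G]
    [LinearMapClass 𝓕 ℝ (Base n l) G] (L : 𝓕) (u : Base n l) :
    L u = ∑ i, u.1 i • L (sdir i) + ∑ p, u.2 p • L (tdir p) := by
  conv_lhs => rw [base_decomp u]
  simp [map_add, map_sum, map_smul]

theorem base_ext {G : Type*} [NormedAddCommGroup G] [NormedSpace ℝ G] {L L' : Base n l →L[ℝ] G}
    (hs : ∀ i, L (sdir i) = L' (sdir i)) (ht : ∀ p, L (tdir p) = L' (tdir p)) : L = L' := by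
  refine ContinuousLinearMap.ext fun u => ?_
  rw [map_base L, map_base L']
  simp [hs, ht]

/-- The projection of `ℝ^n × ℝ^l` to the first factor. -/
def projS (n l : ℕ) : Base n l →L[ℝ] Base n l :=
  (ContinuousLinearMap.inl ℝ _ _).comp (ContinuousLinearMap.fst ℝ _ _)

theorem projS_apply (u : Base n l) : projS n l u = ∑ i, u.1 i • sdir i := by
  rw [base_decomp (projS n l u)]
  simp [projS]

theorem sub_projS_apply (u : Base n l) : u - projS n l u = ∑ i, u.2 i • tdir i := by
  rw [base_decomp (u - projS n l u)]
  simp [projS]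

theorem projS_sdir (i : Fin n) : projS n l (sdir i) = sdir i := by
  simp [projS, sdir]

theorem sub_projS_tdir (i : Fin l) : tdir i - projS n l (tdir i) = tdir i := by
  simp [projS, tdir]

theorem bilinear_projS {M : Base n l →L[ℝ] Base n l →L[ℝ] ℝ} (u v : Base n l) :
    M (projS n l u) (projS n l v) = ∑ i, u.1 i * ∑ j, v.1 j * M (sdir i) (sdir j) := by
  simp [projS_apply, map_sum]
  simp only [Finset.mul_sum]
  rw [Finset.sum_comm]
  exact Finset.sum_congr rfl fun i _ => Finset.sum_congr rfl fun j _ => by ring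

theorem bilinear_sub_projS {M : Base n l →L[ℝ] Base n l →L[ℝ] ℝ} (u v : Base n l) :
    M (u - projS n l u) (v - projS n l v) = ∑ i, u.2 i * ∑ j, v.2 j * M (tdir i) (tdir j) := by
  simp [sub_projS_apply, map_sum]
  simp only [Finset.mul_sum]
  rw [Finset.sum_comm]
  exact Finset.sum_congr rfl fun i _ => Finset.sum_congr rfl fun j _ => by ring

theorem IsSplitPotential.mono {K : Base n l → ℝ} {O O' : Set (Base n l)}
    {V : Base n l → Matrix (Fin n) (Fin n) ℝ} {W : Base n l → Matrix (Fin l) (Fin l) ℝ}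
    (h : IsSplitPotential K O V W) (hO : O' ⊆ O) : IsSplitPotential K O' V W :=
  ⟨h.smooth.mono hO, fun q hq => h.hess_s q (hO hq), fun q hq => h.hess_t q (hO hq)⟩

/-- On a convex open set, a pair of matrix functions that has a potential locally has one
globally. -/
theorem exists_isSplitPotential {U : Set (Base n l)} (hU : IsOpen U) (hc : Convex ℝ U)
    {V : Base n l → Matrix (Fin n) (Fin n) ℝ} {W : Base n l → Matrix (Fin l) (Fin l) ℝ}
    (h : ∀ p ∈ U, ∃ O : Set (Base n l), IsOpen O ∧ p ∈ O ∧
      ∃ K : Base n l → ℝ, IsSplitPotential K O V W) :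
    ∃ K : Base n l → ℝ, IsSplitPotential K U V W := by
  choose! O hO hpO κ hκ using h
  have hat : ∀ p ∈ U, ∀ q ∈ O p, ContDiffAt ℝ ∞ (κ p) q := fun p hp q hq =>
    (hκ p hp).smooth.contDiffAt ((hO p hp).mem_nhds hq)
  have hV : ∀ p ∈ U, ∀ q ∈ O p, ∀ i j, fderiv ℝ (fderiv ℝ (κ p)) q (sdir i) (sdir j) = V q j i :=
    fun p hp q hq i j => by rw [(hκ p hp).hess_s q hq, secondDeriv_eq (hat p hp q hq)]
  have hW : ∀ p ∈ U, ∀ q ∈ O p, ∀ i j, fderiv ℝ (fderiv ℝ (κ p)) q (tdir i) (tdir j) = -W q j i :=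
    fun p hp q hq i j => by
      rw [(hκ p hp).hess_t q hq, secondDeriv_eq (hat p hp q hq), neg_neg]
  obtain ⟨K, hK, hKVW⟩ := exists_potential (projS n l) hU hc hO hpO (fun p hp => (hκ p hp).smooth)
    (fun p hp q hq r hr u v => by
      rw [bilinear_projS, bilinear_projS]
      simp only [hV p hp r hr.1, hV q hq r hr.2])
    (fun p hp q hq r hr u v => by
      rw [bilinear_sub_projS, bilinear_sub_projS]
      simp only [hW p hp r hr.1, hW q hq r hr.2])
  refine ⟨K, hK, fun q hq i j => ?_, fun q hq i j => ?_⟩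
  · have := (hKVW q hq (sdir j) (sdir i)).1
    rw [projS_sdir, projS_sdir, hV q hq q (hpO q hq)] at this
    rw [secondDeriv_eq (hK.contDiffAt (hU.mem_nhds hq)), this]
  · have := (hKVW q hq (tdir j) (tdir i)).2
    rw [sub_projS_tdir, sub_projS_tdir, hW q hq q (hpO q hq)] at this
    rw [secondDeriv_eq (hK.contDiffAt (hU.mem_nhds hq)), this, neg_neg]

/-- On a convex open set, a function whose two pure Hessians vanish is affine in each of the two
groups of variables. -/
theorem exists_biaffine {U : Set (Base n l)} (hU : IsOpen U) (hc : Convex ℝ U) {κ : Base n l → ℝ}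
    (hκ : ContDiffOn ℝ ∞ κ U) (hs : ∀ q ∈ U, ∀ i j, secondDeriv κ q (sdir i) (sdir j) = 0)
    (ht : ∀ q ∈ U, ∀ i j, secondDeriv κ q (tdir i) (tdir j) = 0) :
    ∃ (B : Fin n → ℝ) (C : Fin l → ℝ) (D : Fin n → Fin l → ℝ), ∀ q ∈ U,
      (∀ i, fderiv ℝ κ q (sdir i) = B i + ∑ p, D i p * q.2 p) ∧
      (∀ p, fderiv ℝ κ q (tdir p) = C p + ∑ i, D i p * q.1 i) := by
  have hat : ∀ q ∈ U, ContDiffAt ℝ ∞ κ q := fun q hq => hκ.contDiffAt (hU.mem_nhds hq)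
  obtain ⟨c, M, hM, hMs, hMt, hval⟩ := exists_affine_fderiv (projS n l) hU hc hκ
    (fun q hq u v => by
      rw [bilinear_projS]
      simp [← secondDeriv_eq (hat q hq), hs q hq])
    (fun q hq u v => by
      rw [bilinear_sub_projS]
      simp [← secondDeriv_eq (hat q hq), ht q hq])
  have hMs' : ∀ i j, M (sdir i) (sdir j) = 0 := fun i j => by
    simpa only [projS_sdir] using hMs (sdir i) (sdir j)
  have hMt' : ∀ i j, M (tdir i) (tdir j) = 0 := fun i j => by
    simpa only [sub_projS_tdir] using hMt (tdir i) (tdir j)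
  refine ⟨fun i => c (sdir i), fun p => c (tdir p), fun i p => M (tdir p) (sdir i),
    fun q hq => ⟨fun i => ?_, fun p => ?_⟩⟩
  · rw [hval q hq, add_apply, hM, map_base (M (sdir i)) q]
    simp [hMs', mul_comm, hM (sdir i)]
  · rw [hval q hq, add_apply, hM, map_base (M (tdir p)) q]
    simp [hMt', mul_comm]

end base

/-! ### The partial Legendre transform -/

section legendre

variable {n l : ℕ}

/-- The linear form on `ℝ^n × ℝ^l` with coefficients `a` and `b`. -/
def pairForm (a : EuclideanSpace ℝ (Fin n)) (b : EuclideanSpace ℝ (Fin l)) : Base n l →L[ℝ] ℝ :=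
  (innerSL ℝ a).comp (ContinuousLinearMap.fst ℝ _ _) +
    (innerSL ℝ b).comp (ContinuousLinearMap.snd ℝ _ _)

@[simp]
theorem pairForm_apply (a : EuclideanSpace ℝ (Fin n)) (b : EuclideanSpace ℝ (Fin l))
    (u : Base n l) : pairForm a b u = inner ℝ a u.1 + inner ℝ b u.2 := rfl

theorem inner_single_one {k : ℕ} (a : EuclideanSpace ℝ (Fin k)) (i : Fin k) :
    inner ℝ a (EuclideanSpace.single i (1 : ℝ)) = a i := by
  simp [EuclideanSpace.inner_single_right]

/-- In the coordinates `(η, t)`, a function `Ψ` whose differential is `(s, ϑ)` has Hessian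
`ds ⊗ dη + dϑ ⊗ dt`. -/
theorem hessian_eq_of_fderiv_eq {Ψ : Base n l → ℝ} {η : Base n l → EuclideanSpace ℝ (Fin n)}
    {ϑ : Base n l → EuclideanSpace ℝ (Fin l)} {q : Base n l}
    (hΨ : ContDiffAt ℝ ∞ Ψ (η q, q.2)) (hη : DifferentiableAt ℝ η q) (hϑ : DifferentiableAt ℝ ϑ q)
    (h : ∀ᶠ r in 𝓝 q, fderiv ℝ Ψ (η r, r.2) = pairForm r.1 (ϑ r)) (u u' : Base n l) :
    fderiv ℝ (fderiv ℝ Ψ) (η q, q.2) (fderiv ℝ η q u', u'.2) (fderiv ℝ η q u, u.2) =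
      inner ℝ u'.1 (fderiv ℝ η q u) + inner ℝ (fderiv ℝ ϑ q u') u.2 := by
  have hY : HasFDerivAt (fun r : Base n l => (η r, r.2))
      ((fderiv ℝ η q).prod (ContinuousLinearMap.snd ℝ _ _)) q :=
    hη.hasFDerivAt.prodMk hasFDerivAt_snd
  have h1 := (hΨ.fderiv_infty.differentiableAt (by simp)).hasFDerivAt.comp q hY
  have h2 := (h1.clm_apply (hasFDerivAt_const (fderiv ℝ η q u, u.2) q))
  have h3 : HasFDerivAt (fun r : Base n l => pairForm r.1 (ϑ r) (fderiv ℝ η q u, u.2))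
      ((innerSL ℝ (fderiv ℝ η q u)).comp (ContinuousLinearMap.fst ℝ _ _) +
        (innerSL ℝ u.2).comp (fderiv ℝ ϑ q)) q := by
    simp only [pairForm_apply]
    simp only [real_inner_comm (fderiv ℝ η q u) _, real_inner_comm u.2 _]
    refine HasFDerivAt.add ?_ ?_
    · exact (innerSL ℝ (fderiv ℝ η q u)).hasFDerivAt.comp q hasFDerivAt_fst
    · exact (innerSL ℝ u.2).hasFDerivAt.comp q hϑ.hasFDerivAt
  have h4 : (fun r : Base n l => pairForm r.1 (ϑ r) (fderiv ℝ η q u, u.2)) =ᶠ[𝓝 q]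
      fun r => fderiv ℝ Ψ (η r, r.2) (fderiv ℝ η q u, u.2) :=
    h.mono fun r hr => by simp only [hr]
  have h5 := (h3.unique (h2.congr_of_eventuallyEq h4))
  have h6 := congrArg (fun L => L u') h5
  rw [real_inner_comm, real_inner_comm u.2 (fderiv ℝ ϑ q u')]
  refine Eq.trans ?_ h6.symm
  simp

/-- The function `K` has the differential `η ds - ϑ dt` on `O`. -/
structure HasSplitGradient (K : Base n l → ℝ) (O : Set (Base n l))
    (η : Base n l → EuclideanSpace ℝ (Fin n)) (ϑ : Base n l → EuclideanSpace ℝ (Fin l)) : Prop where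
  smooth : ContDiffOn ℝ ∞ K O
  gradient : ∀ q ∈ O, fderiv ℝ K q = pairForm (η q) (-ϑ q)

namespace HasSplitGradient

variable {K : Base n l → ℝ} {O : Set (Base n l)} {η : Base n l → EuclideanSpace ℝ (Fin n)}
  {ϑ : Base n l → EuclideanSpace ℝ (Fin l)}

theorem mono (h : HasSplitGradient K O η ϑ) {O' : Set (Base n l)} (hO : O' ⊆ O) :
    HasSplitGradient K O' η ϑ := ⟨h.smooth.mono hO, fun q hq => h.gradient q (hO hq)⟩

theorem eta_apply (h : HasSplitGradient K O η ϑ) {q : Base n l} (hq : q ∈ O) (i : Fin n) :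
    η q i = fderiv ℝ K q (sdir i) := by
  rw [h.gradient q hq]
  simp [sdir, inner_single_one]

theorem theta_apply (h : HasSplitGradient K O η ϑ) {q : Base n l} (hq : q ∈ O) (i : Fin l) :
    ϑ q i = -fderiv ℝ K q (tdir i) := by
  rw [h.gradient q hq]
  simp [tdir, inner_single_one]

theorem of_apply (hK : ContDiffOn ℝ ∞ K O) (h1 : ∀ q ∈ O, ∀ i, η q i = fderiv ℝ K q (sdir i))
    (h2 : ∀ q ∈ O, ∀ i, ϑ q i = -fderiv ℝ K q (tdir i)) : HasSplitGradient K O η ϑ :=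
  ⟨hK, fun q hq => base_ext
    (fun i => by rw [← h1 q hq]; simp [sdir, inner_single_one])
    fun p => by rw [← neg_neg (fderiv ℝ K q _), ← h2 q hq]; simp [tdir, inner_single_one]⟩

theorem smooth_eta (h : HasSplitGradient K O η ϑ) (hO : IsOpen O) : ContDiffOn ℝ ∞ η O := by
  rw [contDiffOn_euclidean]
  intro i
  have h1 : ContDiffOn ℝ ∞ (fun q => fderiv ℝ K q (sdir i)) O := fun q hq =>
    ((h.smooth.contDiffAt (hO.mem_nhds hq)).fderiv_infty.clm_apply
      contDiffAt_const).contDiffWithinAt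
  exact h1.congr fun q hq => h.eta_apply hq i

theorem smooth_theta (h : HasSplitGradient K O η ϑ) (hO : IsOpen O) : ContDiffOn ℝ ∞ ϑ O := by
  rw [contDiffOn_euclidean]
  intro i
  have h1 : ContDiffOn ℝ ∞ (fun q => -fderiv ℝ K q (tdir i)) O := fun q hq =>
    ((h.smooth.contDiffAt (hO.mem_nhds hq)).fderiv_infty.clm_apply
      contDiffAt_const).neg.contDiffWithinAt
  exact h1.congr fun q hq => h.theta_apply hq i

theorem fderiv_eta (h : HasSplitGradient K O η ϑ) (hO : IsOpen O) {q : Base n l} (hq : q ∈ O)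
    (u : Base n l) (i : Fin n) : fderiv ℝ η q u i = secondDeriv K q (sdir i) u := by
  have hd : DifferentiableAt ℝ η q :=
    ((h.smooth_eta hO).contDiffAt (hO.mem_nhds hq)).differentiableAt (by simp)
  have h1 : HasFDerivAt (fun r => η r i) ((EuclideanSpace.proj i).comp (fderiv ℝ η q)) q :=
    (EuclideanSpace.proj i : EuclideanSpace ℝ (Fin n) →L[ℝ] ℝ).hasFDerivAt.comp q hd.hasFDerivAt
  have h2 : (fun r => fderiv ℝ K r (sdir i)) =ᶠ[𝓝 q] fun r => η r i := by
    filter_upwards [hO.mem_nhds hq] with r hr using (h.eta_apply hr i).symm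
  rw [secondDeriv, h2.fderiv_eq, h1.fderiv]
  rfl

theorem fderiv_theta (h : HasSplitGradient K O η ϑ) (hO : IsOpen O) {q : Base n l} (hq : q ∈ O)
    (u : Base n l) (i : Fin l) : fderiv ℝ ϑ q u i = -secondDeriv K q (tdir i) u := by
  have hd : DifferentiableAt ℝ ϑ q :=
    ((h.smooth_theta hO).contDiffAt (hO.mem_nhds hq)).differentiableAt (by simp)
  have h1 : HasFDerivAt (fun r => ϑ r i) ((EuclideanSpace.proj i).comp (fderiv ℝ ϑ q)) q :=
    (EuclideanSpace.proj i : EuclideanSpace ℝ (Fin l) →L[ℝ] ℝ).hasFDerivAt.comp q hd.hasFDerivAt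
  have h2 : (fun r => fderiv ℝ K r (tdir i)) =ᶠ[𝓝 q] fun r => -ϑ r i := by
    filter_upwards [hO.mem_nhds hq] with r hr
    rw [h.theta_apply hr i, neg_neg]
  rw [secondDeriv, h2.fderiv_eq, h1.fun_neg.fderiv]
  simp

/-- The mixed derivatives of `K` cancel in the Hessian of its partial Legendre transform. -/
theorem metric_eq (h : HasSplitGradient K O η ϑ) (hO : IsOpen O) {q : Base n l} (hq : q ∈ O)
    (u u' : Base n l) :
    inner ℝ u'.1 (fderiv ℝ η q u) + inner ℝ (fderiv ℝ ϑ q u') u.2 =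
      ∑ i, ∑ j, secondDeriv K q (sdir i) (sdir j) * u.1 i * u'.1 j +
        ∑ i, ∑ j, -secondDeriv K q (tdir i) (tdir j) * u.2 i * u'.2 j := by
  have hK := h.smooth.contDiffAt (hO.mem_nhds hq)
  set M := fderiv ℝ (fderiv ℝ K) q with hM
  have hs : ∀ u v, secondDeriv K q u v = M u v := fun u v => by
    rw [secondDeriv_comm hK, secondDeriv_eq hK]
  have hMc : ∀ u v, M u v = M v u := fderiv_fderiv_comm hK
  have e1 : inner ℝ u'.1 (fderiv ℝ η q u) = M u (projS n l u') := by
    rw [PiLp.inner_apply, projS_apply]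
    simp [h.fderiv_eta hO hq, hs, map_sum, hMc u, mul_comm]
  have e2 : inner ℝ (fderiv ℝ ϑ q u') u.2 = - M u' (u - projS n l u) := by
    rw [PiLp.inner_apply, sub_projS_apply]
    simp [h.fderiv_theta hO hq, hs, map_sum, hMc u']
  have e3 := bilinear_projS (M := M) u u'
  have e4 := bilinear_sub_projS (M := M) u u'
  have e5 : M u (projS n l u') = M (projS n l u) (projS n l u') +
      M (u - projS n l u) (projS n l u') := by
    rw [← add_apply, ← map_add, add_sub_cancel]
  have e6 : M u' (u - projS n l u) = M (u' - projS n l u') (u - projS n l u) +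
      M (projS n l u') (u - projS n l u) := by
    rw [← add_apply, ← map_add, sub_add_cancel]
  rw [e1, e2, e5, e6, e3, hMc (u' - _), e4, hMc (projS n l u')]
  simp only [hs, Finset.mul_sum, neg_mul, Finset.sum_neg_distrib]
  rw [neg_add]
  have e7 : ∀ (i j : Fin n), u.1 i * (u'.1 j * M (sdir i) (sdir j)) =
    M (sdir i) (sdir j) * u.1 i * u'.1 j := fun i j => by ring
  have e8 : ∀ (i j : Fin l), u.2 i * (u'.2 j * M (tdir i) (tdir j)) =
    M (tdir i) (tdir j) * u.2 i * u'.2 j := fun i j => by ring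
  simp only [e7, e8]
  ring

end HasSplitGradient

/-- The standard basis of `ℝ^n × ℝ^l`. -/
def baseVec : Fin n ⊕ Fin l → Base n l := Sum.elim sdir tdir

/-- Matrix of a bilinear form in the standard basis. -/
def gramBase (H : Base n l →L[ℝ] Base n l →L[ℝ] ℝ) : Matrix (Fin n ⊕ Fin l) (Fin n ⊕ Fin l) ℝ :=
  Matrix.of fun κ κ' => H (baseVec κ) (baseVec κ')

theorem gram_eq_mul {ι : Type*} [Fintype ι] (H : Base n l →L[ℝ] Base n l →L[ℝ] ℝ)
    (c : ι → Base n l) (Q : Matrix (Fin n ⊕ Fin l) ι ℝ)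
    (hc : ∀ k, c k = ∑ κ, Q κ k • baseVec κ) :
    (Matrix.of fun k k' => H (c k) (c k')) = Qᵀ * gramBase H * Q := by
  ext k k'
  have h1 : H (c k) = ∑ κ, Q κ k • H (baseVec κ) := by rw [hc k]; simp [map_sum]
  have h2 : ∀ L : Base n l →L[ℝ] ℝ, L (c k') = ∑ κ, Q κ k' * L (baseVec κ) := fun L => by
    rw [hc k']; simp [map_sum]
  rw [Matrix.of_apply, h2]
  simp only [Matrix.mul_apply, Matrix.transpose_apply, gramBase, Matrix.of_apply, h1, sum_apply,
    smul_apply, smul_eq_mul]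
  exact Finset.sum_congr rfl fun κ _ => mul_comm _ _

/-- The determinants of the metric in the coordinates `(s, t)` and `(η, t)`. -/
theorem HasSplitGradient.det_mul {K : Base n l → ℝ} {O : Set (Base n l)}
    {η : Base n l → EuclideanSpace ℝ (Fin n)} {ϑ : Base n l → EuclideanSpace ℝ (Fin l)}
    (h : HasSplitGradient K O η ϑ) (hO : IsOpen O) {q : Base n l} (hq : q ∈ O)
    {H : Base n l →L[ℝ] Base n l →L[ℝ] ℝ}
    (hH : ∀ u u', H (fderiv ℝ η q u, u.2) (fderiv ℝ η q u', u'.2) =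
      ∑ i, ∑ j, secondDeriv K q (sdir i) (sdir j) * u.1 i * u'.1 j +
        ∑ i, ∑ j, -secondDeriv K q (tdir i) (tdir j) * u.2 i * u'.2 j) :
    (Matrix.of fun i j => secondDeriv K q (sdir i) (sdir j)).det ^ 2 * (gramBase H).det =
      (Matrix.of fun i j => secondDeriv K q (sdir i) (sdir j)).det *
        (Matrix.of fun i j => -secondDeriv K q (tdir i) (tdir j)).det := by
  let c : Fin n ⊕ Fin l → Base n l := fun κ => (fderiv ℝ η q (baseVec κ), (baseVec κ).2)
  -- The change of basis between the chart and the split coordinates is block triangular.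
  let J : Matrix (Fin n ⊕ Fin l) (Fin n ⊕ Fin l) ℝ :=
    Matrix.fromBlocks (Matrix.of fun i j => secondDeriv K q (sdir i) (sdir j))
      (Matrix.of fun i p => secondDeriv K q (sdir i) (tdir p)) 0 1
  have hJ : ∀ κ, c κ = ∑ κ', J κ' κ • baseVec κ' := by
    intro κ
    rw [base_decomp (c κ), Fintype.sum_sum_type]
    rcases κ with j | p
    · simp [c, J, baseVec, h.fderiv_eta hO hq, sdir]
    · simp only [c, J, baseVec, h.fderiv_eta hO hq, Sum.elim_inr, Sum.elim_inl,
        Matrix.fromBlocks_apply₁₂, Matrix.fromBlocks_apply₂₂, Matrix.of_apply]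
      congr 1
      refine Finset.sum_congr rfl fun k _ => ?_
      simp [tdir, Matrix.one_apply]
  have hM : (Matrix.of fun κ κ' => H (c κ) (c κ')) =
      Matrix.fromBlocks (Matrix.of fun i j => secondDeriv K q (sdir i) (sdir j)) 0 0
        (Matrix.of fun i j => -secondDeriv K q (tdir i) (tdir j)) := by
    ext κ κ'
    rw [Matrix.of_apply, hH]
    rcases κ with i | i <;> rcases κ' with j | j <;>
      simp [baseVec, sdir, tdir]
  have hdet := congrArg Matrix.det (gram_eq_mul H c J hJ)
  rw [hM, Matrix.det_fromBlocks_zero₂₁, Matrix.det_mul, Matrix.det_mul, Matrix.det_transpose] at hdet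
  have hJd : J.det = (Matrix.of fun i j => secondDeriv K q (sdir i) (sdir j)).det := by
    simp [J]
  rw [hJd] at hdet
  rw [hdet]; ring

end legendre

section legendreChart

variable {n l : ℕ}

theorem hasFDerivAt_legendre {η : Base n l → EuclideanSpace ℝ (Fin n)} {q : Base n l}
    (hη : DifferentiableAt ℝ η q) : HasFDerivAt (fun r : Base n l => (η r, r.2))
      ((fderiv ℝ η q).prod (ContinuousLinearMap.snd ℝ _ _)) q :=
  hη.hasFDerivAt.prodMk hasFDerivAt_snd

theorem isOpen_image_legendre {η : Base n l → EuclideanSpace ℝ (Fin n)} {O : Set (Base n l)}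
    (hO : IsOpen O) (hη : ContDiffOn ℝ ∞ η O)
    (hb : ∀ q ∈ O, Function.Surjective fun u : Base n l => (fderiv ℝ η q u, u.2)) :
    IsOpen ((fun r : Base n l => (η r, r.2)) '' O) := by
  rw [isOpen_iff_mem_nhds]
  rintro _ ⟨q, hq, rfl⟩
  have hηq := hη.contDiffAt (hO.mem_nhds hq)
  have hs : HasStrictFDerivAt (fun r : Base n l => (η r, r.2))
      ((fderiv ℝ η q).prod (ContinuousLinearMap.snd ℝ _ _)) q :=
    (hηq.hasStrictFDerivAt (by simp)).prodMk hasStrictFDerivAt_snd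
  rw [← hs.map_nhds_eq_of_surj (LinearMap.range_eq_top.2 (hb q hq))]
  exact image_mem_map (hO.mem_nhds hq)

/-- The partial Legendre transform of a function `Ψ` with differential `(s, ϑ)` in the coordinates
`(η, t)` has differential `η ds - ϑ dt`. -/
theorem hasSplitGradient_legendre {Ψ : Base n l → ℝ} {η : Base n l → EuclideanSpace ℝ (Fin n)}
    {ϑ : Base n l → EuclideanSpace ℝ (Fin l)} {O : Set (Base n l)} (hO : IsOpen O)
    (hη : ContDiffOn ℝ ∞ η O) (hopen : IsOpen ((fun r : Base n l => (η r, r.2)) '' O))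
    (hΨ : ContDiffOn ℝ ∞ Ψ ((fun r : Base n l => (η r, r.2)) '' O))
    (h : ∀ q ∈ O, fderiv ℝ Ψ (η q, q.2) = pairForm q.1 (ϑ q)) :
    HasSplitGradient (fun q => inner ℝ q.1 (η q) - Ψ (η q, q.2)) O η ϑ := by
  have hΨY : ContDiffOn ℝ ∞ (fun q : Base n l => Ψ (η q, q.2)) O :=
    hΨ.comp (hη.prodMk contDiffOn_snd) (mapsTo_image _ _)
  refine ⟨(contDiffOn_fst.inner ℝ hη).sub hΨY, fun q hq => ?_⟩
  have hηq : DifferentiableAt ℝ η q := (hη.contDiffAt (hO.mem_nhds hq)).differentiableAt (by simp)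
  have h1 := (hΨ.contDiffAt (hopen.mem_nhds (mem_image_of_mem _ hq))).differentiableAt (by simp)
  have h2 := h1.hasFDerivAt.comp q (hasFDerivAt_legendre hηq)
  have h3 := (hasFDerivAt_fst (𝕜 := ℝ) (p := q)).inner ℝ hηq.hasFDerivAt
  refine (h3.sub h2).fderiv.trans ?_
  refine ContinuousLinearMap.ext fun u => ?_
  simp only [h q hq, pairForm_apply, inner_neg_left]
  simp [fderivInnerCLM_apply, real_inner_comm u.1]
  ring

/-- The inverse partial Legendre transform. -/
theorem exists_legendre_dual {K : Base n l → ℝ} {η : Base n l → EuclideanSpace ℝ (Fin n)}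
    {ϑ : Base n l → EuclideanSpace ℝ (Fin l)} {O : Set (Base n l)} (hO : IsOpen O)
    (hK : HasSplitGradient K O η ϑ)
    (hb : ∀ q ∈ O, Function.Bijective fun u : Base n l => (fderiv ℝ η q u, u.2))
    {p : Base n l} (hp : p ∈ O) :
    ∃ O' : Set (Base n l), IsOpen O' ∧ p ∈ O' ∧ O' ⊆ O ∧ ∃ Ψ : Base n l → ℝ,
      ContDiffOn ℝ ∞ Ψ ((fun r : Base n l => (η r, r.2)) '' O') ∧
      ∀ q ∈ O', fderiv ℝ Ψ (η q, q.2) = pairForm q.1 (ϑ q) := by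
  have hη := hK.smooth_eta hO
  let Y : Base n l → Base n l := fun r => (η r, r.2)
  have hY : ∀ q ∈ O, ContDiffAt ℝ ∞ Y q := fun q hq =>
    (hη.contDiffAt (hO.mem_nhds hq)).prodMk contDiffAt_snd
  let DY : Base n l → Base n l →L[ℝ] Base n l := fun q =>
    (fderiv ℝ η q).prod (ContinuousLinearMap.snd ℝ _ _)
  have hDY : ∀ q ∈ O, HasFDerivAt Y (DY q) q := fun q hq => hasFDerivAt_legendre
    ((hη.contDiffAt (hO.mem_nhds hq)).differentiableAt (by simp))
  have hequiv : ∀ q ∈ O, ∃ e : Base n l ≃L[ℝ] Base n l, (e : Base n l →L[ℝ] Base n l) = DY q :=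
    fun q hq => ⟨(LinearEquiv.ofBijective (DY q : Base n l →ₗ[ℝ] Base n l)
      (hb q hq)).toContinuousLinearEquiv, ContinuousLinearMap.ext fun u => rfl⟩
  obtain ⟨e₀, he₀⟩ := hequiv p hp
  -- By the inverse function theorem the chart is invertible near `p`, and the potential is `Ψ = ⟨s,
  -- η⟩ - K` in the chart.
  let Φ := (hY p hp).toOpenPartialHomeomorph Y (f' := e₀) (by rw [he₀]; exact hDY p hp) (by simp)
  have hΦ : ∀ q, Φ q = Y q := fun q => rfl
  have hΦs : ∀ q ∈ Φ.source, Φ.symm (Y q) = q := fun q hq => Φ.left_inv hq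
  refine ⟨Φ.source ∩ O, Φ.open_source.inter hO,
    ⟨(hY p hp).mem_toOpenPartialHomeomorph_source _ _, hp⟩, inter_subset_right,
    fun z => inner ℝ (Φ.symm z).1 (η (Φ.symm z)) - K (Φ.symm z), ?_⟩
  have hsmooth : ∀ q ∈ Φ.source ∩ O, ContDiffAt ℝ ∞
      (fun z => inner ℝ (Φ.symm z).1 (η (Φ.symm z)) - K (Φ.symm z)) (Y q) := fun q hq => by
    obtain ⟨e, he⟩ := hequiv q hq.2
    have hsy : ContDiffAt ℝ ∞ Φ.symm (Y q) := by
      refine Φ.contDiffAt_symm (f₀' := e) (Φ.map_source hq.1) ?_ ?_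
      · rw [hΦs q hq.1, he]; exact hDY q hq.2
      · rw [hΦs q hq.1]; exact hY q hq.2
    have h1 : ContDiffAt ℝ ∞ (fun r : Base n l => inner ℝ r.1 (η r) - K r) (Φ.symm (Y q)) := by
      rw [hΦs q hq.1]
      exact (contDiffAt_fst.inner ℝ (hη.contDiffAt (hO.mem_nhds hq.2))).sub
        (hK.smooth.contDiffAt (hO.mem_nhds hq.2))
    exact h1.comp (Y q) hsy
  refine ⟨?_, fun q hq => ?_⟩
  · rintro _ ⟨q, hq, rfl⟩
    exact (hsmooth q hq).contDiffWithinAt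
  · have hηq : DifferentiableAt ℝ η q :=
      (hη.contDiffAt (hO.mem_nhds hq.2)).differentiableAt (by simp)
    have h1 := ((hsmooth q hq).differentiableAt (by simp)).hasFDerivAt.comp q (hDY q hq.2)
    have h2 : HasFDerivAt (fun r : Base n l => inner ℝ r.1 (η r) - K r) _ q :=
      ((hasFDerivAt_fst (𝕜 := ℝ) (p := q)).inner ℝ hηq.hasFDerivAt).sub
      ((hK.smooth.contDiffAt (hO.mem_nhds hq.2)).differentiableAt (by simp)).hasFDerivAt
    have h3 := h2.congr_of_eventuallyEq (f₁ := (fun z => inner ℝ (Φ.symm z).1 (η (Φ.symm z)) -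
      K (Φ.symm z)) ∘ Y) (by
        filter_upwards [Φ.open_source.mem_nhds hq.1] with r hr
        simp only [Function.comp_apply, hΦs r hr])
    have h4 := h1.unique h3
    refine ContinuousLinearMap.ext fun v => ?_
    obtain ⟨u, hu⟩ := (hb q hq.2).2 v
    have h5 := congrArg (fun L => L u) h4
    rw [← hu]
    refine Eq.trans h5 ?_
    simp [fderivInnerCLM_apply, hK.gradient q hq.2, real_inner_comm u.1]
    ring

/-- A basis of a lattice `L` in `F`, together with linear coordinates on `F` in which it is the
standard basis. -/
structure LatticeCoord {F : Type} [NormedAddCommGroup F] [NormedSpace ℝ F] (L : Submodule ℤ F)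
    (n l : ℕ) where
  coord : F ≃L[ℝ] Base n l
  basis : Module.Basis (Fin n ⊕ Fin l) ℤ L
  coord_basis : ∀ κ, coord (basis κ : F) = baseVec κ

variable {F : Type} [NormedAddCommGroup F] [NormedSpace ℝ F] {L : Submodule ℤ F}

/-- The determinant of a bilinear form does not depend on the basis of the lattice. -/
theorem LatticeCoord.det_gram (C : LatticeCoord L n l) (b : Module.Basis (Fin (n + l)) ℤ L)
    (H : Base n l →L[ℝ] Base n l →L[ℝ] ℝ) :
    (Matrix.of fun i j => H (C.coord (b i : F)) (C.coord (b j : F))).det = (gramBase H).det := by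
  let b' : Module.Basis (Fin n ⊕ Fin l) ℤ L := b.reindex finSumFinEquiv.symm
  let Q := C.basis.toMatrix b'
  have hQ : ∀ κ, C.coord (b' κ : F) = ∑ κ', (Q.map (Int.cast : ℤ → ℝ)) κ' κ • baseVec κ' := by
    intro κ
    have h1 := congrArg (fun x : L => C.coord (x : F)) (C.basis.sum_repr (b' κ))
    rw [← h1]
    simp only [Submodule.coe_sum, Submodule.coe_smul, map_sum]
    refine Finset.sum_congr rfl fun κ' _ => ?_
    rw [map_zsmul, C.coord_basis]
    simp [Q, Module.Basis.toMatrix_apply, Int.cast_smul_eq_zsmul, -zsmul_eq_mul]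
  have hdet : Q.det * Q.det = 1 := by
    have h1 : Q.det * (b'.toMatrix C.basis).det = 1 := by
      rw [← Matrix.det_mul, Module.Basis.toMatrix_mul_toMatrix_flip, Matrix.det_one]
    exact Int.isUnit_mul_self (IsUnit.of_mul_eq_one _ h1)
  have h2 := congrArg Matrix.det (gram_eq_mul H (fun κ => C.coord (b' κ : F)) _ hQ)
  rw [Matrix.det_mul, Matrix.det_mul, Matrix.det_transpose] at h2
  have h3 : (Q.map (Int.cast : ℤ → ℝ)).det = (Q.det : ℝ) := by
    have := (Int.castRingHom ℝ).map_det Q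
    simpa using this.symm
  have h4 : (Q.det : ℝ) * Q.det = 1 := by exact_mod_cast hdet
  rw [h3, mul_right_comm, h4, one_mul] at h2
  rw [← h2, ← Matrix.det_submatrix_equiv_self (finSumFinEquiv (m := n) (n := l))]
  congr 1
  ext κ κ'
  simp [b']

theorem secondDeriv_comp_coord (ι : F ≃L[ℝ] Base n l) {Ψ : Base n l → ℝ} {z : F}
    (h : ContDiffAt ℝ ∞ Ψ (ι z)) (u u' : F) :
    secondDeriv (Ψ ∘ ι) z u u' = fderiv ℝ (fderiv ℝ Ψ) (ι z) (ι u') (ι u) := by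
  rw [← secondDeriv_eq h]
  have : (fun q => fderiv ℝ (Ψ ∘ ι) q u) = (fun r => fderiv ℝ Ψ r (ι u)) ∘ ι := by
    ext q
    rw [ι.comp_right_fderiv]; rfl
  rw [secondDeriv, this, ι.comp_right_fderiv]; rfl

/-- A Monge-Ampère metric is given by the Hessian of a local potential in the coordinates `(s, t)`,
and in these coordinates the equation is `det V = det W`. -/
theorem IsMongeAmpere.exists_hasSplitGradient (C : LatticeCoord L n l) {U : Set (Base n l)}
    {y : Base n l → F} {x : Base n l → F → ℝ} {g : Base n l → Base n l →L[ℝ] Base n l →L[ℝ] ℝ}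
    {η : Base n l → EuclideanSpace ℝ (Fin n)} {ϑ : Base n l → EuclideanSpace ℝ (Fin l)}
    (H : IsMongeAmpere L U y x g) (hU : IsOpen U) (hc : IsSmoothChart U y)
    (hy : ∀ q ∈ U, C.coord (y q) = (η q, q.2))
    (hx : ∀ q ∈ U, ∀ v, x q v = pairForm q.1 (ϑ q) (C.coord v)) {p : Base n l} (hp : p ∈ U) :
    ∃ O : Set (Base n l), IsOpen O ∧ p ∈ O ∧ O ⊆ U ∧ ∃ K : Base n l → ℝ,
      HasSplitGradient K O η ϑ ∧ ∀ q ∈ O,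
      (∀ u u', g q u u' = ∑ i, ∑ j, secondDeriv K q (sdir i) (sdir j) * u.1 i * u'.1 j +
        ∑ i, ∑ j, -secondDeriv K q (tdir i) (tdir j) * u.2 i * u'.2 j) ∧
      (Matrix.of fun i j => secondDeriv K q (sdir i) (sdir j)).det ^ 2 =
        (Matrix.of fun i j => secondDeriv K q (sdir i) (sdir j)).det *
          (Matrix.of fun i j => -secondDeriv K q (tdir i) (tdir j)).det := by
  obtain ⟨O, hO, hpO, hOU, Ψ₀, hΨ₀, hq⟩ := H p hp
  have hη : ContDiffOn ℝ ∞ η O := by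
    have h1 : ContDiffOn ℝ ∞ (fun q => (C.coord (y q)).1) O :=
      (contDiff_fst.comp C.coord.contDiff).comp_contDiffOn (hc.smooth.mono hOU)
    exact h1.congr fun q hq => by rw [hy q (hOU hq)]
  have hηd : ∀ q ∈ O, DifferentiableAt ℝ η q := fun q hq =>
    (hη.contDiffAt (hO.mem_nhds hq)).differentiableAt (by simp)
  have hDy : ∀ q ∈ O, ∀ u, C.coord (fderiv ℝ y q u) = (fderiv ℝ η q u, u.2) := fun q hq u => by
    have hyd : DifferentiableAt ℝ y q :=
      ((hc.smooth.contDiffAt (hU.mem_nhds (hOU hq)))).differentiableAt (by simp)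
    have h1 : HasFDerivAt (fun r => C.coord (y r))
        ((C.coord : F →L[ℝ] Base n l).comp (fderiv ℝ y q)) q :=
      (C.coord : F →L[ℝ] Base n l).hasFDerivAt.comp q hyd.hasFDerivAt
    have h2 := h1.congr_of_eventuallyEq (f₁ := fun r : Base n l => (η r, r.2)) (by
      filter_upwards [hO.mem_nhds hq] with r hr using (hy r (hOU hr)).symm)
    exact congrArg (fun T => T u) (h2.unique (hasFDerivAt_legendre (hηd q hq)))
  have hsurj : ∀ q ∈ O, Function.Surjective fun u : Base n l => (fderiv ℝ η q u, u.2) :=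
    fun q hq => by
      have h1 : (fun u : Base n l => (fderiv ℝ η q u, u.2)) = C.coord ∘ fderiv ℝ y q :=
        funext fun u => (hDy q hq u).symm
      rw [h1]
      exact C.coord.surjective.comp (hc.bijective q (hOU hq)).2
  have hopen := isOpen_image_legendre hO hη hsurj
  -- The potential of the metric, as a function of the coordinates `(η, t)` of the chart.
  let Ψ : Base n l → ℝ := Ψ₀ ∘ C.coord.symm
  have hΨe : Ψ₀ = Ψ ∘ C.coord := by ext z; simp [Ψ]
  have himg : MapsTo C.coord.symm ((fun r : Base n l => (η r, r.2)) '' O) (y '' O) := by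
    rintro _ ⟨q, hq, rfl⟩
    exact ⟨q, hq, by simp [← hy q (hOU hq)]⟩
  have hΨ : ContDiffOn ℝ ∞ Ψ ((fun r : Base n l => (η r, r.2)) '' O) :=
    hΨ₀.comp C.coord.symm.contDiff.contDiffOn himg
  have hΨat : ∀ q ∈ O, ContDiffAt ℝ ∞ Ψ (η q, q.2) := fun q hq =>
    hΨ.contDiffAt (hopen.mem_nhds (mem_image_of_mem _ hq))
  have hDΨ : ∀ q ∈ O, fderiv ℝ Ψ (η q, q.2) = pairForm q.1 (ϑ q) := fun q hqO => by
    refine ContinuousLinearMap.ext fun v => ?_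
    have h1 := (hq q hqO).1 (C.coord.symm v)
    rw [hx q (hOU hqO), hΨe, C.coord.comp_right_fderiv, hy q (hOU hqO)] at h1
    simpa using h1
  have hK := hasSplitGradient_legendre hO hη hopen hΨ hDΨ
  refine ⟨O, hO, hpO, hOU, _, hK, fun q hqO => ?_⟩
  have hsd : ∀ u u', secondDeriv Ψ₀ (y q) u u' =
      fderiv ℝ (fderiv ℝ Ψ) (η q, q.2) (C.coord u') (C.coord u) := fun u u' => by
    rw [hΨe, secondDeriv_comp_coord C.coord (by rw [hy q (hOU hqO)]; exact hΨat q hqO),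
      hy q (hOU hqO)]
  have hϑd : DifferentiableAt ℝ ϑ q :=
    ((hK.smooth_theta hO).contDiffAt (hO.mem_nhds hqO)).differentiableAt (by simp)
  have hess := hessian_eq_of_fderiv_eq (hΨat q hqO) (hηd q hqO) hϑd
    ((hO.eventually_mem hqO).mono hDΨ)
  refine ⟨fun u u' => ?_, ?_⟩
  · rw [(hq q hqO).2.1, hsd, hDy q hqO, hDy q hqO, hess, hK.metric_eq hO hqO]
  · obtain ⟨b, hb⟩ := (hq q hqO).2.2
    have h1 : (Matrix.of fun i j => secondDeriv Ψ₀ (y q) (b i : F) (b j : F)) =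
        Matrix.of fun i j => fderiv ℝ (fderiv ℝ Ψ) (η q, q.2) (C.coord (b i : F))
          (C.coord (b j : F)) := by
      ext i j
      rw [Matrix.of_apply, Matrix.of_apply, hsd, fderiv_fderiv_comm (hΨat q hqO)]
    rw [h1, C.det_gram] at hb
    have h2 := hK.det_mul hO hqO (H := fderiv ℝ (fderiv ℝ Ψ) (η q, q.2)) (fun u u' => by
      rw [fderiv_fderiv_comm (hΨat q hqO), hess, hK.metric_eq hO hqO])
    rwa [hb, mul_one] at h2

/-- The converse of `exists_hasSplitGradient`: a split potential whose gradient gives the chart and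
the dual coordinate has a Legendre dual with the metric as its Hessian, and equality of the two
determinants gives the Monge–Ampère equation. -/
theorem isMongeAmpere_of_hasSplitGradient (C : LatticeCoord L n l) {U : Set (Base n l)}
    {y : Base n l → F} {x : Base n l → F → ℝ} {g : Base n l → Base n l →L[ℝ] Base n l →L[ℝ] ℝ}
    {η : Base n l → EuclideanSpace ℝ (Fin n)} {ϑ : Base n l → EuclideanSpace ℝ (Fin l)}
    {K : Base n l → ℝ} (hK : HasSplitGradient K U η ϑ) (hU : IsOpen U) (hc : IsSmoothChart U y)
    (hy : ∀ q ∈ U, C.coord (y q) = (η q, q.2))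
    (hx : ∀ q ∈ U, ∀ v, x q v = pairForm q.1 (ϑ q) (C.coord v))
    (hg : ∀ q ∈ U, ∀ u u', g q u u' =
      ∑ i, ∑ j, secondDeriv K q (sdir i) (sdir j) * u.1 i * u'.1 j +
        ∑ i, ∑ j, -secondDeriv K q (tdir i) (tdir j) * u.2 i * u'.2 j)
    (hd0 : ∀ q ∈ U, (Matrix.of fun i j => secondDeriv K q (sdir i) (sdir j)).det ≠ 0)
    (hdet : ∀ q ∈ U, (Matrix.of fun i j => secondDeriv K q (sdir i) (sdir j)).det =
      (Matrix.of fun i j => -secondDeriv K q (tdir i) (tdir j)).det) :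
    IsMongeAmpere L U y x g := by
  intro p hp
  have hη := hK.smooth_eta hU
  have hηd : ∀ q ∈ U, DifferentiableAt ℝ η q := fun q hq =>
    (hη.contDiffAt (hU.mem_nhds hq)).differentiableAt (by simp)
  have hDy : ∀ q ∈ U, ∀ u, C.coord (fderiv ℝ y q u) = (fderiv ℝ η q u, u.2) := fun q hq u => by
    have hyd : DifferentiableAt ℝ y q :=
      ((hc.smooth.contDiffAt (hU.mem_nhds hq))).differentiableAt (by simp)
    have h1 : HasFDerivAt (fun r => C.coord (y r))
        ((C.coord : F →L[ℝ] Base n l).comp (fderiv ℝ y q)) q :=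
      (C.coord : F →L[ℝ] Base n l).hasFDerivAt.comp q hyd.hasFDerivAt
    have h2 := h1.congr_of_eventuallyEq (f₁ := fun r : Base n l => (η r, r.2)) (by
      filter_upwards [hU.mem_nhds hq] with r hr using (hy r hr).symm)
    exact congrArg (fun T => T u) (h2.unique (hasFDerivAt_legendre (hηd q hq)))
  have hbij : ∀ q ∈ U, Function.Bijective fun u : Base n l => (fderiv ℝ η q u, u.2) :=
    fun q hq => by
      have h1 : (fun u : Base n l => (fderiv ℝ η q u, u.2)) = C.coord ∘ fderiv ℝ y q :=
        funext fun u => (hDy q hq u).symm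
      rw [h1]
      exact C.coord.bijective.comp (hc.bijective q hq)
  obtain ⟨O, hO, hpO, hOU, Ψ, hΨ, hDΨ⟩ := exists_legendre_dual hU hK hbij hp
  have hopen := isOpen_image_legendre hO (hη.mono hOU) fun q hq => (hbij q (hOU hq)).2
  have hΨat : ∀ q ∈ O, ContDiffAt ℝ ∞ Ψ (η q, q.2) := fun q hq =>
    hΨ.contDiffAt (hopen.mem_nhds (mem_image_of_mem _ hq))
  have himg : MapsTo C.coord (y '' O) ((fun r : Base n l => (η r, r.2)) '' O) := by
    rintro _ ⟨q, hq, rfl⟩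
    exact ⟨q, hq, (hy q (hOU hq)).symm⟩
  refine ⟨O, hO, hpO, hOU, Ψ ∘ C.coord, hΨ.comp C.coord.contDiff.contDiffOn himg, fun q hqO => ?_⟩
  have hqU := hOU hqO
  have hsd : ∀ u u', secondDeriv (Ψ ∘ C.coord) (y q) u u' =
      fderiv ℝ (fderiv ℝ Ψ) (η q, q.2) (C.coord u') (C.coord u) := fun u u' => by
    rw [secondDeriv_comp_coord C.coord (by rw [hy q hqU]; exact hΨat q hqO), hy q hqU]
  have hϑd : DifferentiableAt ℝ ϑ q :=
    ((hK.smooth_theta hU).contDiffAt (hU.mem_nhds hqU)).differentiableAt (by simp)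
  have hess := hessian_eq_of_fderiv_eq (hΨat q hqO) (hηd q hqU) hϑd
    ((hO.eventually_mem hqO).mono hDΨ)
  refine ⟨fun u => ?_, fun u u' => ?_, ?_⟩
  · rw [C.coord.comp_right_fderiv, hy q hqU, hx q hqU, ← hDΨ q hqO]; rfl
  · rw [hsd, hDy q hqU, hDy q hqU, hess, hK.metric_eq hU hqU, hg q hqU]
  · refine ⟨C.basis.reindex finSumFinEquiv, ?_⟩
    have h1 : (Matrix.of fun i j => secondDeriv (Ψ ∘ C.coord) (y q)
        ((C.basis.reindex finSumFinEquiv i : L) : F) ((C.basis.reindex finSumFinEquiv j : L) : F)) =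
        Matrix.of fun i j => fderiv ℝ (fderiv ℝ Ψ) (η q, q.2)
          (C.coord ((C.basis.reindex finSumFinEquiv i : L) : F))
          (C.coord ((C.basis.reindex finSumFinEquiv j : L) : F)) := by
      ext i j
      rw [Matrix.of_apply, Matrix.of_apply, hsd, fderiv_fderiv_comm (hΨat q hqO)]
    rw [h1, C.det_gram]
    have h2 := hK.det_mul hU hqU (H := fderiv ℝ (fderiv ℝ Ψ) (η q, q.2)) (fun u u' => by
      rw [fderiv_fderiv_comm (hΨat q hqO), hess, hK.metric_eq hU hqU])
    rw [← hdet q hqU, ← pow_two] at h2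
    exact mul_left_cancel₀ (pow_ne_zero 2 (hd0 q hqU)) (h2.trans (mul_one _).symm)

end legendreChart

/-! ### Coordinates of the affine charts -/

section latticeCoord

variable {n l : ℕ} {F : Type} [NormedAddCommGroup F] [NormedSpace ℝ F] {L : Submodule ℤ F}

theorem sum_smul_baseVec (c : Fin n ⊕ Fin l → ℝ) : ∑ κ, c κ • (baseVec κ : Base n l) =
    (WithLp.toLp 2 fun i => c (Sum.inl i), WithLp.toLp 2 fun p => c (Sum.inr p)) := by
  rw [Fintype.sum_sum_type, base_decomp (WithLp.toLp 2 _, WithLp.toLp 2 _)]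
  rfl

/-- Coordinates in which the lattice is the set of integral points give a basis of the lattice. -/
def LatticeCoord.ofCoord (C : F ≃L[ℝ] Base n l)
    (h : ∀ y, y ∈ L ↔ ∃ c : Fin n ⊕ Fin l → ℤ, C y = ∑ κ, (c κ : ℝ) • baseVec κ) :
    LatticeCoord L n l where
  coord := C
  basis := Module.Basis.mk (v := fun κ => (⟨C.symm (baseVec κ), (h _).2 ⟨Pi.single κ 1, by
      simp [Pi.single_apply, ite_smul]⟩⟩ : L)) (by
    rw [Fintype.linearIndependent_iff]
    intro c hc κ
    have h1 := congrArg (fun x : L => C (x : F)) hc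
    simp only [Submodule.coe_sum, Submodule.coe_smul, map_sum, Submodule.coe_zero, map_zero,
      ← Int.cast_smul_eq_zsmul ℝ, map_smul, ContinuousLinearEquiv.apply_symm_apply] at h1
    rw [sum_smul_baseVec] at h1
    rcases κ with i | p
    · have := congrArg (fun z : Base n l => z.1 i) h1
      simpa using this
    · have := congrArg (fun z : Base n l => z.2 p) h1
      simpa using this) (by
    rintro ⟨y, hy⟩ -
    obtain ⟨c, hc⟩ := (h y).1 hy
    have h1 : (⟨y, hy⟩ : L) = ∑ κ, c κ • (⟨C.symm (baseVec κ), (h _).2 ⟨Pi.single κ 1, by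
        simp [Pi.single_apply, ite_smul]⟩⟩ : L) := by
      ext1
      apply C.injective
      simp [hc, map_sum, -zsmul_eq_mul, Int.cast_smul_eq_zsmul]
    rw [h1]
    exact Submodule.sum_mem _ fun κ _ => Submodule.smul_mem _ _ (Submodule.subset_span ⟨κ, rfl⟩))
  coord_basis κ := by simp

end latticeCoord

namespace AdaptedFrame

variable {n l d : ℕ} {a : Fin (l + 1) → Fin d → ℤ} {b : Fin (n + 1) → Fin d → ℤ}
  (F : AdaptedFrame a b)

/-- The point with coordinates `η`, `t`, `u` in the frame. -/
def point (η : EuclideanSpace ℝ (Fin n)) (t : EuclideanSpace ℝ (Fin l)) (u : ℝ) : Fin d → ℝ :=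
  ∑ i, η i • toReal (F.e i) + ∑ p, t p • toReal (F.f p) + u • toReal (b 0)

/-- The coordinates of a point along the vectors `e`. -/
def coordE : (Fin d → ℝ) →ₗ[ℝ] EuclideanSpace ℝ (Fin n) where
  toFun y := WithLp.toLp 2 fun i => toReal (F.es i) ⬝ᵥ y
  map_add' x y := by ext i; simp [dotProduct_add]
  map_smul' c x := by ext i; simp [dotProduct_smul]

/-- The coordinates of a point along the vectors `f`. -/
def coordF : (Fin d → ℝ) →ₗ[ℝ] EuclideanSpace ℝ (Fin l) where
  toFun y := WithLp.toLp 2 fun p => toReal (F.fs p) ⬝ᵥ y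
  map_add' x y := by ext i; simp [dotProduct_add]
  map_smul' c x := by ext i; simp [dotProduct_smul]

theorem coordE_apply (y : Fin d → ℝ) (i : Fin n) : F.coordE y i = toReal (F.es i) ⬝ᵥ y := rfl

theorem coordF_apply (y : Fin d → ℝ) (p : Fin l) : F.coordF y p = toReal (F.fs p) ⬝ᵥ y := rfl

theorem point_coord (y : Fin d → ℝ) :
    F.point (F.coordE y) (F.coordF y) (toReal (a 0) ⬝ᵥ y) = y := (F.complete_real y).symm

theorem coordE_point (η : EuclideanSpace ℝ (Fin n)) (t : EuclideanSpace ℝ (Fin l)) (u : ℝ) :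
    F.coordE (F.point η t u) = η := by
  ext i
  simp [coordE_apply, point, toReal_dotProduct, F.es_e, F.es_f, F.es_b]

theorem coordF_point (η : EuclideanSpace ℝ (Fin n)) (t : EuclideanSpace ℝ (Fin l)) (u : ℝ) :
    F.coordF (F.point η t u) = t := by
  ext i
  simp [coordF_apply, point, toReal_dotProduct, F.fs_e, F.fs_f, F.fs_b]

theorem a_zero_point (η : EuclideanSpace ℝ (Fin n)) (t : EuclideanSpace ℝ (Fin l)) (u : ℝ) :
    toReal (a 0) ⬝ᵥ F.point η t u = u := by
  simp [point, dotProduct_add, dotProduct_sum, dotProduct_smul, toReal_dotProduct,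
    F.a_e, F.a_f, F.a_b]

theorem a_dot_coord (i : Fin (l + 1)) (y : Fin d → ℝ) :
    toReal (a i) ⬝ᵥ y = toReal (a 0) ⬝ᵥ y + inner ℝ (F.alR i) (F.coordF y) := by
  rw [F.a_dot, PiLp.inner_apply]
  simp [alR, coordF_apply, mul_comm]

theorem coordE_b (j : Fin (n + 1)) : F.coordE (toReal (b j)) = F.beR j := by
  ext i
  rw [coordE_apply, F.toReal_b]
  simp [dotProduct_sum, toReal_dotProduct, F.es_e, F.es_b, beR]

theorem coordF_b (j : Fin (n + 1)) : F.coordF (toReal (b j)) = 0 := by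
  ext i
  rw [coordF_apply, F.toReal_b]
  simp [dotProduct_sum, toReal_dotProduct, F.fs_e, F.fs_b]

theorem a_zero_dot_b (F : AdaptedFrame a b) (j : Fin (n + 1)) :
    toReal (a 0) ⬝ᵥ toReal (b j) = 1 := by
  rw [F.toReal_b]
  simp [dotProduct_sum, toReal_dotProduct, F.a_e, F.a_b]

theorem toReal_b_eq_point (j : Fin (n + 1)) : toReal (b j) = F.point (F.beR j) 0 1 := by
  conv_lhs => rw [← F.point_coord (toReal (b j)), coordE_b, coordF_b, F.a_zero_dot_b]

theorem point_add (η η' : EuclideanSpace ℝ (Fin n)) (t t' : EuclideanSpace ℝ (Fin l)) (u u' : ℝ) :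
    F.point (η + η') (t + t') (u + u') = F.point η t u + F.point η' t' u' := by
  simp only [point, PiLp.add_apply, add_smul, Finset.sum_add_distrib]
  abel

theorem point_smul (c : ℝ) (η : EuclideanSpace ℝ (Fin n)) (t : EuclideanSpace ℝ (Fin l)) (u : ℝ) :
    F.point (c • η) (c • t) (c * u) = c • F.point η t u := by
  simp only [point, PiLp.smul_apply, smul_eq_mul, smul_add, Finset.smul_sum, smul_smul]

/-- The pairing in coordinates. -/
theorem dotProduct_eq (k y : Fin d → ℝ) : k ⬝ᵥ y = inner ℝ (F.swap.coordF k) (F.coordE y) +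
    inner ℝ (F.swap.coordE k) (F.coordF y) + (toReal (b 0) ⬝ᵥ k) * (toReal (a 0) ⬝ᵥ y) := by
  conv_lhs => rw [← F.point_coord y]
  simp only [point, dotProduct_add, dotProduct_sum, dotProduct_smul, PiLp.inner_apply,
    coordE_apply, coordF_apply, swap]
  simp only [dotProduct_comm k, smul_eq_mul, RCLike.inner_apply, conj_trivial]
  ring

/-- Integral coordinates on the face `a_i^⊥`. -/
def perpLatticeCoord (i : Fin (l + 1)) : LatticeCoord (perpLattice (a i)) n l :=
  LatticeCoord.ofCoord (LinearEquiv.toContinuousLinearEquiv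
    { toFun := fun y : perp (a i) => (F.coordE y, F.coordF y)
      map_add' := fun x y => by simp
      map_smul' := fun c x => by simp
      invFun := fun z => ⟨F.point z.1 z.2 (-inner ℝ (F.alR i) z.2), by
        change toReal (a i) ⬝ᵥ _ = 0
        rw [F.a_dot_coord, a_zero_point, coordF_point, neg_add_cancel]⟩
      left_inv := fun y => by
        ext1
        have h : toReal (a i) ⬝ᵥ (y : Fin d → ℝ) = 0 := y.2
        rw [F.a_dot_coord] at h
        conv_rhs => rw [← F.point_coord y]
        simp only
        rw [eq_neg_of_add_eq_zero_left h]
      right_inv := fun z => by simp [coordE_point, coordF_point] }) (by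
    intro y
    constructor
    · rintro ⟨x, hx⟩
      have hx' : toReal x = y := hx
      refine ⟨Sum.elim (fun i => F.es i ⬝ᵥ x) (fun p => F.fs p ⬝ᵥ x), ?_⟩
      rw [sum_smul_baseVec]
      refine Prod.ext ?_ ?_
      · ext i
        change toReal (F.es i) ⬝ᵥ (y : Fin d → ℝ) = _
        rw [← hx', toReal_dotProduct]; simp
      · ext i
        change toReal (F.fs i) ⬝ᵥ (y : Fin d → ℝ) = _
        rw [← hx', toReal_dotProduct]; simp
    · rintro ⟨c, hc⟩
      rw [sum_smul_baseVec] at hc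
      have h : toReal (a i) ⬝ᵥ (y : Fin d → ℝ) = 0 := y.2
      have h1 : F.coordE y = _ := congrArg Prod.fst hc
      have h2 : F.coordF y = _ := congrArg Prod.snd hc
      rw [F.a_dot_coord] at h
      refine ⟨∑ j, c (Sum.inl j) • F.e j + ∑ p, c (Sum.inr p) • F.f p +
        (-∑ p, F.al i p * c (Sum.inr p)) • b 0, ?_⟩
      change _ = (y : Fin d → ℝ)
      rw [← F.point_coord y, eq_neg_of_add_eq_zero_left h, h1, h2, map_add, map_add, toReal_sum,
        toReal_sum, map_zsmul, ← Int.cast_smul_eq_zsmul ℝ, point]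
      simp [alR, PiLp.inner_apply, mul_comm])

theorem perpLatticeCoord_apply (i : Fin (l + 1)) (y : perp (a i)) :
    (F.perpLatticeCoord i).coord y = (F.coordE y, F.coordF y) := rfl

/-- The coordinates of the class of a point modulo `b_j`. -/
def quotMap (j : Fin (n + 1)) : (Fin d → ℝ) →ₗ[ℝ] Base n l where
  toFun y := (F.coordE y - (toReal (a 0) ⬝ᵥ y) • F.beR j, F.coordF y)
  map_add' x y := by
    refine Prod.ext ?_ ?_
    · simp [dotProduct_add, add_smul]; abel
    · simp
  map_smul' c x := by
    refine Prod.ext ?_ ?_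
    · simp [dotProduct_smul, smul_sub, smul_smul]
    · simp

theorem quotMap_apply (j : Fin (n + 1)) (y : Fin d → ℝ) :
    F.quotMap j y = (F.coordE y - (toReal (a 0) ⬝ᵥ y) • F.beR j, F.coordF y) := rfl

theorem line_le_ker_quotMap (j : Fin (n + 1)) : line (b j) ≤ LinearMap.ker (F.quotMap j) := by
  rw [line, Submodule.span_le, singleton_subset_iff, SetLike.mem_coe, LinearMap.mem_ker,
    quotMap_apply, coordE_b, coordF_b, F.a_zero_dot_b, one_smul, sub_self]
  rfl

theorem mkQ_point_quotMap (j : Fin (n + 1)) (y : Fin d → ℝ) :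
    (line (b j)).mkQ (F.point (F.quotMap j y).1 (F.quotMap j y).2 0) = (line (b j)).mkQ y := by
  rw [Submodule.mkQ_apply, Submodule.mkQ_apply, Submodule.Quotient.eq]
  refine Submodule.mem_span_singleton.2 ⟨-(toReal (a 0) ⬝ᵥ y), ?_⟩
  conv_rhs => rw [← F.point_coord y]
  rw [F.toReal_b_eq_point, ← F.point_smul, eq_sub_iff_add_eq, ← F.point_add, quotMap_apply,
    a_zero_point, coordE_point, coordF_point]
  congr 1
  · rw [neg_smul, neg_add_eq_sub]
  · simp
  · simp

/-- The coordinates `quotMap` on the quotient by `b_j`. -/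
def quotEquiv (j : Fin (n + 1)) : QuotLine (b j) ≃ₗ[ℝ] Base n l :=
  LinearEquiv.ofLinearMap ((line (b j)).liftQ (F.quotMap j) (F.line_le_ker_quotMap j))
    ((line (b j)).mkQ.comp
      ({ toFun := fun z : Base n l => F.point z.1 z.2 0
         map_add' := fun z z' => by
          have := F.point_add z.1 z'.1 z.2 z'.2 0 0
          rwa [add_zero] at this
         map_smul' := fun c z => by
          have := F.point_smul c z.1 z.2 0
          rwa [mul_zero] at this } : Base n l →ₗ[ℝ] (Fin d → ℝ))) (by
      refine LinearMap.ext fun z => ?_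
      change F.quotMap j (F.point z.1 z.2 0) = z
      rw [quotMap_apply, coordE_point, coordF_point, a_zero_point, zero_smul, sub_zero]) (by
      refine LinearMap.ext fun y => ?_
      obtain ⟨y, rfl⟩ := (line (b j)).mkQ_surjective y
      exact F.mkQ_point_quotMap j y)

theorem quotEquiv_mkQ (j : Fin (n + 1)) (y : Fin d → ℝ) :
    F.quotEquiv j ((line (b j)).mkQ y) = F.quotMap j y := rfl

theorem quotEquiv_symm (j : Fin (n + 1)) (z : Base n l) :
    (F.quotEquiv j).symm z = (line (b j)).mkQ (F.point z.1 z.2 0) := rfl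

theorem mem_quotLattice_iff (j : Fin (n + 1)) (y : QuotLine (b j)) : y ∈ quotLattice (b j) ↔
    ∃ c : Fin n ⊕ Fin l → ℤ, F.quotEquiv j y = ∑ κ, (c κ : ℝ) • baseVec κ := by
  constructor
  · rintro ⟨_, ⟨x, rfl⟩, rfl⟩
    refine ⟨Sum.elim (fun i => F.es i ⬝ᵥ x - (a 0 ⬝ᵥ x) * F.be j i) (fun p => F.fs p ⬝ᵥ x), ?_⟩
    rw [sum_smul_baseVec]
    refine Prod.ext ?_ ?_
    · ext i
      change toReal (F.es i) ⬝ᵥ toReal x - (toReal (a 0) ⬝ᵥ toReal x) * F.be j i = _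
      rw [toReal_dotProduct, toReal_dotProduct]; simp
    · ext i
      change toReal (F.fs i) ⬝ᵥ toReal x = _
      rw [toReal_dotProduct]; simp
  · rintro ⟨c, hc⟩
    rw [sum_smul_baseVec, ← LinearEquiv.eq_symm_apply, quotEquiv_symm] at hc
    rw [hc]
    refine ⟨_, ⟨∑ j, c (Sum.inl j) • F.e j + ∑ p, c (Sum.inr p) • F.f p, rfl⟩, ?_⟩
    rw [LinearMap.restrictScalars_apply, map_add, toReal_sum, toReal_sum, point, zero_smul,
      add_zero]

/-- Integral coordinates on the quotient by `b_j`. -/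
def quotLatticeCoord (j : Fin (n + 1)) : LatticeCoord (quotLattice (b j)) n l :=
  LatticeCoord.ofCoord (F.quotEquiv j).toContinuousLinearEquiv (F.mem_quotLattice_iff j)

theorem quotLatticeCoord_mkQ (j : Fin (n + 1)) (y : Fin d → ℝ) :
    (F.quotLatticeCoord j).coord ((line (b j)).mkQ y) =
      (F.coordE y - (toReal (a 0) ⬝ᵥ y) • F.beR j, F.coordF y) := F.quotEquiv_mkQ j y

end AdaptedFrame

/-! ### Integrals of derivatives over the cones of a fan -/

section wedge

variable {E : Type*} [NormedAddCommGroup E] [InnerProductSpace ℝ E] [FiniteDimensional ℝ E]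
  [MeasurableSpace E] [BorelSpace E]

/-- Volume in the coordinates `s = x + r |c| d` with `x` in the hyperplane `c^⊥`. -/
theorem measurePreserving_hyperplane {c d : E} (hc : c ≠ 0) (hd : inner ℝ c d = 1) :
    MeasurePreserving (fun z : ℝ × ↥(Submodule.span ℝ {c})ᗮ => (z.2 : E) + (z.1 * ‖c‖) • d)
      (volume.prod volume) volume := by
  have hc' : ‖c‖ ≠ 0 := norm_ne_zero_iff.2 hc
  let iso : ℝ ≃ₗᵢ[ℝ] ↥(Submodule.span ℝ {c}) :=
    { (LinearEquiv.smulOfNeZero ℝ ℝ ‖c‖⁻¹ (inv_ne_zero hc')).trans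
        (LinearEquiv.toSpanNonzeroSingleton ℝ E c hc) with
      norm_map' := fun r => by
        change ‖(‖c‖⁻¹ • r) • c‖ = ‖r‖
        rw [norm_smul, smul_eq_mul, norm_mul, norm_inv, norm_norm]
        field_simp }
  have hiso : ∀ r, ((iso r : ↥(Submodule.span ℝ {c})) : E) = (‖c‖⁻¹ * r) • c := fun r => rfl
  let h : E := d - (‖c‖⁻¹ * ‖c‖⁻¹) • c
  have hh : h ∈ (Submodule.span ℝ {c})ᗮ := by
    rw [Submodule.mem_orthogonal_singleton_iff_inner_right, inner_sub_right, hd,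
      real_inner_smul_right, real_inner_self_eq_norm_sq]
    field_simp
    norm_num
  -- A translation of the hyperplane that depends on the position along `c`: a shear.
  have h1 : MeasurePreserving (fun z : ℝ × ↥(Submodule.span ℝ {c})ᗮ =>
      (iso z.1, z.2 + (z.1 * ‖c‖) • (⟨h, hh⟩ : ↥(Submodule.span ℝ {c})ᗮ)))
      (volume.prod volume) (volume.prod volume) :=
    MeasurePreserving.skew_product (g := fun (r : ℝ) (x : ↥(Submodule.span ℝ {c})ᗮ) =>
        x + (r * ‖c‖) • (⟨h, hh⟩ : ↥(Submodule.span ℝ {c})ᗮ))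
      iso.measurePreserving (by fun_prop)
      (Eventually.of_forall fun r => map_add_right_eq_self _ _)
  have h2 : MeasurePreserving (fun z : ↥(Submodule.span ℝ {c}) × ↥(Submodule.span ℝ {c})ᗮ =>
      (z.1 : E) + (z.2 : E)) (volume.prod volume) volume := by
    have := ((Submodule.span ℝ {c}).orthogonalDecomposition.symm.measurePreserving).comp
      (WithLp.volume_preserving_toLp ↥(Submodule.span ℝ {c}) ↥(Submodule.span ℝ {c})ᗮ)
    have e : (fun z : ↥(Submodule.span ℝ {c}) × ↥(Submodule.span ℝ {c})ᗮ => (z.1 : E) + (z.2 : E)) =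
        (Submodule.span ℝ {c}).orthogonalDecomposition.symm ∘ WithLp.toLp 2 := by
      ext z
      simp
    rw [e]
    exact this
  have h3 := h2.comp h1
  convert h3 using 1
  ext z
  simp only [Function.comp_apply, hiso, Submodule.coe_add, Submodule.coe_smul, h]
  rw [smul_sub, smul_smul]
  have : z.1 * ‖c‖ * (‖c‖⁻¹ * ‖c‖⁻¹) = ‖c‖⁻¹ * z.1 := by field_simp
  rw [this]
  abel

/-- The divergence theorem for a vector field of constant direction on a wedge: the set `T` is
invariant under translation along `d`, and the boundary of the wedge is `T ∩ c^⊥`, up to parts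
to which `d` is tangent. -/
theorem integral_wedge_fderiv {c d : E} (hc : c ≠ 0) (hd : inner ℝ c d = 1) {T : Set E}
    (hT : MeasurableSet T) (hTd : ∀ x (r : ℝ), x + r • d ∈ T ↔ x ∈ T) {f : E → ℝ}
    (hf : ContDiff ℝ 1 f) (hfc : HasCompactSupport f) {K : Submodule ℝ E}
    (hK : K = Submodule.span ℝ {c}) :
    ∫ s in {s | 0 < inner ℝ c s ∧ s ∈ T}, fderiv ℝ f s d =
      -(‖c‖⁻¹ * ∫ x in {x : ↥Kᗮ | (x : E) ∈ T}, f x) := by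
  subst hK
  have hc' : 0 < ‖c‖ := norm_pos_iff.2 hc
  have hmeas : MeasurableSet {s | 0 < inner ℝ c s ∧ s ∈ T} := by
    have : MeasurableSet {s : E | 0 < inner ℝ c s} :=
      (isOpen_lt continuous_const (by fun_prop)).measurableSet
    exact this.inter hT
  have hcont : Continuous fun s => fderiv ℝ f s d :=
    (hf.continuous_fderiv (by simp)).clm_apply continuous_const
  have hint : Integrable fun s => fderiv ℝ f s d :=
    hcont.integrable_of_hasCompactSupport (hfc.fderiv_apply (𝕜 := ℝ) d)
  have hG := hint.indicator hmeas
  have hΦ := measurePreserving_hyperplane hc hd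
  have hT' : MeasurableSet {x : ↥(Submodule.span ℝ {c})ᗮ | (x : E) ∈ T} :=
    hT.preimage measurable_subtype_coe
  rw [← integral_indicator hmeas, ← hΦ.map_eq, integral_map hΦ.measurable.aemeasurable
    (by rw [hΦ.map_eq]; exact hG.aestronglyMeasurable)]
  -- Fubini, and then the fundamental theorem of calculus in the direction of `d`.
  refine (integral_prod_symm _ (hΦ.integrable_comp_of_integrable hG)).trans ?_
  rw [← integral_indicator hT', ← integral_const_mul, ← integral_neg]
  congr 1
  ext x
  have hx : inner ℝ c (x : E) = 0 :=
    (Submodule.mem_orthogonal_singleton_iff_inner_right).1 x.2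
  have hmem : ∀ r : ℝ, (x : E) + (r * ‖c‖) • d ∈ {s | 0 < inner ℝ c s ∧ s ∈ T} ↔
      r ∈ Ioi (0 : ℝ) ∧ (x : E) ∈ T := fun r => by
    simp only [mem_ofPred_eq, hTd, inner_add_right, hx, real_inner_smul_right, hd, zero_add, mul_one,
      mul_pos_iff_of_pos_right hc', mem_Ioi]
  by_cases hxT : (x : E) ∈ T
  · have e1 : ∀ r : ℝ, indicator {s | 0 < inner ℝ c s ∧ s ∈ T} (fun s => fderiv ℝ f s d)
        ((x : E) + (r * ‖c‖) • d) =
        indicator (Ioi 0) (fun r => ‖c‖⁻¹ * deriv (fun r => f ((x : E) + (r * ‖c‖) • d)) r) r := by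
      intro r
      have hder : HasDerivAt (fun r => f ((x : E) + (r * ‖c‖) • d))
          (fderiv ℝ f ((x : E) + (r * ‖c‖) • d) ((1 * ‖c‖) • d)) r :=
        ((hf.differentiable (by simp)) _).hasFDerivAt.comp_hasDerivAt r
          ((((hasDerivAt_id r).mul_const ‖c‖).smul_const d).const_add _)
      by_cases hr : r ∈ Ioi (0 : ℝ)
      · rw [indicator_of_mem hr, indicator_of_mem ((hmem r).2 ⟨hr, hxT⟩), hder.deriv, map_smul,
          one_mul, smul_eq_mul, inv_mul_cancel_left₀ hc'.ne']
      · rw [indicator_of_notMem hr, indicator_of_notMem fun h => hr ((hmem r).1 h).1]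
    have hd0 : d ≠ 0 := fun h => by simp [h] at hd
    have hcl : IsClosedEmbedding fun r : ℝ => (x : E) + (r * ‖c‖) • d := by
      have h1 : IsClosedEmbedding fun r : ℝ => r • d := isClosedEmbedding_smul_left hd0
      exact (Homeomorph.addLeft (x : E)).isClosedEmbedding.comp
        (h1.comp (Homeomorph.mulRight₀ ‖c‖ hc'.ne').isClosedEmbedding)
    have hcs : HasCompactSupport fun r : ℝ => f ((x : E) + (r * ‖c‖) • d) :=
      hfc.comp_isClosedEmbedding hcl
    have hcd : ContDiff ℝ 1 fun r : ℝ => f ((x : E) + (r * ‖c‖) • d) := hf.comp (by fun_prop)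
    simp only [Function.comp_apply, e1]
    rw [integral_indicator measurableSet_Ioi, integral_const_mul, hcs.integral_Ioi_deriv_eq hcd,
      indicator_of_mem (show x ∈ {x : ↥(Submodule.span ℝ {c})ᗮ | (x : E) ∈ T} from hxT)]
    simp
  · have e1 : ∀ r : ℝ, indicator {s | 0 < inner ℝ c s ∧ s ∈ T} (fun s => fderiv ℝ f s d)
        ((x : E) + (r * ‖c‖) • d) = 0 := fun r =>
      indicator_of_notMem (fun h => hxT ((hmem r).1 h).2) _
    simp only [Function.comp_apply, e1, integral_zero]
    rw [indicator_of_notMem (show x ∉ {x : ↥(Submodule.span ℝ {c})ᗮ | (x : E) ∈ T} from hxT)]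
    simp

end wedge

section fan

variable {k : ℕ} {c : Fin (k + 1) → Fin (k + 1) → EuclideanSpace ℝ (Fin k)}
  {x : Fin (k + 1) → EuclideanSpace ℝ (Fin k)}

namespace IsSimplexEdges

theorem edge_neg (h : IsSimplexEdges c x) (a b : Fin (k + 1)) : c b a = -c a b := by
  rw [h.eq, h.eq, neg_sub]

theorem wall_symm (h : IsSimplexEdges c x) (a b : Fin (k + 1)) : wall c a b = wall c b a := by
  ext s
  rw [h.mem_wall, h.mem_wall]
  constructor <;> rintro ⟨h1, h2⟩ <;> exact ⟨h1.symm, fun j => h1 ▸ h2 j⟩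

theorem wallIntegral_symm (h : IsSimplexEdges c x) (a b : Fin (k + 1))
    (f : EuclideanSpace ℝ (Fin k) → ℝ) : wallIntegral c a b f = wallIntegral c b a f := by
  have key : ∀ (K K' : Submodule ℝ (EuclideanSpace ℝ (Fin k))), K = K' →
      ∫ s in {s : ↥Kᗮ | (s : EuclideanSpace ℝ (Fin k)) ∈ wall c a b}, f s =
      ∫ s in {s : ↥K'ᗮ | (s : EuclideanSpace ℝ (Fin k)) ∈ wall c a b}, f s := by
    rintro K _ rfl; rfl
  refine (key _ (Submodule.span ℝ {c b a}) ?_).trans ?_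
  · rw [h.edge_neg a b, ← Set.neg_singleton, Submodule.span_neg]
  · rw [h.wall_symm]; rfl

/-- The vectors `d b`, `b ≠ a`, are dual to the edges of the cone of the `a`-th vertex. -/
theorem exists_dual (h : IsSimplexEdges c x) (a : Fin (k + 1)) :
    ∃ d : Fin (k + 1) → EuclideanSpace ℝ (Fin k),
      (∀ b b', b ≠ a → inner ℝ (c b' a) (d b) = if b' = b then 1 else 0) ∧
      ∀ u, u = ∑ b ∈ Finset.univ.erase a, inner ℝ (c b a) u • d b := by
  choose d hd using fun b => h.exists_inner_eq fun b' => if b' = b then (1 : ℝ) else 0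
  have h1 : ∀ b b', b ≠ a → inner ℝ (c b' a) (d b) = if b' = b then 1 else 0 := fun b b' hb => by
    rw [h.inner_eq, hd, hd]
    simp [hb.symm]
  refine ⟨d, h1, fun u => ?_⟩
  rw [← sub_eq_zero]
  have h2 : ∀ b', inner ℝ (c b' a) (u - ∑ b ∈ Finset.univ.erase a, inner ℝ (c b a) u • d b) = 0 := by
    intro b'
    by_cases hb' : b' = a
    · rw [hb', h.eq, sub_self, inner_zero_left]
    · rw [inner_sub_right, inner_sum, Finset.sum_congr rfl (g := fun b =>
        if b' = b then inner ℝ (c b a) u else 0) fun b hb => by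
          rw [real_inner_smul_right, h1 b b' (Finset.ne_of_mem_erase hb)]; simp]
      simp [hb']
  refine h.eq_zero_of_inner fun b => ?_
  have e1 := h2 b
  have e2 := h2 0
  rw [h.inner_eq] at e1 e2
  rw [h.zero, inner_zero_left] at e2
  linarith

/-- The divergence theorem on a normal cone. The direction `u` is decomposed along the vectors dual
to the edges at the vertex `a`, so that each summand leaves the cone through a single wall. -/
theorem integral_normalCone_fderiv (h : IsSimplexEdges c x) {f : EuclideanSpace ℝ (Fin k) → ℝ}
    (hf : ContDiff ℝ 1 f) (hfc : HasCompactSupport f) (a : Fin (k + 1))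
    (u : EuclideanSpace ℝ (Fin k)) :
    ∫ s in normalCone c a, fderiv ℝ f s u =
      ∑ b ∈ Finset.univ.erase a, -(inner ℝ (c b a) u / ‖c a b‖ * wallIntegral c a b f) := by
  obtain ⟨d, hd, hu⟩ := h.exists_dual a
  have hcont : ∀ v, Continuous fun s => fderiv ℝ f s v := fun v =>
    (hf.continuous_fderiv (by simp)).clm_apply continuous_const
  have hint : ∀ v, Integrable fun s => fderiv ℝ f s v := fun v =>
    (hcont v).integrable_of_hasCompactSupport (hfc.fderiv_apply (𝕜 := ℝ) v)
  have e1 : ∀ s, fderiv ℝ f s u =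
      ∑ b ∈ Finset.univ.erase a, inner ℝ (c b a) u * fderiv ℝ f s (d b) := fun s => by
    conv_lhs => rw [hu u]
    simp [map_sum]
  simp only [e1]
  rw [integral_finsetSum _ fun b _ => ((hint (d b)).const_mul _).integrableOn]
  refine Finset.sum_congr rfl fun b hb => ?_
  have hb := Finset.ne_of_mem_erase hb
  rw [integral_const_mul, div_mul_eq_mul_div, mul_div_assoc, ← mul_neg]
  congr 1
  let T : Set (EuclideanSpace ℝ (Fin k)) := {s | ∀ b', b' ≠ a → b' ≠ b → 0 < inner ℝ (c b' a) s}
  have hT : MeasurableSet T := by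
    have : IsOpen T := by
      simp only [T, ofPred_forall]
      exact isOpen_iInter_of_finite fun b' => isOpen_iInter_of_finite fun _ =>
        isOpen_iInter_of_finite fun _ => isOpen_lt continuous_const (by fun_prop)
    exact this.measurableSet
  have hQ : normalCone c a = {s | 0 < inner ℝ (c b a) s ∧ s ∈ T} := by
    ext s
    refine ⟨fun hs => ⟨hs b hb, fun b' h1 _ => hs b' h1⟩, fun hs b' h1 => ?_⟩
    by_cases h2 : b' = b
    · rw [h2]; exact hs.1
    · exact hs.2 b' h1 h2
  have hsp : Submodule.span ℝ {c a b} = Submodule.span ℝ {c b a} := by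
    rw [h.edge_neg a b, ← Set.neg_singleton, Submodule.span_neg]
  rw [hQ, integral_wedge_fderiv (h.edge_ne_zero hb) (by rw [hd b b hb, if_pos rfl]) hT (fun s r => by
    refine forall_congr' fun b' => forall_congr' fun _ => forall_congr' fun h2 => ?_
    rw [inner_add_right, real_inner_smul_right, hd b b' hb, if_neg h2, mul_zero, add_zero])
    hf hfc hsp, h.edge_neg a b, norm_neg, inv_mul_eq_div]
  congr 2
  rw [wallIntegral]
  refine setIntegral_congr_set ?_
  -- The wall is the face of the wedge up to a null set of the hyperplane.
  have hnull : ∀ᵐ s : ↥(Submodule.span ℝ {c a b})ᗮ, ∀ b', b' ≠ a → b' ≠ b →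
      inner ℝ (c b' a) (s : EuclideanSpace ℝ (Fin k)) ≠ 0 := by
    rw [ae_all_iff]; intro b'
    by_cases h1 : b' = a
    · simp [h1]
    by_cases h2 : b' = b
    · simp [h2]
    have hmem : d b' ∈ (Submodule.span ℝ {c a b})ᗮ := by
      rw [hsp, Submodule.mem_orthogonal_singleton_iff_inner_right, hd b' b h1, if_neg (Ne.symm h2)]
    let L : ↥(Submodule.span ℝ {c a b})ᗮ →ₗ[ℝ] ℝ :=
      (innerSL ℝ (c b' a) : EuclideanSpace ℝ (Fin k) →ₗ[ℝ] ℝ).comp (Submodule.subtype _)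
    have hne : LinearMap.ker L ≠ ⊤ := by
      intro htop
      have : (⟨d b', hmem⟩ : ↥(Submodule.span ℝ {c a b})ᗮ) ∈ LinearMap.ker L :=
        htop ▸ Submodule.mem_top
      have h3 : inner ℝ (c b' a) (d b') = 0 := this
      rw [hd b' b' h1, if_pos rfl] at h3
      exact one_ne_zero h3
    have := Measure.addHaar_submodule
      (volume : Measure ↥(Submodule.span ℝ {c a b})ᗮ) (LinearMap.ker L) hne
    filter_upwards [measure_eq_zero_iff_ae_notMem.1 this] with s hs _ _ using hs
  filter_upwards [hnull] with s hs
  have hs0 : inner ℝ (c a b) (s : EuclideanSpace ℝ (Fin k)) = 0 :=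
    (Submodule.mem_orthogonal_singleton_iff_inner_right).1 s.2
  refine propext ⟨fun (hsT : (s : EuclideanSpace ℝ (Fin k)) ∈ T) => ⟨hs0, fun j => ?_⟩,
    fun hw b' h1 h2 => (hw.2 b').lt_of_ne' (hs b' h1 h2)⟩
  by_cases h1 : j = a
  · rw [h1, h.eq, sub_self, inner_zero_left]
  by_cases h2 : j = b
  · rw [h2, h.edge_neg a b, inner_neg_left, hs0, neg_zero]
  · exact (hsT j h1 h2).le

/-- The current `γ` in terms of the derivative of the piecewise constant function with values
`x a`, which is the gradient of the piecewise linear function `minForm x`. -/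
theorem gammaCurrent_eq (h : IsSimplexEdges c x) {f : EuclideanSpace ℝ (Fin k) → ℝ}
    (hf : ContDiff ℝ 1 f) (hfc : HasCompactSupport f) (i j : Fin k) :
    gammaCurrent c i j f =
      ∑ a, x a i * ∫ s in normalCone c a, fderiv ℝ f s (EuclideanSpace.single j 1) := by
  have e1 : ∀ a, x a i * ∫ s in normalCone c a, fderiv ℝ f s (EuclideanSpace.single j 1) =
      ∑ b, if a ≠ b then -(x a i * (c b a j / ‖c a b‖ * wallIntegral c a b f)) else 0 := fun a => by
    rw [h.integral_normalCone_fderiv hf hfc, Finset.mul_sum, ← Finset.sum_filter]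
    have : Finset.univ.erase a = Finset.univ.filter fun b => a ≠ b := by ext; simp [eq_comm]
    rw [this]
    refine Finset.sum_congr rfl fun b _ => ?_
    rw [inner_single_one, mul_neg]
  simp only [e1]
  -- The sum over `a ≠ b` is split into the sums over `a < b` and `b < a`.
  have e2 : ∀ a b : Fin (k + 1), (if a ≠ b then
      -(x a i * (c b a j / ‖c a b‖ * wallIntegral c a b f)) else 0) =
      (if a < b then -(x a i * (c b a j / ‖c a b‖ * wallIntegral c a b f)) else 0) +
      if b < a then -(x a i * (c b a j / ‖c a b‖ * wallIntegral c a b f)) else 0 := fun a b => by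
    rcases lt_trichotomy a b with h1 | h1 | h1
    · simp [h1, h1.ne, h1.not_gt]
    · simp [h1]
    · simp [h1, h1.ne', h1.not_gt]
  simp only [e2, Finset.sum_add_distrib]
  rw [add_comm, Finset.sum_comm, ← Finset.sum_add_distrib, gammaCurrent]
  refine Finset.sum_congr rfl fun a _ => ?_
  rw [← Finset.sum_add_distrib]
  refine Finset.sum_congr rfl fun b _ => ?_
  by_cases h1 : a < b
  · rw [if_pos h1, if_pos h1, if_pos h1, h.wallIntegral_symm b a, h.edge_neg a b, norm_neg]
    simp only [h.eq a b, PiLp.sub_apply, PiLp.neg_apply]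
    ring
  · rw [if_neg h1, if_neg h1, if_neg h1, add_zero]

end IsSimplexEdges

end fan

/-! ### Test functions and cutoffs along hyperplanes -/

/-- A smooth nondecreasing odd function, which vanishes on `[-1, 1]` and whose square is `1` outside
`[-2, 2]`. -/
def oddStep (x : ℝ) : ℝ := Real.smoothTransition (x - 1) - Real.smoothTransition (-x - 1)

theorem contDiff_oddStep : ContDiff ℝ ∞ oddStep :=
  (Real.smoothTransition.contDiff.comp (by fun_prop)).sub
    (Real.smoothTransition.contDiff.comp (by fun_prop))

theorem monotone_oddStep : Monotone oddStep := fun x y h =>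
  sub_le_sub (Real.smoothTransition.monotone (by linarith))
    (Real.smoothTransition.monotone (by linarith))

theorem abs_oddStep_le (x : ℝ) : |oddStep x| ≤ 1 := by
  have h1 := Real.smoothTransition.nonneg (x - 1)
  have h2 := Real.smoothTransition.le_one (x - 1)
  have h3 := Real.smoothTransition.nonneg (-x - 1)
  have h4 := Real.smoothTransition.le_one (-x - 1)
  rw [abs_le, oddStep]
  constructor <;> linarith

theorem oddStep_eq_zero {x : ℝ} (hx : |x| ≤ 1) : oddStep x = 0 := by
  rw [abs_le] at hx
  rw [oddStep, Real.smoothTransition.zero_of_nonpos (by linarith),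
    Real.smoothTransition.zero_of_nonpos (by linarith), sub_zero]

theorem oddStep_sq {x : ℝ} (hx : 2 ≤ |x|) : oddStep x ^ 2 = 1 := by
  rcases le_abs.1 hx with h | h
  · rw [oddStep, Real.smoothTransition.one_of_one_le (by linarith),
      Real.smoothTransition.zero_of_nonpos (by linarith)]
    norm_num
  · rw [oddStep, Real.smoothTransition.one_of_one_le (x := -x - 1) (by linarith),
      Real.smoothTransition.zero_of_nonpos (by linarith)]
    norm_num

section cutoff

variable {E : Type*} [NormedAddCommGroup E] [NormedSpace ℝ E] {ι : Type*} [Fintype ι]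

/-- A smooth function that vanishes near the hyperplanes `ℓ i = 0`, and is equal to `1` outside a
neighbourhood of the hyperplanes that shrinks to them as `m` tends to infinity. -/
def cutoff (ℓ : ι → E →L[ℝ] ℝ) (m : ℕ) (q : E) : ℝ := ∏ i, oddStep ((m + 1) * ℓ i q) ^ 2

/-- The complement of the hyperplanes `ℓ i = 0`. -/
def offHyperplanes (ℓ : ι → E →L[ℝ] ℝ) : Set E := {q | ∀ i, ℓ i q ≠ 0}

variable (ℓ : ι → E →L[ℝ] ℝ) (m : ℕ)

theorem isOpen_offHyperplanes : IsOpen (offHyperplanes ℓ) := by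
  simp only [offHyperplanes, ofPred_forall]
  exact isOpen_iInter_of_finite fun i => isOpen_ne_fun (ℓ i).continuous continuous_const

theorem contDiff_cutoff : ContDiff ℝ ∞ (cutoff ℓ m) :=
  contDiff_prod fun i _ => (contDiff_oddStep.comp (contDiff_const.mul (ℓ i).contDiff)).pow 2

theorem cutoff_nonneg (q : E) : 0 ≤ cutoff ℓ m q := Finset.prod_nonneg fun _ _ => sq_nonneg _

theorem cutoff_le_one (q : E) : cutoff ℓ m q ≤ 1 :=
  Finset.prod_le_one (fun _ _ => sq_nonneg _) fun _ _ =>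
    (sq_le_one_iff_abs_le_one _).2 (abs_oddStep_le _)

theorem tendsto_cutoff {q : E} (hq : q ∈ offHyperplanes ℓ) :
    Tendsto (fun m => cutoff ℓ m q) atTop (𝓝 1) := by
  refine tendsto_const_nhds.congr' ?_
  have h1 : ∀ i, ∀ᶠ m : ℕ in atTop, oddStep ((m + 1) * ℓ i q) ^ 2 = 1 := fun i => by
    have h2 : Tendsto (fun m : ℕ => ((m : ℝ) + 1) * |ℓ i q|) atTop atTop :=
      (tendsto_atTop_add_const_right _ _ tendsto_natCast_atTop_atTop).atTop_mul_const
        (abs_pos.2 (hq i))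
    filter_upwards [h2.eventually_ge_atTop 2] with m hm
    refine oddStep_sq ?_
    rwa [abs_mul, abs_of_nonneg (by positivity : (0 : ℝ) ≤ m + 1)]
  filter_upwards [eventually_all.2 h1] with m hm
  simp [cutoff, hm]

theorem tsupport_cutoff_subset : tsupport (cutoff ℓ m) ⊆ offHyperplanes ℓ := by
  have h1 : IsClosed {q : E | ∀ i, 1 ≤ |((m : ℝ) + 1) * ℓ i q|} := by
    simp only [ofPred_forall]
    exact isClosed_iInter fun i => isClosed_le continuous_const (by fun_prop)
  refine (closure_minimal (fun q hq i => ?_) h1).trans fun q hq i h0 => ?_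
  · by_contra hi
    refine hq (Finset.prod_eq_zero (Finset.mem_univ i) ?_)
    rw [oddStep_eq_zero (not_le.1 hi).le]
    norm_num
  · have := hq i
    rw [h0] at this
    norm_num at this

theorem fderiv_cutoff_eq_zero (q : E) {u : E} (hu : ∀ i, ℓ i u = 0) :
    fderiv ℝ (cutoff ℓ m) q u = 0 := by
  have h1 : DifferentiableAt ℝ (cutoff ℓ m) q := (contDiff_cutoff ℓ m).differentiable (by simp) q
  rw [← h1.lineDeriv_eq_fderiv, lineDeriv]
  have : (fun t : ℝ => cutoff ℓ m (q + t • u)) = fun _ => cutoff ℓ m q := by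
    ext t
    simp [cutoff, hu]
  rw [this, deriv_const]

/-- The derivative of the cutoff function is bounded by derivatives of bounded functions. -/
theorem abs_fderiv_cutoff_le (q u : E) {w : ι → E} (hw : ∀ i, ℓ i (w i) = 1) :
    |fderiv ℝ (cutoff ℓ m) q u| ≤
      ∑ i, 2 * |ℓ i u| * fderiv ℝ (fun q => oddStep ((m + 1) * ℓ i q)) q (w i) := by
  classical
  have hd : ∀ i, HasFDerivAt (fun q => oddStep ((m + 1) * ℓ i q))
      (deriv oddStep ((m + 1) * ℓ i q) • (((m : ℝ) + 1) • ℓ i)) q := fun i =>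
    ((contDiff_oddStep.differentiable (by simp) _).hasDerivAt.comp_hasFDerivAt q
      ((ℓ i).hasFDerivAt.const_mul _))
  have h1 : fderiv ℝ (cutoff ℓ m) q = _ :=
    (HasFDerivAt.finsetProd fun i (_ : i ∈ Finset.univ) => (hd i).pow 2).fderiv
  rw [h1, sum_apply]
  refine (Finset.abs_sum_le_sum_abs _ _).trans (Finset.sum_le_sum fun i _ => ?_)
  have hstep : 0 ≤ deriv oddStep ((m + 1) * ℓ i q) := monotone_oddStep.deriv_nonneg
  have hprod : |∏ j ∈ Finset.univ.erase i, oddStep ((m + 1) * ℓ j q) ^ 2| ≤ 1 := by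
    rw [abs_of_nonneg (Finset.prod_nonneg fun _ _ => sq_nonneg _)]
    exact Finset.prod_le_one (fun _ _ => sq_nonneg _) fun _ _ =>
      (sq_le_one_iff_abs_le_one _).2 (abs_oddStep_le _)
  rw [(hd i).fderiv]
  simp only [smul_apply, smul_eq_mul, hw, mul_one, abs_mul, Nat.add_one_sub_one, pow_one,
    nsmul_eq_mul, Nat.cast_ofNat, abs_of_nonneg hstep, abs_two,
    abs_of_nonneg (by positivity : (0 : ℝ) ≤ (m : ℝ) + 1)]
  have h2 := abs_oddStep_le ((m + 1) * ℓ i q)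
  calc _ ≤ 1 * (2 * 1 * (deriv oddStep ((m + 1) * ℓ i q) * ((m + 1) * |ℓ i u|))) := by
        gcongr
    _ = _ := by ring

end cutoff

/-- Test functions on `R`. -/
structure IsTest {E : Type*} [NormedAddCommGroup E] [NormedSpace ℝ E] (R : Set E) (φ : E → ℝ) :
    Prop where
  smooth : ContDiff ℝ ∞ φ
  compact : HasCompactSupport φ
  supp : tsupport φ ⊆ R

namespace IsTest

variable {E : Type*} [NormedAddCommGroup E] [NormedSpace ℝ E] {R R' : Set E} {φ : E → ℝ}

theorem fderiv (h : IsTest R φ) (u : E) : IsTest R (fun x => fderiv ℝ φ x u) where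
  smooth := (h.smooth.fderiv_right (by simp)).clm_apply contDiff_const
  compact := h.compact.fderiv_apply (𝕜 := ℝ) u
  supp := by
    refine (closure_mono fun x hx => ?_).trans ((tsupport_fderiv_subset ℝ (f := φ)).trans h.supp)
    intro h0
    exact hx (by simp [h0])

theorem mul (h : IsTest R φ) {k : E → ℝ} (hk : ContDiff ℝ ∞ k) : IsTest R (fun x => φ x * k x) where
  smooth := h.smooth.mul hk
  compact := h.compact.mul_right
  supp := (tsupport_mul_subset_left (f := φ) (g := k)).trans h.supp

theorem mul_inter (h : IsTest R φ) {k : E → ℝ} (hk : ContDiff ℝ ∞ k) (hs : tsupport k ⊆ R') :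
    IsTest (R ∩ R') (fun x => φ x * k x) where
  smooth := h.smooth.mul hk
  compact := h.compact.mul_right
  supp := subset_inter ((tsupport_mul_subset_left (f := φ) (g := k)).trans h.supp)
    ((tsupport_mul_subset_right (f := φ) (g := k)).trans hs)

theorem mono (h : IsTest R φ) (hR : R ⊆ R') : IsTest R' φ := ⟨h.smooth, h.compact, h.supp.trans hR⟩

theorem eq_zero (h : IsTest R φ) {x : E} (hx : x ∉ R) : φ x = 0 := by
  by_contra h0
  exact hx (h.supp (subset_tsupport _ h0))

end IsTest

section integrals

set_option linter.unusedSectionVars false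

variable {E : Type*} [NormedAddCommGroup E] [NormedSpace ℝ E] [FiniteDimensional ℝ E]
  [MeasurableSpace E] [BorelSpace E] {μ : Measure E} [μ.IsAddHaarMeasure]
  {ι : Type*} [Fintype ι] {ℓ : ι → E →L[ℝ] ℝ} {R Ω : Set E} {F φ : E → ℝ}

theorem ae_offHyperplanes (hℓ : ∀ i, ℓ i ≠ 0) : ∀ᵐ q ∂μ, q ∈ offHyperplanes ℓ := by
  refine ae_all_iff.2 fun i => ?_
  have hne : LinearMap.ker (ℓ i : E →ₗ[ℝ] ℝ) ≠ ⊤ := fun h => hℓ i (by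
    ext x
    have : x ∈ LinearMap.ker (ℓ i : E →ₗ[ℝ] ℝ) := h ▸ Submodule.mem_top
    simpa using this)
  filter_upwards [measure_eq_zero_iff_ae_notMem.1 (Measure.addHaar_submodule μ _ hne)] with q hq h0
  exact hq h0

theorem integrable_mul_test (hΩ : IsOpen Ω) (hF : ContinuousOn F Ω) (hφ : IsTest Ω φ) :
    Integrable (fun x => F x * φ x) μ := by
  have hs : tsupport (fun x => F x * φ x) ⊆ tsupport φ := tsupport_mul_subset_right (f := F)
  refine Continuous.integrable_of_hasCompactSupport (continuous_of_tsupport fun x hx => ?_)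
    hφ.compact.mul_left
  exact (hF.continuousAt (hΩ.mem_nhds (hφ.supp (hs hx)))).mul hφ.smooth.continuous.continuousAt

theorem ContDiffOn.continuousOn_fderiv_apply (hF : ContDiffOn ℝ ∞ F Ω) (hΩ : IsOpen Ω) (u : E) :
    ContinuousOn (fun x => fderiv ℝ F x u) Ω :=
  (hF.continuousOn_fderiv_of_isOpen hΩ (by simp)).clm_apply continuousOn_const

/-- Integration by parts against a test function. -/
theorem integral_mul_fderiv_test (hΩ : IsOpen Ω) (hF : ContDiffOn ℝ ∞ F Ω) (hφ : IsTest Ω φ)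
    (u : E) : ∫ x, F x * fderiv ℝ φ x u ∂μ = -∫ x, fderiv ℝ F x u * φ x ∂μ :=
  integral_mul_fderiv_eq_neg_fderiv_mul_of_integrable
    (integrable_mul_test hΩ (hF.continuousOn_fderiv_apply hΩ u) hφ)
    (integrable_mul_test hΩ hF.continuousOn (hφ.fderiv u))
    (integrable_mul_test hΩ hF.continuousOn hφ)
    (fun x hx => (hF.contDiffAt (hΩ.mem_nhds (hφ.supp hx))).differentiableAt (by simp))
    (fun x _ => hφ.smooth.differentiable (by simp) x)

theorem tendsto_integral_mul_cutoff (hℓ : ∀ i, ℓ i ≠ 0) (hF : Integrable F μ) :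
    Tendsto (fun m => ∫ x, F x * cutoff ℓ m x ∂μ) atTop (𝓝 (∫ x, F x ∂μ)) := by
  refine tendsto_integral_of_dominated_convergence (fun x => ‖F x‖)
    (fun m => hF.1.mul (contDiff_cutoff ℓ m).continuous.aestronglyMeasurable) hF.norm
    (fun m => Eventually.of_forall fun x => ?_) ?_
  · rw [norm_mul, Real.norm_of_nonneg (cutoff_nonneg ℓ m x)]
    exact mul_le_of_le_one_right (norm_nonneg _) (cutoff_le_one ℓ m x)
  · filter_upwards [ae_offHyperplanes (μ := μ) hℓ] with x hx
    simpa using (tendsto_cutoff ℓ hx).const_mul (F x)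

theorem fderiv_mul_cutoff (hφ : ContDiff ℝ ∞ φ) (m : ℕ) (x u : E) :
    fderiv ℝ (fun x => φ x * cutoff ℓ m x) x u =
      fderiv ℝ φ x u * cutoff ℓ m x + φ x * fderiv ℝ (cutoff ℓ m) x u := by
  have := fderiv_mul (hφ.differentiable (by simp) x)
    ((contDiff_cutoff ℓ m).differentiable (by simp) x)
  have h2 := congrArg (fun L => L u) this
  refine h2.trans ?_
  simp
  ring

theorem integral_mul_fderiv_cutoff (hR : IsOpen R) (hF : ContDiffOn ℝ ∞ F (R ∩ offHyperplanes ℓ))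
    (hφ : IsTest R φ) {u : E} (hu : ∀ i, ℓ i u = 0) (m : ℕ) :
    ∫ x, F x * fderiv ℝ φ x u * cutoff ℓ m x ∂μ = -∫ x, fderiv ℝ F x u * φ x * cutoff ℓ m x ∂μ := by
  have h := integral_mul_fderiv_test (μ := μ) (hR.inter (isOpen_offHyperplanes ℓ)) hF
    (hφ.mul_inter (contDiff_cutoff ℓ m) (tsupport_cutoff_subset ℓ m)) u
  simp only [fderiv_mul_cutoff hφ.smooth, fderiv_cutoff_eq_zero ℓ m _ hu, mul_zero, add_zero,
    ← mul_assoc] at h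
  exact h

/-- Integration by parts in a direction parallel to the hyperplanes `ℓ i = 0`, for a function that
need not extend across the hyperplanes. -/
theorem integral_mul_fderiv_of_parallel (hℓ : ∀ i, ℓ i ≠ 0) (hR : IsOpen R)
    (hF : ContDiffOn ℝ ∞ F (R ∩ offHyperplanes ℓ)) (hφ : IsTest R φ) {u : E}
    (hu : ∀ i, ℓ i u = 0) (h1 : Integrable (fun x => F x * fderiv ℝ φ x u) μ)
    (h2 : Integrable (fun x => fderiv ℝ F x u * φ x) μ) :
    ∫ x, F x * fderiv ℝ φ x u ∂μ = -∫ x, fderiv ℝ F x u * φ x ∂μ := by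
  refine tendsto_nhds_unique (tendsto_integral_mul_cutoff hℓ h1) ?_
  simp only [integral_mul_fderiv_cutoff hR hF hφ hu]
  exact (tendsto_integral_mul_cutoff hℓ h2).neg

/-- Nonnegative derivatives of locally bounded functions are locally integrable. -/
theorem integrable_fderiv_of_parallel (hℓ : ∀ i, ℓ i ≠ 0) (hR : IsOpen R)
    (hF : ContDiffOn ℝ ∞ F (R ∩ offHyperplanes ℓ)) (hφ : IsTest R φ) (hφ0 : ∀ x, 0 ≤ φ x) {u : E}
    (hu : ∀ i, ℓ i u = 0) (h1 : Integrable (fun x => F x * fderiv ℝ φ x u) μ)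
    (hpos : ∀ x ∈ R ∩ offHyperplanes ℓ, 0 ≤ fderiv ℝ F x u) :
    Integrable (fun x => fderiv ℝ F x u * φ x) μ := by
  have hint : ∀ m, Integrable (fun x => fderiv ℝ F x u * φ x * cutoff ℓ m x) μ := fun m => by
    have := integrable_mul_test (μ := μ) (hR.inter (isOpen_offHyperplanes ℓ))
      (hF.continuousOn_fderiv_apply (hR.inter (isOpen_offHyperplanes ℓ)) u)
      (hφ.mul_inter (contDiff_cutoff ℓ m) (tsupport_cutoff_subset ℓ m))
    simpa only [mul_assoc] using this
  have hnn : ∀ m x, 0 ≤ fderiv ℝ F x u * φ x * cutoff ℓ m x := fun m x => by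
    by_cases hx : x ∈ R ∩ offHyperplanes ℓ
    · exact mul_nonneg (mul_nonneg (hpos x hx) (hφ0 x)) (cutoff_nonneg ℓ m x)
    · have := (hφ.mul_inter (contDiff_cutoff ℓ m) (tsupport_cutoff_subset ℓ m)).eq_zero hx
      rw [mul_assoc, this, mul_zero]
  have hlim : ∀ᵐ x ∂μ, Tendsto (fun m => fderiv ℝ F x u * φ x * cutoff ℓ m x) atTop
      (𝓝 (fderiv ℝ F x u * φ x)) := by
    filter_upwards [ae_offHyperplanes (μ := μ) hℓ] with x hx
    simpa using (tendsto_cutoff ℓ hx).const_mul (fderiv ℝ F x u * φ x)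
  refine ⟨aestronglyMeasurable_of_tendsto_ae _ (fun m => (hint m).1) hlim, ?_⟩
  have hbound : ∀ m, ∫⁻ x, ‖fderiv ℝ F x u * φ x * cutoff ℓ m x‖ₑ ∂μ ≤
      ENNReal.ofReal (∫ x, ‖F x * fderiv ℝ φ x u‖ ∂μ) := fun m => by
    rw [← ofReal_integral_norm_eq_lintegral_enorm (hint m)]
    refine ENNReal.ofReal_le_ofReal ?_
    simp only [Real.norm_of_nonneg (hnn m _)]
    have := integral_mul_fderiv_cutoff (μ := μ) hR hF hφ hu m
    rw [← neg_eq_iff_eq_neg] at this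
    rw [← this]
    refine (neg_le_abs _).trans ((abs_integral_le_integral_abs).trans
      (integral_mono_of_nonneg (Eventually.of_forall fun x => abs_nonneg _) h1.norm
        (Eventually.of_forall fun x => ?_)))
    simp only [abs_mul _ (cutoff ℓ m x), abs_of_nonneg (cutoff_nonneg ℓ m x)]
    exact mul_le_of_le_one_right (abs_nonneg _) (cutoff_le_one ℓ m x)
  -- Fatou's lemma, as the cutoffs tend to one off the hyperplanes.
  have h2 : ∫⁻ x, ‖fderiv ℝ F x u * φ x‖ₑ ∂μ ≤
      liminf (fun m => ∫⁻ x, ‖fderiv ℝ F x u * φ x * cutoff ℓ m x‖ₑ ∂μ) atTop := by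
    refine le_trans (le_of_eq (lintegral_congr_ae ?_))
      (lintegral_liminf_le' fun m => (hint m).1.enorm)
    filter_upwards [hlim] with x hx using hx.enorm.liminf_eq.symm
  refine (h2.trans (liminf_le_of_frequently_le' (Frequently.of_forall hbound))).trans_lt
    ENNReal.ofReal_lt_top

/-- The function `F` is locally bounded on `R`, disregarding the points outside `Ω`. -/
def LocallyBoundedOn (F : E → ℝ) (R Ω : Set E) : Prop :=
  ∀ q ∈ R, ∃ C, ∀ᶠ x in 𝓝 q, x ∈ Ω → |F x| ≤ C

theorem LocallyBoundedOn.exists_bound (h : LocallyBoundedOn F R Ω) {s : Set E} (hs : IsCompact s)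
    (hsR : s ⊆ R) : ∃ C, 0 ≤ C ∧ ∀ x ∈ s, x ∈ Ω → |F x| ≤ C := by
  refine hs.induction_on (p := fun s => ∃ C, 0 ≤ C ∧ ∀ x ∈ s, x ∈ Ω → |F x| ≤ C)
    ⟨0, le_rfl, by simp⟩ ?_ ?_ ?_
  · rintro s t hst ⟨C, h0, hC⟩
    exact ⟨C, h0, fun x hx => hC x (hst hx)⟩
  · rintro s t ⟨C, h0, hC⟩ ⟨C', h0', hC'⟩
    refine ⟨max C C', le_max_of_le_left h0, ?_⟩
    rintro x (hx | hx) hxΩ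
    · exact (hC x hx hxΩ).trans (le_max_left _ _)
    · exact (hC' x hx hxΩ).trans (le_max_right _ _)
  · intro x hx
    obtain ⟨C, hC⟩ := h x (hsR hx)
    exact ⟨_, mem_nhdsWithin_of_mem_nhds hC, max C 0, le_max_right _ _, fun y hy hyΩ =>
      (hy hyΩ).trans (le_max_left _ _)⟩

theorem LocallyBoundedOn.integrable_mul_test (h : LocallyBoundedOn F R Ω) (hΩ : IsOpen Ω)
    (hae : ∀ᵐ x ∂μ, x ∈ R → x ∈ Ω) (hF : ContinuousOn F Ω) (hφ : IsTest R φ) :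
    Integrable (fun x => F x * φ x) μ := by
  obtain ⟨C, hC0, hC⟩ := h.exists_bound hφ.compact hφ.supp
  have hφi : Integrable φ μ := hφ.smooth.continuous.integrable_of_hasCompactSupport hφ.compact
  have heq : (fun x => F x * φ x) =ᵐ[μ] Ω.indicator (fun x => F x * φ x) := by
    filter_upwards [hae] with x hx
    by_cases hxΩ : x ∈ Ω
    · rw [indicator_of_mem hxΩ]
    · rw [indicator_of_notMem hxΩ, hφ.eq_zero fun hR => hxΩ (hx hR), mul_zero]
  refine Integrable.mono' (hφi.norm.const_mul C) ?_ ?_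
  · refine AEStronglyMeasurable.congr ?_ heq.symm
    rw [aestronglyMeasurable_indicator_iff hΩ.measurableSet]
    exact (hF.mul hφ.smooth.continuous.continuousOn).aestronglyMeasurable hΩ.measurableSet
  · filter_upwards [hae] with x hx
    by_cases hxs : x ∈ tsupport φ
    · rw [norm_mul]
      exact mul_le_mul_of_nonneg_right (hC x hxs (hx (hφ.supp hxs))) (norm_nonneg _)
    · rw [image_eq_zero_of_notMem_tsupport hxs]
      simp

/-- The derivatives of the cutoff functions are concentrated near the hyperplanes, but they are
bounded in `L¹`. Hence they tend to zero when they are cut off along another family of hyperplanes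
in general position. -/
theorem tendsto_integral_fderiv_cutoff {κ : Type*} [Fintype κ] {ℓ' : κ → E →L[ℝ] ℝ}
    (hℓ' : ∀ i, ℓ' i ≠ 0) {w : ι → E} (hw : ∀ i, ℓ i (w i) = 1) (hw' : ∀ i j, ℓ' j (w i) = 0)
    {ζ : E → ℝ} (hζ : IsTest univ ζ) (hζ0 : ∀ x, 0 ≤ ζ x) (u : E) :
    Tendsto (fun m => ∫ x, ζ x * |fderiv ℝ (cutoff ℓ m) x u| * (1 - cutoff ℓ' m x) ∂μ) atTop
      (𝓝 0) := by
  have hstep : ∀ i (m : ℕ), ContDiff ℝ ∞ fun q => oddStep ((m + 1) * ℓ i q) := fun i m =>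
    contDiff_oddStep.comp (contDiff_const.mul (ℓ i).contDiff)
  have hk : ∀ m, ContDiff ℝ ∞ fun q => 1 - cutoff ℓ' m q := fun m =>
    contDiff_const.sub (contDiff_cutoff ℓ' m)
  have hk0 : ∀ m x, 0 ≤ 1 - cutoff ℓ' m x := fun m x => sub_nonneg.2 (cutoff_le_one ℓ' m x)
  have hk1 : ∀ m x, 1 - cutoff ℓ' m x ≤ 1 := fun m x => sub_le_self _ (cutoff_nonneg ℓ' m x)
  have hder : ∀ i m x, fderiv ℝ (fun q => ζ q * (1 - cutoff ℓ' m q)) x (w i) =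
      fderiv ℝ ζ x (w i) * (1 - cutoff ℓ' m x) := fun i m x => by
    have h1 : HasFDerivAt (fun q => 1 - cutoff ℓ' m q) (-fderiv ℝ (cutoff ℓ' m) x) x :=
      ((contDiff_cutoff ℓ' m).differentiable (by simp) x).hasFDerivAt.const_sub 1
    have h2 := ((hζ.smooth.differentiable (by simp) x).hasFDerivAt.mul h1).fderiv
    refine (congrArg (fun L => L (w i)) h2).trans ?_
    simp [fderiv_cutoff_eq_zero ℓ' m x (hw' i), mul_comm]
  -- The derivative of the step function is integrated by parts; what remains is bounded and
  -- supported near the hyperplanes `ℓ'`.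
  have hibp : ∀ i m, ∫ x, ζ x * (1 - cutoff ℓ' m x) *
      fderiv ℝ (fun q => oddStep ((m + 1) * ℓ i q)) x (w i) ∂μ =
      -∫ x, fderiv ℝ ζ x (w i) * (1 - cutoff ℓ' m x) * oddStep ((m + 1) * ℓ i x) ∂μ := fun i m => by
    have h1 := integral_mul_fderiv_test (μ := μ) isOpen_univ (hstep i m).contDiffOn
      (hζ.mul (hk m)) (w i)
    simp only [hder] at h1
    rw [eq_comm, neg_eq_iff_eq_neg] at h1
    simp only [mul_comm _ (fderiv ℝ (fun q => oddStep ((m + 1) * ℓ i q)) _ (w i)),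
      mul_comm _ (oddStep _), h1]
  have hlim : ∀ i, Tendsto (fun m : ℕ => ∫ x, fderiv ℝ ζ x (w i) * (1 - cutoff ℓ' m x) *
      oddStep ((m + 1) * ℓ i x) ∂μ) atTop (𝓝 0) := fun i => by
    have hζi : Integrable (fun x => fderiv ℝ ζ x (w i)) μ :=
      (hζ.fderiv (w i)).smooth.continuous.integrable_of_hasCompactSupport (hζ.fderiv (w i)).compact
    rw [show (0 : ℝ) = ∫ x, (0 : ℝ) ∂μ by simp]
    refine tendsto_integral_of_dominated_convergence (fun x => ‖fderiv ℝ ζ x (w i)‖)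
      (fun m => ((hζ.fderiv (w i)).smooth.continuous.mul (hk m).continuous).mul
        (hstep i m).continuous |>.aestronglyMeasurable) hζi.norm
      (fun m => Eventually.of_forall fun x => ?_) ?_
    · rw [norm_mul, norm_mul, mul_assoc]
      refine mul_le_of_le_one_right (norm_nonneg _) ?_
      rw [Real.norm_of_nonneg (hk0 m x)]
      exact mul_le_one₀ (hk1 m x) (norm_nonneg _) (abs_oddStep_le _)
    · filter_upwards [ae_offHyperplanes (μ := μ) hℓ'] with x hx
      refine squeeze_zero_norm (a := fun m => ‖fderiv ℝ ζ x (w i)‖ * (1 - cutoff ℓ' m x))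
        (fun m => ?_) ?_
      · rw [norm_mul, norm_mul, Real.norm_of_nonneg (hk0 m x)]
        exact mul_le_of_le_one_right (mul_nonneg (norm_nonneg _) (hk0 m x)) (abs_oddStep_le _)
      · simpa using ((tendsto_cutoff ℓ' hx).const_sub 1).const_mul ‖fderiv ℝ ζ x (w i)‖
  have hsum : Tendsto (fun m : ℕ => ∑ i, 2 * |ℓ i u| * -∫ x, fderiv ℝ ζ x (w i) *
      (1 - cutoff ℓ' m x) * oddStep ((m + 1) * ℓ i x) ∂μ) atTop (𝓝 0) := by
    have := tendsto_finsetSum (Finset.univ : Finset ι) fun i _ =>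
      ((hlim i).neg.const_mul (2 * |ℓ i u|))
    simpa using this
  refine squeeze_zero (fun m => integral_nonneg fun x =>
    mul_nonneg (mul_nonneg (hζ0 x) (abs_nonneg _)) (hk0 m x)) (fun m => ?_) hsum
  have hint : ∀ i, Integrable (fun x => ζ x * (1 - cutoff ℓ' m x) *
      fderiv ℝ (fun q => oddStep ((m + 1) * ℓ i q)) x (w i)) μ := fun i => by
    have hc : Continuous fun x => fderiv ℝ (fun q => oddStep ((m + 1) * ℓ i q)) x (w i) :=
      ((hstep i m).continuous_fderiv (by simp)).clm_apply continuous_const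
    exact ((hζ.mul (hk m)).smooth.continuous.mul hc).integrable_of_hasCompactSupport
      (hζ.mul (hk m)).compact.mul_right
  simp only [← hibp]
  simp only [← integral_const_mul]
  rw [← integral_finsetSum _ fun i _ => (hint i).const_mul _]
  have hcont : Continuous fun x => fderiv ℝ (cutoff ℓ m) x u :=
    ((contDiff_cutoff ℓ m).continuous_fderiv (by simp)).clm_apply continuous_const
  refine integral_mono ?_ (integrable_finsetSum _ fun i _ => (hint i).const_mul _) fun x => ?_
  · refine Continuous.integrable_of_hasCompactSupport
      ((hζ.smooth.continuous.mul hcont.abs).mul (hk m).continuous) ?_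
    exact hζ.compact.mul_right.mul_right
  · refine le_of_eq_of_le (mul_right_comm _ _ _) ?_
    refine (mul_le_mul_of_nonneg_left (abs_fderiv_cutoff_le ℓ m x u hw)
      (mul_nonneg (hζ0 x) (hk0 m x))).trans_eq ?_
    rw [Finset.mul_sum]
    exact Finset.sum_congr rfl fun i _ => by ring

end integrals

/-! ### The distributional equation for a pair of one-forms -/

section pair

set_option linter.unusedSectionVars false

variable {E : Type*} [NormedAddCommGroup E] [NormedSpace ℝ E]

/-- The coefficients, in the directions `u` and `v`, of two closed one-forms: the coefficients `Ys`
and `Yt` of the first one are smooth off the hyperplanes `ℓ'`, which are parallel to `u`, and the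
coefficients `Zs` and `Zt` of the second one are smooth off the hyperplanes `ℓ`, which are parallel
to `v`. The function `b` is the mixed derivative of the difference of the two forms. -/
structure IsMixedPair {ι κ : Type*} [Fintype ι] [Fintype κ] (R : Set E) (ℓ : ι → E →L[ℝ] ℝ)
    (ℓ' : κ → E →L[ℝ] ℝ) (u v : E) (Ys Yt Zs Zt b : E → ℝ) : Prop where
  dir_u : ∀ j, ℓ' j u = 0
  dir_v : ∀ i, ℓ i v = 0
  smooth_Ys : ContDiffOn ℝ ∞ Ys (R ∩ offHyperplanes ℓ')
  smooth_Yt : ContDiffOn ℝ ∞ Yt (R ∩ offHyperplanes ℓ')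
  smooth_Zs : ContDiffOn ℝ ∞ Zs (R ∩ offHyperplanes ℓ)
  smooth_Zt : ContDiffOn ℝ ∞ Zt (R ∩ offHyperplanes ℓ)
  closed_Y : ∀ x ∈ R ∩ offHyperplanes ℓ', fderiv ℝ Ys x v = fderiv ℝ Yt x u
  closed_Z : ∀ x ∈ R ∩ offHyperplanes ℓ, fderiv ℝ Zs x v = fderiv ℝ Zt x u
  mixed : ∀ x ∈ R ∩ (offHyperplanes ℓ ∩ offHyperplanes ℓ'), fderiv ℝ Zt x u - fderiv ℝ Yt x u = b x
  bdd_Ys : LocallyBoundedOn Ys R (R ∩ (offHyperplanes ℓ ∩ offHyperplanes ℓ'))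
  bdd_Yt : LocallyBoundedOn Yt R (R ∩ (offHyperplanes ℓ ∩ offHyperplanes ℓ'))
  bdd_Zs : LocallyBoundedOn Zs R (R ∩ (offHyperplanes ℓ ∩ offHyperplanes ℓ'))
  bdd_Zt : LocallyBoundedOn Zt R (R ∩ (offHyperplanes ℓ ∩ offHyperplanes ℓ'))
  bdd_b : LocallyBoundedOn b R (R ∩ (offHyperplanes ℓ ∩ offHyperplanes ℓ'))

namespace IsMixedPair

variable [FiniteDimensional ℝ E]
  [MeasurableSpace E] [BorelSpace E] {μ : Measure E} [μ.IsAddHaarMeasure]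
  {ι κ : Type*} [Fintype ι] [Fintype κ] {ℓ : ι → E →L[ℝ] ℝ} {ℓ' : κ → E →L[ℝ] ℝ} {R : Set E}
  {u v : E} {Ys Yt Zs Zt b χ : E → ℝ} {w : ι → E} {w' : κ → E}

/-- The integrand of the weak form of the equation `∂_v Zs - ∂_u Yt = b`. -/
def integrand (u v : E) (Yt Zs b χ : E → ℝ) (x : E) : ℝ :=
  Zs x * fderiv ℝ χ x v - Yt x * fderiv ℝ χ x u + b x * χ x

section basic

variable (H : IsMixedPair R ℓ ℓ' u v Ys Yt Zs Zt b) (hR : IsOpen R)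
include H hR

theorem isOpen_off : IsOpen (R ∩ (offHyperplanes ℓ ∩ offHyperplanes ℓ')) :=
  hR.inter ((isOpen_offHyperplanes ℓ).inter (isOpen_offHyperplanes ℓ'))

theorem continuousOn_b : ContinuousOn b (R ∩ (offHyperplanes ℓ ∩ offHyperplanes ℓ')) := by
  have h1 := (H.smooth_Zt.mono (inter_subset_inter_right R inter_subset_left)).sub
    (H.smooth_Yt.mono (inter_subset_inter_right R inter_subset_right))
  have h2 := (h1.continuousOn_fderiv_apply (H.isOpen_off hR) u)
  refine h2.congr fun x hx => ?_
  have hZ := ((H.smooth_Zt.mono (inter_subset_inter_right R inter_subset_left)).contDiffAt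
    ((H.isOpen_off hR).mem_nhds hx)).differentiableAt (by simp)
  have hY := ((H.smooth_Yt.mono (inter_subset_inter_right R inter_subset_right)).contDiffAt
    ((H.isOpen_off hR).mem_nhds hx)).differentiableAt (by simp)
  rw [← H.mixed x hx]
  exact (congrArg (fun L => L u) (fderiv_fun_sub hZ hY)).symm

end basic

variable (H : IsMixedPair R ℓ ℓ' u v Ys Yt Zs Zt b) (hR : IsOpen R)
  (hw : ∀ i, ℓ i (w i) = 1) (hw0 : ∀ i j, ℓ' j (w i) = 0)
  (hw' : ∀ i, ℓ' i (w' i) = 1) (hw0' : ∀ i j, ℓ j (w' i) = 0)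

theorem ne_zero_of_apply {ι : Type*} {ℓ : ι → E →L[ℝ] ℝ} {w : ι → E} (hw : ∀ i, ℓ i (w i) = 1)
    (i : ι) : ℓ i ≠ 0 := fun h => by
  have := hw i
  rw [h] at this
  simp at this

include hw hw'

theorem ae_off : ∀ᵐ x ∂μ, x ∈ offHyperplanes ℓ ∩ offHyperplanes ℓ' :=
  (ae_offHyperplanes (ne_zero_of_apply hw)).and (ae_offHyperplanes (ne_zero_of_apply hw'))

include H hR

theorem integrable_Ys {φ : E → ℝ} (hφ : IsTest R φ) : Integrable (fun x => Ys x * φ x) μ :=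
  H.bdd_Ys.integrable_mul_test (H.isOpen_off hR) ((ae_off hw hw').mono fun _ h h' => ⟨h', h⟩)
    (H.smooth_Ys.mono (inter_subset_inter_right R inter_subset_right)).continuousOn hφ

theorem integrable_Yt {φ : E → ℝ} (hφ : IsTest R φ) : Integrable (fun x => Yt x * φ x) μ :=
  H.bdd_Yt.integrable_mul_test (H.isOpen_off hR) ((ae_off hw hw').mono fun _ h h' => ⟨h', h⟩)
    (H.smooth_Yt.mono (inter_subset_inter_right R inter_subset_right)).continuousOn hφ

theorem integrable_Zs {φ : E → ℝ} (hφ : IsTest R φ) : Integrable (fun x => Zs x * φ x) μ :=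
  H.bdd_Zs.integrable_mul_test (H.isOpen_off hR) ((ae_off hw hw').mono fun _ h h' => ⟨h', h⟩)
    (H.smooth_Zs.mono (inter_subset_inter_right R inter_subset_left)).continuousOn hφ

theorem integrable_Zt {φ : E → ℝ} (hφ : IsTest R φ) : Integrable (fun x => Zt x * φ x) μ :=
  H.bdd_Zt.integrable_mul_test (H.isOpen_off hR) ((ae_off hw hw').mono fun _ h h' => ⟨h', h⟩)
    (H.smooth_Zt.mono (inter_subset_inter_right R inter_subset_left)).continuousOn hφ

theorem integrable_b {φ : E → ℝ} (hφ : IsTest R φ) : Integrable (fun x => b x * φ x) μ :=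
  H.bdd_b.integrable_mul_test (H.isOpen_off hR) ((ae_off hw hw').mono fun _ h h' => ⟨h', h⟩)
    (H.continuousOn_b hR) hφ

theorem integrable_integrand (hχ : IsTest R χ) : Integrable (integrand u v Yt Zs b χ) μ :=
  ((H.integrable_Zs hR hw hw' (hχ.fderiv v)).sub (H.integrable_Yt hR hw hw' (hχ.fderiv u))).add
    (H.integrable_b hR hw hw' hχ)

/-- Near points off the hyperplanes `ℓ`, the form `Z` is smooth and closed, and the form `Y` differs
from it by a bounded function. -/
theorem integral_integrand_of_off_left (hχ : IsTest (R ∩ offHyperplanes ℓ) χ) :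
    ∫ x, integrand u v Yt Zs b χ x ∂μ = 0 := by
  have hχR := hχ.mono inter_subset_left
  have hΩ : IsOpen (R ∩ offHyperplanes ℓ) := hR.inter (isOpen_offHyperplanes ℓ)
  have e1 := integral_mul_fderiv_test (μ := μ) hΩ H.smooth_Zs hχ v
  have e2 := integral_mul_fderiv_test (μ := μ) hΩ H.smooth_Zt hχ u
  have e3 : ∫ x, fderiv ℝ Zs x v * χ x ∂μ = ∫ x, fderiv ℝ Zt x u * χ x ∂μ := by
    refine integral_congr_ae (Eventually.of_forall fun x => ?_)
    by_cases hx : x ∈ R ∩ offHyperplanes ℓ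
    · simp only [H.closed_Z x hx]
    · simp only [hχ.eq_zero hx, mul_zero]
  have hae : (fun x => fderiv ℝ (fun x => Zt x - Yt x) x u * χ x) =ᵐ[μ] fun x => b x * χ x := by
    filter_upwards [ae_off (μ := μ) hw hw'] with x hx
    by_cases hxR : x ∈ R
    · have hZ := (H.smooth_Zt.contDiffAt (hΩ.mem_nhds ⟨hxR, hx.1⟩)).differentiableAt (by simp)
      have hY := (H.smooth_Yt.contDiffAt ((hR.inter (isOpen_offHyperplanes ℓ')).mem_nhds
        ⟨hxR, hx.2⟩)).differentiableAt (by simp)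
      rw [fderiv_fun_sub hZ hY, sub_apply, H.mixed x ⟨hxR, hx⟩]
    · rw [hχR.eq_zero hxR, mul_zero, mul_zero]
  have i1 := H.integrable_Zs (μ := μ) hR hw hw' (hχR.fderiv v)
  have i2 := H.integrable_Zt (μ := μ) hR hw hw' (hχR.fderiv u)
  have i3 := H.integrable_Yt (μ := μ) hR hw hw' (hχR.fderiv u)
  have i4 := H.integrable_b (μ := μ) hR hw hw' hχR
  have i5 : Integrable (fun x => (Zt x - Yt x) * fderiv ℝ χ x u) μ := by
    exact (i2.sub i3).congr (Eventually.of_forall fun x => (sub_mul _ _ _).symm)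
  have e4 := integral_mul_fderiv_of_parallel (μ := μ) (F := fun x => Zt x - Yt x)
    (ne_zero_of_apply hw') hΩ ((H.smooth_Zt.mono inter_subset_left).sub
      (H.smooth_Yt.mono (inter_subset_inter_left _ inter_subset_left))) hχ H.dir_u i5
      (i4.congr hae.symm)
  rw [integral_congr_ae hae] at e4
  simp only [sub_mul] at e4
  rw [integral_sub i2 i3] at e4
  have e5 : ∫ x, integrand u v Yt Zs b χ x ∂μ = _ := integral_add (i1.sub i3) i4
  have e6 := integral_sub i1 i3
  rw [e5, e6]
  linarith

/-- The counterpart of `integral_integrand_of_off_left` for test functions supported off the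
hyperplanes `ℓ'`: there the first form is smooth and closed. -/
theorem integral_integrand_of_off_right (hχ : IsTest (R ∩ offHyperplanes ℓ') χ) :
    ∫ x, integrand u v Yt Zs b χ x ∂μ = 0 := by
  have hχR := hχ.mono inter_subset_left
  have hΩ : IsOpen (R ∩ offHyperplanes ℓ') := hR.inter (isOpen_offHyperplanes ℓ')
  have e1 := integral_mul_fderiv_test (μ := μ) hΩ H.smooth_Ys hχ v
  have e2 := integral_mul_fderiv_test (μ := μ) hΩ H.smooth_Yt hχ u
  have e3 : ∫ x, fderiv ℝ Ys x v * χ x ∂μ = ∫ x, fderiv ℝ Yt x u * χ x ∂μ := by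
    refine integral_congr_ae (Eventually.of_forall fun x => ?_)
    by_cases hx : x ∈ R ∩ offHyperplanes ℓ'
    · simp only [H.closed_Y x hx]
    · simp only [hχ.eq_zero hx, mul_zero]
  have hae : (fun x => fderiv ℝ (fun x => Zs x - Ys x) x v * χ x) =ᵐ[μ] fun x => b x * χ x := by
    filter_upwards [ae_off (μ := μ) hw hw'] with x hx
    by_cases hxR : x ∈ R
    · have hZ := (H.smooth_Zs.contDiffAt ((hR.inter (isOpen_offHyperplanes ℓ)).mem_nhds
        ⟨hxR, hx.1⟩)).differentiableAt (by simp)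
      have hY := (H.smooth_Ys.contDiffAt (hΩ.mem_nhds ⟨hxR, hx.2⟩)).differentiableAt (by simp)
      rw [fderiv_fun_sub hZ hY, sub_apply, H.closed_Z x ⟨hxR, hx.1⟩, H.closed_Y x ⟨hxR, hx.2⟩,
        H.mixed x ⟨hxR, hx⟩]
    · rw [hχR.eq_zero hxR, mul_zero, mul_zero]
  have i1 := H.integrable_Zs (μ := μ) hR hw hw' (hχR.fderiv v)
  have i2 := H.integrable_Ys (μ := μ) hR hw hw' (hχR.fderiv v)
  have i3 := H.integrable_Yt (μ := μ) hR hw hw' (hχR.fderiv u)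
  have i4 := H.integrable_b (μ := μ) hR hw hw' hχR
  have i5 : Integrable (fun x => (Zs x - Ys x) * fderiv ℝ χ x v) μ := by
    exact (i1.sub i2).congr (Eventually.of_forall fun x => (sub_mul _ _ _).symm)
  have e4 := integral_mul_fderiv_of_parallel (μ := μ) (F := fun x => Zs x - Ys x)
    (ne_zero_of_apply hw) hΩ ((H.smooth_Zs.mono (inter_subset_inter_left _ inter_subset_left)).sub
      (H.smooth_Ys.mono inter_subset_left)) hχ H.dir_v i5 (i4.congr hae.symm)
  rw [integral_congr_ae hae] at e4
  simp only [sub_mul] at e4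
  rw [integral_sub i1 i2] at e4
  have e5 : ∫ x, integrand u v Yt Zs b χ x ∂μ = _ := integral_add (i1.sub i3) i4
  have e6 := integral_sub i1 i3
  rw [e5, e6]
  linarith

omit hw hw' H hR in
theorem integrand_add {χ₁ χ₂ : E → ℝ} (h1 : ContDiff ℝ ∞ χ₁) (h2 : ContDiff ℝ ∞ χ₂) (x : E) :
    integrand u v Yt Zs b (fun x => χ₁ x + χ₂ x) x =
      integrand u v Yt Zs b χ₁ x + integrand u v Yt Zs b χ₂ x := by
  have := fderiv_fun_add (h1.differentiable (by simp) x) (h2.differentiable (by simp) x)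
  simp only [integrand, this, add_apply]
  ring

omit hw hw' H hR in
/-- The product of a locally bounded function and a test function is dominated by a nonnegative test
function. -/
theorem exists_test_bound {F : E → ℝ} {Ω : Set E} (hF : LocallyBoundedOn F R Ω)
    (hχ : IsTest R χ) : ∃ ζ : E → ℝ, IsTest univ ζ ∧ (∀ x, 0 ≤ ζ x) ∧
      ∀ x ∈ Ω, |F x * χ x| ≤ ζ x := by
  obtain ⟨C, hC0, hC⟩ := hF.exists_bound hχ.compact hχ.supp
  obtain ⟨C', hC'⟩ := hχ.compact.exists_bound_of_continuousOn (f := χ)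
    hχ.smooth.continuous.continuousOn
  obtain ⟨r, hr⟩ := hχ.compact.isBounded.subset_closedBall (0 : E)
  let f : ContDiffBump (0 : E) := ⟨max r 1, max r 1 + 1, by positivity, by linarith⟩
  refine ⟨fun x => C * max C' 0 * f x, ⟨contDiff_const.mul f.contDiff, f.hasCompactSupport.mul_left,
    subset_univ _⟩, fun x => by have := f.nonneg (x := x); positivity, fun x hx => ?_⟩
  change |F x * χ x| ≤ C * max C' 0 * f x
  by_cases hxs : x ∈ tsupport χ
  · rw [f.one_of_mem_closedBall (Metric.closedBall_subset_closedBall (le_max_left _ _) (hr hxs)),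
      mul_one, abs_mul]
    exact mul_le_mul (hC x hxs hx) ((hC' x hxs).trans (le_max_left _ _)) (abs_nonneg _) hC0
  · rw [image_eq_zero_of_notMem_tsupport hxs, mul_zero, abs_zero]
    have := f.nonneg (x := x)
    positivity

omit hw' hw in
/-- The product rule for the two cutoffs. Each cutoff contributes one term only, since its
derivative in the direction parallel to its hyperplanes vanishes. -/
theorem integrand_mul_cutoff (hχ : IsTest R χ) (m : ℕ) (x : E) :
    integrand u v Yt Zs b (fun x => χ x * (1 - cutoff ℓ m x) * (1 - cutoff ℓ' m x)) x =
      integrand u v Yt Zs b χ x * (1 - cutoff ℓ m x) * (1 - cutoff ℓ' m x) -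
      Zs x * χ x * fderiv ℝ (cutoff ℓ' m) x v * (1 - cutoff ℓ m x) +
      Yt x * χ x * fderiv ℝ (cutoff ℓ m) x u * (1 - cutoff ℓ' m x) := by
  have h0 := (hχ.smooth.differentiable (by simp) x).hasFDerivAt
  have h1 : HasFDerivAt (fun q => 1 - cutoff ℓ m q) (-fderiv ℝ (cutoff ℓ m) x) x :=
    ((contDiff_cutoff ℓ m).differentiable (by simp) x).hasFDerivAt.const_sub 1
  have h2 : HasFDerivAt (fun q => 1 - cutoff ℓ' m q) (-fderiv ℝ (cutoff ℓ' m) x) x :=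
    ((contDiff_cutoff ℓ' m).differentiable (by simp) x).hasFDerivAt.const_sub 1
  have h3 : fderiv ℝ (fun x => χ x * (1 - cutoff ℓ m x) * (1 - cutoff ℓ' m x)) x = _ :=
    ((h0.mul h1).mul h2).fderiv
  simp only [integrand, h3, add_apply, smul_apply, neg_apply, smul_eq_mul, Pi.mul_apply,
    fderiv_cutoff_eq_zero ℓ m x H.dir_v, fderiv_cutoff_eq_zero ℓ' m x H.dir_u]
  ring

include hw0 hw0'

/-- The weak form of the equation `∂_v Zs - ∂_u Yt = b` also holds across the intersections of the
two families of hyperplanes. -/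
theorem integral_integrand (hχ : IsTest R χ) : ∫ x, integrand u v Yt Zs b χ x ∂μ = 0 := by
  have hk : ∀ m, ContDiff ℝ ∞ fun q => 1 - cutoff ℓ m q := fun m =>
    contDiff_const.sub (contDiff_cutoff ℓ m)
  have hk' : ∀ m, ContDiff ℝ ∞ fun q => 1 - cutoff ℓ' m q := fun m =>
    contDiff_const.sub (contDiff_cutoff ℓ' m)
  have hk0 : ∀ m x, 0 ≤ 1 - cutoff ℓ m x := fun m x => sub_nonneg.2 (cutoff_le_one ℓ m x)
  have hk0' : ∀ m x, 0 ≤ 1 - cutoff ℓ' m x := fun m x => sub_nonneg.2 (cutoff_le_one ℓ' m x)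
  have hk1' : ∀ m x, 1 - cutoff ℓ' m x ≤ 1 := fun m x => sub_le_self _ (cutoff_nonneg ℓ' m x)
  -- The test function is split into a part supported off the hyperplanes `ℓ`, a part supported off
  -- the hyperplanes `ℓ'`, and the remainder `θ m` near their intersection, which has codimension
  -- two.
  let θ : ℕ → E → ℝ := fun m x => χ x * (1 - cutoff ℓ m x) * (1 - cutoff ℓ' m x)
  have hθ : ∀ m, IsTest R (θ m) := fun m => (hχ.mul (hk m)).mul (hk' m)
  have heq : ∀ m, ∫ x, integrand u v Yt Zs b χ x ∂μ = ∫ x, integrand u v Yt Zs b (θ m) x ∂μ := by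
    intro m
    have t1 : IsTest (R ∩ offHyperplanes ℓ) fun x => χ x * cutoff ℓ m x :=
      hχ.mul_inter (contDiff_cutoff ℓ m) (tsupport_cutoff_subset ℓ m)
    have t2 : IsTest (R ∩ offHyperplanes ℓ') fun x => χ x * (1 - cutoff ℓ m x) * cutoff ℓ' m x :=
      (hχ.mul (hk m)).mul_inter (contDiff_cutoff ℓ' m) (tsupport_cutoff_subset ℓ' m)
    have e1 : χ = fun x => χ x * cutoff ℓ m x +
        (χ x * (1 - cutoff ℓ m x) * cutoff ℓ' m x + θ m x) := by
      ext x; simp only [θ]; ring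
    have e2 : ∀ x, integrand u v Yt Zs b χ x = integrand u v Yt Zs b (fun x => χ x * cutoff ℓ m x) x
        + (integrand u v Yt Zs b (fun x => χ x * (1 - cutoff ℓ m x) * cutoff ℓ' m x) x +
          integrand u v Yt Zs b (θ m) x) := fun x => by
      conv_lhs => rw [e1]
      rw [integrand_add t1.smooth (t2.smooth.add (hθ m).smooth),
        integrand_add t2.smooth (hθ m).smooth]
    simp only [e2]
    rw [integral_add, integral_add, H.integral_integrand_of_off_left hR hw hw' t1,
      H.integral_integrand_of_off_right hR hw hw' t2, zero_add, zero_add]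
    · exact H.integrable_integrand hR hw hw' (t2.mono inter_subset_left)
    · exact H.integrable_integrand hR hw hw' (hθ m)
    · exact H.integrable_integrand hR hw hw' (t1.mono inter_subset_left)
    · exact (H.integrable_integrand hR hw hw' (t2.mono inter_subset_left)).add
        (H.integrable_integrand hR hw hw' (hθ m))
  obtain ⟨ζ, hζ, hζ0, hζb⟩ := exists_test_bound H.bdd_Zs hχ
  obtain ⟨ξ, hξ, hξ0, hξb⟩ := exists_test_bound H.bdd_Yt hχ
  have hJ := H.integrable_integrand (μ := μ) hR hw hw' hχ
  have l1 : Tendsto (fun m => ∫ x, |integrand u v Yt Zs b χ x| * (1 - cutoff ℓ m x) ∂μ) atTop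
      (𝓝 0) := by
    have h1 := (tendsto_integral_mul_cutoff (ne_zero_of_apply hw) hJ.abs).const_sub
      (∫ x, |integrand u v Yt Zs b χ x| ∂μ)
    rw [sub_self] at h1
    refine h1.congr fun m => ?_
    rw [← integral_sub hJ.abs]
    · simp only [mul_sub, mul_one]
    · refine hJ.abs.mono (hJ.abs.1.mul (contDiff_cutoff ℓ m).continuous.aestronglyMeasurable)
        (Eventually.of_forall fun x => ?_)
      rw [norm_mul, Real.norm_of_nonneg (cutoff_nonneg ℓ m x)]
      exact mul_le_of_le_one_right (norm_nonneg _) (cutoff_le_one ℓ m x)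
  have l2 := tendsto_integral_fderiv_cutoff (μ := μ) (ℓ := ℓ') (ne_zero_of_apply hw) hw' hw0' hζ
    hζ0 v
  have l3 := tendsto_integral_fderiv_cutoff (μ := μ) (ℓ := ℓ) (ne_zero_of_apply hw') hw hw0 hξ
    hξ0 u
  -- The contribution of the remainder tends to zero.
  have hlim : Tendsto (fun m => ∫ x, integrand u v Yt Zs b (θ m) x ∂μ) atTop (𝓝 0) := by
    refine squeeze_zero_norm (fun m => ?_) (by simpa using (l1.add l2).add l3)
    have hc : Continuous fun x => fderiv ℝ (cutoff ℓ m) x u :=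
      ((contDiff_cutoff ℓ m).continuous_fderiv (by simp)).clm_apply continuous_const
    have hc' : Continuous fun x => fderiv ℝ (cutoff ℓ' m) x v :=
      ((contDiff_cutoff ℓ' m).continuous_fderiv (by simp)).clm_apply continuous_const
    have j1 : Integrable (fun x => |integrand u v Yt Zs b χ x| * (1 - cutoff ℓ m x)) μ := by
      refine hJ.abs.mono (hJ.abs.1.mul (hk m).continuous.aestronglyMeasurable)
        (Eventually.of_forall fun x => ?_)
      rw [norm_mul, Real.norm_of_nonneg (hk0 m x)]
      exact mul_le_of_le_one_right (norm_nonneg _) (sub_le_self _ (cutoff_nonneg ℓ m x))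
    have j2 : Integrable (fun x => ζ x * |fderiv ℝ (cutoff ℓ' m) x v| * (1 - cutoff ℓ m x)) μ :=
      Continuous.integrable_of_hasCompactSupport
        ((hζ.smooth.continuous.mul hc'.abs).mul (hk m).continuous)
        hζ.compact.mul_right.mul_right
    have j3 : Integrable (fun x => ξ x * |fderiv ℝ (cutoff ℓ m) x u| * (1 - cutoff ℓ' m x)) μ :=
      Continuous.integrable_of_hasCompactSupport
        ((hξ.smooth.continuous.mul hc.abs).mul (hk' m).continuous)
        hξ.compact.mul_right.mul_right
    refine le_of_le_of_eq ?_ ((integral_add (j1.add j2) j3).trans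
      (congrArg (· + _) (integral_add j1 j2)))
    refine norm_integral_le_of_norm_le ((j1.add j2).add j3) ?_
    filter_upwards [ae_off (μ := μ) hw hw'] with x hx
    simp only [θ, H.integrand_mul_cutoff hR hχ]
    have b1 : |Zs x * χ x| ≤ ζ x := by
      by_cases hxR : x ∈ R
      · exact hζb x ⟨hxR, hx⟩
      · rw [hχ.eq_zero hxR, mul_zero, abs_zero]; exact hζ0 x
    have b2 : |Yt x * χ x| ≤ ξ x := by
      by_cases hxR : x ∈ R
      · exact hξb x ⟨hxR, hx⟩
      · rw [hχ.eq_zero hxR, mul_zero, abs_zero]; exact hξ0 x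
    rw [Real.norm_eq_abs, sub_eq_add_neg]
    refine (abs_add_le _ _).trans (add_le_add ((abs_add_le _ _).trans (add_le_add ?_ ?_)) ?_)
    · rw [abs_mul, abs_mul, abs_of_nonneg (hk0 m x), abs_of_nonneg (hk0' m x)]
      exact mul_le_of_le_one_right (mul_nonneg (abs_nonneg _) (hk0 m x)) (hk1' m x)
    · rw [abs_neg, abs_mul, abs_mul, abs_of_nonneg (hk0 m x)]
      exact mul_le_mul_of_nonneg_right (mul_le_mul_of_nonneg_right b1 (abs_nonneg _)) (hk0 m x)
    · rw [abs_mul, abs_mul, abs_of_nonneg (hk0' m x)]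
      exact mul_le_mul_of_nonneg_right (mul_le_mul_of_nonneg_right b2 (abs_nonneg _)) (hk0' m x)
  simp only [← heq] at hlim
  exact tendsto_nhds_unique tendsto_const_nhds hlim

/-- The weak form of the exterior derivative, taken with `Zt` from the one form and `Ys` from the
other, depends only on the jumps `Zt - Yt` and `Zs - Ys` and on `b`. -/
theorem integral_eq (hχ : IsTest R χ) :
    ∫ x, (Zt x * fderiv ℝ χ x u - Ys x * fderiv ℝ χ x v) ∂μ =
      ∫ x, ((Zt x - Yt x) * fderiv ℝ χ x u + (Zs x - Ys x) * fderiv ℝ χ x v + b x * χ x) ∂μ := by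
  have h1 := H.integral_integrand (μ := μ) hR hw hw0 hw' hw0' hχ
  have i1 := H.integrable_integrand (μ := μ) hR hw hw' hχ
  have i2 := (H.integrable_Zt (μ := μ) hR hw hw' (hχ.fderiv u)).sub
    (H.integrable_Ys (μ := μ) hR hw hw' (hχ.fderiv v))
  have h2 := integral_add i2 i1
  rw [h1, add_zero] at h2
  refine h2.symm.trans (integral_congr_ae (Eventually.of_forall fun x => ?_))
  simp only [integrand, Pi.sub_apply]
  ring

end IsMixedPair

end pair

/-! ### Local bounds for monotone gradients -/

section slice

set_option linter.unusedSectionVars false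

variable {X : Type*} [NormedAddCommGroup X] [InnerProductSpace ℝ X] [FiniteDimensional ℝ X]

/-- A map whose derivative is positive semidefinite on a convex set is monotone there. -/
theorem inner_sub_nonneg_of_fderiv {H : X → X} {N : Set X} (hN : Convex ℝ N)
    (hd : ∀ z ∈ N, DifferentiableAt ℝ H z) (hpos : ∀ z ∈ N, ∀ u, 0 ≤ inner ℝ u (fderiv ℝ H z u))
    {x y : X} (hx : x ∈ N) (hy : y ∈ N) : 0 ≤ inner ℝ (H x - H y) (x - y) := by
  have hseg : ∀ r ∈ Icc (0 : ℝ) 1, y + r • (x - y) ∈ N := fun r hr =>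
    hN.add_smul_sub_mem hy hx hr
  have hder : ∀ r ∈ Icc (0 : ℝ) 1, HasDerivAt (fun r : ℝ => inner ℝ (H (y + r • (x - y))) (x - y))
      (inner ℝ (fderiv ℝ H (y + r • (x - y)) (x - y)) (x - y)) r := fun r hr => by
    have h1 : HasDerivAt (fun r : ℝ => y + r • (x - y)) (x - y) r := by
      simpa using ((hasDerivAt_id r).smul_const (x - y)).const_add y
    have h2 := (hd _ (hseg r hr)).hasFDerivAt.comp_hasDerivAt r h1
    simpa using h2.inner ℝ (hasDerivAt_const r (x - y))
  have hmono : MonotoneOn (fun r : ℝ => inner ℝ (H (y + r • (x - y))) (x - y)) (Icc 0 1) := by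
    refine monotoneOn_of_deriv_nonneg (convex_Icc 0 1)
      (fun r hr => (hder r hr).continuousAt.continuousWithinAt)
      (fun r hr => (hder r (interior_subset hr)).differentiableAt.differentiableWithinAt)
      fun r hr => ?_
    rw [(hder r (interior_subset hr)).deriv, real_inner_comm]
    exact hpos _ (hseg r (interior_subset hr)) _
  have := hmono (left_mem_Icc.2 zero_le_one) (right_mem_Icc.2 zero_le_one) zero_le_one
  simp only [zero_smul, add_zero, one_smul, add_sub_cancel] at this
  rw [inner_sub_left]
  linarith

/-- A family of monotone vector fields that is bounded at almost every point is locally bounded: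
the value at a point of a simplex is controlled by the values at the vertices. -/
theorem exists_bound_of_monotone [MeasurableSpace X] [BorelSpace X] {T : Type*} [TopologicalSpace T]
    {s₀ : X} {t₀ : T} {G : X → T → X} {N D : Set X} {P : T → Prop} (hN : N ∈ 𝓝 s₀)
    (hD : ∀ᵐ s : X, s ∈ D)
    (hgen : ∀ s ∈ D ∩ N, ∃ C, ∀ᶠ t in 𝓝 t₀, P t → ‖G s t‖ ≤ C)
    (hmono : ∀ᶠ t in 𝓝 t₀, P t → ∀ x ∈ N, ∀ y ∈ N, 0 ≤ inner ℝ (G x t - G y t) (x - y)) :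
    ∃ C, ∀ᶠ z : X × T in 𝓝 (s₀, t₀), P z.2 → ‖G z.1 z.2‖ ≤ C := by
  obtain ⟨r, hr0, hr⟩ := Metric.mem_nhds_iff.1 hN
  obtain ⟨b, hb, hbr⟩ := exists_mem_interior_convexHull_affineBasis
    (Metric.ball_mem_nhds s₀ (half_pos hr0))
  have hbk : ∀ k, b k ∈ Metric.ball s₀ (r / 2) := fun k =>
    hbr (subset_convexHull ℝ _ (mem_range_self k))
  -- a small translation moves the vertices to points where the fields are bounded
  obtain ⟨v, hvD, hvr, hvs⟩ : ∃ v, (∀ k, b k + v ∈ D) ∧ ‖v‖ < r / 2 ∧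
      s₀ - v ∈ interior (convexHull ℝ (range b)) := by
    have h1 : ∀ᵐ v : X, ∀ k, b k + v ∈ D := ae_all_iff.2 fun k =>
      (measurePreserving_add_left volume (b k)).quasiMeasurePreserving.ae hD
    have h2 : IsOpen {v : X | ‖v‖ < r / 2 ∧ s₀ - v ∈ interior (convexHull ℝ (range b))} :=
      (isOpen_lt continuous_norm continuous_const).inter
        (isOpen_interior.preimage (continuous_const.sub continuous_id))
    obtain ⟨v, hv, hv'⟩ := (Measure.dense_of_ae h1).inter_open_nonempty _ h2
      ⟨0, by simpa using hr0, by simpa using hb⟩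
    exact ⟨v, hv', hv⟩
  have hxN : ∀ k, b k + v ∈ Metric.ball s₀ r := fun k => by
    have h1 := hbk k
    rw [Metric.mem_ball, dist_eq_norm] at h1 ⊢
    calc ‖b k + v - s₀‖ = ‖(b k - s₀) + v‖ := by congr 1; abel
      _ ≤ ‖b k - s₀‖ + ‖v‖ := norm_add_le _ _
      _ < r := by linarith
  obtain ⟨δ, hδ0, hδ⟩ := Metric.mem_nhds_iff.1 (mem_interior_iff_mem_nhds.1 hvs)
  choose C hC using fun k => hgen (b k + v) ⟨hvD k, hr (hxN k)⟩
  obtain ⟨M, hM⟩ : ∃ M, ∀ k, C k ≤ M := by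
    obtain ⟨M, hM⟩ := (finite_range C).bddAbove
    exact ⟨M, fun k => hM (mem_range_self k)⟩
  have hM0 : ∀ {t}, (∀ k, ‖G (b k + v) t‖ ≤ C k) → 0 ≤ M := fun h => by
    have k : Fin (Module.finrank ℝ X + 1) := 0
    exact (norm_nonneg _).trans ((h k).trans (hM k))
  refine ⟨4 * (M * (2 * r)) / δ, ?_⟩
  have ev1 : ∀ᶠ z : X × T in 𝓝 (s₀, t₀), z.1 ∈ Metric.ball s₀ (min r (δ / 2)) :=
    continuous_fst.continuousAt.preimage_mem_nhds
      (Metric.ball_mem_nhds _ (lt_min hr0 (half_pos hδ0)))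
  have ev2 : ∀ᶠ z : X × T in 𝓝 (s₀, t₀), ∀ k, P z.2 → ‖G (b k + v) z.2‖ ≤ C k :=
    (continuous_snd.tendsto (s₀, t₀)).eventually (eventually_all.2 hC)
  have ev3 := (continuous_snd.tendsto (s₀, t₀)).eventually hmono
  filter_upwards [ev1, ev2, ev3] with z h1 h2 h3 hP
  have hzr : z.1 ∈ Metric.ball s₀ r := Metric.ball_subset_ball (min_le_left _ _) h1
  have hzd : ‖z.1 - s₀‖ < δ / 2 := by
    rw [← dist_eq_norm]; exact (Metric.ball_subset_ball (min_le_right _ _) h1 : z.1 ∈ _)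
  have hM0' := hM0 fun k => h2 k hP
  -- the half space of all `y` with `⟨G z, y + v - z⟩ ≤ M` contains the simplex
  have hhull : convexHull ℝ (range b) ⊆ {y | inner ℝ (G z.1 z.2) y ≤
      M * (2 * r) + inner ℝ (G z.1 z.2) (z.1 - v)} := by
    refine convexHull_min ?_ (convex_halfSpace_le (innerSL ℝ (G z.1 z.2)).isBoundedLinearMap.toIsLinearMap _)
    rintro _ ⟨k, rfl⟩
    have h4 := h3 hP _ (hr (hxN k)) _ (hr hzr)
    have h5 : inner ℝ (G (b k + v) z.2) (b k + v - z.1) ≤ M * (2 * r) := by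
      refine (real_inner_le_norm _ _).trans ?_
      have h6 : ‖b k + v - z.1‖ ≤ 2 * r := by
        have e1 := hxN k
        rw [Metric.mem_ball] at e1 hzr
        rw [← dist_eq_norm]
        linarith [dist_triangle_right (b k + v) z.1 s₀]
      exact mul_le_mul ((h2 k hP).trans (hM k)) h6 (norm_nonneg _) hM0'
    rw [inner_sub_left] at h4
    have h7 : inner ℝ (G z.1 z.2) (b k + v - z.1) =
        inner ℝ (G z.1 z.2) (b k) - inner ℝ (G z.1 z.2) (z.1 - v) := by
      rw [← inner_sub_right]; congr 1; abel
    simp only [mem_ofPred_eq]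
    linarith
  by_cases hG : G z.1 z.2 = 0
  · rw [hG, norm_zero]; positivity
  have hGn : 0 < ‖G z.1 z.2‖ := norm_pos_iff.2 hG
  have hmem : z.1 - v + (δ / 4 / ‖G z.1 z.2‖) • G z.1 z.2 ∈ Metric.ball (s₀ - v) δ := by
    rw [Metric.mem_ball, dist_eq_norm]
    calc ‖z.1 - v + (δ / 4 / ‖G z.1 z.2‖) • G z.1 z.2 - (s₀ - v)‖
        = ‖(z.1 - s₀) + (δ / 4 / ‖G z.1 z.2‖) • G z.1 z.2‖ := by congr 1; abel
      _ ≤ ‖z.1 - s₀‖ + ‖(δ / 4 / ‖G z.1 z.2‖) • G z.1 z.2‖ := norm_add_le _ _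
      _ = ‖z.1 - s₀‖ + δ / 4 := by
        rw [norm_smul, Real.norm_of_nonneg (by positivity)]
        field_simp
      _ < δ := by linarith
  have h8 := hhull (hδ hmem)
  simp only [mem_ofPred_eq, inner_add_right, real_inner_smul_right,
    real_inner_self_eq_norm_sq] at h8
  have h9 : δ / 4 / ‖G z.1 z.2‖ * ‖G z.1 z.2‖ ^ 2 = δ / 4 * ‖G z.1 z.2‖ := by field_simp
  rw [h9] at h8
  rw [le_div_iff₀ hδ0]
  linarith

end slice

/-! ### Gradients of potentials over the two families of charts -/

theorem fderiv_apply_comm {E : Type} [NormedAddCommGroup E] [NormedSpace ℝ E] {ψ : E → ℝ}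
    (hψ : ContDiff ℝ ∞ ψ) (u v x : E) : fderiv ℝ (fun y => fderiv ℝ ψ y u) x v =
      fderiv ℝ (fun y => fderiv ℝ ψ y v) x u := secondDeriv_comm hψ.contDiffAt u v

section glue

variable {n l : ℕ}

instance : (volume : Measure (Base n l)).IsAddHaarMeasure := by
  rw [Measure.volume_eq_prod]
  infer_instance

namespace SimplexPair

variable (S : SimplexPair n l)

/-- The linear forms that define the hyperplanes containing the walls between the charts `w_j`. -/
def formW (p : {p : Fin (n + 1) × Fin (n + 1) // p.1 ≠ p.2}) : Base n l →L[ℝ] ℝ :=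
  (innerSL ℝ (S.edgeW p.1.1 p.1.2)).comp (ContinuousLinearMap.fst ℝ _ _)

/-- The linear forms that define the hyperplanes containing the walls between the charts `v_i`. -/
def formV (p : {p : Fin (l + 1) × Fin (l + 1) // p.1 ≠ p.2}) : Base n l →L[ℝ] ℝ :=
  (innerSL ℝ (S.edgeV p.1.1 p.1.2)).comp (ContinuousLinearMap.snd ℝ _ _)

theorem exists_mem_of_offW {q : Base n l} (hq : q ∈ offHyperplanes S.formW) :
    ∃ j, q.1 ∈ normalCone S.edgeW j :=
  S.isSimplexEdges_edgeW.exists_mem_normalCone fun a b hab => hq ⟨(a, b), hab⟩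

theorem exists_mem_of_offV {q : Base n l} (hq : q ∈ offHyperplanes S.formV) :
    ∃ j, q.2 ∈ normalCone S.edgeV j :=
  S.isSimplexEdges_edgeV.exists_mem_normalCone fun a b hab => hq ⟨(a, b), hab⟩

/-- Dual directions to the linear forms `formW`. -/
def dirW (p : {p : Fin (n + 1) × Fin (n + 1) // p.1 ≠ p.2}) : Base n l :=
  ((‖S.edgeW p.1.1 p.1.2‖ ^ 2)⁻¹ • S.edgeW p.1.1 p.1.2, 0)

/-- Dual directions to the linear forms `formV`. -/
def dirV (p : {p : Fin (l + 1) × Fin (l + 1) // p.1 ≠ p.2}) : Base n l :=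
  (0, (‖S.edgeV p.1.1 p.1.2‖ ^ 2)⁻¹ • S.edgeV p.1.1 p.1.2)

theorem formW_dirW (p) : S.formW p (S.dirW p) = 1 := by
  have := norm_ne_zero_iff.2 (S.isSimplexEdges_edgeW.edge_ne_zero p.2)
  change inner ℝ (S.edgeW p.1.1 p.1.2) ((‖S.edgeW p.1.1 p.1.2‖ ^ 2)⁻¹ • S.edgeW p.1.1 p.1.2) = 1
  rw [real_inner_smul_right, real_inner_self_eq_norm_sq]
  exact inv_mul_cancel₀ (pow_ne_zero 2 this)

theorem formV_dirV (p) : S.formV p (S.dirV p) = 1 := by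
  have := norm_ne_zero_iff.2 (S.isSimplexEdges_edgeV.edge_ne_zero p.2)
  change inner ℝ (S.edgeV p.1.1 p.1.2) ((‖S.edgeV p.1.1 p.1.2‖ ^ 2)⁻¹ • S.edgeV p.1.1 p.1.2) = 1
  rw [real_inner_smul_right, real_inner_self_eq_norm_sq]
  exact inv_mul_cancel₀ (pow_ne_zero 2 this)

theorem formV_dirW (p p') : S.formV p (S.dirW p') = 0 := by simp [formV, dirW]

theorem formW_dirV (p p') : S.formW p (S.dirV p') = 0 := by simp [formW, dirV]

theorem formV_sdir (p) (i : Fin n) : S.formV p (sdir i) = 0 := by simp [formV, sdir]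

theorem formW_tdir (p) (i : Fin l) : S.formW p (tdir i) = 0 := by simp [formW, tdir]

theorem ae_offW : ∀ᵐ q : Base n l, q ∈ offHyperplanes S.formW :=
  ae_offHyperplanes (IsMixedPair.ne_zero_of_apply S.formW_dirW)

theorem ae_offV : ∀ᵐ q : Base n l, q ∈ offHyperplanes S.formV :=
  ae_offHyperplanes (IsMixedPair.ne_zero_of_apply S.formV_dirV)

end SimplexPair

/-- The form `ηY ds - ϑY dt` over the charts `v_a`, and the form `ηZ ds - ϑZ dt` over the charts
`w_j`, are locally differentials of potentials of `(V, W)`. On the intersection of a chart `w_j`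
with a chart `v_a` the difference of the two forms is the differential of a biaffine function with
coefficients `B j a`, `C j a` and `D j a`. -/
structure IsGlued (S : SimplexPair n l) (R : Set (Base n l))
    (V : Base n l → Matrix (Fin n) (Fin n) ℝ) (W : Base n l → Matrix (Fin l) (Fin l) ℝ)
    (ηY ηZ : Base n l → EuclideanSpace ℝ (Fin n)) (ϑY ϑZ : Base n l → EuclideanSpace ℝ (Fin l))
    (B : Fin (n + 1) → Fin (l + 1) → Fin n → ℝ) (C : Fin (n + 1) → Fin (l + 1) → Fin l → ℝ)
    (D : Fin (n + 1) → Fin (l + 1) → Fin n → Fin l → ℝ) : Prop where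
  posV : ∀ q ∈ S.regular R, (V q).PosDef
  posW : ∀ q ∈ S.regular R, (W q).PosDef
  potV : ∀ a, ∀ q ∈ S.chartV R a, ∃ O : Set (Base n l), IsOpen O ∧ q ∈ O ∧
    ∃ K : Base n l → ℝ, HasSplitGradient K O ηY ϑY ∧ IsSplitPotential K O V W
  potW : ∀ j, ∀ q ∈ S.chartW R j, ∃ O : Set (Base n l), IsOpen O ∧ q ∈ O ∧
    ∃ K : Base n l → ℝ, HasSplitGradient K O ηZ ϑZ ∧ IsSplitPotential K O V W
  diff_s : ∀ j a, ∀ q ∈ R, q.1 ∈ normalCone S.edgeW j → q.2 ∈ normalCone S.edgeV a → ∀ i,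
    ηZ q i - ηY q i = B j a i + ∑ p, D j a i p * q.2 p
  diff_t : ∀ j a, ∀ q ∈ R, q.1 ∈ normalCone S.edgeW j → q.2 ∈ normalCone S.edgeV a → ∀ p,
    ϑY q p - ϑZ q p = C j a p + ∑ i, D j a i p * q.1 i

/-- What a local potential tells about its gradient. -/
theorem HasSplitGradient.local_facts {K : Base n l → ℝ} {O : Set (Base n l)}
    {η : Base n l → EuclideanSpace ℝ (Fin n)} {ϑ : Base n l → EuclideanSpace ℝ (Fin l)}
    {V : Base n l → Matrix (Fin n) (Fin n) ℝ} {W : Base n l → Matrix (Fin l) (Fin l) ℝ}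
    (h : HasSplitGradient K O η ϑ) (hP : IsSplitPotential K O V W) (hO : IsOpen O) {q : Base n l}
    (hq : q ∈ O) :
    ContDiffAt ℝ ∞ η q ∧ ContDiffAt ℝ ∞ ϑ q ∧
    (∀ i j, fderiv ℝ (fun x => η x i) q (sdir j) = V q i j) ∧
    (∀ p r, fderiv ℝ (fun x => ϑ x p) q (tdir r) = W q p r) ∧
    ∀ i p, fderiv ℝ (fun x => η x i) q (tdir p) = -fderiv ℝ (fun x => ϑ x p) q (sdir i) := by
  have h1 := (h.smooth_eta hO).contDiffAt (hO.mem_nhds hq)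
  have h2 := (h.smooth_theta hO).contDiffAt (hO.mem_nhds hq)
  have e1 : ∀ i u, fderiv ℝ (fun x => η x i) q u = secondDeriv K q (sdir i) u := fun i u => by
    rw [← h.fderiv_eta hO hq]
    have h3 : HasFDerivAt (fun r => η r i) ((EuclideanSpace.proj i).comp (fderiv ℝ η q)) q :=
      (EuclideanSpace.proj i : EuclideanSpace ℝ (Fin n) →L[ℝ] ℝ).hasFDerivAt.comp q
        (h1.differentiableAt (by simp)).hasFDerivAt
    rw [h3.fderiv]; rfl
  have e2 : ∀ i u, fderiv ℝ (fun x => ϑ x i) q u = -secondDeriv K q (tdir i) u := fun i u => by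
    rw [← h.fderiv_theta hO hq]
    have h3 : HasFDerivAt (fun r => ϑ r i) ((EuclideanSpace.proj i).comp (fderiv ℝ ϑ q)) q :=
      (EuclideanSpace.proj i : EuclideanSpace ℝ (Fin l) →L[ℝ] ℝ).hasFDerivAt.comp q
        (h2.differentiableAt (by simp)).hasFDerivAt
    rw [h3.fderiv]; rfl
  refine ⟨h1, h2, fun i j => ?_, fun i j => ?_, fun i p => ?_⟩
  · rw [e1, hP.hess_s q hq]
  · rw [e2, hP.hess_t q hq]
  · rw [e1, e2, neg_neg, secondDeriv_comm (h.smooth.contDiffAt (hO.mem_nhds hq))]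

end glue

section glue2

variable {n l : ℕ}

theorem LocallyBoundedOn.of_continuous {E : Type*} [NormedAddCommGroup E] {F M : E → ℝ}
    {R Ω : Set E} (hM : Continuous M) (h : ∀ x ∈ Ω, |F x| ≤ M x) : LocallyBoundedOn F R Ω :=
  fun q _ => ⟨M q + 1, by
    filter_upwards [hM.continuousAt.eventually (gt_mem_nhds (lt_add_one (M q)))] with x hx hxΩ
    exact (h x hxΩ).trans hx.le⟩

theorem eq_sum_single {k : ℕ} (x : EuclideanSpace ℝ (Fin k)) :
    x = ∑ i, x i • EuclideanSpace.single i (1 : ℝ) := by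
  ext j
  simp [Pi.single_apply]

theorem norm_le_sum_abs {k : ℕ} (x : EuclideanSpace ℝ (Fin k)) : ‖x‖ ≤ ∑ i, |x i| := by
  calc ‖x‖ = ‖∑ i, x i • EuclideanSpace.single i (1 : ℝ)‖ := by rw [← eq_sum_single]
    _ ≤ ∑ i, ‖x i • (EuclideanSpace.single i (1 : ℝ) : EuclideanSpace ℝ (Fin k))‖ := norm_sum_le _ _
    _ = ∑ i, |x i| := by simp [norm_smul]

theorem ContDiffAt.coord {k : ℕ} {E : Type*} [NormedAddCommGroup E] [NormedSpace ℝ E]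
    {η : E → EuclideanSpace ℝ (Fin k)} {q : E} (h : ContDiffAt ℝ ∞ η q) (i : Fin k) :
    ContDiffAt ℝ ∞ (fun x => η x i) q := contDiffAt_euclidean.1 h i

namespace IsGlued

variable {S : SimplexPair n l} {R : Set (Base n l)}
  {V : Base n l → Matrix (Fin n) (Fin n) ℝ} {W : Base n l → Matrix (Fin l) (Fin l) ℝ}
  {ηY ηZ : Base n l → EuclideanSpace ℝ (Fin n)} {ϑY ϑZ : Base n l → EuclideanSpace ℝ (Fin l)}
  {B : Fin (n + 1) → Fin (l + 1) → Fin n → ℝ} {C : Fin (n + 1) → Fin (l + 1) → Fin l → ℝ}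
  {D : Fin (n + 1) → Fin (l + 1) → Fin n → Fin l → ℝ}
  (H : IsGlued S R V W ηY ηZ ϑY ϑZ B C D)

include H

theorem facts_V {a : Fin (l + 1)} {q : Base n l} (hq : q ∈ S.chartV R a) :
    ContDiffAt ℝ ∞ ηY q ∧ ContDiffAt ℝ ∞ ϑY q ∧
    (∀ i j, fderiv ℝ (fun x => ηY x i) q (sdir j) = V q i j) ∧
    (∀ p r, fderiv ℝ (fun x => ϑY x p) q (tdir r) = W q p r) ∧
    ∀ i p, fderiv ℝ (fun x => ηY x i) q (tdir p) = -fderiv ℝ (fun x => ϑY x p) q (sdir i) := by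
  obtain ⟨O, hO, hqO, K, hK, hP⟩ := H.potV a q hq
  exact hK.local_facts hP hO hqO

theorem facts_W {j : Fin (n + 1)} {q : Base n l} (hq : q ∈ S.chartW R j) :
    ContDiffAt ℝ ∞ ηZ q ∧ ContDiffAt ℝ ∞ ϑZ q ∧
    (∀ i j, fderiv ℝ (fun x => ηZ x i) q (sdir j) = V q i j) ∧
    (∀ p r, fderiv ℝ (fun x => ϑZ x p) q (tdir r) = W q p r) ∧
    ∀ i p, fderiv ℝ (fun x => ηZ x i) q (tdir p) = -fderiv ℝ (fun x => ϑZ x p) q (sdir i) := by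
  obtain ⟨O, hO, hqO, K, hK, hP⟩ := H.potW j q hq
  exact hK.local_facts hP hO hqO

theorem inner_fderiv_eta_nonneg {a : Fin (l + 1)} {q : Base n l} (hq : q ∈ S.chartV R a)
    (u : EuclideanSpace ℝ (Fin n)) : 0 ≤ inner ℝ u (fderiv ℝ ηY q (u, 0)) := by
  obtain ⟨O, hO, hqO, K, hK, hP⟩ := H.potV a q hq
  have h1 := hK.metric_eq hO hqO (u, 0) (u, 0)
  simp only [inner_zero_right, add_zero, PiLp.zero_apply, mul_zero, Finset.sum_const_zero] at h1
  rw [h1]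
  have h2 := (H.posV q (S.chartV_subset a hq)).posSemidef.dotProduct_mulVec_nonneg (fun i => u i)
  simp only [dotProduct, Matrix.mulVec, Finset.mul_sum, Pi.star_apply, star_trivial] at h2
  refine h2.trans_eq (Finset.sum_congr rfl fun i _ => Finset.sum_congr rfl fun j _ => ?_)
  rw [hP.hess_s q hqO]
  ring

theorem inner_fderiv_theta_nonneg {j : Fin (n + 1)} {q : Base n l} (hq : q ∈ S.chartW R j)
    (u : EuclideanSpace ℝ (Fin l)) : 0 ≤ inner ℝ u (fderiv ℝ ϑZ q (0, u)) := by
  obtain ⟨O, hO, hqO, K, hK, hP⟩ := H.potW j q hq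
  have h1 := hK.metric_eq hO hqO (0, u) (0, u)
  simp only [inner_zero_left, zero_add, PiLp.zero_apply, mul_zero, Finset.sum_const_zero] at h1
  rw [real_inner_comm, h1]
  have h2 := (H.posW q (S.chartW_subset j hq)).posSemidef.dotProduct_mulVec_nonneg (fun i => u i)
  simp only [dotProduct, Matrix.mulVec, Finset.mul_sum, Pi.star_apply, star_trivial] at h2
  refine h2.trans_eq (Finset.sum_congr rfl fun i _ => Finset.sum_congr rfl fun j _ => ?_)
  rw [hP.hess_t q hqO]
  ring

theorem bdd_diff_s (i : Fin n) : LocallyBoundedOn (fun q => ηZ q i - ηY q i) R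
    (R ∩ (offHyperplanes S.formW ∩ offHyperplanes S.formV)) := by
  refine LocallyBoundedOn.of_continuous (M := fun q => ∑ j, ∑ a, (|B j a i| +
    ∑ p, |D j a i p| * |q.2 p|)) (by fun_prop) fun q hq => ?_
  obtain ⟨j, hj⟩ := S.exists_mem_of_offW hq.2.1
  obtain ⟨a, ha⟩ := S.exists_mem_of_offV hq.2.2
  have h0 : ∀ j a, 0 ≤ |B j a i| + ∑ p, |D j a i p| * |q.2 p| := fun j a => by positivity
  rw [H.diff_s j a q hq.1 hj ha]
  calc _ ≤ |B j a i| + ∑ p, |D j a i p| * |q.2 p| := by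
        refine (abs_add_le _ _).trans (add_le_add_right ((Finset.abs_sum_le_sum_abs _ _).trans_eq
          (Finset.sum_congr rfl fun p _ => abs_mul _ _)) _)
    _ ≤ ∑ a, (|B j a i| + ∑ p, |D j a i p| * |q.2 p|) :=
        Finset.single_le_sum (f := fun a => |B j a i| + ∑ p, |D j a i p| * |q.2 p|)
          (fun a _ => h0 j a) (Finset.mem_univ a)
    _ ≤ _ := Finset.single_le_sum (f := fun j => ∑ a, (|B j a i| + ∑ p, |D j a i p| * |q.2 p|))
          (fun j _ => Finset.sum_nonneg fun a _ => h0 j a) (Finset.mem_univ j)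

theorem bdd_diff_t (p : Fin l) : LocallyBoundedOn (fun q => ϑY q p - ϑZ q p) R
    (R ∩ (offHyperplanes S.formW ∩ offHyperplanes S.formV)) := by
  refine LocallyBoundedOn.of_continuous (M := fun q => ∑ j, ∑ a, (|C j a p| +
    ∑ i, |D j a i p| * |q.1 i|)) (by fun_prop) fun q hq => ?_
  obtain ⟨j, hj⟩ := S.exists_mem_of_offW hq.2.1
  obtain ⟨a, ha⟩ := S.exists_mem_of_offV hq.2.2
  have h0 : ∀ j a, 0 ≤ |C j a p| + ∑ i, |D j a i p| * |q.1 i| := fun j a => by positivity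
  rw [H.diff_t j a q hq.1 hj ha]
  calc _ ≤ |C j a p| + ∑ i, |D j a i p| * |q.1 i| := by
        refine (abs_add_le _ _).trans (add_le_add_right ((Finset.abs_sum_le_sum_abs _ _).trans_eq
          (Finset.sum_congr rfl fun p _ => abs_mul _ _)) _)
    _ ≤ ∑ a, (|C j a p| + ∑ i, |D j a i p| * |q.1 i|) :=
        Finset.single_le_sum (f := fun a => |C j a p| + ∑ i, |D j a i p| * |q.1 i|)
          (fun a _ => h0 j a) (Finset.mem_univ a)
    _ ≤ _ := Finset.single_le_sum (f := fun j => ∑ a, (|C j a p| + ∑ i, |D j a i p| * |q.1 i|))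
          (fun j _ => Finset.sum_nonneg fun a _ => h0 j a) (Finset.mem_univ j)

variable (hR : IsOpen R)
include hR

/-- On the slices `t = const` the field `ηY` is monotone, and it is bounded where `s` does not lie
on a wall. -/
theorem bdd_eta (i : Fin n) : LocallyBoundedOn (fun q => ηY q i) R
    (R ∩ (offHyperplanes S.formW ∩ offHyperplanes S.formV)) := by
  intro q₀ hq₀
  obtain ⟨s₀, t₀⟩ := q₀
  obtain ⟨r, hr0, hr⟩ := Metric.isOpen_iff.1 hR _ hq₀
  have hball : ∀ s ∈ Metric.ball s₀ r, ∀ t ∈ Metric.ball t₀ r, (s, t) ∈ R := fun s hs t ht =>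
    hr (by rw [← ball_prod_same]; exact ⟨hs, ht⟩)
  obtain ⟨M, hM⟩ := exists_bound_of_monotone (s₀ := s₀) (t₀ := t₀) (G := fun s t => ηY (s, t))
    (N := Metric.ball s₀ r) (D := {s | ∀ a b, a ≠ b → inner ℝ (S.edgeW a b) s ≠ 0})
    (P := fun t => ∀ a b, a ≠ b → inner ℝ (S.edgeV a b) t ≠ 0) (Metric.ball_mem_nhds _ hr0)
    S.isSimplexEdges_edgeW.ae_inner_ne_zero (fun s hs => by
      obtain ⟨j, hj⟩ := S.isSimplexEdges_edgeW.exists_mem_normalCone hs.1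
      have hmem : (s, t₀) ∈ S.chartW R j := ⟨hball s hs.2 t₀ (Metric.mem_ball_self hr0), hj⟩
      have hcont : ContinuousAt (fun t => ηZ (s, t)) t₀ :=
        ContinuousAt.comp (f := fun t => (s, t)) (H.facts_W hmem).1.continuousAt (by fun_prop)
      have hδ := fun i => H.bdd_diff_s i (s, t₀) hmem.1
      choose M hM using hδ
      have hc2 : ∀ i, ∀ᶠ t in 𝓝 t₀, |ηZ (s, t) i| < |ηZ (s, t₀) i| + 1 := fun i => by
        have : ContinuousAt (fun t => |ηZ (s, t) i|) t₀ :=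
          (((EuclideanSpace.proj i : EuclideanSpace ℝ (Fin n) →L[ℝ] ℝ).continuous.continuousAt).comp
            hcont).abs
        exact this.eventually (gt_mem_nhds (lt_add_one _))
      -- For `s` off the walls of `τ`, `ηZ` is continuous in `t`, and it differs from `ηY` by a
      -- locally bounded jump.
      refine ⟨∑ i, (|ηZ (s, t₀) i| + 1 + M i), ?_⟩
      have hM' : ∀ᶠ t in 𝓝 t₀, ∀ i, (s, t) ∈ R ∩ (offHyperplanes S.formW ∩ offHyperplanes S.formV) →
          |ηZ (s, t) i - ηY (s, t) i| ≤ M i := by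
        have : Tendsto (fun t => (s, t)) (𝓝 t₀) (𝓝 (s, t₀)) := by
          have : ContinuousAt (fun t => (s, t)) t₀ := by fun_prop
          exact this
        exact this.eventually (eventually_all.2 hM)
      filter_upwards [eventually_all.2 hc2, hM', Metric.ball_mem_nhds t₀ hr0] with t h1 h2 h3 hP
      have hoff : (s, t) ∈ R ∩ (offHyperplanes S.formW ∩ offHyperplanes S.formV) :=
        ⟨hball s hs.2 t h3, fun p => hs.1 _ _ p.2, fun p => hP _ _ p.2⟩
      refine (norm_le_sum_abs _).trans (Finset.sum_le_sum fun i _ => ?_)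
      have e1 := h1 i
      have e2 := h2 i hoff
      have e3 : |ηY (s, t) i| ≤ |ηZ (s, t) i| + |ηZ (s, t) i - ηY (s, t) i| := by
        have := abs_sub (ηZ (s, t) i) (ηZ (s, t) i - ηY (s, t) i)
        rwa [sub_sub_cancel] at this
      linarith) (by
      filter_upwards [Metric.ball_mem_nhds t₀ hr0] with t ht hP x hx y hy
      obtain ⟨a, ha⟩ := S.isSimplexEdges_edgeV.exists_mem_normalCone hP
      have hd : ∀ z ∈ Metric.ball s₀ r, HasFDerivAt (fun s => ηY (s, t))
          ((fderiv ℝ ηY (z, t)).comp (ContinuousLinearMap.inl ℝ _ _)) z := fun z hz => by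
        have h1 := ((H.facts_V (a := a) ⟨hball z hz t ht, ha⟩).1.differentiableAt
          (by simp)).hasFDerivAt
        exact h1.comp z (hasFDerivAt_prodMk_left z t)
      refine inner_sub_nonneg_of_fderiv (convex_ball s₀ r) (fun z hz => (hd z hz).differentiableAt)
        (fun z hz u => ?_) hx hy
      rw [(hd z hz).fderiv]
      exact H.inner_fderiv_eta_nonneg (a := a) ⟨hball z hz t ht, ha⟩ u)
  refine ⟨M, hM.mono fun z hz hz' => ?_⟩
  exact (PiLp.norm_apply_le _ i).trans (hz fun a b hab => hz'.2.2 ⟨(a, b), hab⟩)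

/-- The mirror image of `bdd_eta`. -/
theorem bdd_theta (p : Fin l) : LocallyBoundedOn (fun q => ϑZ q p) R
    (R ∩ (offHyperplanes S.formW ∩ offHyperplanes S.formV)) := by
  intro q₀ hq₀
  obtain ⟨s₀, t₀⟩ := q₀
  obtain ⟨r, hr0, hr⟩ := Metric.isOpen_iff.1 hR _ hq₀
  have hball : ∀ s ∈ Metric.ball s₀ r, ∀ t ∈ Metric.ball t₀ r, (s, t) ∈ R := fun s hs t ht =>
    hr (by rw [← ball_prod_same]; exact ⟨hs, ht⟩)
  obtain ⟨M, hM⟩ := exists_bound_of_monotone (s₀ := t₀) (t₀ := s₀) (G := fun t s => ϑZ (s, t))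
    (N := Metric.ball t₀ r) (D := {s | ∀ a b, a ≠ b → inner ℝ (S.edgeV a b) s ≠ 0})
    (P := fun t => ∀ a b, a ≠ b → inner ℝ (S.edgeW a b) t ≠ 0) (Metric.ball_mem_nhds _ hr0)
    S.isSimplexEdges_edgeV.ae_inner_ne_zero (fun t hs => by
      obtain ⟨j, hj⟩ := S.isSimplexEdges_edgeV.exists_mem_normalCone hs.1
      have hmem : (s₀, t) ∈ S.chartV R j := ⟨hball s₀ (Metric.mem_ball_self hr0) t hs.2, hj⟩
      have hcont : ContinuousAt (fun s => ϑY (s, t)) s₀ :=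
        ContinuousAt.comp (f := fun s => (s, t)) (H.facts_V hmem).2.1.continuousAt (by fun_prop)
      have hδ := fun i => H.bdd_diff_t i (s₀, t) hmem.1
      choose M hM using hδ
      have hc2 : ∀ i, ∀ᶠ s in 𝓝 s₀, |ϑY (s, t) i| < |ϑY (s₀, t) i| + 1 := fun i => by
        have : ContinuousAt (fun s => |ϑY (s, t) i|) s₀ :=
          (((EuclideanSpace.proj i : EuclideanSpace ℝ (Fin l) →L[ℝ] ℝ).continuous.continuousAt).comp
            hcont).abs
        exact this.eventually (gt_mem_nhds (lt_add_one _))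
      refine ⟨∑ i, (|ϑY (s₀, t) i| + 1 + M i), ?_⟩
      have hM' : ∀ᶠ s in 𝓝 s₀, ∀ i, (s, t) ∈ R ∩ (offHyperplanes S.formW ∩ offHyperplanes S.formV) →
          |ϑY (s, t) i - ϑZ (s, t) i| ≤ M i := by
        have : Tendsto (fun s => (s, t)) (𝓝 s₀) (𝓝 (s₀, t)) := by
          have : ContinuousAt (fun s => (s, t)) s₀ := by fun_prop
          exact this
        exact this.eventually (eventually_all.2 hM)
      filter_upwards [eventually_all.2 hc2, hM', Metric.ball_mem_nhds s₀ hr0] with s h1 h2 h3 hP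
      have hoff : (s, t) ∈ R ∩ (offHyperplanes S.formW ∩ offHyperplanes S.formV) :=
        ⟨hball s h3 t hs.2, fun p => hP _ _ p.2, fun p => hs.1 _ _ p.2⟩
      refine (norm_le_sum_abs _).trans (Finset.sum_le_sum fun i _ => ?_)
      have e1 := h1 i
      have e2 := h2 i hoff
      have e3 : |ϑZ (s, t) i| ≤ |ϑY (s, t) i| + |ϑY (s, t) i - ϑZ (s, t) i| := by
        have := abs_sub (ϑY (s, t) i) (ϑY (s, t) i - ϑZ (s, t) i)
        rwa [sub_sub_cancel] at this
      linarith) (by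
      filter_upwards [Metric.ball_mem_nhds s₀ hr0] with s hs hP x hx y hy
      obtain ⟨j, hj⟩ := S.isSimplexEdges_edgeW.exists_mem_normalCone hP
      have hd : ∀ z ∈ Metric.ball t₀ r, HasFDerivAt (fun t => ϑZ (s, t))
          ((fderiv ℝ ϑZ (s, z)).comp (ContinuousLinearMap.inr ℝ _ _)) z := fun z hz => by
        have h1 := ((H.facts_W (j := j) ⟨hball s hs z hz, hj⟩).2.1.differentiableAt
          (by simp)).hasFDerivAt
        exact h1.comp z (hasFDerivAt_prodMk_right s z)
      refine inner_sub_nonneg_of_fderiv (convex_ball t₀ r) (fun z hz => (hd z hz).differentiableAt)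
        (fun z hz u => ?_) hx hy
      rw [(hd z hz).fderiv]
      exact H.inner_fderiv_theta_nonneg (j := j) ⟨hball s hs z hz, hj⟩ u)
  have hswap : Tendsto (fun z : Base n l => (z.2, z.1)) (𝓝 (s₀, t₀)) (𝓝 (t₀, s₀)) :=
    continuous_swap.tendsto (s₀, t₀)
  refine ⟨M, (hswap.eventually hM).mono fun z hz hz' => ?_⟩
  exact (PiLp.norm_apply_le _ p).trans (hz fun a b hab => hz'.2.1 ⟨(a, b), hab⟩)

/-- On a cell the mixed derivative of the jump between the two gradients is the constant `D`. -/
theorem fderiv_theta_sub {q : Base n l} (hq : q ∈ R) {j : Fin (n + 1)} {a : Fin (l + 1)}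
    (hj : q.1 ∈ normalCone S.edgeW j) (ha : q.2 ∈ normalCone S.edgeV a) (i : Fin n) (p : Fin l) :
    fderiv ℝ (fun q => -ϑZ q p) q (sdir i) - fderiv ℝ (fun q => -ϑY q p) q (sdir i) =
      D j a i p := by
  have hZ := ((H.facts_W ⟨hq, hj⟩).2.1.coord p).differentiableAt (by simp)
  have hY := ((H.facts_V ⟨hq, ha⟩).2.1.coord p).differentiableAt (by simp)
  set L : Base n l →L[ℝ] ℝ := ∑ i, D j a i p •
    (EuclideanSpace.proj i : EuclideanSpace ℝ (Fin n) →L[ℝ] ℝ).comp (ContinuousLinearMap.fst ℝ _ _)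
    with hL
  have hLa : ∀ x : Base n l, L x = ∑ i, D j a i p * x.1 i := fun x => by simp [hL]
  have hev : (fun q => ϑY q p - ϑZ q p) =ᶠ[𝓝 q] fun q => C j a p + L q := by
    filter_upwards [(S.isOpen_chartW hR j).mem_nhds ⟨hq, hj⟩,
      (S.isOpen_chartV hR a).mem_nhds ⟨hq, ha⟩] with x h1 h2
    rw [H.diff_t j a x h1.1 h1.2 h2.2, hLa]
  have h1 : HasFDerivAt (fun q => ϑY q p - ϑZ q p) L q :=
    (L.hasFDerivAt.const_add (C j a p)).congr_of_eventuallyEq hev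
  have h2 := (hY.hasFDerivAt.sub hZ.hasFDerivAt).unique h1
  rw [fderiv_fun_neg, fderiv_fun_neg]
  have h3 := congrArg (fun T : Base n l →L[ℝ] ℝ => T (sdir i)) h2
  rw [hLa] at h3
  simp only [sdir, sub_apply] at h3 ⊢
  simp only [neg_apply]
  have h4 : ∑ i', D j a i' p * (EuclideanSpace.single i (1 : ℝ) : EuclideanSpace ℝ (Fin n)) i' =
      D j a i p := by simp
  rw [← h4, ← h3]
  ring

/-- For each pair of coordinates, the gradients in the charts `v_a` and in the charts `w_j` form a
mixed pair: the former are smooth across the walls of `τ`, the latter across those of `σ`. -/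
theorem isMixedPair (i : Fin n) (p : Fin l) : IsMixedPair R S.formW S.formV (sdir i) (tdir p)
    (fun q => ηY q i) (fun q => -ϑY q p) (fun q => ηZ q i) (fun q => -ϑZ q p)
    (fun q => fderiv ℝ (fun q => -ϑZ q p) q (sdir i) - fderiv ℝ (fun q => -ϑY q p) q (sdir i)) where
  dir_u j := S.formV_sdir j i
  dir_v j := S.formW_tdir j p
  smooth_Ys q hq := by
    obtain ⟨a, ha⟩ := S.exists_mem_of_offV hq.2
    exact (ContDiffAt.coord (H.facts_V ⟨hq.1, ha⟩).1 i).contDiffWithinAt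
  smooth_Yt q hq := by
    obtain ⟨a, ha⟩ := S.exists_mem_of_offV hq.2
    exact (ContDiffAt.coord (H.facts_V ⟨hq.1, ha⟩).2.1 p).neg.contDiffWithinAt
  smooth_Zs q hq := by
    obtain ⟨a, ha⟩ := S.exists_mem_of_offW hq.2
    exact (ContDiffAt.coord (H.facts_W ⟨hq.1, ha⟩).1 i).contDiffWithinAt
  smooth_Zt q hq := by
    obtain ⟨a, ha⟩ := S.exists_mem_of_offW hq.2
    exact (ContDiffAt.coord (H.facts_W ⟨hq.1, ha⟩).2.1 p).neg.contDiffWithinAt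
  closed_Y q hq := by
    obtain ⟨a, ha⟩ := S.exists_mem_of_offV hq.2
    rw [(H.facts_V ⟨hq.1, ha⟩).2.2.2.2, fderiv_fun_neg]; rfl
  closed_Z q hq := by
    obtain ⟨a, ha⟩ := S.exists_mem_of_offW hq.2
    rw [(H.facts_W ⟨hq.1, ha⟩).2.2.2.2, fderiv_fun_neg]; rfl
  mixed q hq := rfl
  bdd_Ys := H.bdd_eta hR i
  bdd_Zs := by
    intro q hq
    obtain ⟨M, hM⟩ := H.bdd_eta hR i q hq
    obtain ⟨M', hM'⟩ := H.bdd_diff_s i q hq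
    refine ⟨M + M', ?_⟩
    filter_upwards [hM, hM'] with x h1 h2 hx
    have := abs_add_le (ηY x i) (ηZ x i - ηY x i)
    rw [add_sub_cancel] at this
    exact this.trans (add_le_add (h1 hx) (h2 hx))
  bdd_Zt := by simpa only [LocallyBoundedOn, abs_neg] using H.bdd_theta hR p
  bdd_Yt := by
    intro q hq
    obtain ⟨M, hM⟩ := H.bdd_theta hR p q hq
    obtain ⟨M', hM'⟩ := H.bdd_diff_t p q hq
    refine ⟨M + M', ?_⟩
    filter_upwards [hM, hM'] with x h1 h2 hx
    have := abs_add_le (ϑZ x p) (ϑY x p - ϑZ x p)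
    rw [add_sub_cancel] at this
    rw [abs_neg]
    exact this.trans (add_le_add (h1 hx) (h2 hx))
  bdd_b := by
    refine LocallyBoundedOn.of_continuous (M := fun _ => ∑ j, ∑ a, |D j a i p|) (by fun_prop)
      fun q hq => ?_
    obtain ⟨j, hj⟩ := S.exists_mem_of_offW hq.2.1
    obtain ⟨a, ha⟩ := S.exists_mem_of_offV hq.2.2
    rw [H.fderiv_theta_sub hR hq.1 hj ha]
    exact (Finset.single_le_sum (f := fun a => |D j a i p|) (fun a _ => abs_nonneg _)
      (Finset.mem_univ a)).trans (Finset.single_le_sum (f := fun j => ∑ a, |D j a i p|)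
        (fun j _ => Finset.sum_nonneg fun a _ => abs_nonneg _) (Finset.mem_univ j))

end IsGlued

end glue2

/-! ### Integrability of the Hessians and the weak form of the equation -/

theorem exists_isTest_eventually_ge {E : Type*} [NormedAddCommGroup E] [NormedSpace ℝ E]
    [FiniteDimensional ℝ E] {R : Set E} (hR : IsOpen R) {q : E} (hq : q ∈ R) :
    ∃ φ : E → ℝ, IsTest R φ ∧ (∀ x, 0 ≤ φ x) ∧ ∀ᶠ x in 𝓝 q, 1 / 2 ≤ φ x := by
  obtain ⟨φ, h1, h2, h3, h4, h5⟩ := exists_contDiff_tsupport_subset (n := ⊤) (hR.mem_nhds hq)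
  refine ⟨φ, ⟨h3, h2, h1⟩, fun x => (h4 (mem_range_self x)).1, ?_⟩
  have : ∀ᶠ x in 𝓝 q, φ x ∈ Ioi (1 / 2 : ℝ) := h3.continuous.continuousAt.preimage_mem_nhds
    (Ioi_mem_nhds (by rw [h5]; norm_num))
  exact this.mono fun x hx => le_of_lt hx

/-- A measurable function is locally integrable if its products with test functions can be bounded
by integrable functions. -/
theorem locallyIntegrableOn_of_test {E : Type*} [NormedAddCommGroup E] [NormedSpace ℝ E]
    [FiniteDimensional ℝ E] [MeasurableSpace E] [BorelSpace E] {μ : Measure E}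
    {R Ω : Set E} (hR : IsOpen R) (hΩ : IsOpen Ω) (hΩR : Ω ⊆ R) (hae : ∀ᵐ x ∂μ, x ∈ R → x ∈ Ω)
    {F : E → ℝ} (hF : ContinuousOn F Ω)
    (h : ∀ φ, IsTest R φ → (∀ x, 0 ≤ φ x) → ∃ G, Integrable G μ ∧ ∀ᵐ x ∂μ, |F x * φ x| ≤ G x) :
    LocallyIntegrableOn F R μ := by
  intro q hq
  obtain ⟨φ, hφ, h0, hev⟩ := exists_isTest_eventually_ge hR hq
  obtain ⟨G, hG, hb⟩ := h φ hφ h0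
  obtain ⟨U, hUs, hUo, hqU⟩ := mem_nhds_iff.1 hev
  refine ⟨U ∩ R, inter_mem (mem_nhdsWithin_of_mem_nhds (hUo.mem_nhds hqU)) self_mem_nhdsWithin, ?_⟩
  have hm : MeasurableSet (U ∩ R) := (hUo.inter hR).measurableSet
  have hset : (U ∩ Ω : Set E) =ᵐ[μ] (U ∩ R : Set E) := by
    filter_upwards [hae] with x hx
    exact propext ⟨fun h => ⟨h.1, hΩR h.2⟩, fun h => ⟨h.1, hx h.2⟩⟩
  refine Integrable.mono' (hG.const_mul 2).integrableOn ?_ ?_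
  · rw [← Measure.restrict_congr_set hset]
    exact (hF.mono inter_subset_right).aestronglyMeasurable (hUo.inter hΩ).measurableSet
  · rw [ae_restrict_iff' hm]
    filter_upwards [hb] with x hx hxU
    have h1 : 1 / 2 ≤ φ x := hUs hxU.1
    rw [abs_mul, abs_of_nonneg (h0 x)] at hx
    rw [Real.norm_eq_abs]
    nlinarith [abs_nonneg (F x)]

theorem MeasureTheory.LocallyIntegrableOn.integrable_mul_test {E : Type*} [NormedAddCommGroup E] [NormedSpace ℝ E]
    [FiniteDimensional ℝ E] [MeasurableSpace E] [BorelSpace E] {μ : Measure E}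
    {R : Set E} {F φ : E → ℝ} (hF : LocallyIntegrableOn F R μ) (hφ : IsTest R φ) :
    Integrable (fun x => F x * φ x) μ := by
  have h1 := (hF.integrableOn_compact_subset hφ.supp hφ.compact).mul_continuousOn
    hφ.smooth.continuous.continuousOn hφ.compact
  refine (integrableOn_iff_integrable_of_support_subset ?_).1 h1
  refine (Function.support_mul_subset_right F φ).trans (subset_tsupport φ)

section weak

variable {n l : ℕ}

namespace SimplexPair

variable (S : SimplexPair n l) {R : Set (Base n l)}

theorem mem_regular_of_offV {q : Base n l} (hq : q ∈ R ∩ offHyperplanes S.formV) :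
    q ∈ S.regular R := by
  obtain ⟨a, ha⟩ := S.exists_mem_of_offV hq.2
  exact S.chartV_subset a ⟨hq.1, ha⟩

theorem mem_regular_of_offW {q : Base n l} (hq : q ∈ R ∩ offHyperplanes S.formW) :
    q ∈ S.regular R := by
  obtain ⟨a, ha⟩ := S.exists_mem_of_offW hq.2
  exact S.chartW_subset a ⟨hq.1, ha⟩

end SimplexPair

namespace IsGlued

variable {S : SimplexPair n l} {R : Set (Base n l)}
  {V : Base n l → Matrix (Fin n) (Fin n) ℝ} {W : Base n l → Matrix (Fin l) (Fin l) ℝ}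
  {ηY ηZ : Base n l → EuclideanSpace ℝ (Fin n)} {ϑY ϑZ : Base n l → EuclideanSpace ℝ (Fin l)}
  {B : Fin (n + 1) → Fin (l + 1) → Fin n → ℝ} {C : Fin (n + 1) → Fin (l + 1) → Fin l → ℝ}
  {D : Fin (n + 1) → Fin (l + 1) → Fin n → Fin l → ℝ}
  (H : IsGlued S R V W ηY ηZ ϑY ϑZ B C D) (hR : IsOpen R)

include H

theorem fderiv_eta_eq {q : Base n l} (hq : q ∈ R ∩ offHyperplanes S.formV) (i j : Fin n) :
    fderiv ℝ (fun x => ηY x i) q (sdir j) = V q i j := by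
  obtain ⟨a, ha⟩ := S.exists_mem_of_offV hq.2
  exact (H.facts_V ⟨hq.1, ha⟩).2.2.1 i j

theorem fderiv_theta_eq {q : Base n l} (hq : q ∈ R ∩ offHyperplanes S.formW) (i j : Fin l) :
    fderiv ℝ (fun x => ϑZ x i) q (tdir j) = W q i j := by
  obtain ⟨a, ha⟩ := S.exists_mem_of_offW hq.2
  exact (H.facts_W ⟨hq.1, ha⟩).2.2.2.1 i j

theorem eta_smooth (i : Fin n) : ContDiffOn ℝ ∞ (fun q => ηY q i) (R ∩ offHyperplanes S.formV) :=
  fun q hq => by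
    obtain ⟨a, ha⟩ := S.exists_mem_of_offV hq.2
    exact (ContDiffAt.coord (H.facts_V ⟨hq.1, ha⟩).1 i).contDiffWithinAt

theorem theta_smooth (i : Fin l) : ContDiffOn ℝ ∞ (fun q => ϑZ q i) (R ∩ offHyperplanes S.formW) :=
  fun q hq => by
    obtain ⟨a, ha⟩ := S.exists_mem_of_offW hq.2
    exact (ContDiffAt.coord (H.facts_W ⟨hq.1, ha⟩).2.1 i).contDiffWithinAt

include hR

/-- A diagonal entry of `V` is a nonnegative derivative of a locally bounded function, hence locally
integrable; positivity of the matrix bounds the other entries by the diagonal ones. -/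
theorem locallyIntegrableOn_V (i j : Fin n) : LocallyIntegrableOn (fun q => V q i j) R := by
  have hopen := hR.inter (isOpen_offHyperplanes S.formV)
  refine locallyIntegrableOn_of_test hR hopen inter_subset_left
    (S.ae_offV.mono fun x hx h => ⟨h, hx⟩) ?_ fun φ hφ h0 => ?_
  · exact ((H.eta_smooth i).continuousOn_fderiv_apply hopen (sdir j)).congr fun q hq =>
      (H.fderiv_eta_eq hq i j).symm
  · have hd : ∀ i, Integrable (fun x => V x i i * φ x) := fun i => by
      refine (integrable_fderiv_of_parallel (μ := volume)
        (IsMixedPair.ne_zero_of_apply S.formV_dirV) hR (H.eta_smooth i) hφ h0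
        (u := sdir i) (fun p => S.formV_sdir p i) ?_ fun x hx => ?_).congr ?_
      · exact (H.bdd_eta hR i).integrable_mul_test
          (hR.inter ((isOpen_offHyperplanes _).inter (isOpen_offHyperplanes _)))
          ((S.ae_offW.and S.ae_offV).mono fun _ h h' => ⟨h', h⟩)
          ((H.eta_smooth i).mono
            (inter_subset_inter_right R inter_subset_right)).continuousOn (hφ.fderiv _)
      · rw [H.fderiv_eta_eq hx]
        exact (H.posV x (S.mem_regular_of_offV hx)).posSemidef.diag_nonneg
      · filter_upwards [S.ae_offV] with x hx
        by_cases hxR : x ∈ R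
        · rw [H.fderiv_eta_eq ⟨hxR, hx⟩]
        · rw [hφ.eq_zero hxR, mul_zero, mul_zero]
    refine ⟨_, (hd i).add (hd j), ?_⟩
    filter_upwards [S.ae_offV] with x hx
    by_cases hxR : x ∈ R
    · have hp := H.posV x (S.mem_regular_of_offV ⟨hxR, hx⟩)
      have h1 := hp.posSemidef.dotProduct_mulVec_nonneg (Pi.single i 1 + Pi.single j 1)
      have h2 := hp.posSemidef.dotProduct_mulVec_nonneg (Pi.single i 1 - Pi.single j 1)
      have h3 : V x j i = V x i j := by simpa using hp.1.apply i j
      have h4 := hp.posSemidef.diag_nonneg (i := i)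
      have h5 := hp.posSemidef.diag_nonneg (i := j)
      simp [Matrix.mulVec_add, Matrix.mulVec_sub, h3] at h1 h2
      rw [abs_mul, abs_of_nonneg (h0 x), Pi.add_apply, ← add_mul]
      refine mul_le_mul_of_nonneg_right (abs_le.2 ⟨?_, ?_⟩) (h0 x) <;> linarith
    · simp [hφ.eq_zero hxR]

/-- The mirror image of `locallyIntegrableOn_V`. -/
theorem locallyIntegrableOn_W (i j : Fin l) : LocallyIntegrableOn (fun q => W q i j) R := by
  have hopen := hR.inter (isOpen_offHyperplanes S.formW)
  refine locallyIntegrableOn_of_test hR hopen inter_subset_left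
    (S.ae_offW.mono fun x hx h => ⟨h, hx⟩) ?_ fun φ hφ h0 => ?_
  · exact ((H.theta_smooth i).continuousOn_fderiv_apply hopen (tdir j)).congr fun q hq =>
      (H.fderiv_theta_eq hq i j).symm
  · have hd : ∀ i, Integrable (fun x => W x i i * φ x) := fun i => by
      refine (integrable_fderiv_of_parallel (μ := volume)
        (IsMixedPair.ne_zero_of_apply S.formW_dirW) hR (H.theta_smooth i) hφ h0
        (u := tdir i) (fun p => S.formW_tdir p i) ?_ fun x hx => ?_).congr ?_
      · exact (H.bdd_theta hR i).integrable_mul_test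
          (hR.inter ((isOpen_offHyperplanes _).inter (isOpen_offHyperplanes _)))
          ((S.ae_offW.and S.ae_offV).mono fun _ h h' => ⟨h', h⟩)
          ((H.theta_smooth i).mono
            (inter_subset_inter_right R inter_subset_left)).continuousOn (hφ.fderiv _)
      · rw [H.fderiv_theta_eq hx]
        exact (H.posW x (S.mem_regular_of_offW hx)).posSemidef.diag_nonneg
      · filter_upwards [S.ae_offW] with x hx
        by_cases hxR : x ∈ R
        · rw [H.fderiv_theta_eq ⟨hxR, hx⟩]
        · rw [hφ.eq_zero hxR, mul_zero, mul_zero]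
    refine ⟨_, (hd i).add (hd j), ?_⟩
    filter_upwards [S.ae_offW] with x hx
    by_cases hxR : x ∈ R
    · have hp := H.posW x (S.mem_regular_of_offW ⟨hxR, hx⟩)
      have h1 := hp.posSemidef.dotProduct_mulVec_nonneg (Pi.single i 1 + Pi.single j 1)
      have h2 := hp.posSemidef.dotProduct_mulVec_nonneg (Pi.single i 1 - Pi.single j 1)
      have h3 : W x j i = W x i j := by simpa using hp.1.apply i j
      have h4 := hp.posSemidef.diag_nonneg (i := i)
      have h5 := hp.posSemidef.diag_nonneg (i := j)
      simp [Matrix.mulVec_add, Matrix.mulVec_sub, h3] at h1 h2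
      rw [abs_mul, abs_of_nonneg (h0 x), Pi.add_apply, ← add_mul]
      refine mul_le_mul_of_nonneg_right (abs_le.2 ⟨?_, ?_⟩) (h0 x) <;> linarith
    · simp [hφ.eq_zero hxR]

theorem integral_V_mul {φ : Base n l → ℝ} (hφ : IsTest R φ) (i j : Fin n) :
    ∫ x, V x i j * φ x = -∫ x, ηY x i * fderiv ℝ φ x (sdir j) := by
  have hcongr : ∀ᵐ x : Base n l, V x i j * φ x = fderiv ℝ (fun x => ηY x i) x (sdir j) * φ x := by
    filter_upwards [S.ae_offV] with x hx
    by_cases hxR : x ∈ R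
    · rw [H.fderiv_eta_eq ⟨hxR, hx⟩]
    · rw [hφ.eq_zero hxR, mul_zero, mul_zero]
  rw [integral_mul_fderiv_of_parallel (μ := volume)
    (IsMixedPair.ne_zero_of_apply S.formV_dirV) hR (H.eta_smooth i) hφ
    (fun p => S.formV_sdir p j) ?_ ?_, neg_neg, integral_congr_ae hcongr]
  · exact (H.bdd_eta hR i).integrable_mul_test
      (hR.inter ((isOpen_offHyperplanes _).inter (isOpen_offHyperplanes _)))
      ((S.ae_offW.and S.ae_offV).mono fun _ h h' => ⟨h', h⟩)
      ((H.eta_smooth i).mono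
        (inter_subset_inter_right R inter_subset_right)).continuousOn (hφ.fderiv _)
  · exact ((H.locallyIntegrableOn_V hR i j).integrable_mul_test hφ).congr hcongr

theorem integral_W_mul {φ : Base n l → ℝ} (hφ : IsTest R φ) (i j : Fin l) :
    ∫ x, W x i j * φ x = -∫ x, ϑZ x i * fderiv ℝ φ x (tdir j) := by
  have hcongr : ∀ᵐ x : Base n l, W x i j * φ x = fderiv ℝ (fun x => ϑZ x i) x (tdir j) * φ x := by
    filter_upwards [S.ae_offW] with x hx
    by_cases hxR : x ∈ R
    · rw [H.fderiv_theta_eq ⟨hxR, hx⟩]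
    · rw [hφ.eq_zero hxR, mul_zero, mul_zero]
  rw [integral_mul_fderiv_of_parallel (μ := volume)
    (IsMixedPair.ne_zero_of_apply S.formW_dirW) hR (H.theta_smooth i) hφ
    (fun p => S.formW_tdir p j) ?_ ?_, neg_neg, integral_congr_ae hcongr]
  · exact (H.bdd_theta hR i).integrable_mul_test
      (hR.inter ((isOpen_offHyperplanes _).inter (isOpen_offHyperplanes _)))
      ((S.ae_offW.and S.ae_offV).mono fun _ h h' => ⟨h', h⟩)
      ((H.theta_smooth i).mono
        (inter_subset_inter_right R inter_subset_left)).continuousOn (hφ.fderiv _)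
  · exact ((H.locallyIntegrableOn_W hR i j).integrable_mul_test hφ).congr hcongr

end IsGlued

/-- The product of the normal cones of two vertices. -/
def SimplexPair.cell (S : SimplexPair n l) (c : Fin (n + 1) × Fin (l + 1)) : Set (Base n l) :=
  normalCone S.edgeW c.1 ×ˢ normalCone S.edgeV c.2

/-- The integrand on the cell `c` of the left hand side of the distributional equation, tested with
a function whose derivative in the two directions that belong to the second indices is `χ`. -/
def cellIntegrand (B : Fin (n + 1) → Fin (l + 1) → Fin n → ℝ)
    (C : Fin (n + 1) → Fin (l + 1) → Fin l → ℝ)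
    (D : Fin (n + 1) → Fin (l + 1) → Fin n → Fin l → ℝ) (i : Fin n) (p : Fin l)
    (χ : Base n l → ℝ) (c : Fin (n + 1) × Fin (l + 1)) (x : Base n l) : ℝ :=
  (C c.1 c.2 p + ∑ r, D c.1 c.2 r p * x.1 r) * fderiv ℝ χ x (sdir i) +
    (B c.1 c.2 i + ∑ r, D c.1 c.2 i r * x.2 r) * fderiv ℝ χ x (tdir p) + D c.1 c.2 i p * χ x

theorem integrable_cellIntegrand {B : Fin (n + 1) → Fin (l + 1) → Fin n → ℝ}
    {C : Fin (n + 1) → Fin (l + 1) → Fin l → ℝ}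
    {D : Fin (n + 1) → Fin (l + 1) → Fin n → Fin l → ℝ} {i : Fin n} {p : Fin l}
    {χ : Base n l → ℝ} {R : Set (Base n l)} (hχ : IsTest R χ) (c : Fin (n + 1) × Fin (l + 1)) :
    Integrable (cellIntegrand B C D i p χ c) := by
  have key : ∀ {g φ : Base n l → ℝ}, Continuous g → IsTest R φ → Integrable fun x => g x * φ x :=
    fun hg hφ => (hg.mul hφ.smooth.continuous).integrable_of_hasCompactSupport hφ.compact.mul_left
  exact ((key (by fun_prop) (hχ.fderiv _)).add (key (by fun_prop) (hχ.fderiv _))).add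
    (key continuous_const hχ)

namespace SimplexPair

variable (S : SimplexPair n l)

theorem measurableSet_cell (c) : MeasurableSet (S.cell c) :=
  ((isOpen_normalCone _ _).prod (isOpen_normalCone _ _)).measurableSet

theorem integral_eq_sum_cell {f : Base n l → ℝ} {G : Fin (n + 1) × Fin (l + 1) → Base n l → ℝ}
    (hG : ∀ c, Integrable (G c)) (hf : ∀ c, ∀ x ∈ S.cell c, f x = G c x) :
    ∫ x, f x = ∑ c, ∫ x in S.cell c, G c x := by
  have hi : ∀ c, IntegrableOn f (S.cell c) := fun c =>
    (hG c).integrableOn.congr_fun (fun x hx => (hf c x hx).symm) (S.measurableSet_cell c)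
  have hu : (univ : Set (Base n l)) =ᵐ[volume] ⋃ c, S.cell c := by
    filter_upwards [S.ae_offW, S.ae_offV] with x h1 h2
    obtain ⟨j, hj⟩ := S.exists_mem_of_offW h1
    obtain ⟨a, ha⟩ := S.exists_mem_of_offV h2
    have : x ∈ ⋃ c, S.cell c := mem_iUnion.2 ⟨(j, a), hj, ha⟩
    exact propext (iff_of_true (mem_univ x) this)
  rw [← setIntegral_univ, setIntegral_congr_set hu, integral_iUnion_fintype S.measurableSet_cell
    (fun c c' hcc => Set.disjoint_left.2 fun x h h' => hcc (Prod.ext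
      (S.isSimplexEdges_edgeW.normalCone_unique h.1 h'.1)
      (S.isSimplexEdges_edgeV.normalCone_unique h.2 h'.2))) hi]
  exact Finset.sum_congr rfl fun c _ => setIntegral_congr_fun (S.measurableSet_cell c) (hf c)

end SimplexPair

/-- The current of a split solution, paired with a test function, is a sum over the cells that
involves only the biaffine jumps `B`, `C`, `D` of the potentials. -/
theorem IsGlued.integral_current {S : SimplexPair n l} {R : Set (Base n l)}
    {V : Base n l → Matrix (Fin n) (Fin n) ℝ} {W : Base n l → Matrix (Fin l) (Fin l) ℝ}
    {ηY ηZ : Base n l → EuclideanSpace ℝ (Fin n)} {ϑY ϑZ : Base n l → EuclideanSpace ℝ (Fin l)}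
    {B : Fin (n + 1) → Fin (l + 1) → Fin n → ℝ} {C : Fin (n + 1) → Fin (l + 1) → Fin l → ℝ}
    {D : Fin (n + 1) → Fin (l + 1) → Fin n → Fin l → ℝ}
    (H : IsGlued S R V W ηY ηZ ϑY ϑZ B C D) (hR : IsOpen R) {ψ : Base n l → ℝ} (hψ : IsTest R ψ)
    (i j : Fin n) (p q : Fin l) :
    ∫ x, (W x p q * secondDeriv ψ x (sdir i) (sdir j) +
        V x i j * secondDeriv ψ x (tdir p) (tdir q)) =
      ∑ c, ∫ x in S.cell c, cellIntegrand B C D i p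
        (fun x => fderiv ℝ (fun y => fderiv ℝ ψ y (tdir q)) x (sdir j)) c x := by
  set χ : Base n l → ℝ := fun x => fderiv ℝ (fun y => fderiv ℝ ψ y (tdir q)) x (sdir j) with hχd
  have hχ : IsTest R χ := (hψ.fderiv _).fderiv _
  have e1 : IsTest R fun x => secondDeriv ψ x (sdir i) (sdir j) := (hψ.fderiv _).fderiv _
  have e2 : IsTest R fun x => secondDeriv ψ x (tdir p) (tdir q) := (hψ.fderiv _).fderiv _
  have c1 : ∀ x, fderiv ℝ (fun x => secondDeriv ψ x (sdir i) (sdir j)) x (tdir q) =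
      fderiv ℝ χ x (sdir i) := fun x => by
    have a1 : (fun y => fderiv ℝ (fun y => fderiv ℝ ψ y (sdir i)) y (tdir q)) =
        fun y => fderiv ℝ (fun y => fderiv ℝ ψ y (tdir q)) y (sdir i) :=
      funext fun y => fderiv_apply_comm hψ.smooth _ _ y
    calc _ = fderiv ℝ (fun y => fderiv ℝ (fun y => fderiv ℝ ψ y (sdir i)) y (tdir q)) x (sdir j) :=
          fderiv_apply_comm (hψ.fderiv (sdir i)).smooth _ _ x
      _ = fderiv ℝ (fun y => fderiv ℝ (fun y => fderiv ℝ ψ y (tdir q)) y (sdir i)) x (sdir j) := by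
          rw [a1]
      _ = _ := fderiv_apply_comm (hψ.fderiv (tdir q)).smooth _ _ x
  have c2 : ∀ x, fderiv ℝ (fun x => secondDeriv ψ x (tdir p) (tdir q)) x (sdir j) =
      fderiv ℝ χ x (tdir p) := fun x => by
    have a1 : (fun y => fderiv ℝ (fun y => fderiv ℝ ψ y (tdir p)) y (tdir q)) =
        fun y => fderiv ℝ (fun y => fderiv ℝ ψ y (tdir q)) y (tdir p) :=
      funext fun y => fderiv_apply_comm hψ.smooth _ _ y
    change fderiv ℝ (fun y => fderiv ℝ (fun y => fderiv ℝ ψ y (tdir p)) y (tdir q)) x (sdir j) = _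
    rw [a1]
    exact fderiv_apply_comm (hψ.fderiv (tdir q)).smooth _ _ x
  -- One derivative of each term is moved onto the test function, before the equation for the mixed
  -- pair is used.
  have M := H.isMixedPair hR i p
  rw [integral_add ((H.locallyIntegrableOn_W hR p q).integrable_mul_test e1)
    ((H.locallyIntegrableOn_V hR i j).integrable_mul_test e2), H.integral_W_mul hR e1,
    H.integral_V_mul hR e2]
  simp only [c1, c2]
  have i1 := (M.integrable_Zt (μ := volume) hR S.formW_dirW S.formV_dirV (hχ.fderiv (sdir i)))
  have i2 := (M.integrable_Ys (μ := volume) hR S.formW_dirW S.formV_dirV (hχ.fderiv (tdir p)))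
  have h := M.integral_eq (μ := volume) hR S.formW_dirW (fun i j => S.formV_dirW j i) S.formV_dirV
    (fun i j => S.formW_dirV j i) hχ
  rw [integral_sub i1 i2] at h
  simp only [neg_mul, integral_neg] at h
  rw [← sub_eq_add_neg, h]
  refine S.integral_eq_sum_cell (fun c => integrable_cellIntegrand hχ c) fun c x hx => ?_
  by_cases hxR : x ∈ R
  · rw [H.fderiv_theta_sub hR hxR hx.1 hx.2, H.diff_s c.1 c.2 x hxR hx.1 hx.2 i]
    have := H.diff_t c.1 c.2 x hxR hx.1 hx.2 p
    simp only [cellIntegrand]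
    rw [← this]
    ring
  · simp [cellIntegrand, hχ.eq_zero hxR, (hχ.fderiv (sdir i)).eq_zero hxR,
      (hχ.fderiv (tdir p)).eq_zero hxR]

end weak

/-! ### The standard model of the singularity -/

namespace IsSimplexEdges

variable {k : ℕ} {c : Fin (k + 1) → Fin (k + 1) → EuclideanSpace ℝ (Fin k)}
  {x : Fin (k + 1) → EuclideanSpace ℝ (Fin k)}

/-- Integration by parts for the piecewise linear function `minForm x`, which is continuous and so
does not contribute a term on the walls. -/
theorem sum_integral_inner_mul_fderiv (h : IsSimplexEdges c x) {φ : EuclideanSpace ℝ (Fin k) → ℝ}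
    (hφ : IsTest univ φ) (u : EuclideanSpace ℝ (Fin k)) :
    ∑ j, ∫ s in normalCone c j, inner ℝ (x j) s * fderiv ℝ φ s u =
      -∑ j, inner ℝ (x j) u * ∫ s in normalCone c j, φ s := by
  have hd : Differentiable ℝ φ := hφ.smooth.differentiable (by simp)
  obtain ⟨K, hK⟩ := minForm_lipschitz x
  obtain ⟨K', hK'⟩ := (hφ.smooth.of_le (m := 1) (by simp)).lipschitzWith_of_hasCompactSupport
    hφ.compact (by simp)
  have h1 := hK.integral_lineDeriv_mul_eq (μ := volume) hK' hφ.compact u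
  have h2 : ∀ s, lineDeriv ℝ φ s (-u) * minForm x s = -(minForm x s * fderiv ℝ φ s u) := fun s => by
    rw [(hd s).lineDeriv_eq_fderiv, map_neg]
    ring
  simp only [h2, integral_neg] at h1
  have hi1 : Integrable fun s => minForm x s * fderiv ℝ φ s u :=
    ((continuous_minForm x).mul (hφ.fderiv u).smooth.continuous).integrable_of_hasCompactSupport
      (hφ.fderiv u).compact.mul_left
  have hlin : ∀ j, ∀ s ∈ normalCone c j, lineDeriv ℝ (minForm x) s u = inner ℝ (x j) u :=
    fun j s hs => by
    have hev : minForm x =ᶠ[𝓝 s] innerSL ℝ (x j) := by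
      filter_upwards [(isOpen_normalCone c j).mem_nhds hs] with y hy
      simpa using h.minForm_eq hy
    rw [hev.lineDeriv_eq, ((innerSL ℝ (x j)).differentiableAt).lineDeriv_eq_fderiv,
      ContinuousLinearMap.fderiv]
    simp
  have hi2 : Integrable fun s => lineDeriv ℝ (minForm x) s u * φ s := by
    obtain ⟨M, hM⟩ : ∃ M : ℝ, ∀ j, |inner ℝ (x j) u| ≤ M :=
      ⟨∑ j, |inner ℝ (x j) u|, fun j => Finset.single_le_sum (f := fun j => |inner ℝ (x j) u|)
        (fun _ _ => abs_nonneg _) (Finset.mem_univ j)⟩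
    refine (hφ.smooth.continuous.integrable_of_hasCompactSupport hφ.compact).bdd_mul
      ((measurable_lineDeriv (continuous_minForm x)).aestronglyMeasurable) (c := M) ?_
    filter_upwards [h.ae_mem_normalCone] with s hs
    obtain ⟨j, hj⟩ := hs
    rw [hlin j s hj]
    exact hM j
  rw [h.integral_eq_sum hi1, h.integral_eq_sum hi2] at h1
  have e1 : ∀ j, ∫ s in normalCone c j, lineDeriv ℝ (minForm x) s u * φ s =
      inner ℝ (x j) u * ∫ s in normalCone c j, φ s := fun j => by
    rw [← integral_const_mul]
    refine setIntegral_congr_fun (isOpen_normalCone c j).measurableSet fun s hs => ?_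
    simp only [hlin j s hs]
  have e2 : ∀ j, ∫ s in normalCone c j, minForm x s * fderiv ℝ φ s u =
      ∫ s in normalCone c j, inner ℝ (x j) s * fderiv ℝ φ s u := fun j =>
    setIntegral_congr_fun (isOpen_normalCone c j).measurableSet fun s hs => by
      simp only [h.minForm_eq hs]
  simp only [e1, e2] at h1
  rw [h1, neg_neg]

end IsSimplexEdges

section slices

variable {n l : ℕ} {φ : Base n l → ℝ}

theorem IsTest.slice_fst (hφ : IsTest univ φ) (t : EuclideanSpace ℝ (Fin l)) :
    IsTest univ fun s => φ (s, t) where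
  smooth := hφ.smooth.comp (contDiff_id.prodMk contDiff_const)
  compact := by
    refine HasCompactSupport.intro (hφ.compact.isCompact.image continuous_fst) fun s hs => ?_
    by_contra h0
    exact hs ⟨(s, t), subset_tsupport _ h0, rfl⟩
  supp := subset_univ _

theorem IsTest.slice_snd (hφ : IsTest univ φ) (s : EuclideanSpace ℝ (Fin n)) :
    IsTest univ fun t => φ (s, t) where
  smooth := hφ.smooth.comp (contDiff_const.prodMk contDiff_id)
  compact := by
    refine HasCompactSupport.intro (hφ.compact.isCompact.image continuous_snd) fun t hs => ?_
    by_contra h0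
    exact hs ⟨(s, t), subset_tsupport _ h0, rfl⟩
  supp := subset_univ _

theorem hasFDerivAt_slice_fst (hφ : IsTest univ φ) (s : EuclideanSpace ℝ (Fin n))
    (t : EuclideanSpace ℝ (Fin l)) : HasFDerivAt (fun s => φ (s, t))
      ((fderiv ℝ φ (s, t)).comp (ContinuousLinearMap.inl ℝ _ _)) s :=
  ((hφ.smooth.differentiable (by simp)) (s, t)).hasFDerivAt.comp s (hasFDerivAt_prodMk_left s t)

theorem fderiv_slice_fst (hφ : IsTest univ φ) (s u : EuclideanSpace ℝ (Fin n))
    (t : EuclideanSpace ℝ (Fin l)) : fderiv ℝ (fun s => φ (s, t)) s u = fderiv ℝ φ (s, t) (u, 0) := by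
  rw [(hasFDerivAt_slice_fst hφ s t).fderiv]; rfl

theorem fderiv_slice_snd (hφ : IsTest univ φ) (s : EuclideanSpace ℝ (Fin n))
    (t u : EuclideanSpace ℝ (Fin l)) : fderiv ℝ (fun t => φ (s, t)) t u = fderiv ℝ φ (s, t) (0, u) := by
  have h : HasFDerivAt (fun t => φ (s, t))
      ((fderiv ℝ φ (s, t)).comp (ContinuousLinearMap.inr ℝ _ _)) t :=
    ((hφ.smooth.differentiable (by simp)) (s, t)).hasFDerivAt.comp t (hasFDerivAt_prodMk_right s t)
  rw [h.fderiv]; rfl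

theorem setIntegral_prod_right {f : Base n l → ℝ} (hf : Integrable f)
    (A : Set (EuclideanSpace ℝ (Fin n))) (Q : Set (EuclideanSpace ℝ (Fin l))) :
    ∫ x in A ×ˢ Q, f x = ∫ t in Q, ∫ s in A, f (s, t) := by
  rw [Measure.volume_eq_prod] at hf ⊢
  rw [← setIntegral_prod_swap, setIntegral_prod (fun z => f z.swap) hf.swap.integrableOn]
  rfl

theorem integrable_slice_fst {f : Base n l → ℝ} (hf : Integrable f)
    (A : Set (EuclideanSpace ℝ (Fin n))) (Q : Set (EuclideanSpace ℝ (Fin l))) :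
    IntegrableOn (fun t => ∫ s in A, f (s, t)) Q := by
  have h1 : Integrable f ((volume.restrict A).prod (volume.restrict Q)) := by
    rw [Measure.prod_restrict]; exact hf.integrableOn
  exact h1.integral_prod_right

theorem integrable_slice_snd {f : Base n l → ℝ} (hf : Integrable f)
    (A : Set (EuclideanSpace ℝ (Fin n))) (Q : Set (EuclideanSpace ℝ (Fin l))) :
    IntegrableOn (fun s => ∫ t in Q, f (s, t)) A := by
  have h1 : Integrable f ((volume.restrict A).prod (volume.restrict Q)) := by
    rw [Measure.prod_restrict]; exact hf.integrableOn
  exact h1.integral_prod_left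

theorem IsTest.integrable (hφ : IsTest univ φ) : Integrable φ :=
  hφ.smooth.continuous.integrable_of_hasCompactSupport hφ.compact

theorem IsTest.integrable_mul (hφ : IsTest univ φ) {g : Base n l → ℝ} (hg : Continuous g) :
    Integrable fun x => g x * φ x :=
  (hg.mul hφ.smooth.continuous).integrable_of_hasCompactSupport hφ.compact.mul_left

theorem IsSimplexEdges.sum_integral_fst {c : Fin (n + 1) → Fin (n + 1) → EuclideanSpace ℝ (Fin n)}
    {x : Fin (n + 1) → EuclideanSpace ℝ (Fin n)} (h : IsSimplexEdges c x) (hφ : IsTest univ φ)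
    (u : EuclideanSpace ℝ (Fin n)) (Q : Set (EuclideanSpace ℝ (Fin l))) :
    ∑ j, ∫ z in normalCone c j ×ˢ Q, inner ℝ (x j) z.1 * fderiv ℝ φ z (u, 0) =
      -∑ j, inner ℝ (x j) u * ∫ z in normalCone c j ×ˢ Q, φ z := by
  have hi : ∀ j, Integrable fun z : Base n l => inner ℝ (x j) z.1 * fderiv ℝ φ z (u, 0) := fun j =>
    (hφ.fderiv (u, 0)).integrable_mul (by fun_prop)
  simp only [fun j => setIntegral_prod_right (hi j), setIntegral_prod_right hφ.integrable]
  rw [← integral_finsetSum _ fun j _ => integrable_slice_fst (hi j) _ _]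
  have hc : ∀ j, inner ℝ (x j) u * ∫ t in Q, ∫ s in normalCone c j, φ (s, t) =
      ∫ t in Q, inner ℝ (x j) u * ∫ s in normalCone c j, φ (s, t) := fun j =>
    (integral_const_mul _ _).symm
  simp only [hc]
  rw [← integral_finsetSum _ fun j _ => (integrable_slice_fst hφ.integrable _ _).const_mul _,
    ← integral_neg]
  refine integral_congr_ae (Eventually.of_forall fun t => ?_)
  have := h.sum_integral_inner_mul_fderiv (hφ.slice_fst t) u
  simpa only [fderiv_slice_fst hφ, integral_const_mul] using this

theorem IsSimplexEdges.sum_integral_snd {c : Fin (l + 1) → Fin (l + 1) → EuclideanSpace ℝ (Fin l)}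
    {x : Fin (l + 1) → EuclideanSpace ℝ (Fin l)} (h : IsSimplexEdges c x) (hφ : IsTest univ φ)
    (u : EuclideanSpace ℝ (Fin l)) (Q : Set (EuclideanSpace ℝ (Fin n))) :
    ∑ j, ∫ z in Q ×ˢ normalCone c j, inner ℝ (x j) z.2 * fderiv ℝ φ z (0, u) =
      -∑ j, inner ℝ (x j) u * ∫ z in Q ×ˢ normalCone c j, φ z := by
  have hi : ∀ j, Integrable fun z : Base n l => inner ℝ (x j) z.2 * fderiv ℝ φ z (0, u) := fun j =>
    (hφ.fderiv (0, u)).integrable_mul (by fun_prop)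
  have hp : ∀ {f : Base n l → ℝ}, Integrable f → ∀ j,
      ∫ z in Q ×ˢ normalCone c j, f z = ∫ s in Q, ∫ t in normalCone c j, f (s, t) :=
    fun hf j => setIntegral_prod _ hf.integrableOn
  simp only [fun j => hp (hi j), hp hφ.integrable]
  rw [← integral_finsetSum _ fun j _ => integrable_slice_snd (hi j) _ _]
  have hc : ∀ j, inner ℝ (x j) u * ∫ s in Q, ∫ t in normalCone c j, φ (s, t) =
      ∫ s in Q, inner ℝ (x j) u * ∫ t in normalCone c j, φ (s, t) := fun j =>
    (integral_const_mul _ _).symm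
  simp only [hc]
  rw [← integral_finsetSum _ fun j _ => (integrable_slice_snd hφ.integrable _ _).const_mul _,
    ← integral_neg]
  refine integral_congr_ae (Eventually.of_forall fun s => ?_)
  have := h.sum_integral_inner_mul_fderiv (hφ.slice_snd s) u
  simpa only [fderiv_slice_snd hφ, integral_const_mul] using this

/-- Differentiation under the integral sign. -/
theorem hasFDerivAt_setIntegral (hφ : IsTest univ φ) (Q : Set (EuclideanSpace ℝ (Fin l))) :
    ContDiff ℝ 1 (fun s => ∫ t in Q, φ (s, t)) ∧ HasCompactSupport (fun s => ∫ t in Q, φ (s, t)) ∧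
      ∀ s u, fderiv ℝ (fun s => ∫ t in Q, φ (s, t)) s u = ∫ t in Q, fderiv ℝ φ (s, t) (u, 0) := by
  have hd : Continuous (fderiv ℝ φ) := hφ.smooth.continuous_fderiv (by simp)
  set F' : EuclideanSpace ℝ (Fin n) → EuclideanSpace ℝ (Fin l) → EuclideanSpace ℝ (Fin n) →L[ℝ] ℝ :=
    fun s t => (fderiv ℝ φ (s, t)).comp (ContinuousLinearMap.inl ℝ _ _) with hF'
  have hF'c : Continuous fun z : Base n l => F' z.1 z.2 := hd.clm_comp continuous_const
  have hcomp : HasCompactSupport fun z : Base n l => F' z.1 z.2 :=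
    (hφ.compact.fderiv (𝕜 := ℝ)).comp_left
      (g := fun L : Base n l →L[ℝ] ℝ => L.comp (ContinuousLinearMap.inl ℝ _ _)) (by simp)
  obtain ⟨M, hM⟩ := hcomp.exists_bound_of_continuous hF'c
  set K : Set (EuclideanSpace ℝ (Fin l)) := Prod.snd '' tsupport fun z : Base n l => F' z.1 z.2
    with hK
  have hKc : IsCompact K := hcomp.isCompact.image continuous_snd
  have hb : ∀ s t, ‖F' s t‖ ≤ K.indicator (fun _ => M) t := fun s t => by
    by_cases ht : t ∈ K
    · rw [indicator_of_mem ht]; exact hM (s, t)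
    · have : F' s t = 0 := by
        by_contra h0
        exact ht ⟨(s, t), subset_tsupport _ h0, rfl⟩
      rw [this, norm_zero, indicator_of_notMem ht]
  have hbi : Integrable (K.indicator fun _ => M) (volume.restrict Q) :=
    ((integrable_indicator_iff hKc.measurableSet).2
      (integrableOn_const hKc.measure_lt_top.ne)).integrableOn
  have hmeas : ∀ s, AEStronglyMeasurable (F' s) (volume.restrict Q) := fun s =>
    (hF'c.comp (Continuous.prodMk_right s)).aestronglyMeasurable
  have hder : ∀ s, HasFDerivAt (fun s => ∫ t in Q, φ (s, t)) (∫ t in Q, F' s t) s := fun s =>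
    hasFDerivAt_integral_of_dominated_of_fderiv_le (F := fun s t => φ (s, t)) (F' := F')
      univ_mem (Eventually.of_forall fun s =>
        (hφ.slice_snd s).smooth.continuous.aestronglyMeasurable)
      ((hφ.slice_snd s).smooth.continuous.integrable_of_hasCompactSupport
        (hφ.slice_snd s).compact).integrableOn
      (hmeas s) (Eventually.of_forall fun t s _ => hb s t) hbi
      (Eventually.of_forall fun t s _ => hasFDerivAt_slice_fst hφ s t)
  have hcont : Continuous fun s => ∫ t in Q, F' s t :=
    continuous_of_dominated hmeas (fun s => Eventually.of_forall (hb s)) hbi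
      (Eventually.of_forall fun t => hF'c.comp (Continuous.prodMk_left t))
  refine ⟨contDiff_one_iff_hasFDerivAt.2 ⟨_, hcont, hder⟩, ?_, fun s u => ?_⟩
  · refine HasCompactSupport.intro (hφ.compact.isCompact.image continuous_fst) fun s hs => ?_
    have : ∀ t, φ (s, t) = 0 := fun t => by
      by_contra h0
      exact hs ⟨(s, t), subset_tsupport _ h0, rfl⟩
    simp [this]
  · rw [(hder s).fderiv, ContinuousLinearMap.integral_apply]
    · rfl
    · exact hbi.mono' (hmeas s) (Eventually.of_forall (hb s))

end slices

namespace SimplexPair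

variable {n l : ℕ} (S : SimplexPair n l)

/-- The mixed second derivatives, on the cells, of the model function `minForm (t) * minForm (s)`
up to sign. -/
def modelD (j : Fin (n + 1)) (a : Fin (l + 1)) (i : Fin n) (p : Fin l) : ℝ :=
  S.frame.beR j i * S.frame.alR a p

/-- The product of the two wall currents as a sum of integrals over the cells, by the divergence
theorem in each factor. -/
theorem gammaCurrent_gammaCurrent {ψ : Base n l → ℝ} (hψ : IsTest univ ψ) (i j : Fin n)
    (p q : Fin l) :
    gammaCurrent S.edgeW i j (fun s => gammaCurrent S.edgeV p q (fun t => ψ (s, t))) =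
      ∑ c, S.modelD c.1 c.2 i p *
        ∫ x in S.cell c, fderiv ℝ (fun y => fderiv ℝ ψ y (tdir q)) x (sdir j) := by
  have hφ : IsTest univ fun y => fderiv ℝ ψ y (tdir q) := hψ.fderiv _
  have e1 : (fun s => gammaCurrent S.edgeV p q (fun t => ψ (s, t))) = fun s =>
      ∑ a, S.frame.alR a p * ∫ t in normalCone S.edgeV a, fderiv ℝ ψ (s, t) (tdir q) := by
    funext s
    rw [S.isSimplexEdges_edgeV.gammaCurrent_eq ((hψ.slice_snd s).smooth.of_le (by simp))
      (hψ.slice_snd s).compact]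
    simp only [fderiv_slice_snd hψ]
    rfl
  have hD := fun a => hasFDerivAt_setIntegral hφ (normalCone S.edgeV a)
  have hdiff : ∀ a s, DifferentiableAt ℝ
      (fun s => ∫ t in normalCone S.edgeV a, fderiv ℝ ψ (s, t) (tdir q)) s := fun a s =>
    ((hD a).1.differentiable (by simp)) s
  rw [e1, S.isSimplexEdges_edgeW.gammaCurrent_eq]
  · rw [Fintype.sum_prod_type]
    refine Finset.sum_congr rfl fun J _ => ?_
    have e2 : ∀ s, fderiv ℝ (fun s => ∑ a, S.frame.alR a p *
        ∫ t in normalCone S.edgeV a, fderiv ℝ ψ (s, t) (tdir q)) s (EuclideanSpace.single j 1) =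
        ∑ a, S.frame.alR a p * ∫ t in normalCone S.edgeV a,
          fderiv ℝ (fun y => fderiv ℝ ψ y (tdir q)) (s, t) (sdir j) := fun s => by
      rw [fderiv_fun_sum fun a _ => (hdiff a s).const_mul _]
      simp only [sum_apply]
      refine Finset.sum_congr rfl fun a _ => ?_
      rw [fderiv_const_mul (hdiff a s)]
      simp only [smul_apply, smul_eq_mul, (hD a).2.2]
      rfl
    simp only [e2]
    have hi : Integrable fun x : Base n l =>
        fderiv ℝ (fun y => fderiv ℝ ψ y (tdir q)) x (sdir j) := (hφ.fderiv _).integrable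
    rw [integral_finsetSum _ fun a _ => (integrable_slice_snd hi _ _).const_mul _, Finset.mul_sum]
    refine Finset.sum_congr rfl fun a _ => ?_
    rw [integral_const_mul, modelD, mul_assoc]
    congr 2
    exact (setIntegral_prod _ hi.integrableOn).symm
  · exact ContDiff.sum fun a _ => contDiff_const.mul (hD a).1
  · have hc : ∀ a, HasCompactSupport fun s => S.frame.alR a p *
        ∫ t in normalCone S.edgeV a, fderiv ℝ ψ (s, t) (tdir q) := fun a => (hD a).2.1.mul_left
    refine HasCompactSupport.intro (isCompact_iUnion fun a => (hc a).isCompact) fun s hs => ?_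
    exact Finset.sum_eq_zero fun a _ => image_eq_zero_of_notMem_tsupport
      (f := fun s => S.frame.alR a p *
        ∫ t in normalCone S.edgeV a, fderiv ℝ ψ (s, t) (tdir q)) fun h => hs (mem_iUnion.2 ⟨a, h⟩)

/-- For the model `D = w_j ⊗ v_a` the first-order coefficients depend on `s` and `t` through the
continuous piecewise linear functions `⟨w_j, s⟩` and `⟨v_a, t⟩`, so both first-order terms integrate
by parts without contributions of the walls. -/
theorem sum_integral_modelD {χ : Base n l → ℝ} (hχ : IsTest univ χ) (i : Fin n) (p : Fin l) :
    ∑ c, ∫ x in S.cell c, cellIntegrand 0 0 S.modelD i p χ c x =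
      -∑ c, S.modelD c.1 c.2 i p * ∫ x in S.cell c, χ x := by
  have i1 : ∀ (c : Fin (n + 1) × Fin (l + 1)), Integrable fun x : Base n l =>
      inner ℝ (S.frame.beR c.1) x.1 * fderiv ℝ χ x (sdir i) := fun c =>
    (hχ.fderiv _).integrable_mul (by fun_prop)
  have i2 : ∀ (c : Fin (n + 1) × Fin (l + 1)), Integrable fun x : Base n l =>
      inner ℝ (S.frame.alR c.2) x.2 * fderiv ℝ χ x (tdir p) := fun c =>
    (hχ.fderiv _).integrable_mul (by fun_prop)
  have e : ∀ c, ∫ x in S.cell c, cellIntegrand 0 0 S.modelD i p χ c x =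
      S.frame.alR c.2 p * (∫ x in S.cell c, inner ℝ (S.frame.beR c.1) x.1 * fderiv ℝ χ x (sdir i)) +
      S.frame.beR c.1 i * (∫ x in S.cell c, inner ℝ (S.frame.alR c.2) x.2 * fderiv ℝ χ x (tdir p)) +
      S.modelD c.1 c.2 i p * ∫ x in S.cell c, χ x := fun c => by
    have i12 : Integrable fun x : Base n l =>
        S.frame.alR c.2 p * (inner ℝ (S.frame.beR c.1) x.1 * fderiv ℝ χ x (sdir i)) +
        S.frame.beR c.1 i * (inner ℝ (S.frame.alR c.2) x.2 * fderiv ℝ χ x (tdir p)) :=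
      ((i1 c).const_mul _).add ((i2 c).const_mul _)
    rw [← integral_const_mul, ← integral_const_mul, ← integral_const_mul,
      ← integral_add ((i1 c).const_mul _).integrableOn ((i2 c).const_mul _).integrableOn,
      ← integral_add i12.integrableOn (hχ.integrable.const_mul _).integrableOn]
    refine integral_congr_ae (Eventually.of_forall fun x => ?_)
    have h1 : ∑ r, S.modelD c.1 c.2 r p * x.1 r =
        S.frame.alR c.2 p * inner ℝ (S.frame.beR c.1) x.1 := by
      rw [PiLp.inner_apply, Finset.mul_sum]
      refine Finset.sum_congr rfl fun r _ => ?_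
      simp only [modelD, RCLike.inner_apply, conj_trivial]
      ring
    have h2 : ∑ r, S.modelD c.1 c.2 i r * x.2 r =
        S.frame.beR c.1 i * inner ℝ (S.frame.alR c.2) x.2 := by
      rw [PiLp.inner_apply, Finset.mul_sum]
      refine Finset.sum_congr rfl fun r _ => ?_
      simp only [modelD, RCLike.inner_apply, conj_trivial]
      ring
    simp only [cellIntegrand, h1, h2, Pi.zero_apply, zero_add]
    ring
  simp only [e, Finset.sum_add_distrib]
  -- Each of the two first-order terms contributes `-D` times the integral over the cell, and the
  -- term of order zero contributes `D`: in total `-1 - 1 + 1 = -1`.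
  have s1 : ∑ c : Fin (n + 1) × Fin (l + 1), S.frame.alR c.2 p *
      (∫ x in S.cell c, inner ℝ (S.frame.beR c.1) x.1 * fderiv ℝ χ x (sdir i)) =
      -∑ c, S.modelD c.1 c.2 i p * ∫ x in S.cell c, χ x := by
    rw [Fintype.sum_prod_type_right, Fintype.sum_prod_type_right, ← Finset.sum_neg_distrib]
    refine Finset.sum_congr rfl fun a _ => ?_
    have := S.isSimplexEdges_edgeW.sum_integral_fst hχ (EuclideanSpace.single i 1)
      (normalCone S.edgeV a)
    dsimp only
    rw [← Finset.mul_sum]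
    refine (congrArg _ this).trans ?_
    rw [mul_neg, Finset.mul_sum]
    refine congrArg _ (Finset.sum_congr rfl fun j _ => ?_)
    rw [inner_single_one, modelD, cell]
    ring
  have s2 : ∑ c : Fin (n + 1) × Fin (l + 1), S.frame.beR c.1 i *
      (∫ x in S.cell c, inner ℝ (S.frame.alR c.2) x.2 * fderiv ℝ χ x (tdir p)) =
      -∑ c, S.modelD c.1 c.2 i p * ∫ x in S.cell c, χ x := by
    rw [Fintype.sum_prod_type, Fintype.sum_prod_type, ← Finset.sum_neg_distrib]
    refine Finset.sum_congr rfl fun J _ => ?_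
    have := S.isSimplexEdges_edgeV.sum_integral_snd hχ (EuclideanSpace.single p 1)
      (normalCone S.edgeW J)
    dsimp only
    rw [← Finset.mul_sum]
    refine (congrArg _ this).trans ?_
    rw [mul_neg, Finset.mul_sum]
    refine congrArg _ (Finset.sum_congr rfl fun j _ => ?_)
    rw [inner_single_one, modelD, cell]
    ring
  rw [s1, s2]
  ring

/-- The model function solves the distributional equation. -/
theorem sum_integral_model {R : Set (Base n l)} {ψ : Base n l → ℝ} (hψ : IsTest R ψ) (i j : Fin n)
    (p q : Fin l) :
    ∑ c, ∫ x in S.cell c, cellIntegrand 0 0 S.modelD i p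
        (fun x => fderiv ℝ (fun y => fderiv ℝ ψ y (tdir q)) x (sdir j)) c x =
      -gammaCurrent S.edgeW i j (fun s => gammaCurrent S.edgeV p q (fun t => ψ (s, t))) := by
  have hψ' := hψ.mono (subset_univ R)
  rw [S.gammaCurrent_gammaCurrent hψ', S.sum_integral_modelD ((hψ'.fderiv _).fderiv _)]

end SimplexPair

/-! ### Test functions concentrated near a wall -/

section bump

set_option linter.unusedSectionVars false

variable {E : Type*} [NormedAddCommGroup E] [InnerProductSpace ℝ E]

/-- A smooth function that is radial about `s₀` and positive exactly on the ball of radius `r`. -/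
def radialBump (s₀ : E) (r : ℝ) (s : E) : ℝ := Real.smoothTransition (r ^ 2 - ‖s - s₀‖ ^ 2)

variable {s₀ : E} {r : ℝ}

theorem contDiff_radialBump : ContDiff ℝ ∞ (radialBump s₀ r) :=
  Real.smoothTransition.contDiff.comp
    (contDiff_const.sub ((contDiff_id.sub contDiff_const).norm_sq ℝ))

theorem radialBump_pos {s : E} (hs : s ∈ Metric.ball s₀ r) : 0 < radialBump s₀ r s := by
  rw [Metric.mem_ball, dist_eq_norm] at hs
  exact Real.smoothTransition.pos_of_pos
    (sub_pos.2 (pow_lt_pow_left₀ hs (norm_nonneg _) two_ne_zero))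

theorem tsupport_radialBump (hr : 0 < r) : tsupport (radialBump s₀ r) ⊆ Metric.closedBall s₀ r := by
  refine closure_minimal (fun s hs => ?_) Metric.isClosed_closedBall
  by_contra h
  rw [Metric.mem_closedBall, dist_eq_norm, not_le] at h
  exact hs (Real.smoothTransition.zero_of_nonpos
    (sub_nonpos.2 (pow_le_pow_left₀ hr.le h.le 2)))

theorem fderiv_radialBump_eq_zero {s u : E} (h : inner ℝ (s - s₀) u = 0) :
    fderiv ℝ (radialBump s₀ r) s u = 0 := by
  have h1 : HasFDerivAt (fun s : E => r ^ 2 - ‖s - s₀‖ ^ 2) (-(2 • (innerSL ℝ (s - s₀)))) s := by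
    have := ((hasStrictFDerivAt_norm_sq (s - s₀)).hasFDerivAt.comp s
      ((hasFDerivAt_id s).sub_const s₀)).const_sub (r ^ 2)
    simpa using this
  have h2 := (Real.smoothTransition.contDiff (n := 1)).differentiable (by simp)
    (r ^ 2 - ‖s - s₀‖ ^ 2)
  have h3 := (h2.hasDerivAt.comp_hasFDerivAt s h1).fderiv
  have h4 : fderiv ℝ (radialBump s₀ r) s = _ := h3
  rw [h4]
  simp only [smul_apply, neg_apply, innerSL_apply_apply, h, smul_zero, neg_zero]

end bump

/-- The integrals over the members of the family `Q` of `φ`, of its derivative in the `i`-th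
direction, and of the products of this derivative with the coordinates, are proportional to
`κ`. -/
structure HasMoments {k : ℕ} (Q : Fin (k + 1) → Set (EuclideanSpace ℝ (Fin k)))
    (κ : Fin (k + 1) → ℝ) (φ : EuclideanSpace ℝ (Fin k) → ℝ) (i : Fin k) (a : ℝ) (b : Fin k → ℝ)
    (c : ℝ) : Prop where
  fderiv_eq : ∀ J, ∫ s in Q J, fderiv ℝ φ s (EuclideanSpace.single i 1) = κ J * a
  mul_eq : ∀ J r, ∫ s in Q J, s r * fderiv ℝ φ s (EuclideanSpace.single i 1) = κ J * b r
  eq : ∀ J, ∫ s in Q J, φ s = κ J * c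

/-- The indicator of `j` minus the indicator of `j'`. -/
def altSign {k : ℕ} (j j' : Fin (k + 1)) (J : Fin (k + 1)) : ℝ :=
  (if J = j then 1 else 0) - if J = j' then 1 else 0

theorem sum_altSign {k : ℕ} (j j' : Fin (k + 1)) (X : Fin (k + 1) → ℝ) :
    ∑ J, altSign j j' J * X J = X j - X j' := by
  simp [altSign, sub_mul, Finset.sum_sub_distrib]

namespace IsSimplexEdges

variable {k : ℕ} {c : Fin (k + 1) → Fin (k + 1) → EuclideanSpace ℝ (Fin k)}
  {x : Fin (k + 1) → EuclideanSpace ℝ (Fin k)} (h : IsSimplexEdges c x) {j j' : Fin (k + 1)}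
  (hj : j ≠ j')

/-- The points at which the linear forms given by the vertices `j` and `j'` are smaller than those
given by the other vertices. -/
def nearWall (c : Fin (k + 1) → Fin (k + 1) → EuclideanSpace ℝ (Fin k)) (j j' : Fin (k + 1)) :
    Set (EuclideanSpace ℝ (Fin k)) :=
  {s | ∀ b, b ≠ j → b ≠ j' → 0 < inner ℝ (c b j) s ∧ 0 < inner ℝ (c b j') s}

theorem isOpen_nearWall : IsOpen (nearWall c j j') := by
  simp only [nearWall, ofPred_forall, ofPred_and]
  refine isOpen_iInter_of_finite fun b => isOpen_iInter_of_finite fun _ =>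
    isOpen_iInter_of_finite fun _ => ?_
  exact (isOpen_lt continuous_const (by fun_prop)).inter (isOpen_lt continuous_const (by fun_prop))

include h

theorem mem_wall_of_nearWall {s : EuclideanSpace ℝ (Fin k)} (hs : s ∈ nearWall c j j')
    (h0 : inner ℝ (c j j') s = 0) : s ∈ wall c j j' := by
  refine ⟨h0, fun b => ?_⟩
  by_cases hb : b = j
  · rw [hb, h.eq, sub_self, inner_zero_left]
  by_cases hb' : b = j'
  · rw [hb', h.edge_neg j j', inner_neg_left, h0, neg_zero]
  · exact (hs b hb hb').1.le

theorem exists_nearWall {U : Set (EuclideanSpace ℝ (Fin k))} (hU : U ∈ 𝓝 0) :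
    ∃ s ∈ U, s ∈ nearWall c j j' ∧ inner ℝ (c j j') s = 0 := by
  obtain ⟨s, hs⟩ := h.exists_inner_eq fun b => if b = j ∨ b = j' then 0 else 1
  have e : ∀ a b, inner ℝ (c a b) s =
      (if a = j ∨ a = j' then (0 : ℝ) else 1) - if b = j ∨ b = j' then 0 else 1 := fun a b => by
    rw [h.inner_eq, hs, hs]; ring
  have hlim : Tendsto (fun ε : ℝ => ε • s) (𝓝[>] 0) (𝓝 0) := by
    have : Continuous fun ε : ℝ => ε • s := by fun_prop
    simpa using (this.tendsto 0).mono_left nhdsWithin_le_nhds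
  obtain ⟨ε, hε, hε0⟩ := ((hlim.eventually hU).and self_mem_nhdsWithin).exists
  refine ⟨ε • s, hε, fun b hb hb' => ?_, ?_⟩
  · have hε0' : 0 < ε := hε0
    simp [real_inner_smul_right, e, hb, hb', hε0']
  · simp [real_inner_smul_right, e]

include hj

/-- For a function concentrated near the interior of the wall between `j` and `j'` the divergence
theorem has a boundary term in the two adjacent cones only, with opposite signs. -/
theorem setIntegral_fderiv_nearWall {F : EuclideanSpace ℝ (Fin k) → ℝ} (hF : IsTest univ F)
    (hs : tsupport F ⊆ nearWall c j j') (J : Fin (k + 1)) (u : EuclideanSpace ℝ (Fin k)) :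
    ∫ s in normalCone c J, fderiv ℝ F s u =
      altSign j j' J * (inner ℝ (c j j') u / ‖c j j'‖ * wallIntegral c j j' F) := by
  have hF1 : ContDiff ℝ 1 F := hF.smooth.of_le (by simp)
  -- the function vanishes on the other walls
  have hz : ∀ a b, wall c a b ∩ nearWall c j j' = ∅ → wallIntegral c a b F = 0 := fun a b hab => by
    refine setIntegral_eq_zero_of_forall_eq_zero fun s hs' => ?_
    refine image_eq_zero_of_notMem_tsupport fun h' => ?_
    have : (s : EuclideanSpace ℝ (Fin k)) ∈ wall c a b ∩ nearWall c j j' := ⟨hs', hs h'⟩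
    rw [hab] at this
    exact this
  by_cases h1 : J = j
  · subst h1
    rw [h.integral_normalCone_fderiv hF1 hF.compact, Finset.sum_eq_single j']
    · simp only [altSign, if_true, if_neg hj, h.edge_neg J j', inner_neg_left]; ring
    · intro b hb hb'
      rw [hz, mul_zero, neg_zero]
      refine eq_empty_of_forall_notMem fun s hs' => ?_
      have := (hs'.2 b (Finset.ne_of_mem_erase hb) hb').1
      rw [h.edge_neg J b, inner_neg_left, hs'.1.1, neg_zero] at this
      exact lt_irrefl _ this
    · intro hn
      exact absurd (Finset.mem_erase.2 ⟨hj.symm, Finset.mem_univ _⟩) hn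
  by_cases h2 : J = j'
  · subst h2
    rw [h.integral_normalCone_fderiv hF1 hF.compact, Finset.sum_eq_single j]
    · rw [h.wallIntegral_symm J j, h.edge_neg j J, norm_neg]
      simp only [altSign, if_true, if_neg h1]; ring
    · intro b hb hb'
      rw [hz, mul_zero, neg_zero]
      refine eq_empty_of_forall_notMem fun s hs' => ?_
      have := (hs'.2 b hb' (Finset.ne_of_mem_erase hb)).2
      rw [h.edge_neg J b, inner_neg_left, hs'.1.1, neg_zero] at this
      exact lt_irrefl _ this
    · intro hn
      exact absurd (Finset.mem_erase.2 ⟨hj, Finset.mem_univ _⟩) hn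
  · simp only [altSign, if_neg h1, if_neg h2, sub_zero, zero_mul]
    refine setIntegral_eq_zero_of_forall_eq_zero fun s hs' => ?_
    refine image_eq_zero_of_notMem_tsupport (f := fun s => fderiv ℝ F s u) fun h' => ?_
    have hn : s ∈ nearWall c j j' := by
      refine hs ((closure_mono fun y hy => ?_).trans (tsupport_fderiv_subset ℝ (f := F)) h')
      intro h0
      exact hy (by simp [h0])
    have e1 := (hn J h1 h2).1
    have e2 := hs' j (Ne.symm h1)
    rw [h.edge_neg j J, inner_neg_left] at e1
    linarith

omit hj in
/-- A bump function centred at a point of the wall has positive integral over the wall. -/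
theorem wallIntegral_radialBump_pos {s₀ : EuclideanSpace ℝ (Fin k)} {r : ℝ} (hr : 0 < r)
    (hs : Metric.closedBall s₀ r ⊆ nearWall c j j') (h0 : inner ℝ (c j j') s₀ = 0) :
    0 < wallIntegral c j j' (radialBump s₀ r) := by
  set X : Submodule ℝ (EuclideanSpace ℝ (Fin k)) := (Submodule.span ℝ {c j j'})ᗮ
  have hX : ∀ s, s ∈ X ↔ inner ℝ (c j j') s = 0 := fun s =>
    Submodule.mem_orthogonal_singleton_iff_inner_right
  have hcl : IsClosedEmbedding ((↑) : X → EuclideanSpace ℝ (Fin k)) :=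
    (Submodule.closed_of_finiteDimensional X).isClosedEmbedding_subtypeVal
  have hcomp : HasCompactSupport (radialBump s₀ r) :=
    (isCompact_closedBall s₀ r).of_isClosed_subset (isClosed_tsupport _) (tsupport_radialBump hr)
  have hint : Integrable fun s : X => radialBump s₀ r s :=
    (contDiff_radialBump.continuous.comp continuous_subtype_val).integrable_of_hasCompactSupport
      (hcomp.comp_isClosedEmbedding hcl)
  have h1 : 0 ≤ᵐ[volume.restrict {s : X | (s : EuclideanSpace ℝ (Fin k)) ∈ wall c j j'}]
      fun s : X => radialBump s₀ r s :=
    Eventually.of_forall fun s => Real.smoothTransition.nonneg _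
  refine (setIntegral_pos_iff_support_of_nonneg_ae h1 hint.integrableOn).2 ?_
  refine lt_of_lt_of_le ((Metric.isOpen_ball.preimage continuous_subtype_val).measure_pos volume
    ⟨⟨s₀, (hX s₀).2 h0⟩, Metric.mem_ball_self hr⟩) (measure_mono fun s hs' => ?_)
  · exact ⟨(radialBump_pos hs').ne', h.mem_wall_of_nearWall
      (hs (Metric.ball_subset_closedBall hs')) ((hX s).1 s.2)⟩

/-- First moments of the derivative of a function concentrated near a wall. -/
theorem setIntegral_mul_fderiv_nearWall {φ : EuclideanSpace ℝ (Fin k) → ℝ} (hφ : IsTest univ φ)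
    (hs : tsupport φ ⊆ nearWall c j j') (J : Fin (k + 1)) (i r : Fin k) :
    ∫ s in normalCone c J, s r * fderiv ℝ φ s (EuclideanSpace.single i 1) =
      altSign j j' J * (c j j' i / ‖c j j'‖ * wallIntegral c j j' (fun s => φ s * s r)) -
        (if r = i then 1 else 0) * ∫ s in normalCone c J, φ s := by
  have hL : ContDiff ℝ ∞ fun s : EuclideanSpace ℝ (Fin k) => s r := by fun_prop
  have hG := hφ.mul hL
  have h1 := h.setIntegral_fderiv_nearWall hj hG ((tsupport_mul_subset_left (f := φ)).trans hs) J
    (EuclideanSpace.single i 1)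
  rw [inner_single_one] at h1
  rw [← h1, ← integral_const_mul, ← integral_sub]
  · refine integral_congr_ae (Eventually.of_forall fun s => ?_)
    have hd : HasFDerivAt (fun s : EuclideanSpace ℝ (Fin k) => s r)
        (EuclideanSpace.proj r : EuclideanSpace ℝ (Fin k) →L[ℝ] ℝ) s :=
      (EuclideanSpace.proj r : EuclideanSpace ℝ (Fin k) →L[ℝ] ℝ).hasFDerivAt
    have := ((hφ.smooth.differentiable (by simp) s).hasFDerivAt.mul hd).fderiv
    have hfd : fderiv ℝ (fun s => φ s * s r) s = _ := this
    simp only [hfd]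
    simp
  · exact ((hG.fderiv _).smooth.continuous.integrable_of_hasCompactSupport
      (hG.fderiv _).compact).integrableOn
  · exact ((hφ.smooth.continuous.integrable_of_hasCompactSupport
      hφ.compact).const_mul _).integrableOn

omit h hj in
theorem wallIntegral_eq_zero {F : EuclideanSpace ℝ (Fin k) → ℝ}
    (hF : ∀ s, inner ℝ (c j j') s = 0 → F s = 0) : wallIntegral c j j' F = 0 :=
  setIntegral_eq_zero_of_forall_eq_zero fun s _ =>
    hF s (Submodule.mem_orthogonal_singleton_iff_inner_right.1 s.2)

/-- A function that is symmetric about the wall, differentiated across the wall, has only the moment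
of order zero. -/
theorem exists_even_moments {U : Set (EuclideanSpace ℝ (Fin k))} (hU : U ∈ 𝓝 0) :
    ∃ f N, IsTest U f ∧ ∀ i, HasMoments (normalCone c) (altSign j j') (fun s => fderiv ℝ f s N) i 0
      (fun r => -if r = i then 1 else 0) 1 := by
  obtain ⟨s₀, hsU, hsn, hs0⟩ := h.exists_nearWall (j := j) (j' := j') (interior_mem_nhds.2 hU)
  obtain ⟨r, hr, hrs⟩ := Metric.nhds_basis_closedBall.mem_iff.1
    ((isOpen_interior.inter isOpen_nearWall).mem_nhds ⟨hsU, hsn⟩)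
  have hf : IsTest U (radialBump s₀ r) := ⟨contDiff_radialBump,
    (isCompact_closedBall s₀ r).of_isClosed_subset (isClosed_tsupport _) (tsupport_radialBump hr),
    (tsupport_radialBump hr).trans fun y hy => interior_subset (hrs hy).1⟩
  have hfs : tsupport (radialBump s₀ r) ⊆ nearWall c j j' :=
    (tsupport_radialBump hr).trans fun y hy => (hrs hy).2
  have hf' := hf.mono (subset_univ U)
  have hw := h.wallIntegral_radialBump_pos hr (fun y hy => (hrs hy).2) hs0
  have hc : 0 < ‖c j j'‖ := norm_pos_iff.2 (h.edge_ne_zero hj)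
  -- The length of `N` normalizes the moment of order zero to one.
  set N : EuclideanSpace ℝ (Fin k) :=
    (‖c j j'‖ * wallIntegral c j j' (radialBump s₀ r))⁻¹ • c j j' with hN
  have hφ := hf'.fderiv N
  have hφs := ((IsTest.mk hf.smooth hf.compact hfs).fderiv N).supp
  have h0 : ∀ s, inner ℝ (c j j') s = 0 → fderiv ℝ (radialBump s₀ r) s N = 0 := fun s hs => by
    refine fderiv_radialBump_eq_zero ?_
    rw [hN, real_inner_smul_right, real_inner_comm, inner_sub_right, hs, hs0, sub_zero, mul_zero]
  have e1 : ∀ J, ∫ s in normalCone c J, fderiv ℝ (radialBump s₀ r) s N = altSign j j' J * 1 :=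
    fun J => by
      rw [h.setIntegral_fderiv_nearWall hj hf' hfs, hN, real_inner_smul_right,
        real_inner_self_eq_norm_sq]
      field_simp
  refine ⟨radialBump s₀ r, N, hf, fun i => ⟨fun J => ?_, fun J q => ?_, e1⟩⟩
  · rw [h.setIntegral_fderiv_nearWall hj hφ hφs, wallIntegral_eq_zero h0, mul_zero]
  · rw [h.setIntegral_mul_fderiv_nearWall hj hφ hφs, wallIntegral_eq_zero, e1]
    · ring
    · intro s hs
      rw [h0 s hs, zero_mul]

/-- A function that vanishes on the wall, differentiated twice across the wall, has a moment of
order one. -/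
theorem exists_odd_moments {U : Set (EuclideanSpace ℝ (Fin k))} (hU : U ∈ 𝓝 0) :
    ∃ f N i b, IsTest U f ∧
      HasMoments (normalCone c) (altSign j j') (fun s => fderiv ℝ f s N) i 1 b 0 := by
  obtain ⟨s₀, hsU, hsn, hs0⟩ := h.exists_nearWall (j := j) (j' := j') (interior_mem_nhds.2 hU)
  obtain ⟨r, hr, hrs⟩ := Metric.nhds_basis_closedBall.mem_iff.1
    ((isOpen_interior.inter isOpen_nearWall).mem_nhds ⟨hsU, hsn⟩)
  have hlin : ContDiff ℝ ∞ fun s : EuclideanSpace ℝ (Fin k) => inner ℝ (c j j') s :=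
    (innerSL ℝ (c j j')).contDiff
  have hρ : IsTest U (radialBump s₀ r) := ⟨contDiff_radialBump,
    (isCompact_closedBall s₀ r).of_isClosed_subset (isClosed_tsupport _) (tsupport_radialBump hr),
    (tsupport_radialBump hr).trans fun y hy => interior_subset (hrs hy).1⟩
  have hf := hρ.mul hlin
  set f : EuclideanSpace ℝ (Fin k) → ℝ := fun s => radialBump s₀ r s * inner ℝ (c j j') s with hfd
  have hfs : tsupport f ⊆ nearWall c j j' := (tsupport_mul_subset_left (f := radialBump s₀ r)).trans
    ((tsupport_radialBump hr).trans fun y hy => (hrs hy).2)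
  have hf' := hf.mono (subset_univ U)
  have hw := h.wallIntegral_radialBump_pos hr (fun y hy => (hrs hy).2) hs0
  have hc0 := h.edge_ne_zero hj
  have hc : 0 < ‖c j j'‖ := norm_pos_iff.2 hc0
  obtain ⟨i, hi⟩ : ∃ i, c j j' i ≠ 0 := by
    by_contra! h'
    exact hc0 (by ext i; simpa using h' i)
  set w := wallIntegral c j j' (radialBump s₀ r) with hwd
  -- The factor `m` normalizes the moment of order one to one.
  set m : ℝ := (c j j' i * ‖c j j'‖ * w)⁻¹ with hm
  set N : EuclideanSpace ℝ (Fin k) := m • c j j' with hN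
  have hφ := hf'.fderiv N
  have hφs := ((IsTest.mk hf.smooth hf.compact hfs).fderiv N).supp
  have hfN : ∀ s, inner ℝ (c j j') s = 0 →
      fderiv ℝ f s N = m * ‖c j j'‖ ^ 2 * radialBump s₀ r s := fun s hs => by
    have hd : HasFDerivAt (fun s : EuclideanSpace ℝ (Fin k) => inner ℝ (c j j') s)
        (innerSL ℝ (c j j')) s := (innerSL ℝ (c j j')).hasFDerivAt
    have h1 := ((hρ.smooth.differentiable (by simp) s).hasFDerivAt.mul hd).fderiv
    have h2 : fderiv ℝ f s = _ := h1
    rw [h2, hN]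
    simp only [add_apply, smul_apply, innerSL_apply_apply, smul_eq_mul, hs, zero_mul, add_zero,
      real_inner_smul_right, real_inner_self_eq_norm_sq]
    ring
  have e1 : ∀ J, ∫ s in normalCone c J, fderiv ℝ f s N = altSign j j' J * 0 := fun J => by
    rw [h.setIntegral_fderiv_nearWall hj hf' hfs, wallIntegral_eq_zero, mul_zero]
    intro s hs
    rw [hfd]
    simp only [hs, mul_zero]
  refine ⟨f, N, i, fun q => c j j' i / ‖c j j'‖ *
    wallIntegral c j j' (fun s => fderiv ℝ f s N * s q), hf, ⟨fun J => ?_, fun J q => ?_, e1⟩⟩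
  · rw [h.setIntegral_fderiv_nearWall hj hφ hφs, inner_single_one]
    have e2 : wallIntegral c j j' (fun s => fderiv ℝ f s N) = m * ‖c j j'‖ ^ 2 * w := by
      rw [hwd, wallIntegral, wallIntegral, ← integral_const_mul]
      refine integral_congr_ae (Eventually.of_forall fun s => ?_)
      exact hfN s (Submodule.mem_orthogonal_singleton_iff_inner_right.1 s.2)
    rw [e2, hm]
    field_simp
  · rw [h.setIntegral_mul_fderiv_nearWall hj hφ hφs, e1, mul_zero, mul_zero, sub_zero]

end IsSimplexEdges

/-! ### The differences of the potentials -/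

section plaquette

variable {n l : ℕ}

theorem fderiv_mul_split {f : EuclideanSpace ℝ (Fin n) → ℝ} {g : EuclideanSpace ℝ (Fin l) → ℝ}
    (hf : Differentiable ℝ f) (hg : Differentiable ℝ g) (x u : Base n l) :
    fderiv ℝ (fun y : Base n l => f y.1 * g y.2) x u =
      fderiv ℝ f x.1 u.1 * g x.2 + f x.1 * fderiv ℝ g x.2 u.2 := by
  have h1 : HasFDerivAt (fun y : Base n l => f y.1)
      ((fderiv ℝ f x.1).comp (ContinuousLinearMap.fst ℝ _ _)) x :=
    (hf x.1).hasFDerivAt.comp x hasFDerivAt_fst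
  have h2 : HasFDerivAt (fun y : Base n l => g y.2)
      ((fderiv ℝ g x.2).comp (ContinuousLinearMap.snd ℝ _ _)) x :=
    (hg x.2).hasFDerivAt.comp x hasFDerivAt_snd
  have h3 := (h1.mul h2).fderiv
  have h4 : fderiv ℝ (fun y : Base n l => f y.1 * g y.2) x = _ := h3
  rw [h4]
  change f x.1 * fderiv ℝ g x.2 u.2 + g x.2 * fderiv ℝ f x.1 u.1 = _
  ring

theorem IsTest.prodMul {f : EuclideanSpace ℝ (Fin n) → ℝ} {g : EuclideanSpace ℝ (Fin l) → ℝ}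
    {U : Set (EuclideanSpace ℝ (Fin n))} {U' : Set (EuclideanSpace ℝ (Fin l))}
    (hf : IsTest U f) (hg : IsTest U' g) : IsTest (U ×ˢ U') fun y : Base n l => f y.1 * g y.2 := by
  have hs : Function.support (fun y : Base n l => f y.1 * g y.2) ⊆ tsupport f ×ˢ tsupport g :=
    fun y hy => ⟨subset_tsupport _ (left_ne_zero_of_mul hy),
      subset_tsupport _ (right_ne_zero_of_mul hy)⟩
  have hK : IsCompact (tsupport f ×ˢ tsupport g) := hf.compact.isCompact.prod hg.compact.isCompact
  have ht := closure_minimal hs hK.isClosed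
  exact ⟨(hf.smooth.comp contDiff_fst).mul (hg.smooth.comp contDiff_snd),
    hK.of_isClosed_subset (isClosed_tsupport _) ht, ht.trans (prod_mono hf.supp hg.supp)⟩

variable {B : Fin (n + 1) → Fin (l + 1) → Fin n → ℝ} {C : Fin (n + 1) → Fin (l + 1) → Fin l → ℝ}
  {D : Fin (n + 1) → Fin (l + 1) → Fin n → Fin l → ℝ}

/-- On products of functions of `s` and `t` the sum over the cells factors through the moments of
the two functions. -/
theorem SimplexPair.sum_integral_of_moments (S : SimplexPair n l) {κ : Fin (n + 1) → ℝ}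
    {κ' : Fin (l + 1) → ℝ} {φ : EuclideanSpace ℝ (Fin n) → ℝ} {γ : EuclideanSpace ℝ (Fin l) → ℝ}
    {i : Fin n} {p : Fin l} {a a' c c' : ℝ} {b : Fin n → ℝ} {b' : Fin l → ℝ}
    (hφ : IsTest univ φ) (hγ : IsTest univ γ) (H : HasMoments (normalCone S.edgeW) κ φ i a b c)
    (H' : HasMoments (normalCone S.edgeV) κ' γ p a' b' c') :
    ∑ k, ∫ x in S.cell k, cellIntegrand B C D i p (fun x => φ x.1 * γ x.2) k x =
      ∑ k : Fin (n + 1) × Fin (l + 1), κ k.1 * κ' k.2 * (C k.1 k.2 p * (a * c') +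
        ∑ r, D k.1 k.2 r p * (b r * c') + B k.1 k.2 i * (c * a') +
        ∑ r, D k.1 k.2 i r * (c * b' r) + D k.1 k.2 i p * (c * c')) := by
  refine Finset.sum_congr rfl fun k _ => ?_
  have hφd := hφ.smooth.differentiable (by simp)
  have hγd := hγ.smooth.differentiable (by simp)
  set φ' := fun s => fderiv ℝ φ s (EuclideanSpace.single i 1) with hφ'
  set γ' := fun s => fderiv ℝ γ s (EuclideanSpace.single p 1) with hγ'
  have tφ : IsTest univ φ' := hφ.fderiv _
  have tγ : IsTest univ γ' := hγ.fderiv _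
  have int1 : ∀ {m : ℕ} {f : EuclideanSpace ℝ (Fin m) → ℝ}, IsTest univ f → Integrable f :=
    fun hf => hf.smooth.continuous.integrable_of_hasCompactSupport hf.compact
  have int2 : ∀ {m : ℕ} {f : EuclideanSpace ℝ (Fin m) → ℝ}, IsTest univ f → ∀ r : Fin m,
      Integrable fun s => s r * f s := fun hf r =>
    (Continuous.mul (by fun_prop) hf.smooth.continuous).integrable_of_hasCompactSupport
      hf.compact.mul_left
  have hmul : ∀ (f : EuclideanSpace ℝ (Fin n) → ℝ) (g : EuclideanSpace ℝ (Fin l) → ℝ),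
      ∫ x in S.cell k, f x.1 * g x.2 =
        (∫ s in normalCone S.edgeW k.1, f s) * ∫ t in normalCone S.edgeV k.2, g t := fun f g =>
    setIntegral_prod_mul f g _ _
  have hint : ∀ {f : EuclideanSpace ℝ (Fin n) → ℝ} {g : EuclideanSpace ℝ (Fin l) → ℝ},
      Integrable f → Integrable g → ∀ d : ℝ,
      Integrable (fun x : Base n l => d * (f x.1 * g x.2)) (volume.restrict (S.cell k)) :=
    fun hf hg d => ((hf.mul_prod hg).const_mul d).integrableOn
  have e : ∀ x : Base n l, cellIntegrand B C D i p (fun x => φ x.1 * γ x.2) k x =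
      C k.1 k.2 p * (φ' x.1 * γ x.2) + ∑ r, D k.1 k.2 r p * (x.1 r * φ' x.1 * γ x.2) +
      B k.1 k.2 i * (φ x.1 * γ' x.2) + ∑ r, D k.1 k.2 i r * (φ x.1 * (x.2 r * γ' x.2)) +
      D k.1 k.2 i p * (φ x.1 * γ x.2) := fun x => by
    simp only [cellIntegrand, fderiv_mul_split hφd hγd, sdir, tdir, map_zero, mul_zero, zero_mul,
      add_zero, zero_add, add_mul, Finset.sum_mul, hφ', hγ']
    congr 1
    rw [← add_assoc]
    congr 1
    · congr 1
      congr 1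
      exact Finset.sum_congr rfl fun r _ => by ring
    · exact Finset.sum_congr rfl fun r _ => by ring
  simp only [e]
  have i1 := hint (int1 tφ) (int1 hγ) (C k.1 k.2 p)
  have i2 : Integrable (fun x : Base n l => ∑ r, D k.1 k.2 r p * (x.1 r * φ' x.1 * γ x.2))
      (volume.restrict (S.cell k)) := integrable_finsetSum _ fun r _ =>
    hint (int2 tφ r) (int1 hγ) (D k.1 k.2 r p)
  have i3 := hint (int1 hφ) (int1 tγ) (B k.1 k.2 i)
  have i4 : Integrable (fun x : Base n l => ∑ r, D k.1 k.2 i r * (φ x.1 * (x.2 r * γ' x.2)))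
      (volume.restrict (S.cell k)) := integrable_finsetSum _ fun r _ =>
    hint (int1 hφ) (int2 tγ r) (D k.1 k.2 i r)
  have i5 := hint (int1 hφ) (int1 hγ) (D k.1 k.2 i p)
  rw [integral_add (hg := i5), integral_add (hg := i4), integral_add (hg := i3),
    integral_add i1 i2,
    integral_finsetSum _ fun r _ => hint (int2 tφ r) (int1 hγ) (D k.1 k.2 r p),
    integral_finsetSum _ fun r _ => hint (int1 hφ) (int2 tγ r) (D k.1 k.2 i r)]
  rotate_left
  · exact i1.add i2
  · exact (i1.add i2).add i3
  · exact ((i1.add i2).add i3).add i4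
  simp only [integral_const_mul]
  have m2 : ∀ r, ∫ x in S.cell k, x.1 r * φ' x.1 * γ x.2 = κ k.1 * κ' k.2 * (b r * c') := fun r => by
    rw [hmul (fun s => s r * φ' s) γ, H.mul_eq, H'.eq]; ring
  have m4 : ∀ r, ∫ x in S.cell k, φ x.1 * (x.2 r * γ' x.2) = κ k.1 * κ' k.2 * (c * b' r) :=
    fun r => by
      rw [hmul φ (fun t => t r * γ' t), H.eq, H'.mul_eq]; ring
  have m1 : ∫ x in S.cell k, φ' x.1 * γ x.2 = κ k.1 * κ' k.2 * (a * c') := by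
    rw [hmul φ' γ, H.fderiv_eq, H'.eq]; ring
  have m3 : ∫ x in S.cell k, φ x.1 * γ' x.2 = κ k.1 * κ' k.2 * (c * a') := by
    rw [hmul φ γ', H.eq, H'.fderiv_eq]; ring
  have m5 : ∫ x in S.cell k, φ x.1 * γ x.2 = κ k.1 * κ' k.2 * (c * c') := by
    rw [hmul φ γ, H.eq, H'.eq]; ring
  simp only [m1, m2, m3, m4, m5, mul_add, Finset.mul_sum, mul_left_comm (κ k.1 * κ' k.2)]

theorem sum_altSign_mul (j j' : Fin (n + 1)) (a a' : Fin (l + 1))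
    (X : Fin (n + 1) → Fin (l + 1) → ℝ) :
    ∑ k : Fin (n + 1) × Fin (l + 1), altSign j j' k.1 * altSign a a' k.2 * X k.1 k.2 =
      X j a - X j a' - (X j' a - X j' a') := by
  rw [Fintype.sum_prod_type]
  simp only [mul_assoc, ← Finset.mul_sum, sum_altSign]

/-- The plaquette lemma: if the piecewise biaffine data `B`, `C`, `D` satisfy the homogeneous
equation near the origin, then their alternating sums over two cones in each factor vanish. Test
functions that are concentrated at the product of two walls detect the alternating sums. -/
theorem SimplexPair.plaquette_eq_zero (S : SimplexPair n l) {R : Set (Base n l)} (hR : R ∈ 𝓝 0)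
    (hT : ∀ f g, IsTest R (fun x : Base n l => f x.1 * g x.2) → IsTest univ f → IsTest univ g →
      ∀ i p N M, ∑ k, ∫ x in S.cell k, cellIntegrand B C D i p
        (fun x => fderiv ℝ f x.1 N * fderiv ℝ g x.2 M) k x = 0)
    (j j' : Fin (n + 1)) (a a' : Fin (l + 1)) :
    (∀ i, B j a i - B j a' i - (B j' a i - B j' a' i) = 0) ∧
    (∀ p, C j a p - C j a' p - (C j' a p - C j' a' p) = 0) ∧
    ∀ i p, D j a i p - D j a' i p - (D j' a i p - D j' a' i p) = 0 := by
  by_cases hj : j = j'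
  · subst hj; simp
  by_cases ha : a = a'
  · subst ha; simp
  obtain ⟨U, hU, U', hU', hUR⟩ := mem_nhds_prod_iff.1 hR
  have hu : ∀ {m : ℕ} {T : Set (EuclideanSpace ℝ (Fin m))} {f : EuclideanSpace ℝ (Fin m) → ℝ},
    IsTest T f → IsTest univ f := fun h => h.mono (subset_univ _)
  obtain ⟨f, N, hf, hfm⟩ := S.isSimplexEdges_edgeW.exists_even_moments hj hU
  obtain ⟨g, M, hg, hgm⟩ := S.isSimplexEdges_edgeV.exists_even_moments ha hU'
  -- Two even factors detect the mixed difference of `D` alone.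
  have hD : ∀ i p, D j a i p - D j a' i p - (D j' a i p - D j' a' i p) = 0 := fun i p => by
    have h1 := hT f g ((hf.prodMul hg).mono hUR) (hu hf) (hu hg) i p N M
    rw [S.sum_integral_of_moments ((hu hf).fderiv N) ((hu hg).fderiv M) (hfm i) (hgm p)] at h1
    simp only [mul_zero, zero_add, mul_one, add_zero, mul_neg, mul_ite,
      Finset.sum_neg_distrib, Finset.sum_ite_eq', Finset.mem_univ, if_true] at h1
    rw [← sum_altSign_mul j j' a a' fun j a => D j a i p]
    rw [← neg_eq_zero, ← Finset.sum_neg_distrib, ← h1]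
    exact Finset.sum_congr rfl fun k _ => by ring
  refine ⟨fun i => ?_, fun p => ?_, hD⟩
  -- An even and an odd factor detect the mixed difference of `B`, up to terms with `D`.
  · obtain ⟨g', M', p, b, hg', hgm'⟩ := S.isSimplexEdges_edgeV.exists_odd_moments ha hU'
    have h1 := hT f g' ((hf.prodMul hg').mono hUR) (hu hf) (hu hg') i p N M'
    rw [S.sum_integral_of_moments ((hu hf).fderiv N) ((hu hg').fderiv M') (hfm i) hgm'] at h1
    simp only [mul_zero, zero_add, mul_one, one_mul, add_zero, Finset.sum_const_zero,
      mul_add, Finset.sum_add_distrib, Finset.mul_sum] at h1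
    rw [sum_altSign_mul j j' a a' fun j a => B j a i, Finset.sum_comm] at h1
    have h2 : ∀ r, ∑ k : Fin (n + 1) × Fin (l + 1),
        altSign j j' k.1 * altSign a a' k.2 * (D k.1 k.2 i r * b r) = 0 := fun r => by
      simp only [← mul_assoc, ← Finset.sum_mul]
      rw [sum_altSign_mul j j' a a' fun j a => D j a i r, hD, zero_mul]
    simpa only [h2, Finset.sum_const_zero, add_zero] using h1
  -- An odd and an even factor detect the mixed difference of `C`, up to terms with `D`.
  · obtain ⟨f', N', i, b, hf', hfm'⟩ := S.isSimplexEdges_edgeW.exists_odd_moments hj hU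
    have h1 := hT f' g ((hf'.prodMul hg).mono hUR) (hu hf') (hu hg) i p N' M
    rw [S.sum_integral_of_moments ((hu hf').fderiv N') ((hu hg).fderiv M) hfm' (hgm p)] at h1
    simp only [zero_mul, mul_zero, mul_one, add_zero, Finset.sum_const_zero,
      mul_add, Finset.sum_add_distrib, Finset.mul_sum] at h1
    rw [sum_altSign_mul j j' a a' fun j a => C j a p, Finset.sum_comm] at h1
    have h2 : ∀ r, ∑ k : Fin (n + 1) × Fin (l + 1),
        altSign j j' k.1 * altSign a a' k.2 * (D k.1 k.2 r p * b r) = 0 := fun r => by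
      simp only [← mul_assoc, ← Finset.sum_mul]
      rw [sum_altSign_mul j j' a a' fun j a => D j a r p, hD, zero_mul]
    simpa only [h2, Finset.sum_const_zero, add_zero] using h1

theorem cellIntegrand_sum {ι : Type*} [Fintype ι] {χ : ι → Base n l → ℝ}
    (hχ : ∀ k, Differentiable ℝ (χ k)) (m : ι → ℝ) (i : Fin n) (p : Fin l)
    (c : Fin (n + 1) × Fin (l + 1)) (x : Base n l) :
    cellIntegrand B C D i p (fun x => ∑ k, m k * χ k x) c x =
      ∑ k, m k * cellIntegrand B C D i p (χ k) c x := by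
  have h : ∀ u, fderiv ℝ (fun x => ∑ k, m k * χ k x) x u = ∑ k, m k * fderiv ℝ (χ k) x u :=
    fun u => by
      rw [fderiv_fun_sum fun k _ => (hχ k x).const_mul _]
      simp only [sum_apply]
      refine Finset.sum_congr rfl fun k _ => ?_
      rw [fderiv_const_mul (hχ k x)]
      rfl
  simp only [cellIntegrand, h, Finset.mul_sum, ← Finset.sum_add_distrib]
  refine Finset.sum_congr rfl fun k _ => ?_
  simp only [mul_add]
  ring_nf

/-- The mixed derivatives of the differences between the potentials in the charts `v_a` and `w_j`
are those of the model up to terms that depend on only one of the two charts. -/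
theorem IsGlued.plaquette {S : SimplexPair n l} {R : Set (Base n l)}
    {V : Base n l → Matrix (Fin n) (Fin n) ℝ} {W : Base n l → Matrix (Fin l) (Fin l) ℝ}
    {ηY ηZ : Base n l → EuclideanSpace ℝ (Fin n)} {ϑY ϑZ : Base n l → EuclideanSpace ℝ (Fin l)}
    (H : IsGlued S R V W ηY ηZ ϑY ϑZ B C D) (hR : IsOpen R) (h0 : (0 : Base n l) ∈ R)
    (hcur : ∀ (i j : Fin n) (p q : Fin l) (ψ : Base n l → ℝ), IsTest R ψ →
      ∫ x, (W x p q * secondDeriv ψ x (sdir i) (sdir j) +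
          V x i j * secondDeriv ψ x (tdir p) (tdir q)) =
        -gammaCurrent S.edgeW i j (fun s => gammaCurrent S.edgeV p q (fun t => ψ (s, t))))
    (j j' : Fin (n + 1)) (a a' : Fin (l + 1)) :
    (∀ i, B j a i - B j a' i - (B j' a i - B j' a' i) = 0) ∧
    (∀ p, C j a p - C j a' p - (C j' a p - C j' a' p) = 0) ∧
    ∀ i p, (D j a i p - S.modelD j a i p) - (D j a' i p - S.modelD j a' i p) -
      ((D j' a i p - S.modelD j' a i p) - (D j' a' i p - S.modelD j' a' i p)) = 0 := by
  refine S.plaquette_eq_zero (D := fun j a i p => D j a i p - S.modelD j a i p)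
    (hR.mem_nhds h0) (fun f g hfg hf hg i p N M => ?_) j j' a a'
  have hfd := hf.smooth.differentiable (by simp)
  have hgd := hg.smooth.differentiable (by simp)
  set χ : Fin n × Fin l → Base n l → ℝ := fun k x =>
    fderiv ℝ f x.1 (EuclideanSpace.single k.1 1) * fderiv ℝ g x.2 (EuclideanSpace.single k.2 1)
    with hχd
  have hχ : ∀ k, IsTest univ (χ k) := fun k =>
    ((hf.fderiv (EuclideanSpace.single k.1 1)).prodMul
      (hg.fderiv (EuclideanSpace.single k.2 1))).mono (subset_univ _)
  have hχ' : ∀ k : Fin n × Fin l, (fun x => fderiv ℝ (fun y => fderiv ℝ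
      (fun x : Base n l => f x.1 * g x.2) y (tdir k.2)) x (sdir k.1)) = χ k := fun k => by
    funext x
    have e1 : (fun y => fderiv ℝ (fun x : Base n l => f x.1 * g x.2) y (tdir k.2)) =
        fun y => f y.1 * fderiv ℝ g y.2 (EuclideanSpace.single k.2 1) := by
      funext y
      rw [fderiv_mul_split hfd hgd]
      simp [tdir]
    rw [e1, fderiv_mul_split hfd ((hg.fderiv _).smooth.differentiable (by simp))]
    simp [sdir, hχd]
  -- Derivatives in the directions `N` and `M` are combinations of those along the standard bases.
  have hlin : (fun x : Base n l => fderiv ℝ f x.1 N * fderiv ℝ g x.2 M) =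
      fun x => ∑ k, (N k.1 * M k.2) * χ k x := by
    funext x
    conv_lhs => rw [eq_sum_single N, eq_sum_single M]
    simp only [map_sum, map_smul, smul_eq_mul, Finset.sum_mul_sum, Fintype.sum_prod_type, hχd]
    exact Finset.sum_congr rfl fun i _ => Finset.sum_congr rfl fun p _ => by ring
  -- The model satisfies the same equation, so the difference satisfies the homogeneous one.
  have hz : ∀ k, ∑ c, ∫ x in S.cell c,
      cellIntegrand B C (fun j a i p => D j a i p - S.modelD j a i p) i p (χ k) c x = 0 := fun k => by
    have h1 := (H.integral_current hR hfg i k.1 p k.2).symm.trans (hcur i k.1 p k.2 _ hfg)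
    rw [← S.sum_integral_model hfg i k.1 p k.2] at h1
    simp only [hχ'] at h1
    rw [← sub_eq_zero, ← Finset.sum_sub_distrib] at h1
    rw [← h1]
    refine Finset.sum_congr rfl fun c _ => ?_
    rw [← integral_sub (integrable_cellIntegrand (hχ k) c).integrableOn
      (integrable_cellIntegrand (hχ k) c).integrableOn]
    refine integral_congr_ae (Eventually.of_forall fun x => ?_)
    simp only [cellIntegrand, Pi.zero_apply, sub_mul, Finset.sum_sub_distrib]
    ring
  rw [hlin]
  simp only [cellIntegrand_sum fun k => (hχ k).smooth.differentiable (by simp)]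
  have hI : ∀ c, ∫ x in S.cell c, ∑ k : Fin n × Fin l, (N k.1 * M k.2) *
      cellIntegrand B C (fun j a i p => D j a i p - S.modelD j a i p) i p (χ k) c x =
      ∑ k : Fin n × Fin l, (N k.1 * M k.2) * ∫ x in S.cell c,
        cellIntegrand B C (fun j a i p => D j a i p - S.modelD j a i p) i p (χ k) c x := fun c => by
    rw [integral_finsetSum _ fun k _ =>
      ((integrable_cellIntegrand (hχ k) c).const_mul _).integrableOn]
    simp only [integral_const_mul]
  simp only [hI]
  rw [Finset.sum_comm]
  refine Finset.sum_eq_zero fun k _ => ?_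
  rw [← Finset.mul_sum, hz, mul_zero]

end plaquette

/-! ### Polyhedral embeddings -/

section monotone

variable {n l n' l' : ℕ}

/-- The map `H` is smooth on `U`, and on the fibres of the second component of the linear
coordinates `π` its derivative is positive with respect to the first component. -/
structure IsFiberMonotone (π : Base n l ≃L[ℝ] Base n' l') (U : Set (Base n l))
    (H : Base n l → EuclideanSpace ℝ (Fin n')) : Prop where
  smooth : ContDiffOn ℝ ∞ H U
  pos : ∀ q ∈ U, ∀ u, (π u).2 = 0 → u ≠ 0 → 0 < inner ℝ (fderiv ℝ H q u) (π u).1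

namespace IsFiberMonotone

variable {π : Base n l ≃L[ℝ] Base n' l'} {U : Set (Base n l)}
  {H : Base n l → EuclideanSpace ℝ (Fin n')}

theorem hasFDerivAt (h : IsFiberMonotone π U H) (hU : IsOpen U) {q : Base n l} (hq : q ∈ U) :
    HasFDerivAt H (fderiv ℝ H q) q :=
  ((h.smooth.contDiffAt (hU.mem_nhds hq)).differentiableAt (by simp)).hasFDerivAt

/-- The derivative of the map `q ↦ (H q, (π q).2)`. -/
def coordFDeriv (π : Base n l ≃L[ℝ] Base n' l') (T : Base n l →L[ℝ] EuclideanSpace ℝ (Fin n')) :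
    Base n l →L[ℝ] Base n' l' :=
  T.prod ((ContinuousLinearMap.snd ℝ _ _).comp (π : Base n l →L[ℝ] Base n' l'))

theorem hasStrictFDerivAt (h : IsFiberMonotone π U H) (hU : IsOpen U) {q : Base n l} (hq : q ∈ U) :
    HasStrictFDerivAt (fun r => (H r, (π r).2)) (coordFDeriv π (fderiv ℝ H q)) q :=
  ((h.smooth.contDiffAt (hU.mem_nhds hq)).hasStrictFDerivAt (by simp)).prodMk
    ((ContinuousLinearMap.snd ℝ _ _).comp (π : Base n l →L[ℝ] Base n' l')).hasStrictFDerivAt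

theorem bijective (h : IsFiberMonotone π U H) {q : Base n l} (hq : q ∈ U) :
    Function.Bijective (coordFDeriv π (fderiv ℝ H q)) := by
  have hinj : Function.Injective (coordFDeriv π (fderiv ℝ H q)) := by
    rw [injective_iff_map_eq_zero]
    intro u hu
    by_contra hne
    have h1 := h.pos q hq u (congrArg Prod.snd hu) hne
    rw [show fderiv ℝ H q u = 0 from congrArg Prod.fst hu, inner_zero_left] at h1
    exact lt_irrefl _ h1
  refine ⟨hinj, ?_⟩
  exact (LinearMap.injective_iff_surjective_of_finrank_eq_finrank
    (f := (coordFDeriv π (fderiv ℝ H q) : Base n l →ₗ[ℝ] Base n' l'))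
    π.toLinearEquiv.finrank_eq).1 hinj

/-- On a fibre, the map is strictly monotone. -/
theorem inner_sub_pos (h : IsFiberMonotone π U H) (hU : IsOpen U) (hc : Convex ℝ U)
    {q q' : Base n l} (hq : q ∈ U) (hq' : q' ∈ U) (hne : q ≠ q') (h2 : (π q).2 = (π q').2) :
    0 < inner ℝ (H q - H q') (π (q - q')).1 := by
  set u := q - q' with hu
  have hu2 : (π u).2 = 0 := by rw [hu, map_sub, Prod.snd_sub, h2, sub_self]
  have hmem : ∀ r ∈ Icc (0 : ℝ) 1, q' + r • u ∈ U := fun r hr =>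
    hc.add_smul_sub_mem hq' hq hr
  have hd : ∀ r ∈ Icc (0 : ℝ) 1, HasDerivAt (fun r : ℝ => inner ℝ (π u).1 (H (q' + r • u)))
      (inner ℝ (π u).1 (fderiv ℝ H (q' + r • u) u)) r := fun r hr => by
    have h1 : HasDerivAt (fun r : ℝ => q' + r • u) u r := by
      simpa using ((hasDerivAt_id r).smul_const u).const_add q'
    exact (innerSL ℝ (π u).1).hasFDerivAt.comp_hasDerivAt r
      ((h.hasFDerivAt hU (hmem r hr)).comp_hasDerivAt r h1)
  have hm : StrictMonoOn (fun r : ℝ => inner ℝ (π u).1 (H (q' + r • u))) (Icc 0 1) := by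
    refine strictMonoOn_of_deriv_pos (convex_Icc 0 1)
      (fun r hr => (hd r hr).continuousAt.continuousWithinAt) fun r hr => ?_
    have hr' := interior_subset hr
    rw [(hd r hr').deriv, real_inner_comm]
    exact h.pos _ (hmem r hr') u hu2 (sub_ne_zero.2 hne)
  have h3 := hm (left_mem_Icc.2 zero_le_one) (right_mem_Icc.2 zero_le_one) zero_lt_one
  simp only [zero_smul, add_zero, one_smul] at h3
  rw [show q' + u = q by rw [hu]; abel] at h3
  rw [inner_sub_left, real_inner_comm, real_inner_comm (π u).1 (H q')]
  linarith

/-- A fibrewise monotone gradient, completed by the coordinate of the fibre, is a chart: it is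
injective because of strict monotonicity on the convex fibres, and so is its derivative, by
positivity. -/
theorem isSmoothChart (h : IsFiberMonotone π U H) (hU : IsOpen U) (hc : Convex ℝ U)
    {G : Type} [NormedAddCommGroup G] [NormedSpace ℝ G] (C : G ≃L[ℝ] Base n' l') {y : Base n l → G}
    (hy : ∀ q ∈ U, C (y q) = (H q, (π q).2)) : IsSmoothChart U y := by
  have hy' : ∀ q ∈ U, y q = C.symm (H q, (π q).2) := fun q hq => by
    rw [← hy q hq, C.symm_apply_apply]
  refine ⟨?_, fun q hq q' hq' heq => ?_, fun q hq => ?_⟩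
  · refine ContDiffOn.congr (f := fun q => C.symm (H q, (π q).2)) ?_ hy'
    exact C.symm.contDiff.comp_contDiffOn (h.smooth.prodMk (by fun_prop))
  · by_contra hne
    have h1 := (hy q hq).symm.trans ((congrArg C heq).trans (hy q' hq'))
    have h2 := h.inner_sub_pos hU hc hq hq' hne (Prod.ext_iff.1 h1).2
    rw [show H q = H q' from (Prod.ext_iff.1 h1).1, sub_self, inner_zero_left] at h2
    exact lt_irrefl _ h2
  · have h1 : HasFDerivAt y ((C.symm : Base n' l' →L[ℝ] G).comp (coordFDeriv π (fderiv ℝ H q))) q :=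
      ((C.symm : Base n' l' →L[ℝ] G).hasFDerivAt.comp q
        (h.hasStrictFDerivAt hU hq).hasFDerivAt).congr_of_eventuallyEq (by
          filter_upwards [hU.mem_nhds hq] with r hr using hy' r hr)
    rw [h1.fderiv]
    exact C.symm.bijective.comp (h.bijective hq)

end IsFiberMonotone

end monotone

theorem IsSimplexEdges.dense_normalCone {k : ℕ}
    {c : Fin (k + 1) → Fin (k + 1) → EuclideanSpace ℝ (Fin k)}
    {x : Fin (k + 1) → EuclideanSpace ℝ (Fin k)} (h : IsSimplexEdges c x) :
    Dense {t | ∃ j, t ∈ normalCone c j} :=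
  Measure.dense_of_ae (μ := volume) h.ae_mem_normalCone

namespace AdaptedFrame

variable {n l d : ℕ} {a : Fin (l + 1) → Fin d → ℤ} {b : Fin (n + 1) → Fin d → ℤ}
  (F : AdaptedFrame a b)

theorem mem_dualCone_iff (y : Fin d → ℝ) :
    y ∈ dualCone a ↔ -minForm F.alR (F.coordF y) ≤ toReal (a 0) ⬝ᵥ y := by
  constructor
  · intro h
    obtain ⟨i, hi⟩ := exists_minForm_eq F.alR (F.coordF y)
    have := h i
    rw [F.a_dot_coord] at this
    linarith
  · intro h i
    have := minForm_le F.alR (F.coordF y) i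
    rw [F.a_dot_coord]
    linarith

theorem continuous_coordE : Continuous F.coordE := F.coordE.continuous_of_finiteDimensional

theorem continuous_coordF : Continuous F.coordF := F.coordF.continuous_of_finiteDimensional

theorem continuous_point {X : Type*} [TopologicalSpace X] {η : X → EuclideanSpace ℝ (Fin n)}
    {t : X → EuclideanSpace ℝ (Fin l)} {u : X → ℝ} (hη : Continuous η) (ht : Continuous t)
    (hu : Continuous u) : Continuous fun x => F.point (η x) (t x) (u x) := by
  unfold point
  fun_prop

/-- The boundary of the dual cone is the graph of the function `-minForm`. -/
theorem mem_frontier_dualCone (y : Fin d → ℝ) :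
    y ∈ frontier (dualCone a) ↔ toReal (a 0) ⬝ᵥ y = -minForm F.alR (F.coordF y) := by
  have hset : dualCone a = {y | -minForm F.alR (F.coordF y) ≤ toReal (a 0) ⬝ᵥ y} :=
    Set.ext F.mem_dualCone_iff
  have hc1 : Continuous fun y => -minForm F.alR (F.coordF y) :=
    ((continuous_minForm _).comp F.continuous_coordF).neg
  have hc2 : Continuous fun y : Fin d → ℝ => toReal (a 0) ⬝ᵥ y := by
    unfold dotProduct; fun_prop
  constructor
  · intro hy
    rw [hset] at hy
    exact (frontier_le_subset_eq hc1 hc2 hy).symm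
  · intro hy
    refine ⟨subset_closure ((F.mem_dualCone_iff y).2 hy.ge), fun hint => ?_⟩
    -- the boundary points leave the cone in the direction `-b_0`
    have hc3 : Continuous fun r : ℝ => y + r • toReal (b 0) := by fun_prop
    have h1 : ∀ᶠ r : ℝ in 𝓝 0, y + r • toReal (b 0) ∈ dualCone a :=
      (hc3.tendsto' 0 y (by simp)).eventually (mem_interior_iff_mem_nhds.1 hint)
    obtain ⟨r, hr, hr0⟩ := ((h1.filter_mono nhdsWithin_le_nhds).and
      (self_mem_nhdsWithin (a := (0 : ℝ)) (s := Iio 0))).exists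
    rw [F.mem_dualCone_iff, map_add, map_smul, coordF_b, smul_zero, add_zero, dotProduct_add,
      dotProduct_smul, F.a_zero_dot_b, hy, smul_eq_mul, mul_one] at hr
    have : r < 0 := hr0
    linarith

theorem point_mem_frontier (z : Base n l) :
    F.point z.1 z.2 (-minForm F.alR z.2) ∈ frontier (dualCone a) := by
  rw [F.mem_frontier_dualCone, a_zero_point, coordF_point]

/-- The coordinates along `e` and `f` identify the boundary of the dual cone with a vector
space. -/
def frontierHomeomorph : Base n l ≃ₜ frontier (dualCone a) where
  toFun z := ⟨F.point z.1 z.2 (-minForm F.alR z.2), F.point_mem_frontier z⟩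
  invFun y := (F.coordE y, F.coordF y)
  left_inv z := by simp only [coordE_point, coordF_point]
  right_inv y := by
    ext1
    change F.point (F.coordE y) (F.coordF y) _ = _
    rw [← (F.mem_frontier_dualCone y).1 y.2, F.point_coord]
  continuous_toFun := (F.continuous_point continuous_fst continuous_snd
    ((continuous_minForm _).comp continuous_snd).neg).subtype_mk _
  continuous_invFun := (F.continuous_coordE.comp continuous_subtype_val).prodMk
    (F.continuous_coordF.comp continuous_subtype_val)

variable {n' l' : ℕ}

/-- If `H` is monotone on the fibres, over each of the charts and up to the shears that relate the
charts, then the point with coordinates `H` and `t` on the boundary of the dual cone defines a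
polyhedral affine structure. -/
theorem isPolyhedral {c : Fin (l + 1) → Fin (l + 1) → EuclideanSpace ℝ (Fin l)}
    {c' : Fin (n + 1) → Fin (n + 1) → EuclideanSpace ℝ (Fin n)}
    (hα : IsSimplexEdges c F.alR) {π : Base n' l' ≃L[ℝ] Base n l}
    {R D : Set (Base n' l')} (hR : IsOpen R) (hRc : Convex ℝ R)
    {A : Fin (l + 1) → Set (Base n' l')} {B : Fin (n + 1) → Set (Base n' l')}
    (hA : ∀ i q, q ∈ A i ↔ q ∈ R ∧ (π q).2 ∈ normalCone c i)
    (hB : ∀ j q, q ∈ B j ↔ q ∈ R ∧ (π q).1 ∈ normalCone c' j)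
    (hD : ∀ q, q ∈ D ↔ (∃ i, q ∈ A i) ∨ ∃ j, q ∈ B j)
    {H : Base n' l' → EuclideanSpace ℝ (Fin n)} {h : Base n' l' → Fin d → ℝ}
    (hh : ∀ q ∈ D, h q = F.point (H q) (π q).2 (-minForm F.alR (π q).2))
    (hHA : ∀ i, IsFiberMonotone π (A i) H)
    (hHB : ∀ j, IsFiberMonotone π (B j) fun q => H q + minForm F.alR (π q).2 • F.beR j) :
    IsPolyhedral a b D A B h := by
  have hAo : ∀ i, IsOpen (A i) := fun i => by
    rw [show A i = R ∩ (fun q => (π q).2) ⁻¹' normalCone c i from Set.ext (hA i)]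
    exact hR.inter ((isOpen_normalCone c i).preimage (by fun_prop))
  have hBo : ∀ i, IsOpen (B i) := fun i => by
    rw [show B i = R ∩ (fun q => (π q).1) ⁻¹' normalCone c' i from Set.ext (hB i)]
    exact hR.inter ((isOpen_normalCone c' i).preimage (by fun_prop))
  have hAc : ∀ i, Convex ℝ (A i) := fun i => by
    rw [show A i = R ∩ (fun q => (π q).2) ⁻¹' normalCone c i from Set.ext (hA i)]
    exact hRc.inter ((convex_normalCone c i).linear_preimage
      ((LinearMap.snd ℝ _ _).comp (π : Base n' l' →ₗ[ℝ] Base n l)))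
  have hBc : ∀ i, Convex ℝ (B i) := fun i => by
    rw [show B i = R ∩ (fun q => (π q).1) ⁻¹' normalCone c' i from Set.ext (hB i)]
    exact hRc.inter ((convex_normalCone c' i).linear_preimage
      ((LinearMap.fst ℝ _ _).comp (π : Base n' l' →ₗ[ℝ] Base n l)))
  have hAD : ∀ i, A i ⊆ D := fun i q hq => (hD q).2 (Or.inl ⟨i, hq⟩)
  have hBD : ∀ i, B i ⊆ D := fun i q hq => (hD q).2 (Or.inr ⟨i, hq⟩)
  have hmin : Continuous fun q : Base n' l' => minForm F.alR (π q).2 :=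
    (continuous_minForm _).comp (by fun_prop)
  have hHc : ∀ q ∈ D, ContinuousAt H q := fun q hq => by
    rcases (hD q).1 hq with ⟨i, hi⟩ | ⟨j, hj⟩
    · exact ((hHA i).smooth.contDiffAt ((hAo i).mem_nhds hi)).continuousAt
    · have h1 := ((hHB j).smooth.contDiffAt ((hBo j).mem_nhds hj)).continuousAt.sub
        (g := fun q => minForm F.alR (π q).2 • F.beR j)
        (hmin.smul continuous_const).continuousAt
      exact h1.congr (Eventually.of_forall fun r => by simp)
  -- the map in the coordinates of the boundary is open
  set Φ : Base n' l' → Base n l := fun q => (H q, (π q).2) with hΦ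
  have hΦo : ∀ q ∈ D, map Φ (𝓝 q) = 𝓝 (Φ q) := fun q hq => by
    rcases (hD q).1 hq with ⟨i, hi⟩ | ⟨j, hj⟩
    · exact ((hHA i).hasStrictFDerivAt (hAo i) hi).map_nhds_eq_of_surj
        (LinearMap.range_eq_top.2 ((hHA i).bijective hi).2)
    · have h1 := ((hHB j).hasStrictFDerivAt (hBo j) hj).map_nhds_eq_of_surj
        (LinearMap.range_eq_top.2 ((hHB j).bijective hj).2)
      let Sh : Base n l ≃ₜ Base n l :=
        { toFun := fun z => (z.1 - minForm F.alR z.2 • F.beR j, z.2)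
          invFun := fun z => (z.1 + minForm F.alR z.2 • F.beR j, z.2)
          left_inv := fun z => by simp
          right_inv := fun z => by simp
          continuous_toFun := (continuous_fst.sub (((continuous_minForm _).comp
            continuous_snd).smul continuous_const)).prodMk continuous_snd
          continuous_invFun := (continuous_fst.add (((continuous_minForm _).comp
            continuous_snd).smul continuous_const)).prodMk continuous_snd }
      have h2 := congrArg (map Sh) h1
      rw [Sh.map_nhds_eq, map_map] at h2
      have h3 : ∀ r : Base n' l', Sh (H r + minForm F.alR (π r).2 • F.beR j, (π r).2) = Φ r :=
        fun r => Prod.ext (add_sub_cancel_right _ _) rfl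
      rw [h3] at h2
      rw [← h2]
      exact congrFun (congrArg map (funext fun r => (h3 r).symm)) _
  -- the points of a fibre are separated, also across the walls
  have hΦi : InjOn Φ D := by
    intro q hq q' hq' heq
    by_contra hne
    have ht : (π q).2 = (π q').2 := (Prod.ext_iff.1 heq).2
    have hHeq : H q = H q' := (Prod.ext_iff.1 heq).1
    have hmem : ∀ r ∈ D, r ∈ R := fun r hr => by
      rcases (hD r).1 hr with ⟨i, hi⟩ | ⟨j, hj⟩
      exacts [((hA i r).1 hi).1, ((hB j r).1 hj).1]
    by_cases hcone : ∃ i, (π q).2 ∈ normalCone c i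
    · obtain ⟨i, hi⟩ := hcone
      have h2 := (hHA i).inner_sub_pos (hAo i) (hAc i) ((hA i q).2 ⟨hmem q hq, hi⟩)
        ((hA i q').2 ⟨hmem q' hq', ht ▸ hi⟩) hne ht
      rw [hHeq, sub_self, inner_zero_left] at h2
      exact lt_irrefl _ h2
    · obtain ⟨j, hj⟩ : ∃ j, q ∈ B j :=
        ((hD q).1 hq).resolve_left fun ⟨i, hi⟩ => hcone ⟨i, ((hA i q).1 hi).2⟩
      -- compare with a point `q''` of the segment that lies in the chart of `q`
      obtain ⟨r, hr, hr0⟩ : ∃ r : ℝ, q + r • (q' - q) ∈ B j ∧ r ∈ Ioo (0 : ℝ) 1 := by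
        have hcr : Continuous fun r : ℝ => q + r • (q' - q) := by fun_prop
        have h1 : ∀ᶠ r : ℝ in 𝓝 0, q + r • (q' - q) ∈ B j :=
          (hcr.tendsto' 0 q (by simp)).eventually ((hBo j).mem_nhds hj)
        exact ((h1.filter_mono nhdsWithin_le_nhds).and
          (Ioo_mem_nhdsGT (zero_lt_one' ℝ))).exists
      set q'' := q + r • (q' - q) with hq''
      have hu : q - q'' = r • (q - q') := by rw [hq'']; module
      have hu' : q'' - q' = (1 - r) • (q - q') := by rw [hq'']; module
      have hπ2 : (π (q - q')).2 = 0 := by rw [map_sub, Prod.snd_sub, ht, sub_self]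
      have ht'' : (π q'').2 = (π q).2 := by
        have h4 : (π (q - q'')).2 = 0 := by rw [hu, map_smul, Prod.smul_snd, hπ2, smul_zero]
        rw [map_sub, Prod.snd_sub, sub_eq_zero] at h4
        exact h4.symm
      have hne' : q ≠ q'' := by
        rw [← sub_ne_zero, hu]
        exact smul_ne_zero hr0.1.ne' (sub_ne_zero.2 hne)
      have hpos : 0 < inner ℝ (H q - H q'') (π (q - q')).1 := by
        have h1 := (hHB j).inner_sub_pos (hBo j) (hBc j) hj hr hne' ht''.symm
        simp only [ht'', add_sub_add_right_eq_sub] at h1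
        rw [hu, map_smul, Prod.smul_fst, inner_smul_right] at h1
        exact pos_of_mul_pos_right h1 hr0.1.le
      -- the second part of the segment is a limit of segments over open cones
      have hnn : 0 ≤ inner ℝ (H q'' - H q') (π (q - q')).1 := by
        set ξ : EuclideanSpace ℝ (Fin l) → Base n' l' := fun t => π.symm (0, t) with hξ
        have hξc : Continuous ξ := by fun_prop
        have hξ0 : ξ 0 = 0 := by rw [hξ]; simp
        have hsh : ∀ z : Base n' l', Tendsto (fun t => z + ξ t) (𝓝 0) (𝓝 z) := fun z =>
          (continuous_const.add hξc).tendsto' 0 z (by simp [hξ0])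
        have hlim : Tendsto (fun t => inner ℝ (H (q'' + ξ t) - H (q' + ξ t)) (π (q - q')).1) (𝓝 0)
            (𝓝 (inner ℝ (H q'' - H q') (π (q - q')).1)) :=
          ((((hHc q'' (hBD j hr)).tendsto.comp (hsh q'')).sub
            ((hHc q' hq').tendsto.comp (hsh q')))).inner tendsto_const_nhds
        refine isClosed_Ici.mem_of_frequently_of_tendsto ?_ hlim
        have hdense : ∃ᶠ t in 𝓝 (0 : EuclideanSpace ℝ (Fin l)),
            ∃ i, (π q).2 + t ∈ normalCone c i := by
          have h5 : Dense ((fun t => (π q).2 + t) ⁻¹' {t | ∃ j, t ∈ normalCone c j}) :=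
            hα.dense_normalCone.preimage (Homeomorph.addLeft (π q).2).isOpenMap
          exact mem_closure_iff_frequently.1 (h5 0)
        have hR1 : ∀ᶠ t in 𝓝 (0 : EuclideanSpace ℝ (Fin l)), q'' + ξ t ∈ R :=
          (hsh q'').eventually (hR.mem_nhds ((hB j q'').1 hr).1)
        have hR2 : ∀ᶠ t in 𝓝 (0 : EuclideanSpace ℝ (Fin l)), q' + ξ t ∈ R :=
          (hsh q').eventually (hR.mem_nhds (hmem q' hq'))
        refine (hdense.and_eventually (hR1.and hR2)).mono ?_
        rintro t ⟨⟨i, hi⟩, h1, h2⟩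
        have e1 : (π (q'' + ξ t)).2 = (π q).2 + t := by
          rw [map_add, Prod.snd_add, ht'', hξ, π.apply_symm_apply]
        have e2 : (π (q' + ξ t)).2 = (π q).2 + t := by
          rw [map_add, Prod.snd_add, ← ht, hξ, π.apply_symm_apply]
        have h6 := (hHA i).inner_sub_pos (hAo i) (hAc i) ((hA i _).2 ⟨h1, e1 ▸ hi⟩)
          ((hA i _).2 ⟨h2, e2 ▸ hi⟩) (by
            rw [← sub_ne_zero, add_sub_add_right_eq_sub, hu']
            exact smul_ne_zero (sub_pos.2 hr0.2).ne' (sub_ne_zero.2 hne)) (e1.trans e2.symm)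
        rw [add_sub_add_right_eq_sub, hu', map_smul, Prod.smul_fst, inner_smul_right] at h6
        exact (pos_of_mul_pos_right h6 (sub_pos.2 hr0.2).le).le
      have h7 : inner ℝ (H q - H q') (π (q - q')).1 = inner ℝ (H q - H q'') (π (q - q')).1 +
          inner ℝ (H q'' - H q') (π (q - q')).1 := by
        rw [← inner_add_left, sub_add_sub_cancel]
      have h8 : inner ℝ (H q - H q') (π (q - q')).1 = 0 := by
        rw [hHeq, sub_self, inner_zero_left]
      linarith
  have hDo : IsOpen D := by
    rw [show D = (⋃ i, A i) ∪ ⋃ j, B j from Set.ext fun q => by simp [hD q]]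
    exact (isOpen_iUnion hAo).union (isOpen_iUnion hBo)
  have hΦe : IsOpenEmbedding (D.domRestrict Φ) := by
    refine IsOpenEmbedding.of_continuous_injective_isOpenMap ?_ (injOn_iff_injective.1 hΦi) ?_
    · exact continuousOn_iff_continuous_domRestrict.1 fun q hq =>
        ((hHc q hq).prodMk (by fun_prop)).continuousWithinAt
    · rw [isOpenMap_iff_nhds_le]
      rintro ⟨q, hq⟩
      rw [show D.domRestrict Φ = Φ ∘ Subtype.val from rfl, ← map_map, map_nhds_subtype_val,
        hDo.nhdsWithin_eq hq, hΦo q hq]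
      exact le_rfl
  have hfr : ∀ q (hq : q ∈ D), h q = (F.frontierHomeomorph (Φ q) : Fin d → ℝ) := hh
  have hmaps : MapsTo h D (frontier (dualCone a)) := fun q hq => by
    rw [hfr q hq]; exact Subtype.coe_prop _
  have hcoordF : ∀ q ∈ D, F.coordF (h q) = (π q).2 := fun q hq => by rw [hh q hq, coordF_point]
  have hcoordE : ∀ q ∈ D, F.coordE (h q) = H q := fun q hq => by rw [hh q hq, coordE_point]
  have ha0 : ∀ q ∈ D, toReal (a 0) ⬝ᵥ h q = -minForm F.alR (π q).2 := fun q hq => by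
    rw [hh q hq, a_zero_point]
  have hface : ∀ i, ∀ p ∈ A i, h p ∈ perp (a i) := fun i p hp => by
    have hpD := hAD i hp
    change toReal (a i) ⬝ᵥ h p = 0
    rw [F.a_dot_coord, hcoordF p hpD, ha0 p hpD, hα.minForm_eq ((hA i p).1 hp).2, neg_add_cancel]
  refine ⟨hmaps, ?_, hface, fun i => ?_, fun j => ?_⟩
  · have h1 := F.frontierHomeomorph.isOpenEmbedding.comp hΦe
    convert h1 using 1
    funext q
    exact Subtype.ext (hfr q q.2)
  · refine (hHA i).isSmoothChart (hAo i) (hAc i) (F.perpLatticeCoord i).coord fun q hq => ?_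
    rw [F.perpLatticeCoord_apply, perpCoord, dif_pos (hface i q hq)]
    exact Prod.ext (hcoordE q (hAD i hq)) (hcoordF q (hAD i hq))
  · refine (hHB j).isSmoothChart (hBo j) (hBc j) (F.quotLatticeCoord j).coord fun q hq => ?_
    have hqD := hBD j hq
    rw [quotCoord, F.quotLatticeCoord_mkQ, hcoordE q hqD, hcoordF q hqD, ha0 q hqD, neg_smul,
      sub_neg_eq_add]

end AdaptedFrame

/-! ### Gradients of split potentials -/

section gradients

variable {n l : ℕ} {K : Base n l → ℝ} {O : Set (Base n l)}
  {η η' : Base n l → EuclideanSpace ℝ (Fin n)} {ϑ ϑ' : Base n l → EuclideanSpace ℝ (Fin l)}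
  {V : Base n l → Matrix (Fin n) (Fin n) ℝ} {W : Base n l → Matrix (Fin l) (Fin l) ℝ}

namespace HasSplitGradient

theorem congr (h : HasSplitGradient K O η ϑ) (h1 : ∀ q ∈ O, η' q = η q)
    (h2 : ∀ q ∈ O, ϑ' q = ϑ q) : HasSplitGradient K O η' ϑ' :=
  ⟨h.smooth, fun q hq => by rw [h.gradient q hq, h1 q hq, h2 q hq]⟩

theorem isSplitPotential_iff (h : HasSplitGradient K O η ϑ) (hO : IsOpen O) :
    IsSplitPotential K O V W ↔ ∀ q ∈ O, (∀ i j, V q i j = fderiv ℝ η q (sdir j) i) ∧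
      ∀ i j, W q i j = fderiv ℝ ϑ q (tdir j) i := by
  constructor
  · intro H q hq
    refine ⟨fun i j => ?_, fun i j => ?_⟩
    · rw [h.fderiv_eta hO hq, H.hess_s q hq]
    · rw [h.fderiv_theta hO hq, H.hess_t q hq]
  · intro H
    refine ⟨h.smooth, fun q hq i j => ?_, fun q hq i j => ?_⟩
    · rw [(H q hq).1, h.fderiv_eta hO hq]
    · rw [(H q hq).2, h.fderiv_theta hO hq]

theorem metric_eq_of_isSplitPotential (h : HasSplitGradient K O η ϑ) (hO : IsOpen O)
    (hP : IsSplitPotential K O V W) {q : Base n l} (hq : q ∈ O) (u u' : Base n l) :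
    inner ℝ u'.1 (fderiv ℝ η q u) + inner ℝ (fderiv ℝ ϑ q u') u.2 =
      ∑ i, ∑ j, V q i j * u.1 i * u'.1 j + ∑ i, ∑ j, W q i j * u.2 i * u'.2 j := by
  rw [h.metric_eq hO hq]
  simp only [hP.hess_s q hq, hP.hess_t q hq]

/-- Adding a function that is affine in `s` and in `t` to the potential. -/
theorem add_biaffine (h : HasSplitGradient K O η ϑ) (hO : IsOpen O)
    (B : EuclideanSpace ℝ (Fin n)) (C : EuclideanSpace ℝ (Fin l))
    (T : EuclideanSpace ℝ (Fin l) →L[ℝ] EuclideanSpace ℝ (Fin n)) :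
    HasSplitGradient (fun q => K q + (inner ℝ B q.1 + inner ℝ C q.2 + inner ℝ (T q.2) q.1)) O
      (fun q => η q + B + T q.2)
      (fun q => ϑ q - C - ContinuousLinearMap.adjoint T q.1) := by
  refine ⟨h.smooth.add (((contDiffOn_const.inner ℝ contDiffOn_fst).add
    (contDiffOn_const.inner ℝ contDiffOn_snd)).add
    ((T.contDiff.comp_contDiffOn contDiffOn_snd).inner ℝ contDiffOn_fst)), fun q hq => ?_⟩
  have h1 : HasFDerivAt K (fderiv ℝ K q) q :=
    ((h.smooth.contDiffAt (hO.mem_nhds hq)).differentiableAt (by simp)).hasFDerivAt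
  have h2 : HasFDerivAt (fun q : Base n l => inner ℝ B q.1 + inner ℝ C q.2) (pairForm B C) q :=
    (pairForm B C).hasFDerivAt
  have h3 := (T.hasFDerivAt.comp q (hasFDerivAt_snd (𝕜 := ℝ) (p := q))).inner ℝ
    (hasFDerivAt_fst (𝕜 := ℝ) (p := q))
  refine (h1.add (h2.add h3)).fderiv.trans (ContinuousLinearMap.ext fun u => ?_)
  rw [h.gradient q hq]
  have e1 : inner ℝ (ContinuousLinearMap.adjoint T q.1) u.2 = inner ℝ (T u.2) q.1 := by
    rw [ContinuousLinearMap.adjoint_inner_left, real_inner_comm]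
  simp only [add_apply, pairForm_apply, ContinuousLinearMap.comp_apply, fderivInnerCLM_apply,
    ContinuousLinearMap.prod_apply, inner_add_left, inner_sub_left, inner_neg_left, e1]
  change _ + (_ + (inner ℝ (T q.2) u.1 + inner ℝ (T u.2) q.1)) = _
  ring

/-- Biaffine functions have no pure second derivatives, so adding one changes neither `V` nor `W`.
-/
theorem isSplitPotential_add_biaffine (h : HasSplitGradient K O η ϑ) (hO : IsOpen O)
    (hP : IsSplitPotential K O V W)
    (B : EuclideanSpace ℝ (Fin n)) (C : EuclideanSpace ℝ (Fin l))
    (T : EuclideanSpace ℝ (Fin l) →L[ℝ] EuclideanSpace ℝ (Fin n)) :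
    IsSplitPotential (fun q => K q + (inner ℝ B q.1 + inner ℝ C q.2 + inner ℝ (T q.2) q.1)) O
      V W := by
  rw [(h.add_biaffine hO B C T).isSplitPotential_iff hO]
  rw [h.isSplitPotential_iff hO] at hP
  intro q hq
  have h1 := (((h.smooth_eta hO).contDiffAt (hO.mem_nhds hq)).differentiableAt
    (by simp)).hasFDerivAt
  have h2 := (((h.smooth_theta hO).contDiffAt (hO.mem_nhds hq)).differentiableAt
    (by simp)).hasFDerivAt
  have h3 := (h1.add_const B).add (T.hasFDerivAt.comp q (hasFDerivAt_snd (𝕜 := ℝ) (p := q)))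
  have h4 := (h2.sub_const C).sub ((ContinuousLinearMap.adjoint T).hasFDerivAt.comp q
    (hasFDerivAt_fst (𝕜 := ℝ) (p := q)))
  refine ⟨fun i j => ?_, fun i j => ?_⟩
  · rw [(hP q hq).1, show fderiv ℝ (fun q => η q + B + T q.2) q = _ from h3.fderiv, add_apply,
      show (T.comp (ContinuousLinearMap.snd ℝ _ _)) (sdir j : Base n l) = T 0 from rfl, map_zero,
      add_zero]
  · rw [(hP q hq).2, show fderiv ℝ (fun q => ϑ q - C - ContinuousLinearMap.adjoint T q.1) q = _
      from h4.fderiv, sub_apply, show ((ContinuousLinearMap.adjoint T).comp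
      (ContinuousLinearMap.fst ℝ _ _)) (tdir j : Base n l) = ContinuousLinearMap.adjoint T 0
      from rfl, map_zero, sub_zero]

/-- Two potentials of the same pair of matrix functions differ by a function that is affine in `s`
and in `t`. -/
theorem exists_biaffine {K' : Base n l → ℝ} (h : HasSplitGradient K O η ϑ)
    (h' : HasSplitGradient K' O η' ϑ') (hO : IsOpen O) (hc : Convex ℝ O)
    (hP : IsSplitPotential K O V W) (hP' : IsSplitPotential K' O V W) :
    ∃ (B : EuclideanSpace ℝ (Fin n)) (C : EuclideanSpace ℝ (Fin l))
      (T : EuclideanSpace ℝ (Fin l) →L[ℝ] EuclideanSpace ℝ (Fin n)), ∀ q ∈ O,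
      η' q = η q + B + T q.2 ∧ ϑ' q = ϑ q - C - ContinuousLinearMap.adjoint T q.1 := by
  have hd : ∀ q ∈ O, DifferentiableAt ℝ K q := fun q hq =>
    (h.smooth.contDiffAt (hO.mem_nhds hq)).differentiableAt (by simp)
  have hd' : ∀ q ∈ O, DifferentiableAt ℝ K' q := fun q hq =>
    (h'.smooth.contDiffAt (hO.mem_nhds hq)).differentiableAt (by simp)
  have hsd : ∀ q ∈ O, ∀ u u', secondDeriv (fun q => K' q - K q) q u u' =
      secondDeriv K' q u u' - secondDeriv K q u u' := fun q hq u u' => by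
    have e1 : (fun q => fderiv ℝ (fun q => K' q - K q) q u) =ᶠ[𝓝 q]
        fun q => fderiv ℝ K' q u - fderiv ℝ K q u := by
      filter_upwards [hO.mem_nhds hq] with r hr
      rw [fderiv_fun_sub (hd' r hr) (hd r hr), sub_apply]
    have e2 : DifferentiableAt ℝ (fun q => fderiv ℝ K' q u) q :=
      ((h'.smooth.contDiffAt (hO.mem_nhds hq)).fderiv_infty.clm_apply
        contDiffAt_const).differentiableAt (by simp)
    have e3 : DifferentiableAt ℝ (fun q => fderiv ℝ K q u) q :=
      ((h.smooth.contDiffAt (hO.mem_nhds hq)).fderiv_infty.clm_apply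
        contDiffAt_const).differentiableAt (by simp)
    rw [secondDeriv, e1.fderiv_eq, fderiv_fun_sub e2 e3, sub_apply]
    rfl
  obtain ⟨B, C, D, hBCD⟩ := _root_.exists_biaffine hO hc (κ := fun q => K' q - K q)
    (h'.smooth.sub h.smooth)
    (fun q hq i j => by rw [hsd q hq, ← hP.hess_s q hq, ← hP'.hess_s q hq, sub_self])
    (fun q hq i j => by
      rw [hsd q hq, ← neg_inj, neg_sub, neg_zero, sub_eq_add_neg, add_comm, ← hP'.hess_t q hq,
        ← sub_neg_eq_add, ← hP.hess_t q hq, sub_self])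
  refine ⟨WithLp.toLp 2 B, WithLp.toLp 2 C,
    LinearMap.toContinuousLinearMap (Matrix.toEuclideanLin (Matrix.of D)), fun q hq => ⟨?_, ?_⟩⟩
  · ext i
    have h1 := (hBCD q hq).1 i
    rw [fderiv_fun_sub (hd' q hq) (hd q hq), sub_apply, ← h.eta_apply hq, ← h'.eta_apply hq] at h1
    simp [Matrix.toLpLin_apply, Matrix.mulVec, dotProduct]
    linarith
  · ext p
    have h1 := (hBCD q hq).2 p
    rw [fderiv_fun_sub (hd' q hq) (hd q hq), sub_apply] at h1
    have h2 : ∀ T : EuclideanSpace ℝ (Fin l) →L[ℝ] EuclideanSpace ℝ (Fin n),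
        ContinuousLinearMap.adjoint T q.1 p = inner ℝ q.1 (T (EuclideanSpace.single p 1)) :=
      fun T => by rw [← inner_single_one, ContinuousLinearMap.adjoint_inner_left]
    rw [PiLp.sub_apply, PiLp.sub_apply, h2, h.theta_apply hq, h'.theta_apply hq, PiLp.inner_apply]
    simp [Matrix.toLpLin_apply]
    linarith

end HasSplitGradient

theorem sum_eq_dotProduct_mulVec {k : ℕ} (M : Matrix (Fin k) (Fin k) ℝ) (x : Fin k → ℝ) :
    ∑ i, ∑ j, M i j * x i * x j = star x ⬝ᵥ M *ᵥ x := by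
  simp only [dotProduct, Matrix.mulVec, Finset.mul_sum, Pi.star_apply, star_trivial]
  exact Finset.sum_congr rfl fun i _ => Finset.sum_congr rfl fun j _ => by ring

theorem Matrix.PosDef.sum_pos {k : ℕ} {M : Matrix (Fin k) (Fin k) ℝ} (h : M.PosDef)
    {x : EuclideanSpace ℝ (Fin k)} (hx : x ≠ 0) : 0 < ∑ i, ∑ j, M i j * x i * x j := by
  rw [sum_eq_dotProduct_mulVec M (fun i => x i)]
  exact h.dotProduct_mulVec_pos fun h0 => hx (by ext i; exact congrFun h0 i)

variable {U : Set (Base n l)}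

/-- The first part of the gradient of a potential is monotone in `s`. -/
theorem isFiberMonotone_eta (hpot : ∀ q ∈ U, ∃ O : Set (Base n l), IsOpen O ∧ q ∈ O ∧
      ∃ K : Base n l → ℝ, HasSplitGradient K O η ϑ ∧ IsSplitPotential K O V W)
    (hV : ∀ q ∈ U, (V q).PosDef) :
    IsFiberMonotone (ContinuousLinearEquiv.refl ℝ (Base n l)) U η := by
  refine ⟨fun q hq => ?_, fun q hq u hu hne => ?_⟩
  · obtain ⟨O, hO, hqO, K, hK, -⟩ := hpot q hq
    exact ((hK.smooth_eta hO).contDiffAt (hO.mem_nhds hqO)).contDiffWithinAt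
  · obtain ⟨O, hO, hqO, K, hK, hP⟩ := hpot q hq
    have hu2 : u.2 = 0 := hu
    have h1 := hK.metric_eq_of_isSplitPotential hO hP hqO u u
    rw [hu2, inner_zero_right, add_zero] at h1
    simp only [PiLp.zero_apply, mul_zero, Finset.sum_const_zero, add_zero] at h1
    change 0 < inner ℝ (fderiv ℝ η q u) u.1
    rw [real_inner_comm, h1]
    exact (hV q hq).sum_pos fun h0 => hne (Prod.ext h0 hu2)

/-- The second part of the gradient of a potential is monotone in `t`. -/
theorem isFiberMonotone_theta (hpot : ∀ q ∈ U, ∃ O : Set (Base n l), IsOpen O ∧ q ∈ O ∧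
      ∃ K : Base n l → ℝ, HasSplitGradient K O η ϑ ∧ IsSplitPotential K O V W)
    (hW : ∀ q ∈ U, (W q).PosDef) :
    IsFiberMonotone (ContinuousLinearEquiv.prodComm ℝ (EuclideanSpace ℝ (Fin n))
      (EuclideanSpace ℝ (Fin l))) U ϑ := by
  refine ⟨fun q hq => ?_, fun q hq u hu hne => ?_⟩
  · obtain ⟨O, hO, hqO, K, hK, -⟩ := hpot q hq
    exact ((hK.smooth_theta hO).contDiffAt (hO.mem_nhds hqO)).contDiffWithinAt
  · obtain ⟨O, hO, hqO, K, hK, hP⟩ := hpot q hq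
    have hu1 : u.1 = 0 := hu
    have h1 := hK.metric_eq_of_isSplitPotential hO hP hqO u u
    rw [hu1, inner_zero_left, zero_add] at h1
    simp only [PiLp.zero_apply, mul_zero, Finset.sum_const_zero, zero_add] at h1
    change 0 < inner ℝ (fderiv ℝ ϑ q u) u.2
    rw [h1]
    exact (hW q hq).sum_pos fun h0 => hne (Prod.ext hu1 h0)

end gradients

/-! ### The gradient of a bi-PIKAS -/

/-- The functions `η` and `θ` are the coordinates of the embeddings of a bi-PIKAS that corresponds
to the pair `(V, W)`. On the chart of `v_a` they give the gradient `(η, θ + ⟨w, s⟩ v_a)` of a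
potential, and on the chart of `w_j` the gradient `(η + ⟨v, t⟩ w_j, θ)`. Here `⟨w, s⟩` and
`⟨v, t⟩` stand for the minima of `s` and `t` on the simplices, which enter since the embeddings
lie in the boundaries of the dual cones. -/
structure IsEmbeddingGradient {n l : ℕ} (S : SimplexPair n l) (R : Set (Base n l))
    (V : Base n l → Matrix (Fin n) (Fin n) ℝ) (W : Base n l → Matrix (Fin l) (Fin l) ℝ)
    (η : Base n l → EuclideanSpace ℝ (Fin n)) (θ : Base n l → EuclideanSpace ℝ (Fin l)) :
    Prop where
  potV : ∀ a, ∀ q ∈ S.chartV R a, ∃ O : Set (Base n l), IsOpen O ∧ q ∈ O ∧ O ⊆ S.chartV R a ∧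
    ∃ K : Base n l → ℝ, HasSplitGradient K O η
      (fun r => θ r + minForm S.frame.beR r.1 • S.frame.alR a) ∧ IsSplitPotential K O V W
  potW : ∀ j, ∀ q ∈ S.chartW R j, ∃ O : Set (Base n l), IsOpen O ∧ q ∈ O ∧ O ⊆ S.chartW R j ∧
    ∃ K : Base n l → ℝ, HasSplitGradient K O
      (fun r => η r + minForm S.frame.alR r.2 • S.frame.beR j) θ ∧ IsSplitPotential K O V W

namespace BiPIKAS

variable {n l : ℕ} {S : SimplexPair n l} {R : Set (Base n l)} (P : BiPIKAS S R)

/-- The coordinates of `h` along the basis of `N_σ`. -/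
def eta (q : Base n l) : EuclideanSpace ℝ (Fin n) := S.frame.coordE (P.h q)

/-- The coordinates of `k` along the basis of `N^*_τ`. -/
def theta (q : Base n l) : EuclideanSpace ℝ (Fin l) := S.frame.swap.coordE (P.k q)

variable {P} {q : Base n l}

theorem coordF_h (hq : q ∈ S.regular R) : S.frame.coordF (P.h q) = q.2 := by
  ext p
  rw [AdaptedFrame.coordF_apply, S.frame_fs, P.h_proj q hq]

theorem coordF_k (hq : q ∈ S.regular R) : S.frame.swap.coordF (P.k q) = q.1 := by
  ext i
  rw [AdaptedFrame.coordF_apply, ← P.k_proj q hq i, dotProduct_comm]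
  change _ ⬝ᵥ toReal (S.frame.e i) = _
  rw [S.frame_e]

theorem v_zero_dot_h (hq : q ∈ S.regular R) :
    toReal (S.v 0) ⬝ᵥ P.h q = -minForm S.frame.alR q.2 := by
  rw [(S.frame.mem_frontier_dualCone _).1 (P.h_polyhedral.mapsTo hq), coordF_h hq]

theorem w_zero_dot_k (hq : q ∈ S.regular R) :
    toReal (S.w 0) ⬝ᵥ P.k q = -minForm S.frame.beR q.1 := by
  rw [(S.frame.swap.mem_frontier_dualCone _).1 (P.k_polyhedral.mapsTo hq), coordF_k hq]
  rfl

theorem k_dot (hq : q ∈ S.regular R) (y : Fin (n + l + 1) → ℝ) :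
    P.k q ⬝ᵥ y = inner ℝ q.1 (S.frame.coordE y) + inner ℝ (P.theta q) (S.frame.coordF y) -
      minForm S.frame.beR q.1 * (toReal (S.v 0) ⬝ᵥ y) := by
  rw [S.frame.dotProduct_eq, coordF_k hq, w_zero_dot_k hq, neg_mul, ← sub_eq_add_neg]
  rfl

theorem coord_perpCoord {a : Fin (l + 1)} (hq : q ∈ S.chartV R a) :
    (S.frame.perpLatticeCoord a).coord (perpCoord (S.v a) P.h q) = (P.eta q, q.2) := by
  rw [AdaptedFrame.perpLatticeCoord_apply, P.perpCoord_coe hq, coordF_h (S.chartV_subset a hq)]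
  rfl

theorem coord_quotCoord {j : Fin (n + 1)} (hq : q ∈ S.chartW R j) :
    (S.frame.quotLatticeCoord j).coord (quotCoord (S.w j) P.h q) =
      (P.eta q + minForm S.frame.alR q.2 • S.frame.beR j, q.2) := by
  rw [quotCoord, AdaptedFrame.quotLatticeCoord_mkQ, coordF_h (S.chartW_subset j hq),
    v_zero_dot_h (S.chartW_subset j hq), neg_smul, sub_neg_eq_add]
  rfl

theorem k_dot_perp {a : Fin (l + 1)} (hq : q ∈ S.chartV R a) (y : perp (S.v a)) :
    P.k q ⬝ᵥ (y : Fin (n + l + 1) → ℝ) =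
      pairForm q.1 (P.theta q + minForm S.frame.beR q.1 • S.frame.alR a)
        ((S.frame.perpLatticeCoord a).coord y) := by
  have hy : toReal (S.v a) ⬝ᵥ (y : Fin (n + l + 1) → ℝ) = 0 := y.2
  rw [S.frame.a_dot_coord] at hy
  rw [k_dot (S.chartV_subset a hq), AdaptedFrame.perpLatticeCoord_apply, pairForm_apply,
    eq_neg_of_add_eq_zero_left hy, inner_add_left, inner_smul_left]
  simp
  ring

theorem k_dot_quot {j : Fin (n + 1)} (hq : q ∈ S.chartW R j) (y : Fin (n + l + 1) → ℝ) :
    P.k q ⬝ᵥ y = pairForm q.1 (P.theta q)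
      ((S.frame.quotLatticeCoord j).coord ((line (S.w j)).mkQ y)) := by
  rw [k_dot (S.chartW_subset j hq), AdaptedFrame.quotLatticeCoord_mkQ, pairForm_apply,
    S.isSimplexEdges_edgeW.minForm_eq hq.2, inner_sub_right, inner_smul_right,
    real_inner_comm q.1]
  ring

/-- The local potentials on the charts of the `v_a`. -/
theorem exists_hasSplitGradient_chartV (hR : IsOpen R) (P : BiPIKAS S R) {a : Fin (l + 1)}
    {p : Base n l} (hp : p ∈ S.chartV R a) :
    ∃ O : Set (Base n l), IsOpen O ∧ p ∈ O ∧ O ⊆ S.chartV R a ∧ ∃ K : Base n l → ℝ,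
      HasSplitGradient K O P.eta
        (fun r => P.theta r + minForm S.frame.beR r.1 • S.frame.alR a) ∧ ∀ q ∈ O,
      (∀ u u', P.g q u u' = ∑ i, ∑ j, secondDeriv K q (sdir i) (sdir j) * u.1 i * u'.1 j +
        ∑ i, ∑ j, -secondDeriv K q (tdir i) (tdir j) * u.2 i * u'.2 j) ∧
      (Matrix.of fun i j => secondDeriv K q (sdir i) (sdir j)).det ^ 2 =
        (Matrix.of fun i j => secondDeriv K q (sdir i) (sdir j)).det *
          (Matrix.of fun i j => -secondDeriv K q (tdir i) (tdir j)).det :=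
  (P.mongeAmpere_v a).exists_hasSplitGradient (S.frame.perpLatticeCoord a) (S.isOpen_chartV hR a)
    (P.h_polyhedral.chart_perp a) (fun _ hq => coord_perpCoord hq) (fun _ hq => k_dot_perp hq) hp

/-- The local potentials on the charts of the `w_j`. -/
theorem exists_hasSplitGradient_chartW (hR : IsOpen R) (P : BiPIKAS S R) {j : Fin (n + 1)}
    {p : Base n l} (hp : p ∈ S.chartW R j) :
    ∃ O : Set (Base n l), IsOpen O ∧ p ∈ O ∧ O ⊆ S.chartW R j ∧ ∃ K : Base n l → ℝ,
      HasSplitGradient K O (fun r => P.eta r + minForm S.frame.alR r.2 • S.frame.beR j)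
        P.theta ∧ ∀ q ∈ O,
      (∀ u u', P.g q u u' = ∑ i, ∑ j, secondDeriv K q (sdir i) (sdir j) * u.1 i * u'.1 j +
        ∑ i, ∑ j, -secondDeriv K q (tdir i) (tdir j) * u.2 i * u'.2 j) ∧
      (Matrix.of fun i j => secondDeriv K q (sdir i) (sdir j)).det ^ 2 =
        (Matrix.of fun i j => secondDeriv K q (sdir i) (sdir j)).det *
          (Matrix.of fun i j => -secondDeriv K q (tdir i) (tdir j)).det := by
  obtain ⟨x, hx, hMA⟩ := P.mongeAmpere_w j
  refine hMA.exists_hasSplitGradient (S.frame.quotLatticeCoord j) (S.isOpen_chartW hR j)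
    (P.h_polyhedral.chart_quot j) (fun _ hq => coord_quotCoord hq) (fun q hq v => ?_) hp
  obtain ⟨y, rfl⟩ := (line (S.w j)).mkQ_surjective v
  rw [hx q hq, k_dot_quot hq]

/-- The restriction of the metric to the directions of `s`. -/
def matV (P : BiPIKAS S R) (q : Base n l) : Matrix (Fin n) (Fin n) ℝ :=
  open Classical in if q ∈ S.regular R then .of fun i j => P.g q (sdir i) (sdir j) else 0

/-- The restriction of the metric to the directions of `t`. -/
def matW (P : BiPIKAS S R) (q : Base n l) : Matrix (Fin l) (Fin l) ℝ :=
  open Classical in if q ∈ S.regular R then .of fun i j => P.g q (tdir i) (tdir j) else 0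

theorem matV_apply (P : BiPIKAS S R) (hq : q ∈ S.regular R) (i j : Fin n) :
    P.matV q i j = P.g q (sdir i) (sdir j) := by
  rw [matV, if_pos hq, Matrix.of_apply]

theorem matW_apply (P : BiPIKAS S R) (hq : q ∈ S.regular R) (i j : Fin l) :
    P.matW q i j = P.g q (tdir i) (tdir j) := by
  rw [matW, if_pos hq, Matrix.of_apply]

theorem isSplitPotential_of_metric {O : Set (Base n l)} {K : Base n l → ℝ}
    (hK : ContDiffOn ℝ ∞ K O) (hO : O ⊆ S.regular R)
    (hg : ∀ q ∈ O, ∀ u u', P.g q u u' =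
      ∑ i, ∑ j, secondDeriv K q (sdir i) (sdir j) * u.1 i * u'.1 j +
        ∑ i, ∑ j, -secondDeriv K q (tdir i) (tdir j) * u.2 i * u'.2 j) :
    IsSplitPotential K O P.matV P.matW := by
  refine ⟨hK, fun q hq i j => ?_, fun q hq i j => ?_⟩
  · rw [P.matV_apply (hO hq), hg q hq]
    simp [sdir]
  · rw [P.matW_apply (hO hq), hg q hq]
    simp [tdir]

theorem isEmbeddingGradient (hR : IsOpen R) (P : BiPIKAS S R) :
    IsEmbeddingGradient S R P.matV P.matW P.eta P.theta := by
  refine ⟨fun a p hp => ?_, fun j p hp => ?_⟩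
  · obtain ⟨O, hO, hpO, hOU, K, hK, hg⟩ := P.exists_hasSplitGradient_chartV hR hp
    exact ⟨O, hO, hpO, hOU, K, hK, isSplitPotential_of_metric hK.smooth
      (hOU.trans (S.chartV_subset a)) fun q hq => (hg q hq).1⟩
  · obtain ⟨O, hO, hpO, hOU, K, hK, hg⟩ := P.exists_hasSplitGradient_chartW hR hp
    exact ⟨O, hO, hpO, hOU, K, hK, isSplitPotential_of_metric hK.smooth
      (hOU.trans (S.chartW_subset j)) fun q hq => (hg q hq).1⟩

/-- The metric restricts to a positive definite matrix on every subspace. -/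
theorem posDef_of_metric (P : BiPIKAS S R) (hq : q ∈ S.regular R) {k : ℕ}
    (b : EuclideanSpace ℝ (Fin k) →L[ℝ] Base n l) (hb : Function.Injective b) :
    (Matrix.of fun i j => P.g q (b (EuclideanSpace.single i 1))
      (b (EuclideanSpace.single j 1))).PosDef := by
  refine Matrix.PosDef.of_dotProduct_mulVec_pos ?_ fun x hx => ?_
  · ext i j
    simp [P.g_symm q hq (b (EuclideanSpace.single i 1))]
  · have h1 := P.g_pos q hq (b (WithLp.toLp 2 x)) fun h0 => hx (by
      have := hb (h0.trans (map_zero b).symm)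
      ext i
      exact congrArg (fun y : EuclideanSpace ℝ (Fin k) => y i) this)
    rw [eq_sum_single (WithLp.toLp 2 x)] at h1
    simp only [map_sum, map_smul, sum_apply, smul_apply, smul_eq_mul] at h1
    rw [← sum_eq_dotProduct_mulVec]
    refine h1.trans_eq ?_
    rw [Finset.sum_comm]
    simp only [Finset.mul_sum, Matrix.of_apply]
    exact Finset.sum_congr rfl fun i _ => Finset.sum_congr rfl fun j _ => by ring

theorem posDef_matV (P : BiPIKAS S R) (hq : q ∈ S.regular R) : (P.matV q).PosDef := by
  have h1 := P.posDef_of_metric hq (ContinuousLinearMap.inl ℝ _ _)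
    (fun x y h => congrArg Prod.fst h)
  rw [matV, if_pos hq]
  exact h1

theorem posDef_matW (P : BiPIKAS S R) (hq : q ∈ S.regular R) : (P.matW q).PosDef := by
  have h1 := P.posDef_of_metric hq (ContinuousLinearMap.inr ℝ _ _)
    (fun x y h => congrArg Prod.snd h)
  rw [matW, if_pos hq]
  exact h1

/-- The Monge–Ampère equation in a chart reads `(det V) ^ 2 = det V * det W`, and `det V` is
positive. -/
theorem det_matV (hR : IsOpen R) (P : BiPIKAS S R) (hq : q ∈ S.regular R) :
    (P.matV q).det = (P.matW q).det := by
  suffices H : (P.matV q).det ^ 2 = (P.matV q).det * (P.matW q).det by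
    rw [pow_two] at H
    exact mul_left_cancel₀ (P.posDef_matV hq).det_pos.ne' H
  rcases S.mem_regular_iff.1 hq with ⟨a, ha⟩ | ⟨j, hj⟩
  · obtain ⟨O, hO, hpO, hOU, K, hK, hg⟩ := P.exists_hasSplitGradient_chartV hR ha
    have hP := isSplitPotential_of_metric hK.smooth (hOU.trans (S.chartV_subset a))
      fun q hq => (hg q hq).1
    have h1 := (hg q hpO).2
    simp only [← hP.hess_s q hpO, ← hP.hess_t q hpO] at h1
    exact h1
  · obtain ⟨O, hO, hpO, hOU, K, hK, hg⟩ := P.exists_hasSplitGradient_chartW hR hj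
    have hP := isSplitPotential_of_metric hK.smooth (hOU.trans (S.chartW_subset j))
      fun q hq => (hg q hq).1
    have h1 := (hg q hpO).2
    simp only [← hP.hess_s q hpO, ← hP.hess_t q hpO] at h1
    exact h1

end BiPIKAS

namespace IsEmbeddingGradient

variable {n l : ℕ} {S : SimplexPair n l} {R : Set (Base n l)}
  {V : Base n l → Matrix (Fin n) (Fin n) ℝ} {W : Base n l → Matrix (Fin l) (Fin l) ℝ}
  {η : Base n l → EuclideanSpace ℝ (Fin n)} {θ : Base n l → EuclideanSpace ℝ (Fin l)}

/-- The discontinuities of the gradient are those of the model `minForm (s) * minForm (t)`. -/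
theorem exists_isGlued (h : IsEmbeddingGradient S R V W η θ)
    (hV : ∀ q ∈ S.regular R, (V q).PosDef) (hW : ∀ q ∈ S.regular R, (W q).PosDef) :
    ∃ ηZ ϑY, IsGlued S R V W η ηZ ϑY θ 0 0 S.modelD := by
  classical
  refine ⟨fun q => η q + minForm S.frame.alR q.2 •
      (if hj : ∃ j, q.1 ∈ normalCone S.edgeW j then S.frame.beR hj.choose else 0),
    fun q => θ q + minForm S.frame.beR q.1 •
      (if ha : ∃ a, q.2 ∈ normalCone S.edgeV a then S.frame.alR ha.choose else 0),
    hV, hW, fun a q hq => ?_, fun j q hq => ?_, fun j a q hq hj ha i => ?_,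
    fun j a q hq hj ha p => ?_⟩
  · obtain ⟨O, hO, hqO, hOU, K, hK, hP⟩ := h.potV a q hq
    refine ⟨O, hO, hqO, K, hK.congr (fun _ _ => rfl) fun r hr => ?_, hP⟩
    have hex : ∃ a, r.2 ∈ normalCone S.edgeV a := ⟨a, (hOU hr).2⟩
    rw [dif_pos hex, S.isSimplexEdges_edgeV.normalCone_unique hex.choose_spec (hOU hr).2]
  · obtain ⟨O, hO, hqO, hOU, K, hK, hP⟩ := h.potW j q hq
    refine ⟨O, hO, hqO, K, hK.congr (fun r hr => ?_) fun _ _ => rfl, hP⟩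
    have hex : ∃ j, r.1 ∈ normalCone S.edgeW j := ⟨j, (hOU hr).2⟩
    rw [dif_pos hex, S.isSimplexEdges_edgeW.normalCone_unique hex.choose_spec (hOU hr).2]
  · have hex : ∃ j, q.1 ∈ normalCone S.edgeW j := ⟨j, hj⟩
    rw [dif_pos hex, S.isSimplexEdges_edgeW.normalCone_unique hex.choose_spec hj,
      S.isSimplexEdges_edgeV.minForm_eq ha, PiLp.inner_apply]
    simp [SimplexPair.modelD, Finset.sum_mul]
    exact Finset.sum_congr rfl fun p _ => by ring
  · have hex : ∃ a, q.2 ∈ normalCone S.edgeV a := ⟨a, ha⟩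
    rw [dif_pos hex, S.isSimplexEdges_edgeV.normalCone_unique hex.choose_spec ha,
      S.isSimplexEdges_edgeW.minForm_eq hj, PiLp.inner_apply]
    simp [SimplexPair.modelD, Finset.sum_mul]
    exact Finset.sum_congr rfl fun p _ => by ring

end IsEmbeddingGradient

namespace BiPIKAS

variable {n l : ℕ} {S : SimplexPair n l} {R : Set (Base n l)}

/-- The split solution given by a bi-PIKAS. -/
def splitSolution (hR : IsOpen R) (P : BiPIKAS S R) : SingularSplitSolution S R where
  V := P.matV
  W := P.matW
  V_off p hp := by rw [matV, if_neg hp]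
  W_off p hp := by rw [matW, if_neg hp]
  V_posDef p hp := P.posDef_matV hp
  W_posDef p hp := P.posDef_matW hp
  det_eq p hp := P.det_matV hR hp
  potential p hp := by
    rcases S.mem_regular_iff.1 hp with ⟨a, ha⟩ | ⟨j, hj⟩
    · obtain ⟨O, hO, hpO, hOU, K, -, hP⟩ := (P.isEmbeddingGradient hR).potV a p ha
      exact ⟨O, hO, hpO, hOU.trans (S.chartV_subset a), K, hP⟩
    · obtain ⟨O, hO, hpO, hOU, K, -, hP⟩ := (P.isEmbeddingGradient hR).potW j p hj
      exact ⟨O, hO, hpO, hOU.trans (S.chartW_subset j), K, hP⟩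
  V_locInt i j := by
    obtain ⟨_, _, H⟩ := (P.isEmbeddingGradient hR).exists_isGlued
      (fun _ => P.posDef_matV) fun _ => P.posDef_matW
    exact H.locallyIntegrableOn_V hR i j
  W_locInt i j := by
    obtain ⟨_, _, H⟩ := (P.isEmbeddingGradient hR).exists_isGlued
      (fun _ => P.posDef_matV) fun _ => P.posDef_matW
    exact H.locallyIntegrableOn_W hR i j
  current i j p q ψ hψ hψc hψR := by
    obtain ⟨_, _, H⟩ := (P.isEmbeddingGradient hR).exists_isGlued
      (fun _ => P.posDef_matV) fun _ => P.posDef_matW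
    have ht : IsTest R ψ := ⟨hψ, hψc, hψR⟩
    rw [H.integral_current hR ht, S.sum_integral_model ht]

end BiPIKAS

/-! ### The bi-PIKAS given by an embedding gradient -/

section splitMetric

variable {n l : ℕ}

/-- The metric `V^{ij} ds_i ds_j + W^{pq} dt_p dt_q`. -/
def splitMetric (V : Matrix (Fin n) (Fin n) ℝ) (W : Matrix (Fin l) (Fin l) ℝ) :
    Base n l →L[ℝ] Base n l →L[ℝ] ℝ :=
  ∑ i, ∑ j, V i j • (pairForm (EuclideanSpace.single i 1) 0).smulRight
      (pairForm (EuclideanSpace.single j 1) 0 : Base n l →L[ℝ] ℝ) +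
    ∑ i, ∑ j, W i j • (pairForm 0 (EuclideanSpace.single i 1)).smulRight
      (pairForm 0 (EuclideanSpace.single j 1) : Base n l →L[ℝ] ℝ)

theorem splitMetric_apply (V : Matrix (Fin n) (Fin n) ℝ) (W : Matrix (Fin l) (Fin l) ℝ)
    (u u' : Base n l) : splitMetric V W u u' = ∑ i, ∑ j, V i j * u.1 i * u'.1 j +
      ∑ i, ∑ j, W i j * u.2 i * u'.2 j := by
  simp [splitMetric, sum_apply, EuclideanSpace.inner_single_left, mul_assoc]

theorem splitMetric_symm {V : Matrix (Fin n) (Fin n) ℝ} {W : Matrix (Fin l) (Fin l) ℝ}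
    (hV : V.PosDef) (hW : W.PosDef) (u u' : Base n l) :
    splitMetric V W u u' = splitMetric V W u' u := by
  have hV' : ∀ i j, V i j = V j i := fun i j => (hV.isHermitian.apply i j).symm
  have hW' : ∀ i j, W i j = W j i := fun i j => (hW.isHermitian.apply i j).symm
  rw [splitMetric_apply, splitMetric_apply]
  congr 1
  · rw [Finset.sum_comm]
    exact Finset.sum_congr rfl fun i _ => Finset.sum_congr rfl fun j _ => by rw [hV' j i]; ring
  · rw [Finset.sum_comm]
    exact Finset.sum_congr rfl fun i _ => Finset.sum_congr rfl fun j _ => by rw [hW' j i]; ring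

theorem splitMetric_pos {V : Matrix (Fin n) (Fin n) ℝ} {W : Matrix (Fin l) (Fin l) ℝ}
    (hV : V.PosDef) (hW : W.PosDef) {u : Base n l} (hu : u ≠ 0) : 0 < splitMetric V W u u := by
  rw [splitMetric_apply]
  by_cases h1 : u.1 = 0
  · have h2 : u.2 ≠ 0 := fun h2 => hu (Prod.ext h1 h2)
    rw [h1]
    simpa using hW.sum_pos h2
  · refine add_pos_of_pos_of_nonneg (hV.sum_pos h1) ?_
    by_cases h2 : u.2 = 0
    · simp [h2]
    · exact (hW.sum_pos h2).le

/-- The split metric is smooth because its coefficients are second derivatives of a smooth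
potential. -/
theorem IsSplitPotential.contDiffAt_splitMetric {K : Base n l → ℝ} {O : Set (Base n l)}
    {V : Base n l → Matrix (Fin n) (Fin n) ℝ} {W : Base n l → Matrix (Fin l) (Fin l) ℝ}
    (h : IsSplitPotential K O V W) (hO : IsOpen O) {q : Base n l} (hq : q ∈ O) :
    ContDiffAt ℝ ∞ (fun q => splitMetric (V q) (W q)) q := by
  have hK := h.smooth.contDiffAt (hO.mem_nhds hq)
  have h1 : ∀ u u' : Base n l, ContDiffAt ℝ ∞ (fun q => secondDeriv K q u u') q := fun u u' =>
    (ContDiffAt.fderiv_infty (hK.fderiv_infty.clm_apply contDiffAt_const)).clm_apply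
      contDiffAt_const
  have hV : ∀ i j, ContDiffAt ℝ ∞ (fun q => V q i j) q := fun i j =>
    (h1 (sdir i) (sdir j)).congr_of_eventuallyEq
      (eventually_of_mem (hO.mem_nhds hq) fun r hr => h.hess_s r hr i j)
  have hW : ∀ i j, ContDiffAt ℝ ∞ (fun q => W q i j) q := fun i j =>
    (h1 (tdir i) (tdir j)).neg.congr_of_eventuallyEq
      (eventually_of_mem (hO.mem_nhds hq) fun r hr => h.hess_t r hr i j)
  unfold splitMetric
  exact (ContDiffAt.sum fun i _ => ContDiffAt.sum fun j _ =>
    (hV i j).smul contDiffAt_const).add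
    (ContDiffAt.sum fun i _ => ContDiffAt.sum fun j _ => (hW i j).smul contDiffAt_const)

end splitMetric

theorem IsSmoothChart.mono {n l : ℕ} {F : Type} [NormedAddCommGroup F] [NormedSpace ℝ F]
    {U O : Set (Base n l)} {y : Base n l → F} (h : IsSmoothChart U y) (hO : O ⊆ U) :
    IsSmoothChart O y :=
  ⟨h.smooth.mono hO, h.injOn.mono hO, fun p hp => h.bijective p (hO hp)⟩

/-- A local version of `isMongeAmpere_of_hasSplitGradient`. -/
theorem isMongeAmpere_of_local {n l : ℕ} {F : Type} [NormedAddCommGroup F] [NormedSpace ℝ F]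
    {L : Submodule ℤ F} (C : LatticeCoord L n l) {U : Set (Base n l)}
    {y : Base n l → F} {x : Base n l → F → ℝ}
    {η : Base n l → EuclideanSpace ℝ (Fin n)} {ϑ : Base n l → EuclideanSpace ℝ (Fin l)}
    {V : Base n l → Matrix (Fin n) (Fin n) ℝ} {W : Base n l → Matrix (Fin l) (Fin l) ℝ}
    (hc : IsSmoothChart U y)
    (hpot : ∀ q ∈ U, ∃ O : Set (Base n l), IsOpen O ∧ q ∈ O ∧ O ⊆ U ∧ ∃ K : Base n l → ℝ,
      HasSplitGradient K O η ϑ ∧ IsSplitPotential K O V W)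
    (hV : ∀ q ∈ U, (V q).PosDef) (hdet : ∀ q ∈ U, (V q).det = (W q).det)
    (hy : ∀ q ∈ U, C.coord (y q) = (η q, q.2))
    (hx : ∀ q ∈ U, ∀ v, x q v = pairForm q.1 (ϑ q) (C.coord v)) :
    IsMongeAmpere L U y x fun q => splitMetric (V q) (W q) := by
  intro p hp
  obtain ⟨O, hO, hpO, hOU, K, hK, hP⟩ := hpot p hp
  have hVq : ∀ q ∈ O, (Matrix.of fun i j => secondDeriv K q (sdir i) (sdir j)) = V q :=
    fun q hq => by ext i j; rw [Matrix.of_apply, hP.hess_s q hq]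
  have hWq : ∀ q ∈ O, (Matrix.of fun i j => -secondDeriv K q (tdir i) (tdir j)) = W q :=
    fun q hq => by ext i j; rw [Matrix.of_apply, hP.hess_t q hq]
  obtain ⟨O', hO', hpO', hOO', H⟩ := isMongeAmpere_of_hasSplitGradient C hK hO (hc.mono hOU)
    (fun q hq => hy q (hOU hq)) (fun q hq => hx q (hOU hq))
    (g := fun q => splitMetric (V q) (W q)) (fun q hq u u' => by
      rw [splitMetric_apply]
      simp only [hP.hess_s q hq, hP.hess_t q hq])
    (fun q hq => by rw [hVq q hq]; exact (hV q (hOU hq)).det_pos.ne')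
    (fun q hq => by rw [hVq q hq, hWq q hq]; exact hdet q (hOU hq)) p hpO
  exact ⟨O', hO', hpO', hOO'.trans hOU, H⟩

namespace IsEmbeddingGradient

variable {n l : ℕ} {S : SimplexPair n l} {R : Set (Base n l)}
  {V : Base n l → Matrix (Fin n) (Fin n) ℝ} {W : Base n l → Matrix (Fin l) (Fin l) ℝ}
  {η : Base n l → EuclideanSpace ℝ (Fin n)} {θ : Base n l → EuclideanSpace ℝ (Fin l)}

theorem potV' (H : IsEmbeddingGradient S R V W η θ) (a : Fin (l + 1)) : ∀ q ∈ S.chartV R a,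
    ∃ O : Set (Base n l), IsOpen O ∧ q ∈ O ∧ ∃ K : Base n l → ℝ, HasSplitGradient K O η
      (fun r => θ r + minForm S.frame.beR r.1 • S.frame.alR a) ∧ IsSplitPotential K O V W :=
  fun q hq => let ⟨O, hO, hqO, _, h⟩ := H.potV a q hq; ⟨O, hO, hqO, h⟩

theorem potW' (H : IsEmbeddingGradient S R V W η θ) (j : Fin (n + 1)) : ∀ q ∈ S.chartW R j,
    ∃ O : Set (Base n l), IsOpen O ∧ q ∈ O ∧ ∃ K : Base n l → ℝ, HasSplitGradient K O
      (fun r => η r + minForm S.frame.alR r.2 • S.frame.beR j) θ ∧ IsSplitPotential K O V W :=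
  fun q hq => let ⟨O, hO, hqO, _, h⟩ := H.potW j q hq; ⟨O, hO, hqO, h⟩

theorem isPolyhedral_h (H : IsEmbeddingGradient S R V W η θ) (hR : IsOpen R) (hRc : Convex ℝ R)
    (hV : ∀ q ∈ S.regular R, (V q).PosDef) :
    IsPolyhedral S.v S.w (S.regular R) (S.chartV R) (S.chartW R)
      fun q => S.frame.point (η q) q.2 (-minForm S.frame.alR q.2) :=
  S.frame.isPolyhedral S.isSimplexEdges_edgeV (c' := S.edgeW)
    (π := ContinuousLinearEquiv.refl ℝ (Base n l)) hR hRc (fun _ _ => Iff.rfl)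
    (fun _ _ => Iff.rfl) (fun _ => S.mem_regular_iff) (H := η) (fun _ _ => rfl)
    (fun a => isFiberMonotone_eta (H.potV' a) fun q hq => hV q (S.chartV_subset a hq))
    (fun j => isFiberMonotone_eta (H.potW' j) fun q hq => hV q (S.chartW_subset j hq))

theorem isPolyhedral_k (H : IsEmbeddingGradient S R V W η θ) (hR : IsOpen R) (hRc : Convex ℝ R)
    (hW : ∀ q ∈ S.regular R, (W q).PosDef) :
    IsPolyhedral S.w S.v (S.regular R) (S.chartW R) (S.chartV R)
      fun q => S.frame.swap.point (θ q) q.1 (-minForm S.frame.beR q.1) :=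
  S.frame.swap.isPolyhedral S.isSimplexEdges_edgeW (c' := S.edgeV)
    (π := ContinuousLinearEquiv.prodComm ℝ (EuclideanSpace ℝ (Fin n))
      (EuclideanSpace ℝ (Fin l))) hR hRc (fun _ _ => Iff.rfl)
    (fun _ _ => Iff.rfl) (fun _ => S.mem_regular_iff.trans or_comm) (H := θ) (fun _ _ => rfl)
    (fun j => isFiberMonotone_theta (H.potW' j) fun q hq => hW q (S.chartW_subset j hq))
    (fun a => isFiberMonotone_theta (H.potV' a) fun q hq => hW q (S.chartV_subset a hq))

/-- The bi-PIKAS with the coordinates `η` and `θ`. -/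
def biPIKAS (H : IsEmbeddingGradient S R V W η θ) (hR : IsOpen R) (hRc : Convex ℝ R)
    (hV : ∀ q ∈ S.regular R, (V q).PosDef) (hW : ∀ q ∈ S.regular R, (W q).PosDef)
    (hdet : ∀ q ∈ S.regular R, (V q).det = (W q).det) : BiPIKAS S R where
  h q := S.frame.point (η q) q.2 (-minForm S.frame.alR q.2)
  k q := S.frame.swap.point (θ q) q.1 (-minForm S.frame.beR q.1)
  g q := splitMetric (V q) (W q)
  g_smooth p hp := by
    rcases S.mem_regular_iff.1 hp with ⟨a, ha⟩ | ⟨j, hj⟩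
    · obtain ⟨O, hO, hpO, -, K, -, hP⟩ := H.potV a p ha
      exact (hP.contDiffAt_splitMetric hO hpO).contDiffWithinAt
    · obtain ⟨O, hO, hpO, -, K, -, hP⟩ := H.potW j p hj
      exact (hP.contDiffAt_splitMetric hO hpO).contDiffWithinAt
  g_symm p hp := splitMetric_symm (hV p hp) (hW p hp)
  g_pos p hp _ := splitMetric_pos (hV p hp) (hW p hp)
  h_proj p hp i := by
    rw [← S.frame_fs, ← AdaptedFrame.coordF_apply, AdaptedFrame.coordF_point]
  k_proj p hp i := by
    rw [← S.frame_e, dotProduct_comm]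
    change S.frame.swap.coordF _ i = _
    rw [AdaptedFrame.coordF_point]
  h_polyhedral := H.isPolyhedral_h hR hRc hV
  k_polyhedral := H.isPolyhedral_k hR hRc hW
  mongeAmpere_v a := by
    have hp := H.isPolyhedral_h hR hRc hV
    refine isMongeAmpere_of_local (S.frame.perpLatticeCoord a) (hp.chart_perp a) (H.potV a)
      (fun q hq => hV q (S.chartV_subset a hq)) (fun q hq => hdet q (S.chartV_subset a hq))
      (fun q hq => ?_) fun q hq y => ?_
    · rw [AdaptedFrame.perpLatticeCoord_apply, perpCoord, dif_pos (hp.face a q hq)]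
      simp only [AdaptedFrame.coordE_point, AdaptedFrame.coordF_point]
    · have hy : toReal (S.v a) ⬝ᵥ (y : Fin (n + l + 1) → ℝ) = 0 := y.2
      rw [S.frame.a_dot_coord] at hy
      rw [S.frame.dotProduct_eq, AdaptedFrame.coordF_point, AdaptedFrame.coordE_point,
        AdaptedFrame.a_zero_point, AdaptedFrame.perpLatticeCoord_apply, pairForm_apply,
        eq_neg_of_add_eq_zero_left hy, inner_add_left, inner_smul_left]
      simp
      ring
  mongeAmpere_w j := by
    have hp := H.isPolyhedral_h hR hRc hV
    have key : ∀ q ∈ S.chartW R j, ∀ y, pairForm q.1 (θ q)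
        ((S.frame.quotLatticeCoord j).coord ((line (S.w j)).mkQ y)) =
        S.frame.swap.point (θ q) q.1 (-minForm S.frame.beR q.1) ⬝ᵥ y := fun q hq y => by
      rw [S.frame.dotProduct_eq, AdaptedFrame.coordF_point, AdaptedFrame.coordE_point,
        AdaptedFrame.a_zero_point, AdaptedFrame.quotLatticeCoord_mkQ, pairForm_apply,
        S.isSimplexEdges_edgeW.minForm_eq hq.2, inner_sub_right, inner_smul_right,
        real_inner_comm q.1]
      ring
    refine ⟨fun q v => pairForm q.1 (θ q) ((S.frame.quotLatticeCoord j).coord v), key, ?_⟩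
    refine isMongeAmpere_of_local (S.frame.quotLatticeCoord j) (hp.chart_quot j) (H.potW j)
      (fun q hq => hV q (S.chartW_subset j hq)) (fun q hq => hdet q (S.chartW_subset j hq))
      (fun q hq => ?_) fun q hq y => rfl
    rw [quotCoord, AdaptedFrame.quotLatticeCoord_mkQ, AdaptedFrame.coordE_point,
      AdaptedFrame.coordF_point, AdaptedFrame.a_zero_point, neg_smul, sub_neg_eq_add]

theorem biPIKAS_eta (H : IsEmbeddingGradient S R V W η θ) (hR : IsOpen R) (hRc : Convex ℝ R)
    (hV : ∀ q ∈ S.regular R, (V q).PosDef) (hW : ∀ q ∈ S.regular R, (W q).PosDef)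
    (hdet : ∀ q ∈ S.regular R, (V q).det = (W q).det) :
    (H.biPIKAS hR hRc hV hW hdet).eta = η :=
  funext fun _ => AdaptedFrame.coordE_point _ _ _ _

theorem biPIKAS_theta (H : IsEmbeddingGradient S R V W η θ) (hR : IsOpen R) (hRc : Convex ℝ R)
    (hV : ∀ q ∈ S.regular R, (V q).PosDef) (hW : ∀ q ∈ S.regular R, (W q).PosDef)
    (hdet : ∀ q ∈ S.regular R, (V q).det = (W q).det) :
    (H.biPIKAS hR hRc hV hW hdet).theta = θ :=
  funext fun _ => AdaptedFrame.coordE_point _ _ _ _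

end IsEmbeddingGradient

/-! ### The correspondence of split solutions and bi-PIKAS -/

section correspondence

variable {n l : ℕ} {S : SimplexPair n l} {R : Set (Base n l)}

/-- The split solution `A` and the bi-PIKAS `P` have common potentials. -/
def IsCompatible (A : SingularSplitSolution S R) (P : BiPIKAS S R) : Prop :=
  IsEmbeddingGradient S R A.V A.W P.eta P.theta

theorem BiPIKAS.isCompatible_splitSolution (hR : IsOpen R) (P : BiPIKAS S R) :
    IsCompatible (P.splitSolution hR) P := P.isEmbeddingGradient hR

theorem HasSplitGradient.matrix_eq {K K' : Base n l → ℝ} {O O' : Set (Base n l)}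
    {η : Base n l → EuclideanSpace ℝ (Fin n)} {ϑ : Base n l → EuclideanSpace ℝ (Fin l)}
    {V V' : Base n l → Matrix (Fin n) (Fin n) ℝ} {W W' : Base n l → Matrix (Fin l) (Fin l) ℝ}
    (h : HasSplitGradient K O η ϑ) (h' : HasSplitGradient K' O' η ϑ) (hO : IsOpen O)
    (hO' : IsOpen O') (hP : IsSplitPotential K O V W) (hP' : IsSplitPotential K' O' V' W')
    {q : Base n l} (hq : q ∈ O) (hq' : q ∈ O') : V q = V' q ∧ W q = W' q := by
  have h1 := (h.isSplitPotential_iff hO).1 hP q hq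
  have h2 := (h'.isSplitPotential_iff hO').1 hP' q hq'
  exact ⟨by ext i j; rw [h1.1, h2.1], by ext i j; rw [h1.2, h2.2]⟩

theorem IsCompatible.matrix_eq {A : SingularSplitSolution S R} {P : BiPIKAS S R}
    (h : IsCompatible A P) (hR : IsOpen R) {q : Base n l} (hq : q ∈ S.regular R) :
    A.V q = P.matV q ∧ A.W q = P.matW q := by
  have h' := P.isEmbeddingGradient hR
  rcases S.mem_regular_iff.1 hq with ⟨a, ha⟩ | ⟨j, hj⟩
  · obtain ⟨O, hO, hqO, -, K, hK, hP⟩ := h.potV a q ha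
    obtain ⟨O', hO', hqO', -, K', hK', hP'⟩ := h'.potV a q ha
    exact hK.matrix_eq hK' hO hO' hP hP' hqO hqO'
  · obtain ⟨O, hO, hqO, -, K, hK, hP⟩ := h.potW j q hj
    obtain ⟨O', hO', hqO', -, K', hK', hP'⟩ := h'.potW j q hj
    exact hK.matrix_eq hK' hO hO' hP hP' hqO hqO'

/-- A bi-PIKAS that corresponds to a split solution has the metric of the split solution. -/
theorem IsCompatible.metric_eq {A : SingularSplitSolution S R} {P : BiPIKAS S R}
    (h : IsCompatible A P) (hR : IsOpen R) {q : Base n l} (hq : q ∈ S.regular R) :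
    P.g q = splitMetric (A.V q) (A.W q) := by
  refine ContinuousLinearMap.ext fun u => ContinuousLinearMap.ext fun u' => ?_
  rw [splitMetric_apply]
  rcases S.mem_regular_iff.1 hq with ⟨a, ha⟩ | ⟨j, hj⟩
  · obtain ⟨O, hO, hqO, -, K, hK, hP⟩ := h.potV a q ha
    obtain ⟨O', hO', hqO', -, K', hK', hg⟩ := P.exists_hasSplitGradient_chartV hR ha
    rw [(hg q hqO').1, ← hK'.metric_eq hO' hqO', ← hK.metric_eq_of_isSplitPotential hO hP hqO]
  · obtain ⟨O, hO, hqO, -, K, hK, hP⟩ := h.potW j q hj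
    obtain ⟨O', hO', hqO', -, K', hK', hg⟩ := P.exists_hasSplitGradient_chartW hR hj
    rw [(hg q hqO').1, ← hK'.metric_eq hO' hqO', ← hK.metric_eq_of_isSplitPotential hO hP hqO]

theorem SingularSplitSolution.ext_of_regular {A A' : SingularSplitSolution S R}
    (h : ∀ q ∈ S.regular R, A.V q = A'.V q ∧ A.W q = A'.W q) : A = A' := by
  have hV : A.V = A'.V := funext fun q => by
    by_cases hq : q ∈ S.regular R
    · exact (h q hq).1
    · rw [A.V_off q hq, A'.V_off q hq]
  have hW : A.W = A'.W := funext fun q => by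
    by_cases hq : q ∈ S.regular R
    · exact (h q hq).2
    · rw [A.W_off q hq, A'.W_off q hq]
  cases A
  cases A'
  cases hV
  cases hW
  rfl

/-- Affine coordinates that differ by a shear define the same affine structure. -/
theorem exists_affineEquiv_of_shear {F : Type} [NormedAddCommGroup F] [NormedSpace ℝ F]
    (C : F ≃L[ℝ] Base n l) {O : Set (Base n l)} (hO : IsOpen O)
    {y y' : Base n l → F} {η η' : Base n l → EuclideanSpace ℝ (Fin n)}
    (hy : ∀ q ∈ O, C (y q) = (η q, q.2)) (hy' : ∀ q ∈ O, C (y' q) = (η' q, q.2))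
    {B : EuclideanSpace ℝ (Fin n)} {T : EuclideanSpace ℝ (Fin l) →L[ℝ] EuclideanSpace ℝ (Fin n)}
    (h : ∀ q ∈ O, η' q = η q + B + T q.2) {p : Base n l} (hp : p ∈ O) :
    ∃ A : F ≃ᵃ[ℝ] F, ∀ᶠ q in 𝓝 p, y' q = A (y q) := by
  let L : Base n l ≃ₗ[ℝ] Base n l :=
    { toFun := fun z => (z.1 + T z.2, z.2)
      map_add' := fun z z' => Prod.ext (by simp; abel) rfl
      map_smul' := fun c z => Prod.ext (by simp) rfl
      invFun := fun z => (z.1 - T z.2, z.2)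
      left_inv := fun z => by simp
      right_inv := fun z => by simp }
  refine ⟨((C.toLinearEquiv.trans L).toAffineEquiv.trans
    (AffineEquiv.constVAdd ℝ (Base n l) (B, 0))).trans C.symm.toLinearEquiv.toAffineEquiv, ?_⟩
  filter_upwards [hO.mem_nhds hp] with q hq
  have h1 : y' q = C.symm (η' q, q.2) := by rw [← hy' q hq, C.symm_apply_apply]
  rw [h1, h q hq]
  change _ = C.symm ((B, 0) + L (C (y q)))
  rw [hy q hq]
  congr 1
  refine Prod.ext ?_ ?_
  · change η q + B + T q.2 = B + (η q + T q.2)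
    abel
  · exact (zero_add _).symm

/-- The equivalence class of a bi-PIKAS is determined by the split solution. -/
theorem IsCompatible.equiv {A : SingularSplitSolution S R} {P P' : BiPIKAS S R}
    (h : IsCompatible A P) (h' : IsCompatible A P') (hR : IsOpen R) :
    (BiPIKAS.setoid S R).r P P' := by
  refine ⟨fun p hp => by rw [h.metric_eq hR hp, h'.metric_eq hR hp], fun a p hp => ?_,
    fun j p hp => ?_⟩
  · obtain ⟨O, hO, hpO, hOU, K, hK, hP⟩ := h.potV a p hp
    obtain ⟨O', hO', hpO', -, K', hK', hP'⟩ := h'.potV a p hp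
    obtain ⟨ε, hε, hball⟩ := Metric.isOpen_iff.1 (hO.inter hO') p ⟨hpO, hpO'⟩
    have hb1 := hball.trans inter_subset_left
    have hb2 := hball.trans inter_subset_right
    obtain ⟨B, C, T, hT⟩ := (hK.mono hb1).exists_biaffine (hK'.mono hb2) Metric.isOpen_ball
      (convex_ball p ε) (hP.mono hb1) (hP'.mono hb2)
    exact exists_affineEquiv_of_shear (S.frame.perpLatticeCoord a).coord Metric.isOpen_ball
      (fun q hq => BiPIKAS.coord_perpCoord (hOU (hb1 hq)))
      (fun q hq => BiPIKAS.coord_perpCoord (hOU (hb1 hq)))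
      (fun q hq => (hT q hq).1) (Metric.mem_ball_self hε)
  · obtain ⟨O, hO, hpO, hOU, K, hK, hP⟩ := h.potW j p hp
    obtain ⟨O', hO', hpO', -, K', hK', hP'⟩ := h'.potW j p hp
    obtain ⟨ε, hε, hball⟩ := Metric.isOpen_iff.1 (hO.inter hO') p ⟨hpO, hpO'⟩
    have hb1 := hball.trans inter_subset_left
    have hb2 := hball.trans inter_subset_right
    obtain ⟨B, C, T, hT⟩ := (hK.mono hb1).exists_biaffine (hK'.mono hb2) Metric.isOpen_ball
      (convex_ball p ε) (hP.mono hb1) (hP'.mono hb2)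
    exact exists_affineEquiv_of_shear (S.frame.quotLatticeCoord j).coord Metric.isOpen_ball
      (fun q hq => BiPIKAS.coord_quotCoord (hOU (hb1 hq)))
      (fun q hq => BiPIKAS.coord_quotCoord (hOU (hb1 hq)))
      (fun q hq => (hT q hq).1) (Metric.mem_ball_self hε)

end correspondence

section partialLegendre

variable {n l : ℕ}

/-- The linear map that takes the standard basis to the vectors `x b`. -/
def sumSmul (x : Fin l → EuclideanSpace ℝ (Fin n)) :
    EuclideanSpace ℝ (Fin l) →L[ℝ] EuclideanSpace ℝ (Fin n) :=
  ∑ b, (EuclideanSpace.proj b : EuclideanSpace ℝ (Fin l) →L[ℝ] ℝ).smulRight (x b)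

theorem sumSmul_apply (x : Fin l → EuclideanSpace ℝ (Fin n)) (t : EuclideanSpace ℝ (Fin l)) :
    sumSmul x t = ∑ b, t b • x b := by
  simp [sumSmul, sum_apply]

theorem adjoint_apply (T : EuclideanSpace ℝ (Fin l) →L[ℝ] EuclideanSpace ℝ (Fin n))
    (s : EuclideanSpace ℝ (Fin n)) (b : Fin l) :
    ContinuousLinearMap.adjoint T s b = inner ℝ s (T (EuclideanSpace.single b 1)) := by
  rw [← inner_single_one, ContinuousLinearMap.adjoint_inner_left]

theorem adjoint_sumSmul (x : Fin l → EuclideanSpace ℝ (Fin n)) (s : EuclideanSpace ℝ (Fin n))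
    (b : Fin l) : ContinuousLinearMap.adjoint (sumSmul x) s b = inner ℝ s (x b) := by
  rw [adjoint_apply, sumSmul_apply]
  simp

variable {S : SimplexPair n l} {R : Set (Base n l)}

namespace AdaptedFrame

variable {d : ℕ} {a : Fin (l + 1) → Fin d → ℤ} {b : Fin (n + 1) → Fin d → ℤ}

theorem ext_coord (F : AdaptedFrame a b) {y y' : Fin d → ℝ} (h1 : F.coordE y = F.coordE y')
    (h2 : F.coordF y = F.coordF y') (h3 : toReal (a 0) ⬝ᵥ y = toReal (a 0) ⬝ᵥ y') : y = y' := by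
  rw [← F.point_coord y, h1, h2, h3, F.point_coord]

end AdaptedFrame

/-- The right hand side of the partial Legendre transform. -/
def legendrePoint (S : SimplexPair n l) (c : Fin n → ℝ) (t : EuclideanSpace ℝ (Fin l))
    (f : Fin l → Fin (n + l + 1) → ℝ) : Fin (n + l + 1) → ℝ :=
  ∑ a, c a • toReal (S.e a : Fin (n + l + 1) → ℤ) + ∑ b, t b • f b

theorem legendrePoint_eq (c : Fin n → ℝ) (t : EuclideanSpace ℝ (Fin l))
    (f : Fin l → Fin (n + l + 1) → ℝ) : legendrePoint S c t f =
      S.frame.point (WithLp.toLp 2 c) 0 0 + ∑ b, t b • f b := by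
  simp [legendrePoint, AdaptedFrame.point, S.frame_e]

theorem coordE_legendrePoint (c : Fin n → ℝ) (t : EuclideanSpace ℝ (Fin l))
    (f : Fin l → Fin (n + l + 1) → ℝ) : S.frame.coordE (legendrePoint S c t f) =
      WithLp.toLp 2 c + sumSmul (fun b => S.frame.coordE (f b)) t := by
  rw [legendrePoint_eq, map_add, map_sum, AdaptedFrame.coordE_point, sumSmul_apply]
  simp only [map_smul]

theorem coordF_legendrePoint (c : Fin n → ℝ) (t : EuclideanSpace ℝ (Fin l))
    {f : Fin l → Fin (n + l + 1) → ℝ}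
    (hf : ∀ b, S.frame.coordF (f b) = EuclideanSpace.single b 1) :
    S.frame.coordF (legendrePoint S c t f) = t := by
  rw [legendrePoint_eq, map_add, map_sum, AdaptedFrame.coordF_point, zero_add]
  simp only [map_smul, hf]
  exact (eq_sum_single t).symm

theorem v_zero_dot_legendrePoint (c : Fin n → ℝ) (t : EuclideanSpace ℝ (Fin l))
    (f : Fin l → Fin (n + l + 1) → ℝ) : toReal (S.v 0) ⬝ᵥ legendrePoint S c t f =
      ∑ b, t b * (toReal (S.v 0) ⬝ᵥ f b) := by
  rw [legendrePoint_eq, dotProduct_add, AdaptedFrame.a_zero_point, zero_add, dotProduct_sum]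
  simp only [dotProduct_smul, smul_eq_mul]

/-- Compatibility is stated in the adapted frame. Other admissible vectors `f_p` differ from the
frame by multiples of the `e_i` and of `w_0`, and subtracting a bilinear function of `s` and `t`
from the potential compensates for the difference. -/
theorem isPartialLegendre_of_isCompatible {A : SingularSplitSolution S R} {P : BiPIKAS S R}
    (h : IsCompatible A P) : IsPartialLegendre A P := by
  intro f hf
  have hf' : ∀ b, S.frame.coordF (f b) = EuclideanSpace.single b 1 := fun b => by
    ext p
    rw [AdaptedFrame.coordF_apply, S.frame_fs, hf]
    simp
  refine ⟨fun a hfa p hp => ?_, fun j p hp => ?_⟩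
  · have hv : ∀ b, toReal (S.v 0) ⬝ᵥ f b = -S.frame.alR a b := fun b => by
      have h1 : toReal (S.v a) ⬝ᵥ f b = 0 := hfa b
      rw [S.frame.a_dot_coord, hf' b, inner_single_one] at h1
      linarith
    obtain ⟨O, hO, hpO, hOU, K, hK, hP⟩ := h.potV a p hp
    set T := -sumSmul fun b => S.frame.coordE (f b) with hT
    have hK' := hK.add_biaffine hO 0 0 T
    refine ⟨O, hO, hpO, hOU, _, hK.isSplitPotential_add_biaffine hO hP 0 0 T,
      fun q hq => ⟨?_, fun b => ?_⟩⟩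
    · have hqr := S.chartV_subset a (hOU hq)
      change P.h q = legendrePoint S _ q.2 f
      simp only [← hK'.eta_apply hq]
      refine S.frame.ext_coord ?_ ?_ ?_
      · rw [coordE_legendrePoint]
        change P.eta q = (P.eta q + 0 + T q.2) + _
        rw [hT, neg_apply]
        abel
      · rw [coordF_legendrePoint _ _ hf', BiPIKAS.coordF_h hqr]
      · rw [v_zero_dot_legendrePoint, BiPIKAS.v_zero_dot_h hqr,
          S.isSimplexEdges_edgeV.minForm_eq (hOU hq).2, PiLp.inner_apply]
        simp [hv]
    · have hqr := S.chartV_subset a (hOU hq)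
      rw [← hK'.theta_apply hq, BiPIKAS.k_dot hqr, hf', inner_single_one, hv, hT]
      simp [adjoint_sumSmul]
      ring
  · obtain ⟨O, hO, hpO, hOU, K, hK, hP⟩ := h.potW j p hp
    set T := -sumSmul fun b => S.frame.coordE (f b) - (toReal (S.v 0) ⬝ᵥ f b) • S.frame.beR j
      with hT
    have hK' := hK.add_biaffine hO 0 0 T
    refine ⟨O, hO, hpO, hOU, _, hK.isSplitPotential_add_biaffine hO hP 0 0 T,
      fun q hq => ⟨?_, fun b => ?_⟩⟩
    · change quotCoord _ _ _ = (line (S.w j)).mkQ (legendrePoint S _ q.2 f)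
      simp only [← hK'.eta_apply hq]
      apply (S.frame.quotLatticeCoord j).coord.injective
      rw [BiPIKAS.coord_quotCoord (hOU hq), AdaptedFrame.quotLatticeCoord_mkQ,
        coordE_legendrePoint, coordF_legendrePoint _ _ hf', v_zero_dot_legendrePoint]
      refine Prod.ext ?_ rfl
      change _ = (P.eta q + minForm S.frame.alR q.2 • S.frame.beR j + 0 + T q.2) + _ - _
      rw [hT, neg_apply, sumSmul_apply, sumSmul_apply]
      simp only [smul_sub, Finset.sum_sub_distrib, Finset.sum_smul, smul_smul]
      abel
    · have hqr := S.chartW_subset j (hOU hq)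
      rw [← hK'.theta_apply hq, BiPIKAS.k_dot hqr, hf', inner_single_one, hT,
        S.isSimplexEdges_edgeW.minForm_eq (hOU hq).2]
      simp [adjoint_sumSmul, inner_sub_right, inner_smul_right, real_inner_comm q.1]
      ring

/-- The partial Legendre relation is used for the vectors `f_b - (v_a)_b w_0` in the chart `v_a`,
which lie in `v_a^⊥`, and for the frame vectors `f_b` in the chart `w_j`. -/
theorem IsPartialLegendre.isCompatible {A : SingularSplitSolution S R} {P : BiPIKAS S R}
    (h : IsPartialLegendre A P) : IsCompatible A P := by
  have hm : ∀ (u : Fin l → ℝ) a b, toReal (S.m a : Fin (n + l + 1) → ℤ) ⬝ᵥ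
      S.frame.point 0 (EuclideanSpace.single b 1) (u b) = if a = b then 1 else 0 :=
    fun u a b => by
      rw [← S.frame_fs, ← AdaptedFrame.coordF_apply, AdaptedFrame.coordF_point]
      simp
  refine ⟨fun a p hp => ?_, fun j p hp => ?_⟩
  · obtain ⟨O, hO, hpO, hOU, K, hP, hK⟩ := (h (fun b =>
      S.frame.point 0 (EuclideanSpace.single b 1) (-S.frame.alR a b)) (hm _)).1 a (fun b => by
        change toReal (S.v a) ⬝ᵥ _ = 0
        rw [S.frame.a_dot_coord, AdaptedFrame.a_zero_point, AdaptedFrame.coordF_point,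
          inner_single_one, neg_add_cancel]) p hp
    refine ⟨O, hO, hpO, hOU, K, HasSplitGradient.of_apply hP.smooth (fun q hq i => ?_)
      fun q hq b => ?_, hP⟩
    · have h1 := congrArg S.frame.coordE (hK q hq).1
      have h2 : S.frame.coordE (P.h q) = _ := h1.trans (coordE_legendrePoint _ _ _)
      rw [BiPIKAS.eta, h2, sumSmul_apply]
      simp [AdaptedFrame.coordE_point]
    · rw [← (hK q hq).2 b, BiPIKAS.k_dot (S.chartV_subset a (hOU hq)),
        AdaptedFrame.coordE_point, AdaptedFrame.coordF_point, AdaptedFrame.a_zero_point,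
        inner_single_one]
      simp
  · obtain ⟨O, hO, hpO, hOU, K, hP, hK⟩ := (h (fun b =>
      S.frame.point 0 (EuclideanSpace.single b 1) 0) (hm fun _ => 0)).2 j p hp
    refine ⟨O, hO, hpO, hOU, K, HasSplitGradient.of_apply hP.smooth (fun q hq i => ?_)
      fun q hq b => ?_, hP⟩
    · have h1 := congrArg (S.frame.quotLatticeCoord j).coord (hK q hq).1
      rw [BiPIKAS.coord_quotCoord (hOU hq), AdaptedFrame.quotLatticeCoord_mkQ] at h1
      have h2 := (Prod.ext_iff.1 h1).1
      dsimp only at h2 ⊢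
      rw [h2]
      change (S.frame.coordE (legendrePoint S _ q.2 _) - (_ ⬝ᵥ legendrePoint S _ q.2 _) • _) i = _
      rw [coordE_legendrePoint, v_zero_dot_legendrePoint, sumSmul_apply]
      simp [AdaptedFrame.coordE_point, AdaptedFrame.a_zero_point]
    · rw [← (hK q hq).2 b, BiPIKAS.k_dot (S.chartW_subset j (hOU hq)),
        AdaptedFrame.coordE_point, AdaptedFrame.coordF_point, AdaptedFrame.a_zero_point,
        inner_single_one]
      simp

end partialLegendre

/-! ### The bi-PIKAS of a split solution -/

section existence

variable {n l : ℕ} {S : SimplexPair n l} {R : Set (Base n l)}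

/-- The first part of the gradient. -/
def gradS (K : Base n l → ℝ) (q : Base n l) : EuclideanSpace ℝ (Fin n) :=
  WithLp.toLp 2 fun i => fderiv ℝ K q (sdir i)

/-- The second part of the gradient, with the opposite sign. -/
def gradT (K : Base n l → ℝ) (q : Base n l) : EuclideanSpace ℝ (Fin l) :=
  WithLp.toLp 2 fun p => -fderiv ℝ K q (tdir p)

theorem IsSplitPotential.hasSplitGradient {K : Base n l → ℝ} {O : Set (Base n l)}
    {V : Base n l → Matrix (Fin n) (Fin n) ℝ} {W : Base n l → Matrix (Fin l) (Fin l) ℝ}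
    (h : IsSplitPotential K O V W) : HasSplitGradient K O (gradS K) (gradT K) :=
  HasSplitGradient.of_apply h.smooth (fun _ _ _ => rfl) fun _ _ _ => rfl

theorem apply_eq_sum (T : EuclideanSpace ℝ (Fin l) →L[ℝ] EuclideanSpace ℝ (Fin n))
    (t : EuclideanSpace ℝ (Fin l)) (i : Fin n) :
    T t i = ∑ p, T (EuclideanSpace.single p 1) i * t p := by
  conv_lhs => rw [eq_sum_single t, map_sum]
  simp [mul_comm]

/-- The potentials on the charts can be normalized such that their differences on the cells are
those of the model: this is where the equation of currents enters, through the vanishing of the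
plaquettes of the differences. -/
theorem SingularSplitSolution.exists_normalized_potentials (A : SingularSplitSolution S R)
    (hR : IsOpen R) (hRc : Convex ℝ R) (hR0 : (0 : Base n l) ∈ R) :
    ∃ (ηV : Fin (l + 1) → Base n l → EuclideanSpace ℝ (Fin n))
      (ϑV : Fin (l + 1) → Base n l → EuclideanSpace ℝ (Fin l))
      (ηW : Fin (n + 1) → Base n l → EuclideanSpace ℝ (Fin n))
      (ϑW : Fin (n + 1) → Base n l → EuclideanSpace ℝ (Fin l)),
      (∀ a, ∃ K : Base n l → ℝ, HasSplitGradient K (S.chartV R a) (ηV a) (ϑV a) ∧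
        IsSplitPotential K (S.chartV R a) A.V A.W) ∧
      (∀ j, ∃ K : Base n l → ℝ, HasSplitGradient K (S.chartW R j) (ηW j) (ϑW j) ∧
        IsSplitPotential K (S.chartW R j) A.V A.W) ∧
      ∀ j a, ∀ q ∈ S.chartV R a, q ∈ S.chartW R j →
        ηW j q = ηV a q + inner ℝ (S.frame.alR a) q.2 • S.frame.beR j ∧
        ϑV a q = ϑW j q + inner ℝ (S.frame.beR j) q.1 • S.frame.alR a := by
  classical
  have hpot : ∀ q ∈ S.regular R, ∃ O : Set (Base n l), IsOpen O ∧ q ∈ O ∧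
      ∃ K : Base n l → ℝ, IsSplitPotential K O A.V A.W := fun q hq =>
    let ⟨O, hO, hqO, _, h⟩ := A.potential q hq; ⟨O, hO, hqO, h⟩
  choose KV hKV using fun a => exists_isSplitPotential (S.isOpen_chartV hR a)
    (S.convex_chartV hRc a) fun q hq => hpot q (S.chartV_subset a hq)
  choose KW hKW using fun j => exists_isSplitPotential (S.isOpen_chartW hR j)
    (S.convex_chartW hRc j) fun q hq => hpot q (S.chartW_subset j hq)
  choose B C T hBCT using fun j a => ((hKV a).hasSplitGradient.mono
    (inter_subset_left (t := S.chartW R j))).exists_biaffine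
    ((hKW j).hasSplitGradient.mono (inter_subset_right (s := S.chartV R a)))
    ((S.isOpen_chartV hR a).inter (S.isOpen_chartW hR j))
    ((S.convex_chartV hRc a).inter (S.convex_chartW hRc j))
    ((hKV a).mono inter_subset_left) ((hKW j).mono inter_subset_right)
  -- the differences of the potentials on the cells
  have hglued : IsGlued S R A.V A.W
      (fun q => if h : ∃ a, q.2 ∈ normalCone S.edgeV a then gradS (KV h.choose) q else 0)
      (fun q => if h : ∃ j, q.1 ∈ normalCone S.edgeW j then gradS (KW h.choose) q else 0)
      (fun q => if h : ∃ a, q.2 ∈ normalCone S.edgeV a then gradT (KV h.choose) q else 0)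
      (fun q => if h : ∃ j, q.1 ∈ normalCone S.edgeW j then gradT (KW h.choose) q else 0)
      (fun j a i => B j a i) (fun j a p => C j a p)
      (fun j a i p => T j a (EuclideanSpace.single p 1) i) := by
    refine ⟨A.V_posDef, A.W_posDef, fun a q hq => ?_, fun j q hq => ?_, fun j a q hq hj ha i => ?_,
      fun j a q hq hj ha p => ?_⟩
    · refine ⟨_, S.isOpen_chartV hR a, hq, KV a, (hKV a).hasSplitGradient.congr (fun r hr => ?_)
        (fun r hr => ?_), hKV a⟩
      all_goals
        have hex : ∃ a, r.2 ∈ normalCone S.edgeV a := ⟨a, hr.2⟩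
        rw [dif_pos hex, S.isSimplexEdges_edgeV.normalCone_unique hex.choose_spec hr.2]
    · refine ⟨_, S.isOpen_chartW hR j, hq, KW j, (hKW j).hasSplitGradient.congr (fun r hr => ?_)
        (fun r hr => ?_), hKW j⟩
      all_goals
        have hex : ∃ j, r.1 ∈ normalCone S.edgeW j := ⟨j, hr.2⟩
        rw [dif_pos hex, S.isSimplexEdges_edgeW.normalCone_unique hex.choose_spec hr.2]
    · have hexj : ∃ j, q.1 ∈ normalCone S.edgeW j := ⟨j, hj⟩
      have hexa : ∃ a, q.2 ∈ normalCone S.edgeV a := ⟨a, ha⟩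
      rw [dif_pos hexj, S.isSimplexEdges_edgeW.normalCone_unique hexj.choose_spec hj,
        dif_pos hexa, S.isSimplexEdges_edgeV.normalCone_unique hexa.choose_spec ha,
        (hBCT j a q ⟨⟨hq, ha⟩, hq, hj⟩).1, ← apply_eq_sum]
      simp
      ring
    · have hexj : ∃ j, q.1 ∈ normalCone S.edgeW j := ⟨j, hj⟩
      have hexa : ∃ a, q.2 ∈ normalCone S.edgeV a := ⟨a, ha⟩
      rw [dif_pos hexj, S.isSimplexEdges_edgeW.normalCone_unique hexj.choose_spec hj,
        dif_pos hexa, S.isSimplexEdges_edgeV.normalCone_unique hexa.choose_spec ha,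
        (hBCT j a q ⟨⟨hq, ha⟩, hq, hj⟩).2]
      simp only [PiLp.sub_apply, adjoint_apply, PiLp.inner_apply, RCLike.inner_apply, conj_trivial]
      ring
  have hplaq := fun j a => hglued.plaquette hR hR0
    (fun i j p q ψ hψ => A.current i j p q ψ hψ.smooth hψ.compact hψ.supp)
    j 0 a 0
  have hB : ∀ j a, B j a + (B 0 0 - B j 0) = B 0 a := fun j a => by
    ext i
    have := (hplaq j a).1 i
    simp only [PiLp.add_apply, PiLp.sub_apply]
    linarith
  have hC : ∀ j a, C j a + (C 0 0 - C j 0) = C 0 a := fun j a => by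
    ext i
    have := (hplaq j a).2.1 i
    simp only [PiLp.add_apply, PiLp.sub_apply]
    linarith
  have hT : ∀ j a, T j a + (T 0 0 - T j 0) = T 0 a +
      (innerSL ℝ (S.frame.alR a)).smulRight (S.frame.beR j) := fun j a => by
    refine ContinuousLinearMap.ext fun t => ?_
    ext i
    rw [apply_eq_sum, apply_eq_sum _ t]
    refine Finset.sum_congr rfl fun p _ => ?_
    have := (hplaq j a).2.2 i p
    simp only [SimplexPair.modelD, S.frame.alR_zero, S.frame.beR_zero, PiLp.zero_apply, mul_zero,
      zero_mul, sub_zero] at this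
    congr 1
    simp only [add_apply, sub_apply, PiLp.add_apply, PiLp.sub_apply,
      ContinuousLinearMap.smulRight_apply, innerSL_apply_apply, inner_single_one, PiLp.smul_apply,
      smul_eq_mul]
    linarith
  -- Biaffine functions are added to the potentials so that the jumps relative to the index `0` in
  -- each factor vanish; the plaquette relations then make all the jumps equal to the model.
  refine ⟨fun a q => gradS (KV a) q + B 0 a + T 0 a q.2,
    fun a q => gradT (KV a) q - C 0 a - ContinuousLinearMap.adjoint (T 0 a) q.1,
    fun j q => gradS (KW j) q + (B 0 0 - B j 0) + (T 0 0 - T j 0) q.2,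
    fun j q => gradT (KW j) q - (C 0 0 - C j 0) - ContinuousLinearMap.adjoint (T 0 0 - T j 0) q.1,
    fun a => ⟨_, (hKV a).hasSplitGradient.add_biaffine (S.isOpen_chartV hR a) _ _ _,
      (hKV a).hasSplitGradient.isSplitPotential_add_biaffine (S.isOpen_chartV hR a) (hKV a) _ _ _⟩,
    fun j => ⟨_, (hKW j).hasSplitGradient.add_biaffine (S.isOpen_chartW hR j) _ _ _,
      (hKW j).hasSplitGradient.isSplitPotential_add_biaffine (S.isOpen_chartW hR j) (hKW j) _ _ _⟩,
    fun j a q hqa hqj => ?_⟩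
  have h1 := hBCT j a q ⟨hqa, hqj⟩
  have h2 : inner ℝ (S.frame.alR a) q.2 • S.frame.beR j =
      (T j a + (T 0 0 - T j 0)) q.2 - T 0 a q.2 := by
    rw [hT, add_apply, add_sub_cancel_left]; rfl
  have h3 : inner ℝ (S.frame.beR j) q.1 • S.frame.alR a =
      ContinuousLinearMap.adjoint (T j a + (T 0 0 - T j 0)) q.1 -
        ContinuousLinearMap.adjoint (T 0 a) q.1 := by
    rw [hT, map_add, add_apply, add_sub_cancel_left]
    ext p
    rw [adjoint_apply]
    simp [inner_single_one, inner_smul_right, real_inner_comm q.1]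
    ring
  constructor
  · dsimp only
    rw [h1.1, h2, ← hB j a, add_apply]
    abel
  · dsimp only
    rw [h1.2, h3, ← hC j a, map_add, add_apply]
    abel

/-- Every split solution comes from a bi-PIKAS. -/
theorem SingularSplitSolution.exists_isCompatible (A : SingularSplitSolution S R)
    (hR : IsOpen R) (hRc : Convex ℝ R) (hR0 : (0 : Base n l) ∈ R) :
    ∃ P : BiPIKAS S R, IsCompatible A P := by
  classical
  obtain ⟨ηV, ϑV, ηW, ϑW, hKV, hKW, hcell⟩ := A.exists_normalized_potentials hR hRc hR0
  -- The gradient is read off the charts `v_a` where one contains the point, and off the charts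
  -- `w_j`, where the bilinear term is subtracted, elsewhere; `θ` the other way round.
  set η : Base n l → EuclideanSpace ℝ (Fin n) := fun q =>
    if h : ∃ a, q.2 ∈ normalCone S.edgeV a then ηV h.choose q else
      if h : ∃ j, q.1 ∈ normalCone S.edgeW j then
        ηW h.choose q - minForm S.frame.alR q.2 • S.frame.beR h.choose else 0 with hη
  set θ : Base n l → EuclideanSpace ℝ (Fin l) := fun q =>
    if h : ∃ j, q.1 ∈ normalCone S.edgeW j then ϑW h.choose q else
      if h : ∃ a, q.2 ∈ normalCone S.edgeV a then
        ϑV h.choose q - minForm S.frame.beR q.1 • S.frame.alR h.choose else 0 with hθ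
  have huV : ∀ {a} {t : EuclideanSpace ℝ (Fin l)} (ha : t ∈ normalCone S.edgeV a)
      (hex : ∃ a, t ∈ normalCone S.edgeV a), hex.choose = a := fun ha hex =>
    S.isSimplexEdges_edgeV.normalCone_unique hex.choose_spec ha
  have huW : ∀ {j} {s : EuclideanSpace ℝ (Fin n)} (hj : s ∈ normalCone S.edgeW j)
      (hex : ∃ j, s ∈ normalCone S.edgeW j), hex.choose = j := fun hj hex =>
    S.isSimplexEdges_edgeW.normalCone_unique hex.choose_spec hj
  have hηV : ∀ a, ∀ q ∈ S.chartV R a, η q = ηV a q := fun a q hq => by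
    have hex : ∃ a, q.2 ∈ normalCone S.edgeV a := ⟨a, hq.2⟩
    simp only [hη]
    rw [dif_pos hex, huV hq.2 hex]
  have hθW : ∀ j, ∀ q ∈ S.chartW R j, θ q = ϑW j q := fun j q hq => by
    have hex : ∃ j, q.1 ∈ normalCone S.edgeW j := ⟨j, hq.2⟩
    simp only [hθ]
    rw [dif_pos hex, huW hq.2 hex]
  have hηW : ∀ j, ∀ q ∈ S.chartW R j,
      η q + minForm S.frame.alR q.2 • S.frame.beR j = ηW j q := fun j q hq => by
    have hex : ∃ j, q.1 ∈ normalCone S.edgeW j := ⟨j, hq.2⟩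
    by_cases hexa : ∃ a, q.2 ∈ normalCone S.edgeV a
    · obtain ⟨a, ha⟩ := hexa
      rw [hηV a q ⟨hq.1, ha⟩, (hcell j a q ⟨hq.1, ha⟩ hq).1,
        S.isSimplexEdges_edgeV.minForm_eq ha]
    · simp only [hη]
      rw [dif_neg hexa, dif_pos hex, huW hq.2 hex, sub_add_cancel]
  have hθV : ∀ a, ∀ q ∈ S.chartV R a,
      θ q + minForm S.frame.beR q.1 • S.frame.alR a = ϑV a q := fun a q hq => by
    have hex : ∃ a, q.2 ∈ normalCone S.edgeV a := ⟨a, hq.2⟩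
    by_cases hexj : ∃ j, q.1 ∈ normalCone S.edgeW j
    · obtain ⟨j, hj⟩ := hexj
      rw [hθW j q ⟨hq.1, hj⟩, (hcell j a q hq ⟨hq.1, hj⟩).2,
        S.isSimplexEdges_edgeW.minForm_eq hj]
    · simp only [hθ]
      rw [dif_neg hexj, dif_pos hex, huV hq.2 hex, sub_add_cancel]
  have H : IsEmbeddingGradient S R A.V A.W η θ := by
    refine ⟨fun a q hq => ?_, fun j q hq => ?_⟩
    · obtain ⟨K, hK, hP⟩ := hKV a
      exact ⟨_, S.isOpen_chartV hR a, hq, Subset.rfl, K, hK.congr (hηV a) (hθV a), hP⟩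
    · obtain ⟨K, hK, hP⟩ := hKW j
      exact ⟨_, S.isOpen_chartW hR j, hq, Subset.rfl, K, hK.congr (hηW j) (hθW j), hP⟩
  refine ⟨H.biPIKAS hR hRc A.V_posDef A.W_posDef A.det_eq, ?_⟩
  rw [IsCompatible, H.biPIKAS_eta, H.biPIKAS_theta]
  exact H

/-- Equivalent bi-PIKAS correspond to the same split solution. -/
theorem IsCompatible.of_equiv {A : SingularSplitSolution S R} {P P' : BiPIKAS S R}
    (h : IsCompatible A P) (hR : IsOpen R) (hP : (BiPIKAS.setoid S R).r P P') :
    IsCompatible A P' := by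
  suffices hA : A = P'.splitSolution hR from hA ▸ P'.isCompatible_splitSolution hR
  refine SingularSplitSolution.ext_of_regular fun q hq => ?_
  rw [(h.matrix_eq hR hq).1, (h.matrix_eq hR hq).2]
  change _ = P'.matV q ∧ _ = P'.matW q
  simp only [BiPIKAS.matV, BiPIKAS.matW, hP.1 q hq, and_self]

theorem IsCompatible.unique {A A' : SingularSplitSolution S R} {P : BiPIKAS S R}
    (h : IsCompatible A P) (h' : IsCompatible A' P) (hR : IsOpen R) : A = A' :=
  SingularSplitSolution.ext_of_regular fun q hq => by
    rw [(h.matrix_eq hR hq).1, (h.matrix_eq hR hq).2, (h'.matrix_eq hR hq).1,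
      (h'.matrix_eq hR hq).2]
    exact ⟨rfl, rfl⟩

end existence

end

theorem mainTheorem1 {n l : ℕ} (S : SimplexPair n l) (R : Set (Base n l)) (hRo : IsOpen R)
    (hRc : Convex ℝ R) (hR0 : (0 : Base n l) ∈ R) :
    (∃ Φ : SingularSplitSolution S R ≃ Quotient (BiPIKAS.setoid S R),
      ∀ (A : SingularSplitSolution S R) (P : BiPIKAS S R),
        (Φ A = Quotient.mk (BiPIKAS.setoid S R) P ↔ IsPartialLegendre A P) ∧
        (Φ A = Quotient.mk (BiPIKAS.setoid S R) P → ∀ p ∈ S.regular R, ∀ u u' : Base n l,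
          P.g p u u' = ∑ i, ∑ j, A.V p i j * u.1 i * u'.1 j +
            ∑ i, ∑ j, A.W p i j * u.2 i * u'.2 j)) ∧
    ∀ (P : BiPIKAS S R) (i₁ i₂ : Fin (l + 1)) (j₁ j₂ : Fin (n + 1)) (c : ℝ → Base n l),
      IsLoop S R i₁ j₁ i₂ j₂ c →
      P.HasMonodromy i₁ c (fun y =>
        y + (toReal (S.v i₂ - S.v i₁) ⬝ᵥ y) • toReal (S.w j₂ - S.w j₁)) := by
  refine ⟨?_, fun P i₁ i₂ j₁ j₂ c hc => P.hasMonodromy hRo hc⟩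
  choose Q hQ using fun A : SingularSplitSolution S R => A.exists_isCompatible hRo hRc hR0
  have hiff : ∀ (A : SingularSplitSolution S R) (P : BiPIKAS S R),
      Quotient.mk (BiPIKAS.setoid S R) (Q A) = Quotient.mk (BiPIKAS.setoid S R) P ↔
        IsCompatible A P := fun A P =>
    ⟨fun h => (hQ A).of_equiv hRo (Quotient.exact h),
      fun h => Quotient.sound ((hQ A).equiv h hRo)⟩
  have hbij : Function.Bijective fun A => Quotient.mk (BiPIKAS.setoid S R) (Q A) := by
    refine ⟨fun A A' h => (hQ A).unique ((hiff A' _).1 h.symm) hRo, fun x => ?_⟩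
    obtain ⟨P, rfl⟩ := Quotient.exists_rep x
    exact ⟨P.splitSolution hRo, (hiff _ _).2 (P.isCompatible_splitSolution hRo)⟩
  refine ⟨Equiv.ofBijective _ hbij, fun A P => ⟨(hiff A P).trans
    ⟨isPartialLegendre_of_isCompatible, IsPartialLegendre.isCompatible⟩, fun h p hp u u' => ?_⟩⟩
  rw [((hiff A P).1 h).metric_eq hRo hp, splitMetric_apply]
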